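/- **Setting.** Let $q\in\mathbb C^\times$ with $|q|\neq 1$, fix $\log q$, put $\tau=\log q/(2\pi i)$ and $q^x=e^{x\log q}$ for $x\in\mathbb C$. *The superalgebra $\widehat{S\mathfrak S_q}$* has basis $C$ (central, even) and $z^nT_q^kM_{ij}$ ($n,k\in\mathbb Z$, $i,j\in\{1,2\}$, $M_{ij}$ the $2\times2$ matrix units, of parity $i+j$). Its bracket is the super commutator of the associative product $(z^nT_q^kM_{ij})(z^{n'}T_q^{k'}M_{rs})=\delta_{jr}\,q^{kn'}z^{n+n'}T_q^{k+k'}M_{is}$ plus $\psi\, C$, where $\psi(z^nT_q^kM_{ij},z^{n'}T_q^{k'}M_{rs})=(-1)^{i+1}n\,q^{-kn}$ if $n+n'=0$, $k+k'=0$, $j=r$, $i=s$, and $\psi=0$ otherwise. The principal $\frac12\mathbb Z$-gradation is $\deg z^nT_q^kM_{ii}=n$, $\deg z^nT_q^kM_{12}=\deg z^{n+1}T_q^kM_{21}=n+\frac12$, $\deg C=0$. For $\lambda\in(\widehat{S\mathfrak S_q})_0^*$ put $\Delta_{k,i}=-\lambda(T_q^kM_{ii})$ and $c=\lambda(C)$.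 For $\kappa\in\mathbb C$ let $\mathbb C_\kappa$ be the one-dimensional module on which $M_{11}$ acts by $\kappa$, $M_{22}$ by $-\kappa$, and $C$ and all other basis elements by $0$. *The superalgebra $\widehat{\mathfrak{gl}}_{\infty|\infty}[m]$.* Let $R_m=\mathbb C[t]/(t^{m+1})$. $\mathfrak{gl}_{\infty|\infty}[m]$ is the superalgebra of $2\times2$ block matrices whose blocks are $\mathbb Z\times\mathbb Z$ matrices over $R_m$ with finitely many nonzero diagonals, with the super commutator; it is graded by $\deg E_{ij}M_{\alpha\beta}=j-i+\frac{\beta-\alpha}2$. Its central extension by $R_m$ (in degree $0$) is given by the cocycle $\mathrm{Str}([J,A]B)$, $J=\sum_{j\le0}E_{jj}(M_{11}+M_{22})$, with $\mathrm{Str}$ the sum of the diagonal entries of the first block minus that of the second. A functional on its degree $0$ part has labels $\lambda^{(l)}_{j,i}=\lambda(t^lE_{jj}M_{ii})$ and central charges $c_l=\lambda(t^l)$, $0\le l\le m$; it is said to have finite support if it depends on finitely many diagonal entries only, and is then determined by its labels and central charges. *The maps $\widehat\varphi$.* For $a\in\mathbb C$ and $s=q^a$ the homomorphism $\widehat\varphi_s^{[m]}:\widehat{S\mathfrak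 S_q}\to\widehat{\mathfrak{gl}}_{\infty|\infty}[m]$ is given by $C\mapsto1\in R_m$ and $$z^nT_q^kM_{\alpha\beta}\mapsto\sum_{j}q^{(a-j)k}e^{(k\log q)t}E_{j-n,j}M_{\alpha\beta}+\epsilon,$$ where $\epsilon=-(-1)^{\alpha}\frac{q^{ak}}{1-q^k}e^{(k\log q)t}\in R_m$ if $n=0$, $\alpha=\beta$, $k\ne0$, and $\epsilon=0$ otherwise. (It depends on the choice of $a$, since replacing $a$ by $a+1$ shifts the indices.) Highest weight modules are $\frac12\mathbb Z$-graded, generated by a nonzero vector spanning the degree $0$ part, killed by all positive degrees, on which degree $0$ acts by $\lambda$; $L(\mathfrak g,\lambda)$ is the irreducible one; quasifinite means that all graded pieces are finite dimensional; isomorphisms are graded. **Theorem.** Let $L=L(\widehat{S\mathfrak S_q},\lambda)$ be an irreducible quasifinite highest weight module with central charge $c$. (1) There are quasipolynomials $P_{12},P_{21}$ with $P_{12}(0)-P_{21}(0)=c$ and, for all integers $n\ne0$, $$\Delta_{n,1}+\Delta_{n,2}=P_{21}(n),\qquad \Delta_{n,1}=\frac{P_{12}(n)-P_{21}(n)}{q^n-1}.$$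 (2) Let $P_{12},P_{21}$ be any such pair and write $P_{ij}(x)=\sum_{b\in\mathbb C}P_{ij,b}(x\log q)\,q^{bx}$ with polynomials $P_{ij,b}$, almost all zero. For $a\in\mathbb C$ put $$h_k^{(l)}(a)=\sum_{b\in a-k+\tau^{-1}\mathbb Z}P_{12,b}^{(l)}(0),\qquad h_{k-\frac12}^{(l)}(a)=\sum_{b\in a-k+\tau^{-1}\mathbb Z}P_{21,b}^{(l)}(0)\qquad(k\in\mathbb Z,\ l\ge0),$$ $$c_l(a)=\sum_k\big(h_k^{(l)}-h_{k-\frac12}^{(l)}\big),\qquad \tilde h_k^{(l)}=h_k^{(l)}-\delta_{k,0}c_l,$$ and, for $m\ge0$, let $\lambda_{a}^{[m]}$ be the finitely supported functional on $(\widehat{\mathfrak{gl}}_{\infty|\infty}[m])_0$ with central charges $c_l(a)$ and labels $$\lambda_{i,1}^{(l)}=\sum_{k\ge i}\big(\tilde h_k^{(l)}-h_{k-\frac12}^{(l)}\big),\qquad \lambda_{i,2}^{(l)}=\sum_{k\ge i}\big(h_{k+\frac12}^{(l)}-\tilde h_k^{(l)}\big)\qquad(i\in\mathbb Z,\ 0\le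 l\le m).$$ Let $a_1,\dots,a_N$ represent the distinct congruence classes modulo $\mathbb Z+\tau^{-1}\mathbb Z$ of the exponents $b$ with $P_{12,b}\ne0$ or $P_{21,b}\neq0$, and let $m_r$ be the maximal degree of the $P_{12,b}$, $P_{21,b}$ with $b$ in the class of $a_r$. Then the modules $L(\widehat{\mathfrak{gl}}_{\infty|\infty}[m_r],\lambda_{a_r}^{[m_r]})$ exist and are quasifinite, and $$L\;\cong\;\mathbb C_\kappa\otimes\bigotimes_{r=1}^N\big(\widehat\varphi_{s_r}^{[m_r]}\big)^*L\big(\widehat{\mathfrak{gl}}_{\infty|\infty}[m_r],\lambda_{a_r}^{[m_r]}\big),\qquad s_r=q^{a_r},\quad \kappa=\lambda(M_{11})-\sum_{r}\sum_i\lambda_{i,1}^{(0)}(a_r).$$ (3) (Uniqueness.) If $a_1,\dots,a_N$ are pairwise incongruent modulo $\mathbb Z+\tau^{-1}\mathbb Z$, $m_1,\dots,m_N\ge0$, the modules $L(\widehat{\mathfrak{gl}}_{\infty|\infty}[m_r],\mu_r)$ are quasifinite, $\kappa'\in\mathbb C$, and $L\cong\mathbb C_{\kappa'}\otimes\bigotimes_r(\widehat\varphi_{s_r}^{[m_r]})^*L(\widehat{\mathfrak{gl}}_{\infty|\infty}[m_r],\mu_r)$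 with $s_r=q^{a_r}$, then, for any $P_{12},P_{21}$ as in (2): $\mu_r=\lambda_{a_r}^{[m_r]}$ for all $r$; $h_k^{(l)}(a_r)=h_{k-\frac12}^{(l)}(a_r)=0$ for all $k$ and all $l>m_r$; $h_0^{(l)}(b)=h_{-\frac12}^{(l)}(b)=0$ for all $l$ and all $b$ not congruent to any $a_r$; and $\kappa'=\lambda(M_{11})-\sum_r\sum_i\lambda_{i,1}^{(0)}(a_r)$. -/

import Mathlib

open scoped TensorProduct Polynomial

noncomputable section

namespace QPDO

/-! ### Half-integer graded superalgebras and their modules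

A degree in `(1/2)ℤ` is encoded by its double, an integer `d`; all gradations are consistent
with parity, so the parity of a homogeneous element is `d` modulo `2`. -/

/-- The carrier, super bracket and principal gradation of a `(1/2)ℤ`-graded Lie superalgebra.
Only used for the two concrete superalgebras `SSq` and `glHat` below. -/
structure HalfGraded where
  carrier : Type
  [grp : AddCommGroup carrier]
  [mod : Module ℂ carrier]
  bracket : carrier → carrier → carrier
  deg : ℤ → Submodule ℂ carrier

attribute [instance] HalfGraded.grp HalfGraded.mod

/-- A complex vector space with candidate graded pieces, parity operator and action of `g`.
The module axioms are `IsGradedModule`. -/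
structure GradedAction (g : HalfGraded) where
  carrier : Type
  [grp : AddCommGroup carrier]
  [mod : Module ℂ carrier]
  deg : ℤ → Submodule ℂ carrier
  par : carrier →ₗ[ℂ] carrier
  act : g.carrier →ₗ[ℂ] Module.End ℂ carrier

attribute [instance] GradedAction.grp GradedAction.mod

namespace GradedAction

variable {g : HalfGraded}

/-- `V` is a `(1/2)ℤ`-graded module over the Lie superalgebra `g`. -/
structure IsGradedModule (V : GradedAction g) : Prop where
  internal : DirectSum.IsInternal V.deg
  par_apply : ∀ (d : ℤ) (v : V.carrier), v ∈ V.deg d → V.par v = ((-1 : ℂ) ^ d) • v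
  act_mem : ∀ (i j : ℤ) (x : g.carrier) (v : V.carrier),
    x ∈ g.deg i → v ∈ V.deg j → V.act x v ∈ V.deg (i + j)
  act_bracket : ∀ (i j : ℤ) (x y : g.carrier), x ∈ g.deg i → y ∈ g.deg j →
    V.act (g.bracket x y) =
      V.act x * V.act y - ((-1 : ℂ) ^ (i * j)) • (V.act y * V.act x)

/-- All graded pieces are finite dimensional. -/
def Quasifinite (V : GradedAction g) : Prop := ∀ d : ℤ, FiniteDimensional ℂ (V.deg d)

/-- `V` is a highest weight module of highest weight `lam ∈ (g_0)^*`: the degree zero piece is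
spanned by a nonzero vector `v` of weight `lam` that is annihilated by all positive degrees and
generates `V` under the negative degrees. -/
def IsHighestWeight (V : GradedAction g) (lam : Module.Dual ℂ (g.deg 0)) : Prop :=
  V.IsGradedModule ∧ ∃ v : V.carrier, v ≠ 0 ∧ V.deg 0 = Submodule.span ℂ {v} ∧
    (∀ h : g.deg 0, V.act (h : g.carrier) v = lam h • v) ∧
    (∀ d : ℤ, 0 < d → ∀ x ∈ g.deg d, V.act x v = 0) ∧
    (∀ W : Submodule ℂ V.carrier, v ∈ W →
      (∀ d : ℤ, d < 0 → ∀ x ∈ g.deg d, ∀ w ∈ W, V.act x w ∈ W) → W = ⊤)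

/-- No invariant subspaces other than `0` and `V`. -/
def IsIrreducible (V : GradedAction g) : Prop :=
  ∀ W : Submodule ℂ V.carrier, (∀ (x : g.carrier), ∀ w ∈ W, V.act x w ∈ W) → W = ⊥ ∨ W = ⊤

/-- `V` is (a model of) the irreducible highest weight module `L(g, lam)`. -/
def IsL (V : GradedAction g) (lam : Module.Dual ℂ (g.deg 0)) : Prop :=
  V.IsHighestWeight lam ∧ V.IsIrreducible

/-- Isomorphism of graded `g`-modules (linear, commuting with the action, preserving degree and
parity). -/
def Iso (V W : GradedAction g) : Prop :=
  ∃ e : V.carrier ≃ₗ[ℂ] W.carrier,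
    (∀ (x : g.carrier) (v : V.carrier), e (V.act x v) = W.act x (e v)) ∧
    (∀ v : V.carrier, e (V.par v) = W.par (e v)) ∧
    (∀ d : ℤ, (V.deg d).map (e : V.carrier →ₗ[ℂ] W.carrier) = W.deg d)

/-- Pull-back of an action along a linear map. -/
def pullback {k : HalfGraded} (f : k.carrier →ₗ[ℂ] g.carrier) (V : GradedAction g) :
    GradedAction k where
  carrier := V.carrier
  deg := V.deg
  par := V.par
  act := V.act ∘ₗ f

end GradedAction

/-! ### The centrally extended superalgebra of quantum pseudo-differential operators -/

/-- `(n, k, i, j)` stands for the basis element `z^n T_q^k M_{i+1, j+1}`, that is, the indices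
`1, 2` of matrix units are encoded by `0, 1`. -/
abbrev Idx : Type := ℤ × ℤ × Fin 2 × Fin 2

/-- Twice the principal degree: `z^n T_q^k M_{ii}` has degree `n`, `z^n T_q^k M_{12}` has degree
`n + 1/2` and `z^{n+1} T_q^k M_{21}` has degree `n + 1/2`. -/
def Idx.deg (x : Idx) : ℤ := 2 * x.1 + ((x.2.2.2 : ℕ) : ℤ) - ((x.2.2.1 : ℕ) : ℤ)

/-- `(-1)^{|M_{ij}| |M_{rs}|}`. -/
def Idx.sign (x y : Idx) : ℂ :=
  if x.2.2.1 ≠ x.2.2.2 ∧ y.2.2.1 ≠ y.2.2.2 then -1 else 1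

/-- The associative product
`(z^n T_q^k M_{ij}) (z^n' T_q^k' M_{rs}) = δ_{jr} q^{k n'} z^{n+n'} T_q^{k+k'} M_{is}`. -/
def mulBasis (q : ℂ) (x y : Idx) : Idx →₀ ℂ :=
  if x.2.2.2 = y.2.2.1 then
    Finsupp.single (x.1 + y.1, x.2.1 + y.2.1, x.2.2.1, y.2.2.2) (q ^ (x.2.1 * y.1))
  else 0

/-- The super 2-cocycle on basis elements. For `n = -n' > 0` it is
`Str_0((1 + σ + ... + σ^{n-1})(σ^{-n}(T_q^k M_{ij}) T_q^k' M_{rs}))`, which equals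
`(-1)^{i+1} n q^{-kn}` (for `i ∈ {1,2}`) if `k + k' = 0`, `j = r`, `i = s`, and is zero
otherwise; for `n = -n' < 0` the same closed formula is the value forced by super skew-symmetry. -/
def psiBasis (q : ℂ) (x y : Idx) : ℂ :=
  if x.1 + y.1 = 0 ∧ x.2.1 + y.2.1 = 0 ∧ x.2.2.2 = y.2.2.1 ∧ x.2.2.1 = y.2.2.2 then
    (-1) ^ (x.2.2.1 : ℕ) * (x.1 : ℂ) * q ^ (-(x.2.1 * x.1))
  else 0

/-- The central extension `\widehat{S𝔖_q}`: pairs `(F, c)` stand for `F + c C`, where `F` is a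
finite linear combination of the `z^n T_q^k M_{ij}`. -/
def SSq (q : ℂ) : HalfGraded where
  carrier := (Idx →₀ ℂ) × ℂ
  bracket := fun X Y =>
    (X.1.sum fun x a => Y.1.sum fun y b =>
        (a * b) • (mulBasis q x y - Idx.sign x y • mulBasis q y x),
      X.1.sum fun x a => Y.1.sum fun y b => a * b * psiBasis q x y)
  deg := fun d =>
    Submodule.prod (Finsupp.supported ℂ ℂ {x : Idx | x.deg = d}) (if d = 0 then ⊤ else ⊥)

namespace SSq

variable (q : ℂ)

/-- `T_q^k M_{ii}` as a degree zero element. -/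
def diag (k : ℤ) (i : Fin 2) : (SSq q).deg 0 :=
  ⟨(Finsupp.single (0, k, i, i) 1, 0), by
    refine Submodule.mem_prod.2 ⟨?_, ?_⟩
    · exact Finsupp.single_mem_supported ℂ 1 (by simp [Idx.deg])
    · simp⟩

/-- The central element `C` as a degree zero element. -/
def centralC : (SSq q).deg 0 :=
  ⟨(0, 1), Submodule.mem_prod.2 ⟨Submodule.zero_mem _, by simp⟩⟩

/-- The projection onto the even part (central element included). -/
def evenPart : (SSq q).carrier →ₗ[ℂ] (SSq q).carrier :=
  LinearMap.prodMap
    (Finsupp.linearCombination ℂ fun x : Idx =>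
      if x.2.2.1 = x.2.2.2 then Finsupp.single x (1 : ℂ) else 0)
    LinearMap.id

/-- The projection onto the odd part. -/
def oddPart : (SSq q).carrier →ₗ[ℂ] (SSq q).carrier :=
  LinearMap.id - evenPart q

/-- The labels `Δ_{k,i} = -lam(T_q^k M_{ii})` (with `i = 1, 2` encoded by `0, 1`). -/
def label {q : ℂ} (lam : Module.Dual ℂ ((SSq q).deg 0)) (k : ℤ) (i : Fin 2) : ℂ :=
  -lam (diag q k i)

variable {q}

/-- Tensor product of modules, `X (v ⊗ w) = X v ⊗ w + (-1)^{|X||v|} v ⊗ X w`. -/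
def tensor (V W : GradedAction (SSq q)) : GradedAction (SSq q) where
  carrier := V.carrier ⊗[ℂ] W.carrier
  deg := fun d => ⨆ i : ℤ,
    LinearMap.range (TensorProduct.map (V.deg i).subtype (W.deg (d - i)).subtype)
  par := TensorProduct.map V.par W.par
  act :=
    (LinearMap.rTensorHom W.carrier ∘ₗ V.act) +
    (LinearMap.lTensorHom V.carrier ∘ₗ W.act ∘ₗ evenPart q) +
    (TensorProduct.mapBilinear (RingHom.id ℂ) V.carrier W.carrier V.carrier W.carrier V.par ∘ₗ
      W.act ∘ₗ oddPart q)

/-- The one-dimensional module on which `F + c C` acts by `κ Str_0(F_0)`, where `F_0` is the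
`z^0`-part of `F`; that is, `M_{11}` acts by `κ`, `M_{22}` by `-κ` and every other basis element
(including `C`) by zero. -/
def charModule (q κ : ℂ) : GradedAction (SSq q) where
  carrier := ℂ
  deg := fun d => if d = 0 then ⊤ else ⊥
  par := LinearMap.id
  act := LinearMap.smulRight
    (κ • ((Finsupp.lapply ((0, 0, 0, 0) : Idx) - Finsupp.lapply ((0, 0, 1, 1) : Idx)) ∘ₗ
      LinearMap.fst ℂ (Idx →₀ ℂ) ℂ)) (1 : Module.End ℂ ℂ)

/-- Tensor product of a list of modules; the empty tensor product is the trivial module. -/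
def tensorList (l : List (GradedAction (SSq q))) : GradedAction (SSq q) :=
  l.foldr tensor (charModule q 0)

end SSq

/-! ### The central extension of `gl_{∞|∞}[m]` -/

/-- Truncated polynomials `R_m = ℂ[t]/(t^{m+1})`. -/
abbrev Trunc (m : ℕ) : Type := AdjoinRoot (Polynomial.X ^ (m + 1) : ℂ[X])

namespace Trunc

/-- The class of `t`. -/
def t (m : ℕ) : Trunc m := AdjoinRoot.root _

/-- The coefficient of `t^l` (for `l ≤ m`). -/
def coeff (m l : ℕ) : Trunc m →ₗ[ℂ] ℂ :=
  Polynomial.lcoeff ℂ l ∘ₗ AdjoinRoot.modByMonicHom (Polynomial.monic_X_pow (m + 1))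

/-- `exp(y t) = ∑_{l ≤ m} y^l t^l / l!`. -/
def exp (m : ℕ) (y : ℂ) : Trunc m :=
  ∑ l ∈ Finset.range (m + 1), (y ^ l / (l.factorial : ℂ)) • t m ^ l

end Trunc

/-- Matrices over `R_m` with finitely many nonzero diagonals. A row or column index `p : ℤ` stands
for the half-integer `p/2`: the index `2j` is the `j`-th index of the first (even) block and
`2j + 1` the `j`-th index of the second (odd) block, so `E_{ij} M_{αβ}` with `α, β ∈ {0, 1}` is
the matrix unit at `(2i + α, 2j + β)`, of parity `α + β`. -/
def band (m : ℕ) : Submodule ℂ (ℤ → ℤ → Trunc m) where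
  carrier := {A | ∃ B : ℤ, ∀ p r : ℤ, B < |p - r| → A p r = 0}
  zero_mem' := ⟨0, fun _ _ _ => rfl⟩
  add_mem' := by
    rintro A A' ⟨B, hB⟩ ⟨B', hB'⟩
    refine ⟨max B B', fun p r h => ?_⟩
    have h1 := hB p r (lt_of_le_of_lt (le_max_left _ _) h)
    have h2 := hB' p r (lt_of_le_of_lt (le_max_right _ _) h)
    simp [h1, h2]
  smul_mem' := by
    rintro c A ⟨B, hB⟩
    exact ⟨B, fun p r h => by simp [hB p r h]⟩

/-- The super commutator, entrywise: the `(p, s)` entry of `A B - (-1)^{|A||B|} B A`. All sums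
are finite for banded matrices. -/
def superComm {m : ℕ} (A B : ℤ → ℤ → Trunc m) (p s : ℤ) : Trunc m :=
  ∑ᶠ r : ℤ, (A p r * B r s - ((-1 : ℂ) ^ ((r - p) * (s - r))) • (B p r * A r s))

theorem superComm_mem {m : ℕ} {A B : ℤ → ℤ → Trunc m} (hA : A ∈ band m) (hB : B ∈ band m) :
    superComm A B ∈ band m := by
  obtain ⟨a, ha⟩ := hA
  obtain ⟨b, hb⟩ := hB
  refine ⟨|a| + |b|, fun p s h => ?_⟩
  have key : ∀ r : ℤ, A p r * B r s - ((-1 : ℂ) ^ ((r - p) * (s - r))) • (B p r * A r s) = 0 := by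
    intro r
    have htri : |p - s| ≤ |p - r| + |r - s| := abs_sub_le p r s
    have ha' := le_abs_self a
    have hb' := le_abs_self b
    have h1 : A p r * B r s = 0 := by
      by_cases h : a < |p - r|
      · rw [ha p r h, zero_mul]
      · rw [hb r s (by linarith), mul_zero]
    have h2 : B p r * A r s = 0 := by
      by_cases h : b < |p - r|
      · rw [hb p r h, zero_mul]
      · rw [ha r s (by linarith), mul_zero]
    rw [h1, h2, smul_zero, sub_zero]
  simp only [superComm, key, finsum_zero]

/-- The super 2-cocycle `C(A, B) = Str([J, A] B)` with `J = ∑_{j ≤ 0} E_{jj} (M_{11} + M_{22})`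
and `Str(A) = ∑_p (-1)^p A_{pp}`. -/
def glCocycle {m : ℕ} (A B : ℤ → ℤ → Trunc m) : Trunc m :=
  ∑ᶠ x : ℤ × ℤ,
    ((-1 : ℂ) ^ x.1 * ((if x.1 ≤ 1 then 1 else 0) - (if x.2 ≤ 1 then 1 else 0))) •
      (A x.1 x.2 * B x.2 x.1)

/-- Matrices supported on the diagonal `r - p = d`, that is, of principal degree `d/2`. -/
def diagonal (m : ℕ) (d : ℤ) : Submodule ℂ (band m) where
  carrier := {A | ∀ p r : ℤ, r - p ≠ d → (A : ℤ → ℤ → Trunc m) p r = 0}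
  zero_mem' := fun _ _ _ => rfl
  add_mem' := by
    intro A A' h h' p r hd
    simp [h p r hd, h' p r hd]
  smul_mem' := by
    intro c A h p r hd
    simp [h p r hd]

/-- The central extension `\widehat{gl}_{∞|∞}[m]` by `R_m`. -/
def glHat (m : ℕ) : HalfGraded where
  carrier := band m × Trunc m
  bracket := fun X Y =>
    (⟨superComm X.1.1 Y.1.1, superComm_mem X.1.2 Y.1.2⟩, glCocycle X.1.1 Y.1.1)
  deg := fun d => Submodule.prod (diagonal m d) (if d = 0 then ⊤ else ⊥)

/-! ### The embeddings of `\widehat{S𝔖_q}` into `\widehat{gl}_{∞|∞}[m]`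

Throughout, `ℓ` is a chosen logarithm of `q`, and `q^x` means `exp(ℓ x)` for complex `x`. -/

/-- With `s = q^a`, the image
`∑_j (s q^{-j+t})^k E_{j-n, j} M_{αβ}` of `z^n T_q^k M_{αβ}`, where
`(s q^{-j+t})^k = q^{(a-j)k} exp(k ℓ t)`. -/
def phiMatrix (ℓ a : ℂ) (m : ℕ) (x : Idx) : band m :=
  ⟨fun p r =>
    if r % 2 = ((x.2.2.2 : ℕ) : ℤ) ∧ p = 2 * (r / 2 - x.1) + ((x.2.2.1 : ℕ) : ℤ) then
      Complex.exp (ℓ * (a - ((r / 2 : ℤ) : ℂ)) * (x.2.1 : ℂ)) •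
        Trunc.exp m ((x.2.1 : ℂ) * ℓ)
    else 0, by
    refine ⟨2 * |x.1| + 2, fun p r h => if_neg ?_⟩
    rintro ⟨h1, h2⟩
    have h3 : (((x.2.2.1 : ℕ) : ℤ)) ≤ 1 := by have := x.2.2.1.2; omega
    have h4 : (((x.2.2.2 : ℕ) : ℤ)) ≤ 1 := by have := x.2.2.2.2; omega
    have h5 := le_abs_self x.1
    have h6 := neg_abs_le x.1
    rcases lt_abs.1 h with h | h <;> omega⟩

/-- The central correction: `T_q^k M_{ii}`, `k ≠ 0`, receives the additional term
`-(-1)^i q^{ak} / (1 - q^k) exp(k ℓ t) ∈ R_m` (with `i ∈ {1, 2}`). -/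
def phiCentral (ℓ a : ℂ) (m : ℕ) (x : Idx) : Trunc m :=
  if x.1 = 0 ∧ x.2.2.1 = x.2.2.2 ∧ x.2.1 ≠ 0 then
    ((-1) ^ (x.2.2.1 : ℕ) * (Complex.exp (ℓ * a * (x.2.1 : ℂ)) /
      (1 - Complex.exp (ℓ * (x.2.1 : ℂ))))) • Trunc.exp m ((x.2.1 : ℂ) * ℓ)
  else 0

/-- The homomorphism `\hat φ_s^{[m]}`, `s = q^a`; it sends `C` to `1 ∈ R_m`. -/
def phiHat (q ℓ a : ℂ) (m : ℕ) : (SSq q).carrier →ₗ[ℂ] (glHat m).carrier :=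
  LinearMap.coprod
    (Finsupp.linearCombination ℂ fun x : Idx => (phiMatrix ℓ a m x, phiCentral ℓ a m x))
    (LinearMap.toSpanSingleton ℂ (band m × Trunc m) (0, 1))

/-! ### Quasipolynomials, congruence classes, and the resulting weights

A quasipolynomial `P(x) = ∑_b P_b(x ℓ) q^{b x}` is encoded by the finitely supported family
of polynomials `b ↦ P_b`. -/

/-- The value `P(x) = ∑_b P_b(x ℓ) q^{b x}`. -/
def qpEval (ℓ : ℂ) (P : ℂ →₀ ℂ[X]) (x : ℂ) : ℂ :=
  P.sum fun b p => p.eval (x * ℓ) * Complex.exp (ℓ * b * x)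

/-- The labels of `lam` are given by the quasipolynomials `P12` and `P21`. -/
def HasLabels (q ℓ : ℂ) (lam : Module.Dual ℂ ((SSq q).deg 0)) (P12 P21 : ℂ →₀ ℂ[X]) : Prop :=
  (∀ n : ℤ, n ≠ 0 →
    SSq.label lam n 0 + SSq.label lam n 1 = qpEval ℓ P21 n ∧
    SSq.label lam n 0 = (qpEval ℓ P12 n - qpEval ℓ P21 n) / (q ^ n - 1)) ∧
  qpEval ℓ P12 0 - qpEval ℓ P21 0 = lam (SSq.centralC q)

/-- `b ∈ τ⁻¹ ℤ`, where `τ = ℓ / (2πi)`. -/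
def InPeriods (ℓ b : ℂ) : Prop := ∃ r : ℤ, b = r * (2 * Real.pi * Complex.I / ℓ)

/-- Congruence modulo `ℤ + τ⁻¹ ℤ`. -/
def Cong (ℓ a b : ℂ) : Prop := ∃ k : ℤ, InPeriods ℓ (a - b - k)

open Classical in
/-- The `l`-th derivative at `0` of the polynomial attached to the exponent `a`. Exponents matter
only modulo `τ⁻¹ ℤ`, as `q^{τ⁻¹ n} = 1` for integers `n`, so the polynomials of all exponents that
agree with `a` modulo `τ⁻¹ ℤ` are added up. -/
def jet (ℓ : ℂ) (P : ℂ →₀ ℂ[X]) (a : ℂ) (l : ℕ) : ℂ :=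
  P.sum fun b p =>
    if InPeriods ℓ (b - a) then ((Polynomial.derivative (R := ℂ))^[l] p).eval 0 else 0

section Weights

variable (ℓ : ℂ) (P12 P21 : ℂ →₀ ℂ[X]) (a : ℂ)

/-- The central charge `c_l = ∑_k (h_k^{(l)} - h_{k-1/2}^{(l)})`, where
`h_k^{(l)} = (d/dx)^l P_{12,a-k}(0)` and `h_{k-1/2}^{(l)} = (d/dx)^l P_{21,a-k}(0)`. -/
def chargeS (l : ℕ) : ℂ := ∑ᶠ k : ℤ, (jet ℓ P12 (a - k) l - jet ℓ P21 (a - k) l)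

/-- `h_k^{(l)} - δ_{k,0} c_l`. -/
def hTilde (k : ℤ) (l : ℕ) : ℂ :=
  jet ℓ P12 (a - k) l - if k = 0 then chargeS ℓ P12 P21 a l else 0

/-- The label on `t^l E_{ii} M_{11}`: `∑_{k ≥ i} (\tilde h_k^{(l)} - h_{k-1/2}^{(l)})`. -/
def label1 (i : ℤ) (l : ℕ) : ℂ :=
  ∑ᶠ (k : ℤ) (_ : i ≤ k), (hTilde ℓ P12 P21 a k l - jet ℓ P21 (a - k) l)

/-- The label on `t^l E_{ii} M_{22}`: `∑_{k ≥ i} (h_{k+1/2}^{(l)} - \tilde h_k^{(l)})`. -/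
def label2 (i : ℤ) (l : ℕ) : ℂ :=
  ∑ᶠ (k : ℤ) (_ : i ≤ k), (jet ℓ P21 (a - (k + 1 : ℤ)) l - hTilde ℓ P12 P21 a k l)

end Weights

/-- The functional reading off the coefficient of `t^l E_{pp}`. -/
def entryCoeff (m : ℕ) (p : ℤ) (l : ℕ) : Module.Dual ℂ (band m × Trunc m) :=
  Trunc.coeff m l ∘ₗ LinearMap.proj p ∘ₗ LinearMap.proj p ∘ₗ (band m).subtype ∘ₗ
    LinearMap.fst ℂ (band m) (Trunc m)

/-- The functional reading off the coefficient of the central element `t^l`. -/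
def centralCoeff (m l : ℕ) : Module.Dual ℂ (band m × Trunc m) :=
  Trunc.coeff m l ∘ₗ LinearMap.snd ℂ (band m) (Trunc m)

/-- The functional of finite support on the degree zero part of `\widehat{gl}_{∞|∞}[m]` with
labels `label1`, `label2` and central charges `chargeS`. -/
def weightS (ℓ : ℂ) (P12 P21 : ℂ →₀ ℂ[X]) (a : ℂ) (m : ℕ) :
    Module.Dual ℂ ((glHat m).deg 0) :=
  LinearMap.domRestrict
    (∑ l ∈ Finset.range (m + 1),
      ((∑ᶠ i : ℤ, label1 ℓ P12 P21 a i l • entryCoeff m (2 * i) l) +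
        (∑ᶠ i : ℤ, label2 ℓ P12 P21 a i l • entryCoeff m (2 * i + 1) l) +
        chargeS ℓ P12 P21 a l • centralCoeff m l) :
      Module.Dual ℂ (glHat m).carrier)
    ((glHat m).deg 0)

/-- `a_1, ..., a_N` are representatives of the distinct classes modulo `ℤ + τ⁻¹ ℤ` of the
exponents of `P12` and `P21`. -/
def IsClassReps (ℓ : ℂ) (P12 P21 : ℂ →₀ ℂ[X]) {N : ℕ} (a : Fin N → ℂ) : Prop :=
  (∀ i j, i ≠ j → ¬ Cong ℓ (a i) (a j)) ∧
  (∀ b ∈ P12.support ∪ P21.support, ∃ i, Cong ℓ b (a i)) ∧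
  (∀ i, ∃ b ∈ P12.support ∪ P21.support, Cong ℓ b (a i))

open Classical in
/-- The maximal degree of the polynomials attached to the exponents in the class of `a`. -/
def maxDeg (ℓ : ℂ) (P12 P21 : ℂ →₀ ℂ[X]) (a : ℂ) : ℕ :=
  ((P12.support ∪ P21.support).filter fun b => Cong ℓ b a).sup fun b =>
    max (P12 b).natDegree (P21 b).natDegree

/-- The parameter of the one-dimensional factor:
`κ = lam(M_{11}) - ∑_S ∑_i (label of the S-th weight on E_{ii} M_{11})`. -/
def kappa {q : ℂ} (ℓ : ℂ) (lam : Module.Dual ℂ ((SSq q).deg 0)) (P12 P21 : ℂ →₀ ℂ[X])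
    {N : ℕ} (a : Fin N → ℂ) : ℂ :=
  lam (SSq.diag q 0 0) - ∑ i : Fin N, ∑ᶠ j : ℤ, label1 ℓ P12 P21 (a i) j 0

/-- The `\widehat{S𝔖_q}`-module `ℂ_κ ⊗ (⊗_i M_i)`, where the `\widehat{gl}_{∞|∞}[m_i]`-module
`M_i` is pulled back along `\hat φ_{s_i}^{[m_i]}`, `s_i = q^{a_i}`. -/
def realization (q ℓ κ : ℂ) {N : ℕ} (a : Fin N → ℂ) (m : Fin N → ℕ)
    (M : ∀ i, GradedAction (glHat (m i))) : GradedAction (SSq q) :=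
  SSq.tensor (SSq.charModule q κ)
    (SSq.tensorList (List.ofFn fun i => (M i).pullback (phiHat q ℓ (a i) (m i))))

end QPDO

end

/-! An irreducible highest weight module is determined by its weight (`GradedAction.IsL.iso`). So
three things are needed: the weights on both sides must agree, the right-hand side must be
irreducible, and its factors must exist.

Weights. The piece of `L` of degree -1/2 is finite dimensional, so the vectors `T_q^k M_{21} v`
satisfy a linear relation, and so do the vectors `z^{-1} T_q^k M_{12} v`. Bracketing with degree 1/2
turns these relations into linear recurrences in `n` for `Δ_{n,1} + Δ_{n,2}` and `q^n Δ_{n,1} +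
Δ_{n,2} + δ_{n,0} c`; bilateral solutions of recurrences are quasipolynomials (`exists_labels`). The
sequences `p(n) u^n` are generalized eigenvectors of the shift, so a quasipolynomial is determined,
up to periods of its exponents, by its values at positive integers (`jet_eq_zero_of_qpEval`). The
weight of a product of pull-backs is described by quasipolynomials too (`exists_hasLabels`).
Comparing jets gives existence (`weight_eq`) and uniqueness (`weight_unique`) of the data.

Density. The entries of the image of `z^n f(T_q) M_{αβ}` under `phiHat` are values of `f` at the
points `q^{a-j+t}`. For incongruent `a_i` all these points are distinct, so finitely many rows of
all images can be prescribed at once (`exists_section`). On the other hand, on a fixed vector of an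
irreducible module of finitely supported weight, matrices of nonzero degree with enough vanishing
rows act by zero (`GradedAction.IsL.locally_trivial`, `glHat_locally_trivial`). Hence pull-backs
stay irreducible (`SSq.pullback_isL`). Moreover, on each tensor some element of `SSq` imitates the
action on a single factor, which makes the tensor product irreducible (`SSq.isL_tensor`).

Existence of the factors. These are found inside `L` and not as quotients of induced modules. Since
the weight of `L` is a sum of pull-backs of finitely supported weights, better and better
approximations of a tuple of matrices eventually act on a given vector in a constant way, up to an
explicit scalar. The limit is an action of the product of the `glHat (m i)` on `L`
(`CompatibleWeights.exists_limitAction`). What the `r`-th factor generates from the highest weight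
vector is the required irreducible module, and its graded pieces lie in those of `L`
(`exists_factor`).

For uniqueness the weights of the factors are arbitrary, but quasifiniteness over `glHat` forces
finite support (`finSupp_of_quasifinite`), so the computation of weights applies to them. -/

noncomputable section
namespace QPDO

/-! ### Gradings -/

section Gradings

variable {E : Type*} [AddCommGroup E] [Module ℂ E] {A : ℤ → Submodule ℂ E}

/-- The decomposition given by an internal grading. -/
def gradedEquiv (h : DirectSum.IsInternal A) : E ≃ₗ[ℂ] DirectSum ℤ fun i => A i :=
  (LinearEquiv.ofBijective (DirectSum.coeLinearMap A) h).symm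

/-- The projections onto the pieces of an internal grading. -/
def gradedProj (h : DirectSum.IsInternal A) (d : ℤ) : E →ₗ[ℂ] E :=
  (A d).subtype ∘ₗ DirectSum.component ℂ ℤ (fun i => A i) d ∘ₗ
    (gradedEquiv h).toLinearMap

theorem gradedProj_mem (h : DirectSum.IsInternal A) (d : ℤ) (a : E) : gradedProj h d a ∈ A d :=
  Submodule.coe_mem _

theorem gradedEquiv_apply (h : DirectSum.IsInternal A) {d : ℤ} {a : E} (ha : a ∈ A d) :
    gradedEquiv h a = DirectSum.lof ℂ ℤ (fun i => A i) d ⟨a, ha⟩ := by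
  rw [gradedEquiv, LinearEquiv.symm_apply_eq]
  exact (DirectSum.coeLinearMap_lof A d ⟨a, ha⟩).symm

theorem gradedProj_same (h : DirectSum.IsInternal A) {d : ℤ} {a : E} (ha : a ∈ A d) :
    gradedProj h d a = a := by
  simp [gradedProj, gradedEquiv_apply h ha, DirectSum.component.lof_self]

theorem gradedProj_ne (h : DirectSum.IsInternal A) {d e : ℤ} (hde : d ≠ e) {a : E}
    (ha : a ∈ A d) : gradedProj h e a = 0 := by
  simp [gradedProj, gradedEquiv_apply h ha, DirectSum.component.of, hde]

theorem eq_zero_of_gradedProj (h : DirectSum.IsInternal A) {a : E}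
    (ha : ∀ d, gradedProj h d a = 0) : a = 0 := by
  have : gradedEquiv h a = 0 := by
    ext d
    exact congrArg _ (Subtype.ext (ha d))
  simpa using this

theorem iSup_eq_top_of_isInternal (h : DirectSum.IsInternal A) : ⨆ d, A d = ⊤ :=
  h.submodule_iSup_eq_top

theorem isInternal_induction (h : DirectSum.IsInternal A) {p : E → Prop} (a : E)
    (hom : ∀ d, ∀ x ∈ A d, p x) (zero : p 0) (add : ∀ x y, p x → p y → p (x + y)) : p a :=
  Submodule.iSup_induction A (motive := p)
    (by rw [iSup_eq_top_of_isInternal h]; trivial) hom zero add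

theorem mem_of_gradedProj_mem (h : DirectSum.IsInternal A) {d : ℤ} {a : E}
    (ha : ∀ e, e ≠ d → gradedProj h e a = 0) : a ∈ A d := by
  have : a - gradedProj h d a = 0 := by
    refine eq_zero_of_gradedProj h fun e => ?_
    rw [map_sub]
    by_cases hed : e = d
    · subst hed
      rw [gradedProj_same h (gradedProj_mem h _ a), sub_self]
    · rw [ha e hed, gradedProj_ne h (Ne.symm hed) (gradedProj_mem h d a), sub_zero]
  rw [sub_eq_zero.1 this]
  exact gradedProj_mem h d a

theorem eq_zero_of_mem_of_mem (h : DirectSum.IsInternal A) {d e : ℤ} (hde : d ≠ e) {a : E}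
    (hd : a ∈ A d) (he : a ∈ A e) : a = 0 := by
  rw [← gradedProj_same h hd, gradedProj_ne h hde.symm he]

end Gradings

/-! ### Representations and the subspaces generated by negative degrees -/

/-- The graded pieces span, and the bracket is graded. -/
structure HalfGraded.IsGraded (g : HalfGraded) : Prop where
  iSup_deg : ⨆ d, g.deg d = ⊤
  bracket_mem : ∀ (i j : ℤ) (x y : g.carrier), x ∈ g.deg i → y ∈ g.deg j →
    g.bracket x y ∈ g.deg (i + j)

section Rep

variable {g : HalfGraded} {E : Type*} [AddCommGroup E] [Module ℂ E]

/-- The super bracket acts by the super commutator. -/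
def IsRep (ρ : g.carrier →ₗ[ℂ] Module.End ℂ E) : Prop :=
  ∀ (i j : ℤ) (x y : g.carrier), x ∈ g.deg i → y ∈ g.deg j →
    ρ (g.bracket x y) = ρ x * ρ y - ((-1 : ℂ) ^ (i * j)) • (ρ y * ρ x)

theorem IsRep.apply_apply {ρ : g.carrier →ₗ[ℂ] Module.End ℂ E} (h : IsRep ρ) {i j : ℤ}
    {x y : g.carrier} (hx : x ∈ g.deg i) (hy : y ∈ g.deg j) (u : E) :
    ρ x (ρ y u) = ρ (g.bracket x y) u + ((-1 : ℂ) ^ (i * j)) • ρ y (ρ x u) := by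
  rw [h i j x y hx hy]
  simp

theorem neg_one_zpow_mul_self (n : ℤ) : (-1 : ℂ) ^ n * (-1 : ℂ) ^ n = 1 := by
  rw [← mul_zpow]; simp

theorem IsRep.apply_apply' {ρ : g.carrier →ₗ[ℂ] Module.End ℂ E} (h : IsRep ρ) {i j : ℤ}
    {x y : g.carrier} (hx : x ∈ g.deg i) (hy : y ∈ g.deg j) (u : E) :
    ρ y (ρ x u) = ((-1 : ℂ) ^ (i * j)) • (ρ x (ρ y u) - ρ (g.bracket x y) u) := by
  rw [h.apply_apply hx hy u, add_sub_cancel_left, smul_smul, neg_one_zpow_mul_self, one_smul]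

/-- The smallest subspace that contains `E0` and is stable under the negative degrees. -/
def negSpan (ρ : g.carrier →ₗ[ℂ] Module.End ℂ E) (E0 : Submodule ℂ E) : Submodule ℂ E :=
  sInf {W | E0 ≤ W ∧ ∀ d : ℤ, d < 0 → ∀ x ∈ g.deg d, ∀ w ∈ W, ρ x w ∈ W}

variable {ρ : g.carrier →ₗ[ℂ] Module.End ℂ E} {E0 : Submodule ℂ E}

theorem le_negSpan : E0 ≤ negSpan ρ E0 := le_sInf fun _ h => h.1

theorem negSpan_le {W : Submodule ℂ E} (h : E0 ≤ W)
    (h' : ∀ d : ℤ, d < 0 → ∀ x ∈ g.deg d, ∀ w ∈ W, ρ x w ∈ W) : negSpan ρ E0 ≤ W :=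
  sInf_le ⟨h, h'⟩

theorem negSpan_stable {d : ℤ} (hd : d < 0) {x : g.carrier} (hx : x ∈ g.deg d) {w : E}
    (hw : w ∈ negSpan ρ E0) : ρ x w ∈ negSpan ρ E0 := by
  rw [negSpan, Submodule.mem_sInf] at hw ⊢
  intro W hW
  exact hW.2 d hd x hx w (hw W hW)

theorem stable_of_homogeneous (hg : g.IsGraded) {W : Submodule ℂ E}
    (h : ∀ d : ℤ, ∀ x ∈ g.deg d, ∀ w ∈ W, ρ x w ∈ W) (x : g.carrier) {w : E} (hw : w ∈ W) :
    ρ x w ∈ W := by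
  refine Submodule.iSup_induction g.deg (motive := fun x => ρ x w ∈ W)
    (by rw [hg.iSup_deg]; trivial) (fun d x hx => h d x hx w hw) ?_ ?_
  · simp
  · intro x y hx hy
    rw [map_add]
    exact W.add_mem hx hy

/-- This replaces the triangular decomposition of an enveloping algebra. The vectors that all
nonnegative degrees keep inside the span are closed under a negative `y`: moving `x` past `y` costs
a bracket of smaller degree, which is either negative or covered by the same hypothesis on the
vector. -/
theorem negSpan_invariant (hg : g.IsGraded) (hρ : IsRep ρ)
    (h0 : ∀ d : ℤ, 0 ≤ d → ∀ x ∈ g.deg d, ∀ w ∈ E0, ρ x w ∈ E0) (x : g.carrier) {w : E}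
    (hw : w ∈ negSpan ρ E0) : ρ x w ∈ negSpan ρ E0 := by
  let W : Submodule ℂ E :=
    { carrier := {w | w ∈ negSpan ρ E0 ∧ ∀ d : ℤ, 0 ≤ d → ∀ x ∈ g.deg d, ρ x w ∈ negSpan ρ E0}
      zero_mem' := by simp
      add_mem' := by
        rintro a b ⟨ha, ha'⟩ ⟨hb, hb'⟩
        refine ⟨add_mem ha hb, fun d hd x hx => ?_⟩
        rw [map_add]
        exact add_mem (ha' d hd x hx) (hb' d hd x hx)
      smul_mem' := by
        rintro c a ⟨ha, ha'⟩
        refine ⟨Submodule.smul_mem _ _ ha, fun d hd x hx => ?_⟩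
        rw [map_smul]
        exact Submodule.smul_mem _ _ (ha' d hd x hx) }
  have hW : negSpan ρ E0 ≤ W := by
    refine negSpan_le (fun w hw => ⟨le_negSpan hw, fun d hd x hx => le_negSpan (h0 d hd x hx w hw)⟩)
      ?_
    rintro e he y hy w ⟨hw, hw'⟩
    refine ⟨negSpan_stable he hy hw, fun d hd x hx => ?_⟩
    rw [hρ.apply_apply hx hy]
    refine add_mem ?_ (Submodule.smul_mem _ _ (negSpan_stable he hy (hw' d hd x hx)))
    have hb := hg.bracket_mem d e x y hx hy
    by_cases hde : d + e < 0
    · exact negSpan_stable hde hb hw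
    · exact hw' _ (not_lt.1 hde) _ hb
  refine stable_of_homogeneous hg (fun d x hx w hw => ?_) x hw
  by_cases hd : d < 0
  · exact negSpan_stable hd hx hw
  · exact (hW hw).2 d (not_lt.1 hd) x hx

end Rep

/-! ### Highest weight modules -/

namespace GradedAction

variable {g : HalfGraded} {V : GradedAction g} {lam : Module.Dual ℂ (g.deg 0)}

theorem IsGradedModule.isRep (h : V.IsGradedModule) : IsRep V.act := h.act_bracket

theorem IsGradedModule.proj_act (h : V.IsGradedModule) {k : ℤ} {x : g.carrier}
    (hx : x ∈ g.deg k) (d : ℤ) (u : V.carrier) :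
    gradedProj h.internal (k + d) (V.act x u) = V.act x (gradedProj h.internal d u) := by
  refine isInternal_induction h.internal (p := fun u => gradedProj h.internal (k + d) (V.act x u) =
    V.act x (gradedProj h.internal d u)) u (fun e w hw => ?_) (by simp) fun a b ha hb => ?_
  · have hm := h.act_mem k e x w hx hw
    by_cases hde : e = d
    · subst hde
      rw [gradedProj_same _ hw, gradedProj_same _ hm]
    · rw [gradedProj_ne _ hde hw, gradedProj_ne _ (by omega) hm, map_zero]
  · simp only [map_add, ha, hb]

/-- A chosen highest weight vector. -/
def IsHighestWeight.vec (h : V.IsHighestWeight lam) : V.carrier := h.2.choose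

section Vector

variable (h : V.IsHighestWeight lam)
include h

theorem IsHighestWeight.vec_ne_zero : h.vec ≠ 0 := h.2.choose_spec.1

theorem IsHighestWeight.deg_zero : V.deg 0 = Submodule.span ℂ {h.vec} := h.2.choose_spec.2.1

theorem IsHighestWeight.vec_mem : h.vec ∈ V.deg 0 := by
  rw [h.deg_zero]; exact Submodule.mem_span_singleton_self _

theorem IsHighestWeight.act_deg_zero {x : g.carrier} (hx : x ∈ g.deg 0) :
    V.act x h.vec = lam ⟨x, hx⟩ • h.vec := h.2.choose_spec.2.2.1 ⟨x, hx⟩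

theorem IsHighestWeight.act_pos {d : ℤ} (hd : 0 < d) {x : g.carrier} (hx : x ∈ g.deg d) :
    V.act x h.vec = 0 := h.2.choose_spec.2.2.2.1 d hd x hx

theorem IsHighestWeight.eq_top (W : Submodule ℂ V.carrier) (hv : h.vec ∈ W)
    (hW : ∀ d : ℤ, d < 0 → ∀ x ∈ g.deg d, ∀ w ∈ W, V.act x w ∈ W) : W = ⊤ :=
  h.2.choose_spec.2.2.2.2 W hv hW

theorem IsHighestWeight.induction {p : V.carrier → Prop} (u : V.carrier)
    (vec : p h.vec) (zero : p 0) (add : ∀ a b, p a → p b → p (a + b))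
    (smul : ∀ (c : ℂ) a, p a → p (c • a))
    (act : ∀ d : ℤ, d < 0 → ∀ x ∈ g.deg d, ∀ w, p w → p (V.act x w)) : p u := by
  let W : Submodule ℂ V.carrier :=
    { carrier := {u | p u}, zero_mem' := zero, add_mem' := fun ha hb => add _ _ ha hb
      smul_mem' := fun c _ ha => smul c _ ha }
  have : W = ⊤ := h.eq_top W vec act
  have hu : u ∈ W := by rw [this]; trivial
  exact hu

theorem IsHighestWeight.proj_pos {d : ℤ} (hd : 0 < d) (u : V.carrier) :
    gradedProj h.1.internal d u = 0 := by
  revert d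
  refine h.induction (p := fun u => ∀ {d : ℤ}, 0 < d → gradedProj h.1.internal d u = 0) u
    (fun hd => gradedProj_ne _ (by omega) h.vec_mem) (by simp) ?_ ?_ ?_
  · intro a b ha hb d hd
    rw [map_add, ha hd, hb hd, add_zero]
  · intro c a ha d hd
    rw [map_smul, ha hd, smul_zero]
  · intro e he x hx w hw d hd
    have := h.1.proj_act hx (d - e) w
    rw [add_sub_cancel] at this
    rw [this, hw (by omega), map_zero]

theorem IsHighestWeight.deg_pos {d : ℤ} (hd : 0 < d) : V.deg d = ⊥ := by
  rw [eq_bot_iff]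
  intro u hu
  rw [Submodule.mem_bot, ← gradedProj_same h.1.internal hu]
  exact h.proj_pos hd u

end Vector

/-- Annihilated by all positive degrees. -/
def IsSingular (V : GradedAction g) (u : V.carrier) : Prop :=
  ∀ d : ℤ, 0 < d → ∀ x ∈ g.deg d, V.act x u = 0

/-- Degrees are bounded above by zero, and each positive element raises the lowest degree that
occurs in a vector, so repeated application must stop at a singular vector. The vectors need not be
homogeneous and `W` need not be graded; the induction is on a lower bound for the degrees of the
components. -/
theorem IsHighestWeight.exists_singular (h : V.IsHighestWeight lam) (W : Submodule ℂ V.carrier)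
    (hW : ∀ d : ℤ, 0 < d → ∀ x ∈ g.deg d, ∀ w ∈ W, V.act x w ∈ W) (hne : W ≠ ⊥) :
    ∃ w ∈ W, w ≠ 0 ∧ V.IsSingular w := by
  have key : ∀ n : ℕ, ∀ w ∈ W, w ≠ 0 → (∀ d : ℤ, d < -n → gradedProj h.1.internal d w = 0) →
      ∃ w ∈ W, w ≠ 0 ∧ V.IsSingular w := by
    intro n
    induction n with
    | zero =>
      intro w hw hw0 hd
      refine ⟨w, hw, hw0, fun d hd' x hx => ?_⟩
      refine eq_zero_of_gradedProj h.1.internal fun e => ?_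
      by_cases he : 0 < e
      · exact h.proj_pos he _
      · have := h.1.proj_act hx (e - d) w
        rw [add_sub_cancel] at this
        rw [this, hd _ (by push_cast; omega), map_zero]
    | succ n ih =>
      intro w hw hw0 hd
      by_cases hs : V.IsSingular w
      · exact ⟨w, hw, hw0, hs⟩
      · simp only [IsSingular, not_forall] at hs
        obtain ⟨d, hd', x, hx, hxw⟩ := hs
        refine ih _ (hW d hd' x hx w hw) hxw fun e he => ?_
        have := h.1.proj_act hx (e - d) w
        rw [add_sub_cancel] at this
        rw [this, hd _ (by push_cast; omega), map_zero]
  obtain ⟨w, hw, hw0⟩ := W.ne_bot_iff.1 hne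
  have hfin : ∀ w : V.carrier, ∃ n : ℕ, ∀ d : ℤ, d < -n → gradedProj h.1.internal d w = 0 := by
    intro w
    refine isInternal_induction h.1.internal (p := fun w => ∃ n : ℕ, ∀ d : ℤ, d < -n →
      gradedProj h.1.internal d w = 0) w (fun e u hu => ⟨e.natAbs, fun d hd =>
      gradedProj_ne _ (by omega) hu⟩) ⟨0, by simp⟩ ?_
    rintro a b ⟨n, hn⟩ ⟨n', hn'⟩
    refine ⟨max n n', fun d hd => ?_⟩
    rw [map_add, hn d (by push_cast at hd; omega), hn' d (by push_cast at hd; omega), add_zero]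
  obtain ⟨n, hn⟩ := hfin w
  exact key n w hw hw0 hn

/-- A nonzero invariant subspace contains a singular vector, hence the highest weight vector, hence
everything. Together with `IsL.mem_deg_zero` this reduces all later irreducibility proofs to
singular vectors. -/
theorem IsHighestWeight.irreducible_of_singular (h : V.IsHighestWeight lam)
    (hs : ∀ u, V.IsSingular u → u ∈ V.deg 0) : V.IsIrreducible := by
  intro W hW
  by_cases hne : W = ⊥
  · exact Or.inl hne
  · right
    obtain ⟨w, hw, hw0, hsing⟩ := h.exists_singular W (fun d _ x _ w hw => hW x w hw) hne
    have := hs w hsing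
    rw [h.deg_zero, Submodule.mem_span_singleton] at this
    obtain ⟨c, rfl⟩ := this
    have hc : c ≠ 0 := by rintro rfl; simp at hw0
    refine h.eq_top W ?_ fun d _ x _ w hw => hW x w hw
    simpa [smul_smul, inv_mul_cancel₀ hc] using W.smul_mem c⁻¹ hw

/-- Components of a singular vector are singular, and a nonzero one of degree `d < 0` would generate
a nonzero submodule living in degrees at most `d`. -/
theorem IsL.mem_deg_zero (hg : g.IsGraded) (h : V.IsL lam) {u : V.carrier}
    (hu : V.IsSingular u) : u ∈ V.deg 0 := by
  refine mem_of_gradedProj_mem h.1.1.internal fun d hd0 => ?_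
  by_cases hd : 0 < d
  · exact h.1.proj_pos hd u
  by_contra hne
  have hsd : V.IsSingular (gradedProj h.1.1.internal d u) := by
    intro k hk x hx
    rw [← h.1.1.proj_act hx, hu k hk x hx, map_zero]
  -- All singular vectors of degree `d` are taken, since degree zero need not preserve the line
  -- spanned by one of them.
  let E0 : Submodule ℂ V.carrier :=
    { carrier := {w | w ∈ V.deg d ∧ V.IsSingular w}
      zero_mem' := ⟨zero_mem _, fun d _ x _ => map_zero _⟩
      add_mem' := by
        rintro a b ⟨ha, ha'⟩ ⟨hb, hb'⟩
        refine ⟨add_mem ha hb, fun d hd x hx => ?_⟩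
        rw [map_add, ha' d hd x hx, hb' d hd x hx, add_zero]
      smul_mem' := by
        rintro c a ⟨ha, ha'⟩
        refine ⟨Submodule.smul_mem _ _ ha, fun d hd x hx => ?_⟩
        rw [map_smul, ha' d hd x hx, smul_zero] }
  have hinv := fun x w => negSpan_invariant (ρ := V.act) (E0 := E0) hg h.1.1.isRep (by
    rintro e he x hx w ⟨hw, hw'⟩
    rcases he.lt_or_eq with he | rfl
    · rw [hw' e he x hx]; exact zero_mem _
    · refine ⟨by simpa using h.1.1.act_mem 0 d x w hx hw, fun k hk y hy => ?_⟩
      rw [h.1.1.isRep.apply_apply hy hx, hw' k hk y hy,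
        hw' (k + 0) (by omega) _ (hg.bracket_mem k 0 y x hy hx)]
      simp) x (w := w)
  -- Negative degrees only lower the degree, so every component above `d` stays zero, in particular
  -- the one in degree zero.
  have hlow : negSpan V.act E0 ≤ LinearMap.ker (gradedProj h.1.1.internal 0) := by
    let W : Submodule ℂ V.carrier := ⨅ e : {e : ℤ // d < e}, LinearMap.ker
      (gradedProj h.1.1.internal e)
    have : negSpan V.act E0 ≤ W := by
      refine negSpan_le ?_ ?_
      · rintro w ⟨hw, -⟩
        rw [Submodule.mem_iInf]
        rintro ⟨e, he⟩
        exact gradedProj_ne _ he.ne hw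
      · intro k hk x hx w hw
        rw [Submodule.mem_iInf] at hw ⊢
        rintro ⟨e, he⟩
        have h1 := h.1.1.proj_act hx (e - k) w
        rw [add_sub_cancel] at h1
        have h2 : gradedProj h.1.1.internal (e - k) w = 0 := hw ⟨e - k, by omega⟩
        rw [LinearMap.mem_ker, h1, h2, map_zero]
    exact this.trans (iInf_le _ (⟨0, by omega⟩ : {e : ℤ // d < e}))
  rcases h.2 _ hinv with hb | ht
  · have := le_negSpan (ρ := V.act) (E0 := E0) (x := gradedProj h.1.1.internal d u)
      ⟨gradedProj_mem _ _ _, hsd⟩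
    rw [hb] at this
    exact hne this
  · have : h.1.vec ∈ negSpan V.act E0 := by rw [ht]; trivial
    have := hlow this
    rw [LinearMap.mem_ker, gradedProj_same _ h.1.vec_mem] at this
    exact h.1.vec_ne_zero this

theorem IsGradedModule.par_par (h : V.IsGradedModule) (u : V.carrier) :
    V.par (V.par u) = u := by
  refine isInternal_induction h.internal (p := fun u => V.par (V.par u) = u) u (fun e w hw => ?_) (by simp) fun a b ha hb => ?_
  · rw [h.par_apply _ _ hw, map_smul, h.par_apply _ _ hw, smul_smul, neg_one_zpow_mul_self,
      one_smul]
  · simp only [map_add, ha, hb]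

/-! ### Uniqueness of the irreducible highest weight module -/

/-- The action on the direct sum. -/
def prodAct (V V' : GradedAction g) : g.carrier →ₗ[ℂ] Module.End ℂ (V.carrier × V'.carrier) where
  toFun x := (V.act x).prodMap (V'.act x)
  map_add' x y := by ext <;> simp
  map_smul' c x := by ext <;> simp

/-- The second coordinates `b` with `(0, b)` in the submodule generated by the pair of highest
weight vectors form a submodule of the irreducible `V'`. It is not all of `V'`, because in degree
zero the generated submodule is just the line of that pair. Irreducibility of `V` plays no role
here. -/
theorem IsL.eq_zero_of_graph (hg : g.IsGraded) {V' : GradedAction g} (h : V.IsHighestWeight lam)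
    (h' : V'.IsL lam) {b : V'.carrier}
    (hb : (0, b) ∈ negSpan (prodAct V V') (Submodule.span ℂ {(h.vec, h'.1.vec)})) : b = 0 := by
  set S := negSpan (prodAct V V') (Submodule.span ℂ {(h.vec, h'.1.vec)}) with hS
  have hrep : IsRep (prodAct V V') := by
    intro i j x y hx hy
    ext u <;> simp [prodAct, h.1.act_bracket i j x y hx hy, h'.1.1.act_bracket i j x y hx hy]
  have hinv : ∀ x, ∀ w ∈ S, prodAct V V' x w ∈ S := fun x w hw =>
    negSpan_invariant hg hrep (by
      intro d hd x hx w hw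
      rw [Submodule.mem_span_singleton] at hw ⊢
      obtain ⟨c, rfl⟩ := hw
      rcases hd.lt_or_eq with hd | rfl
      · refine ⟨0, ?_⟩
        ext <;> simp [prodAct, h.act_pos hd hx, h'.1.act_pos hd hx]
      · refine ⟨c * lam ⟨x, hx⟩, ?_⟩
        ext <;> simp [prodAct, h.act_deg_zero hx, h'.1.act_deg_zero hx, smul_smul]) x hw
  let K : Submodule ℂ V'.carrier := S.comap (LinearMap.inr ℂ V.carrier V'.carrier)
  have hK : ∀ x, ∀ w ∈ K, V'.act x w ∈ K := by
    intro x w hw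
    have := hinv x _ hw
    simpa [K, prodAct] using this
  rcases h'.2 K hK with hbot | htop
  · have : b ∈ K := hb
    rw [hbot] at this
    exact this
  · exfalso
    have hv : ((0, h'.1.vec) : V.carrier × V'.carrier) ∈ S := by
      have : h'.1.vec ∈ K := by rw [htop]; trivial
      exact this
    -- Pairs whose degree zero components are the same multiple of the two highest weight vectors.
    let W : Submodule ℂ (V.carrier × V'.carrier) :=
      { carrier := {w | ∃ c : ℂ, gradedProj h.1.internal 0 w.1 = c • h.vec ∧
          gradedProj h'.1.1.internal 0 w.2 = c • h'.1.vec}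
        zero_mem' := ⟨0, by simp⟩
        add_mem' := by
          rintro a b ⟨c, h1, h2⟩ ⟨c', h1', h2'⟩
          exact ⟨c + c', by simp [h1, h1', add_smul], by simp [h2, h2', add_smul]⟩
        smul_mem' := by
          rintro e a ⟨c, h1, h2⟩
          exact ⟨e * c, by simp [h1, mul_smul], by simp [h2, mul_smul]⟩ }
    have hSW : S ≤ W := by
      refine negSpan_le ?_ ?_
      · rw [Submodule.span_singleton_le_iff_mem]
        exact ⟨1, by simp [gradedProj_same _ h.vec_mem], by simp [gradedProj_same _ h'.1.vec_mem]⟩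
      · rintro d hd x hx w -
        refine ⟨0, ?_, ?_⟩
        · have := h.1.proj_act hx (0 - d) w.1
          rw [add_sub_cancel, h.proj_pos (d := 0 - d) (by omega), map_zero] at this
          rw [zero_smul]
          exact this
        · have := h'.1.1.proj_act hx (0 - d) w.2
          rw [add_sub_cancel, h'.1.proj_pos (d := 0 - d) (by omega), map_zero] at this
          rw [zero_smul]
          exact this
    obtain ⟨c, h1, h2⟩ := hSW hv
    have hc : c = 0 := by
      have : c • h.vec = 0 := by rw [← h1]; simp
      exact (smul_eq_zero.1 this).resolve_right h.vec_ne_zero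
    rw [gradedProj_same _ h'.1.vec_mem, hc, zero_smul] at h2
    exact h'.1.vec_ne_zero h2

theorem graph_comm {V' : GradedAction g} (h : V.IsHighestWeight lam) (h' : V'.IsHighestWeight lam)
    {a : V.carrier} {b : V'.carrier}
    (hb : (a, b) ∈ negSpan (prodAct V V') (Submodule.span ℂ {(h.vec, h'.vec)})) :
    (b, a) ∈ negSpan (prodAct V' V) (Submodule.span ℂ {(h'.vec, h.vec)}) := by
  have : negSpan (prodAct V V') (Submodule.span ℂ {(h.vec, h'.vec)}) ≤
      (negSpan (prodAct V' V) (Submodule.span ℂ {(h'.vec, h.vec)})).comap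
        (LinearEquiv.prodComm ℂ V.carrier V'.carrier).toLinearMap := by
    refine negSpan_le ?_ ?_
    · rw [Submodule.span_singleton_le_iff_mem]
      exact le_negSpan (Submodule.mem_span_singleton_self _)
    · intro d hd x hx w hw
      exact negSpan_stable (ρ := prodAct V' V) hd hx hw
  exact this hb

theorem graph_exists {V' : GradedAction g} (h : V.IsHighestWeight lam)
    (h' : V'.IsHighestWeight lam) (a : V.carrier) :
    ∃ b, (a, b) ∈ negSpan (prodAct V V') (Submodule.span ℂ {(h.vec, h'.vec)}) := by
  refine h.induction (p := fun a => ∃ b, (a, b) ∈ negSpan (prodAct V V')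
    (Submodule.span ℂ {(h.vec, h'.vec)})) a ?_ ⟨0, zero_mem _⟩ ?_ ?_ ?_
  · exact ⟨h'.vec, le_negSpan (Submodule.mem_span_singleton_self _)⟩
  · rintro a b ⟨a', ha⟩ ⟨b', hb⟩
    exact ⟨a' + b', add_mem ha hb⟩
  · rintro c a ⟨a', ha⟩
    exact ⟨c • a', Submodule.smul_mem _ c ha⟩
  · rintro d hd x hx w ⟨w', hw⟩
    exact ⟨V'.act x w', negSpan_stable (ρ := prodAct V V') hd hx hw⟩

/-- The generated submodule is graded; this is what makes the isomorphism read off from it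
homogeneous. -/
theorem graph_proj {V' : GradedAction g} (h : V.IsHighestWeight lam)
    (h' : V'.IsHighestWeight lam) {a : V.carrier} {b : V'.carrier}
    (hab : (a, b) ∈ negSpan (prodAct V V') (Submodule.span ℂ {(h.vec, h'.vec)})) (d : ℤ) :
    (gradedProj h.1.internal d a, gradedProj h'.1.internal d b) ∈
      negSpan (prodAct V V') (Submodule.span ℂ {(h.vec, h'.vec)}) := by
  set S := negSpan (prodAct V V') (Submodule.span ℂ {(h.vec, h'.vec)})
  let W : Submodule ℂ (V.carrier × V'.carrier) := ⨅ d : ℤ, S.comap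
    ((gradedProj h.1.internal d).prodMap (gradedProj h'.1.internal d))
  have : S ≤ W := by
    refine negSpan_le ?_ ?_
    · rw [Submodule.span_singleton_le_iff_mem, Submodule.mem_iInf]
      intro d
      by_cases hd : d = 0
      · subst hd
        simpa [gradedProj_same _ h.vec_mem, gradedProj_same _ h'.vec_mem] using
          le_negSpan (Submodule.mem_span_singleton_self _)
      · simp only [Submodule.mem_comap, LinearMap.prodMap_apply,
          gradedProj_ne _ (Ne.symm hd) h.vec_mem, gradedProj_ne _ (Ne.symm hd) h'.vec_mem]
        exact S.zero_mem
    · intro e he x hx w hw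
      rw [Submodule.mem_iInf] at hw ⊢
      intro d
      have h1 := h.1.proj_act hx (d - e) w.1
      have h2 := h'.1.proj_act hx (d - e) w.2
      rw [add_sub_cancel] at h1 h2
      have := negSpan_stable (ρ := prodAct V V') he hx (hw (d - e))
      simp only [prodAct, LinearMap.coe_mk, AddHom.coe_mk, LinearMap.prodMap_apply,
        Submodule.mem_comap, h1, h2] at this ⊢
      exact this
  exact (Submodule.mem_iInf _).1 (this hab) d

/-- Irreducible highest weight modules with the same highest weight are isomorphic. -/
theorem IsL.iso (hg : g.IsGraded) {V' : GradedAction g} (h : V.IsL lam) (h' : V'.IsL lam) :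
    V.Iso V' := by
  -- `S` is the graph of the isomorphism: its projections are injective by irreducibility and
  -- surjective because the modules are generated by their highest weight vectors.
  set S := negSpan (prodAct V V') (Submodule.span ℂ {(h.1.vec, h'.1.vec)}) with hS
  have hinj : ∀ b, ((0, b) : V.carrier × V'.carrier) ∈ S → b = 0 := fun b =>
    IsL.eq_zero_of_graph hg h.1 h'
  have hinj' : ∀ a, ((a, 0) : V.carrier × V'.carrier) ∈ S → a = 0 := fun a ha =>
    IsL.eq_zero_of_graph hg h'.1 h (graph_comm h.1 h'.1 ha)
  let f : S →ₗ[ℂ] V.carrier := LinearMap.fst ℂ _ _ ∘ₗ S.subtype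
  let f' : S →ₗ[ℂ] V'.carrier := LinearMap.snd ℂ _ _ ∘ₗ S.subtype
  have hf : Function.Bijective f := by
    constructor
    · rw [← LinearMap.ker_eq_bot, LinearMap.ker_eq_bot']
      rintro ⟨⟨a, b⟩, hab⟩ (h0 : a = 0)
      subst h0
      have := hinj b hab
      subst this
      rfl
    · intro a
      obtain ⟨b, hb⟩ := graph_exists h.1 h'.1 a
      exact ⟨⟨(a, b), hb⟩, rfl⟩
  have hf' : Function.Bijective f' := by
    constructor
    · rw [← LinearMap.ker_eq_bot, LinearMap.ker_eq_bot']
      rintro ⟨⟨a, b⟩, hab⟩ (h0 : b = 0)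
      subst h0
      have := hinj' a hab
      subst this
      rfl
    · intro b
      obtain ⟨a, ha⟩ := graph_exists h'.1 h.1 b
      exact ⟨⟨(a, b), graph_comm h'.1 h.1 ha⟩, rfl⟩
  let e : V.carrier ≃ₗ[ℂ] V'.carrier :=
    (LinearEquiv.ofBijective f hf).symm.trans (LinearEquiv.ofBijective f' hf')
  have he : ∀ a, (a, e a) ∈ S := by
    intro a
    obtain ⟨s, rfl⟩ := hf.2 a
    have : e (f s) = f' s := by
      simp only [e, LinearEquiv.trans_apply]
      rw [show (LinearEquiv.ofBijective f hf).symm (f s) = s from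
        (LinearEquiv.ofBijective f hf).symm_apply_apply s]
      rfl
    rw [this]
    exact s.2
  have huniq : ∀ a b, (a, b) ∈ S → b = e a := by
    intro a b hab
    have := S.sub_mem hab (he a)
    rw [Prod.mk_sub_mk, sub_self] at this
    exact sub_eq_zero.1 (hinj _ this)
  have hdeg : ∀ (d : ℤ) (a : V.carrier), a ∈ V.deg d ↔ e a ∈ V'.deg d := by
    intro d a
    constructor
    · intro ha
      refine mem_of_gradedProj_mem h'.1.1.internal fun c hc => ?_
      have := graph_proj h.1 h'.1 (he a) c
      rw [gradedProj_ne _ (Ne.symm hc) ha] at this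
      exact hinj _ this
    · intro ha
      refine mem_of_gradedProj_mem h.1.1.internal fun c hc => ?_
      have := graph_proj h.1 h'.1 (he a) c
      rw [gradedProj_ne _ (Ne.symm hc) ha] at this
      exact hinj' _ this
  refine ⟨e, fun x v => ?_, fun v => ?_, fun d => ?_⟩
  · refine (huniq _ _ ?_).symm
    have hinv : ∀ x, ∀ w ∈ S, prodAct V V' x w ∈ S := fun x w hw =>
      negSpan_invariant hg (by
        intro i j x y hx hy
        ext u <;> simp [prodAct, h.1.1.act_bracket i j x y hx hy,
          h'.1.1.act_bracket i j x y hx hy]) (by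
        intro d hd x hx w hw
        rw [Submodule.mem_span_singleton] at hw ⊢
        obtain ⟨c, rfl⟩ := hw
        rcases hd.lt_or_eq with hd | rfl
        · refine ⟨0, ?_⟩
          ext <;> simp [prodAct, h.1.act_pos hd hx, h'.1.act_pos hd hx]
        · refine ⟨c * lam ⟨x, hx⟩, ?_⟩
          ext <;> simp [prodAct, h.1.act_deg_zero hx, h'.1.act_deg_zero hx, smul_smul]) x hw
    exact hinv x _ (he v)
  · refine isInternal_induction h.1.1.internal (p := fun v => e (V.par v) = V'.par (e v)) v (fun d w hw => ?_) (by simp) fun a b ha hb => ?_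
    · rw [h.1.1.par_apply d w hw, h'.1.1.par_apply d _ ((hdeg d w).1 hw), map_smul]
    · simp only [map_add, ha, hb]
  · ext b
    rw [Submodule.mem_map]
    constructor
    · rintro ⟨a, ha, rfl⟩
      exact (hdeg d a).1 ha
    · intro hb
      refine ⟨e.symm b, (hdeg d _).2 (by simpa using hb), by simp⟩

/-! ### Locally trivial families of elements -/

/-- If the graded subsets `Z N k` shrink under brackets in a controlled way and the highest weight
vanishes on the brackets of total degree zero, then on each vector the elements of `Z N k` with
large `N` act by zero if `k ≠ 0`, and by the highest weight if `k = 0`. -/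
theorem IsL.locally_trivial (hg : g.IsGraded) (h : V.IsL lam) (lam' : Module.Dual ℂ g.carrier)
    (hlam' : ∀ x : g.deg 0, lam' x = lam x) (Z : ℕ → ℤ → Set g.carrier)
    (hdeg : ∀ N k, ∀ X ∈ Z N k, X ∈ g.deg k)
    (hanti : ∀ N N' k, N ≤ N' → Z N' k ⊆ Z N k)
    (hbr : ∀ j : ℤ, ∃ c : ℕ, ∀ N k, ∀ x ∈ g.deg j, ∀ X ∈ Z (N + c) k,
      g.bracket x X ∈ Z N (j + k))
    (hzero : ∀ j : ℤ, ∃ N0 : ℕ, ∀ x ∈ g.deg j, ∀ X ∈ Z N0 (-j), lam' (g.bracket x X) = 0)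
    (u : V.carrier) (k : ℤ) :
    ∃ N0, ∀ N, N0 ≤ N → ∀ X ∈ Z N k, V.act X u = (if k = 0 then lam' X else 0) • u := by
  suffices H : ∀ k, ∃ N, ∀ X ∈ Z N k, V.act X u = (if k = 0 then lam' X else 0) • u by
    obtain ⟨N, hN⟩ := H k
    exact ⟨N, fun N' hN' X hX => hN X (hanti _ _ _ hN' hX)⟩
  have hrep := h.1.1.isRep
  refine h.1.induction (p := fun u => ∀ k, ∃ N, ∀ X ∈ Z N k,
    V.act X u = (if k = 0 then lam' X else 0) • u) u ?_ ?_ ?_ ?_ ?_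
  -- On the highest weight vector, a negative `X` produces a vector of negative degree, which is
  -- zero as soon as it is singular. Positive `x` turns it into `[x, X] v`: here the bracket has
  -- negative degree closer to zero (induction), degree zero (`hzero`), or positive degree.
  · have neg : ∀ n : ℕ, ∃ N, ∀ i : ℕ, i < n → ∀ X ∈ Z N (-((i : ℤ) + 1)),
        V.act X h.1.vec = 0 := by
      intro n
      induction n with
      | zero => exact ⟨0, by simp⟩
      | succ n ih =>
        obtain ⟨N, hN⟩ := ih
        obtain ⟨N0, hN0⟩ := hzero ((n : ℤ) + 1)
        choose c hc using hbr
        -- Only the losses `c j` with `0 < j ≤ n` matter, so a finite supremum controls all positive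
        -- `x` at once.
        let C := (Finset.range (n + 1)).sup fun i => c (i : ℤ)
        refine ⟨max N0 (N + C), fun i hi X hX => ?_⟩
        rcases Nat.lt_succ_iff_lt_or_eq.1 hi with hi | rfl
        · exact hN i hi X (hanti _ _ _ ((Nat.le_add_right _ _).trans (le_max_right _ _)) hX)
        · have hXd := hdeg _ _ _ hX
          have hmem := h.1.1.act_mem _ _ _ _ hXd h.1.vec_mem
          refine eq_zero_of_mem_of_mem h.1.1.internal (show -((i : ℤ) + 1) + 0 ≠ 0 by omega) hmem ?_
          refine h.mem_deg_zero hg fun j hj x hx => ?_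
          rw [hrep.apply_apply hx hXd, h.1.act_pos hj hx, map_zero, smul_zero, add_zero]
          have hbd := hg.bracket_mem _ _ _ _ hx hXd
          rcases lt_trichotomy j ((i : ℤ) + 1) with hlt | rfl | hgt
          · have hcj : c j ≤ C := by
              have : j.toNat ∈ Finset.range (i + 1) := by simp; omega
              have h2 := Finset.le_sup (f := fun i : ℕ => c (i : ℤ)) this
              simpa [Int.toNat_of_nonneg hj.le] using h2
            have hb := hc j N _ x hx X (hanti _ _ _
              ((Nat.add_le_add_left hcj N).trans (le_max_right _ _)) hX)
            have := hN (i - j.toNat) (by omega) (g.bracket x X)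
              (by convert hb using 2; omega)
            exact this
          · have hb0 : g.bracket x X ∈ g.deg 0 := by simpa using hbd
            rw [h.1.act_deg_zero hb0, ← hlam',
              hN0 x hx X (hanti _ _ _ (le_max_left _ _) hX), zero_smul]
          · exact h.1.act_pos (by omega) hbd
    intro k
    rcases lt_trichotomy k 0 with hk | rfl | hk
    · obtain ⟨N, hN⟩ := neg ((-k - 1).toNat + 1)
      refine ⟨N, fun X hX => ?_⟩
      rw [if_neg hk.ne, zero_smul]
      exact hN (-k - 1).toNat (by omega) X (by convert hX using 2; omega)
    · refine ⟨0, fun X hX => ?_⟩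
      rw [if_pos rfl, h.1.act_deg_zero (hdeg _ _ _ hX), ← hlam']
    · refine ⟨0, fun X hX => ?_⟩
      rw [if_neg hk.ne', zero_smul, h.1.act_pos hk (hdeg _ _ _ hX)]
  · exact fun k => ⟨0, by simp⟩
  · intro a b ha hb k
    obtain ⟨N, hN⟩ := ha k
    obtain ⟨N', hN'⟩ := hb k
    refine ⟨max N N', fun X hX => ?_⟩
    rw [map_add, hN X (hanti _ _ _ (le_max_left _ _) hX),
      hN' X (hanti _ _ _ (le_max_right _ _) hX), smul_add]
  · intro c a ha k
    obtain ⟨N, hN⟩ := ha k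
    refine ⟨N, fun X hX => ?_⟩
    rw [map_smul, hN X hX, smul_comm]
  · intro e he y hy w hw k
    obtain ⟨N, hN⟩ := hw k
    obtain ⟨N', hN'⟩ := hw (e + k)
    obtain ⟨c, hc⟩ := hbr e
    obtain ⟨N0, hN0⟩ := hzero e
    refine ⟨max N (max (N' + c) N0), fun X hX => ?_⟩
    have hXd := hdeg _ _ _ hX
    have h1 := hN X (hanti _ _ _ (le_max_left _ _) hX)
    have h2 : V.act (g.bracket y X) w = 0 := by
      rw [hN' _ (hc N' k y hy X (hanti _ _ _
        ((le_max_left _ _).trans (le_max_right _ _)) hX))]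
      split_ifs with hek
      · have hke : k = -e := by omega
        subst hke
        rw [hN0 y hy X (hanti _ _ _ ((le_max_right _ _).trans (le_max_right _ _)) hX), zero_smul]
      · exact zero_smul _ _
    rw [hrep.apply_apply' hy hXd, h1, h2, sub_zero, map_smul]
    split_ifs with hk
    · simp [hk]
    · simp

end GradedAction

/-- Pointwise eventually constant sequences of bilinear maps have a bilinear limit. -/
theorem exists_eventual_limit {G V : Type*} [AddCommGroup G] [Module ℂ G] [AddCommGroup V]
    [Module ℂ V] (F : ℕ → G →ₗ[ℂ] V →ₗ[ℂ] V)
    (h : ∀ x u, ∃ t, ∀ᶠ N in Filter.atTop, F N x u = t) :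
    ∃ T : G →ₗ[ℂ] V →ₗ[ℂ] V, ∀ x u, ∀ᶠ N in Filter.atTop, F N x u = T x u := by
  choose t ht using h
  have uniq : ∀ {x u s}, (∀ᶠ N in Filter.atTop, F N x u = s) → t x u = s := fun {x u s} hs => by
    obtain ⟨N, h1, h2⟩ := ((ht x u).and hs).exists
    exact h1.symm.trans h2
  refine ⟨LinearMap.mk₂ ℂ t ?_ ?_ ?_ ?_, fun x u => ht x u⟩
  · intro x y u
    refine uniq ?_
    filter_upwards [ht x u, ht y u] with N h1 h2
    simp [h1, h2]
  · intro c x u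
    refine uniq ?_
    filter_upwards [ht x u] with N h1
    simp [h1]
  · intro x u w
    refine uniq ?_
    filter_upwards [ht x u, ht x w] with N h1 h2
    simp [h1, h2]
  · intro c x u
    refine uniq ?_
    filter_upwards [ht x u] with N h1
    simp [h1]


/-! ### Quasipolynomials on the integers -/

section Sequences

/-- The shift on sequences. -/
def seqShift (M : Type*) [Semiring M] : Module.End ℂ (M → ℂ) where
  toFun s n := s (n + 1)
  map_add' _ _ := rfl
  map_smul' _ _ := rfl

/-- After removing the factor `u ^ n`, the operator `shift - u` is `u` times the forward difference.
For a polynomial `f`, a high power therefore vanishes, so `f n * u ^ n` is a generalized eigenvector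
of the shift. -/
theorem seqShift_sub_pow_apply (u : ℂ) (f : ℕ → ℂ) (k n : ℕ) :
    ((seqShift ℕ - u • (1 : Module.End ℂ (ℕ → ℂ))) ^ k) (fun n => f n * u ^ n) n =
      u ^ k * ((fwdDiff 1)^[k] f n) * u ^ n := by
  induction k generalizing f n with
  | zero => simp
  | succ k ih =>
    have : (seqShift ℕ - u • (1 : Module.End ℂ (ℕ → ℂ))) (fun n => f n * u ^ n) =
        u • fun n => (fwdDiff 1 f) n * u ^ n := by
      ext n
      simp [seqShift, fwdDiff]
      ring
    rw [pow_succ, Module.End.mul_apply, this, map_smul, Pi.smul_apply, ih, Function.iterate_succ,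
      Function.comp_apply, smul_eq_mul]
    ring

theorem fwdDiff_iter_comp_natCast (f : ℂ → ℂ) (k n : ℕ) :
    (fwdDiff 1)^[k] (fun n : ℕ => f n) n = (fwdDiff 1)^[k] f n := by
  induction k generalizing f n with
  | zero => rfl
  | succ k ih =>
    rw [Function.iterate_succ, Function.iterate_succ, Function.comp_apply, Function.comp_apply,
      ← ih]
    refine congrArg (fun g => (fwdDiff 1)^[k] g n) (funext fun n => ?_)
    simp [fwdDiff]

/-- The summands are generalized eigenvectors of the shift for distinct eigenvalues, hence
independent; each then vanishes, and a polynomial with infinitely many zeros is zero. -/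
theorem quasipoly_unique {ι : Type*} (s : Finset ι) (u : ι → ℂ) (hu0 : ∀ i ∈ s, u i ≠ 0)
    (hinj : Set.InjOn u s) (p : ι → ℂ[X])
    (h : ∀ n : ℕ, 1 ≤ n → ∑ i ∈ s, (p i).eval (n : ℂ) * u i ^ n = 0) : ∀ i ∈ s, p i = 0 := by
  classical
  -- The relation is only known from `n = 1` on, so the sequences are moved by one place.
  let v : ι → ℕ → ℂ := fun i n => (((p i).comp (Polynomial.X + 1)).eval (n : ℂ) * u i) * u i ^ n
  have hv : ∀ i, v i ∈ (seqShift ℕ).maxGenEigenspace (u i) := by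
    intro i
    rw [Module.End.mem_maxGenEigenspace]
    refine ⟨((p i).comp (Polynomial.X + 1) * Polynomial.C (u i)).natDegree + 1, ?_⟩
    ext n
    rw [seqShift_sub_pow_apply]
    have h1 := fwdDiff_iter_comp_natCast
      (((p i).comp (Polynomial.X + 1) * Polynomial.C (u i)).eval)
      (((p i).comp (Polynomial.X + 1) * Polynomial.C (u i)).natDegree + 1) n
    rw [Polynomial.fwdDiff_iter_eq_zero_of_degree_lt (Nat.lt_succ_self _)] at h1
    simp only [Polynomial.eval_mul, Polynomial.eval_C] at h1
    rw [h1]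
    simp
  have hsum : ∑ i ∈ s, v i = 0 := by
    ext n
    have := h (n + 1) (by omega)
    simp only [Finset.sum_apply, Pi.zero_apply, v]
    rw [← this]
    refine Finset.sum_congr rfl fun i _ => ?_
    simp [Polynomial.eval_comp]
    ring
  have hind := Module.End.independent_maxGenEigenspace (seqShift ℕ)
  have hzero : ∀ i ∈ s, v i = 0 := by
    have h2 := (iSupIndep_iff_finsetSum_eq_zero_imp_eq_zero _).1 hind (s.image u)
      (fun z => ∑ i ∈ s.filter fun i => u i = z, v i) (by
        intro z _
        refine Submodule.sum_mem _ fun i hi => ?_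
        rw [← (Finset.mem_filter.1 hi).2]
        exact hv i) (by
        rw [← hsum]
        exact Finset.sum_fiberwise_of_maps_to (fun i hi => Finset.mem_image_of_mem u hi) v)
    intro i hi
    have h3 := h2 (u i) (Finset.mem_image_of_mem u hi)
    have h4 : (s.filter fun j => u j = u i) = {i} := by
      ext j
      simp only [Finset.mem_filter, Finset.mem_singleton]
      exact ⟨fun hj => hinj hj.1 hi hj.2, by rintro rfl; exact ⟨hi, rfl⟩⟩
    simpa [h4] using h3
  intro i hi
  have h0 := hzero i hi
  refine Polynomial.eq_zero_of_infinite_isRoot _ (Set.Infinite.mono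
    (s := Set.range fun n : ℕ => ((n : ℂ) + 1)) ?_ ?_)
  · rintro _ ⟨n, rfl⟩
    have := congrFun h0 n
    simpa [v, hu0 i hi, Polynomial.eval_comp] using this
  · refine Set.infinite_range_of_injective fun a b hab => ?_
    simpa using hab

/-- Every polynomial has a discrete antiderivative. -/
theorem exists_antidifference (p : ℂ[X]) :
    ∃ r : ℂ[X], ∀ x : ℂ, r.eval (x + 1) - r.eval x = p.eval x := by
  induction p using Polynomial.induction_on' with
  | add p q hp hq =>
    obtain ⟨r, hr⟩ := hp
    obtain ⟨r', hr'⟩ := hq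
    refine ⟨r + r', fun x => ?_⟩
    simp only [Polynomial.eval_add]
    linear_combination hr x + hr' x
  | monomial n c =>
    -- The Bernoulli polynomial of index `n + 1` has difference `(n + 1) x ^ n`.
    have hb : ((Polynomial.bernoulli (n + 1)).map (algebraMap ℚ ℂ)).comp (1 + Polynomial.X) =
        (Polynomial.bernoulli (n + 1)).map (algebraMap ℚ ℂ) +
          Polynomial.C ((n : ℂ) + 1) * Polynomial.X ^ n := by
      have : (Polynomial.bernoulli (n + 1)).comp (1 + Polynomial.X) =
          Polynomial.bernoulli (n + 1) + Polynomial.C ((n : ℚ) + 1) * Polynomial.X ^ n := by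
        refine Polynomial.funext fun x => ?_
        rw [Polynomial.eval_comp]
        simp [Polynomial.bernoulli_eval_one_add]
      have h2 := congrArg (Polynomial.map (algebraMap ℚ ℂ)) this
      rw [Polynomial.map_comp] at h2
      simpa using h2
    refine ⟨Polynomial.C (c / (n + 1)) * (Polynomial.bernoulli (n + 1)).map (algebraMap ℚ ℂ),
      fun x => ?_⟩
    have h3 := congrArg (Polynomial.eval x) hb
    simp only [Polynomial.eval_comp, Polynomial.eval_add, Polynomial.eval_one, Polynomial.eval_X,
      Polynomial.eval_mul, Polynomial.eval_C, Polynomial.eval_pow, add_comm (1 : ℂ) x] at h3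
    simp only [Polynomial.eval_mul, Polynomial.eval_C, h3, Polynomial.eval_monomial]
    have : (n : ℂ) + 1 ≠ 0 := by exact_mod_cast Nat.succ_ne_zero n
    field_simp
    ring

/-- Induction on `k`: one factor `shift - u` is undone by summing a polynomial, at the price of a
constant of integration. -/
theorem eq_quasipoly_of_pow_eq_zero (u : ℂ) (hu : u ≠ 0) (k : ℕ) (s : ℤ → ℂ)
    (h : ((seqShift ℤ - u • (1 : Module.End ℂ (ℤ → ℂ))) ^ k) s = 0) :
    ∃ p : ℂ[X], ∀ n : ℤ, s n = p.eval (n : ℂ) * u ^ n := by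
  induction k generalizing s with
  | zero => exact ⟨0, fun n => by simpa using congrFun h n⟩
  | succ k ih =>
    rw [pow_succ, Module.End.mul_apply] at h
    obtain ⟨p, hp⟩ := ih _ h
    -- The sequence `s n * u ^ (-n)` has difference `u⁻¹ * p n`.
    obtain ⟨r, hr⟩ := exists_antidifference (Polynomial.C u⁻¹ * p)
    have hp' : ∀ n : ℤ, s (n + 1) - u * s n = p.eval (n : ℂ) * u ^ n := fun n => by
      rw [← hp n]; simp [seqShift]
    let d : ℤ → ℂ := fun n => s n * u ^ (-n) - r.eval (n : ℂ)
    have hd : ∀ n, d (n + 1) = d n := by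
      intro n
      have h1 := hr (n : ℂ)
      rw [Polynomial.eval_mul, Polynomial.eval_C] at h1
      have h2 : s (n + 1) = u * s n + p.eval (n : ℂ) * u ^ n := by rw [← hp' n]; ring
      have h3 : r.eval ((n : ℂ) + 1) = r.eval (n : ℂ) + u⁻¹ * p.eval (n : ℂ) := by rw [← h1]; ring
      have h4 : u ^ n * u ^ (-n) = 1 := by rw [← zpow_add₀ hu]; simp
      have h5 : u ^ (-(n + 1)) = u⁻¹ * u ^ (-n) := by
        rw [neg_add, zpow_add₀ hu, zpow_neg_one, mul_comm]
      simp only [d]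
      push_cast
      rw [h2, h3, h5]
      have h6 : u * u⁻¹ = 1 := mul_inv_cancel₀ hu
      linear_combination s n * u ^ (-n) * h6 + p.eval (n : ℂ) * u⁻¹ * h4
    have hd0 : ∀ n, d n = d 0 := by
      intro n
      induction n using Int.induction_on with
      | zero => rfl
      | succ n ih => rw [hd, ih]
      | pred n ih => rw [← ih, ← hd, sub_add_cancel]
    refine ⟨r + Polynomial.C (d 0), fun n => ?_⟩
    rw [Polynomial.eval_add, Polynomial.eval_C, ← hd0 n]
    simp only [d, add_sub_cancel]
    rw [mul_assoc, ← zpow_add₀ hu]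
    simp

end Sequences

/-! ### Jets of quasipolynomials modulo the periods of the exponents. -/

section Jets

variable {ℓ : ℂ}

theorem qpEval_add (P Q : ℂ →₀ ℂ[X]) (x : ℂ) :
    qpEval ℓ (P + Q) x = qpEval ℓ P x + qpEval ℓ Q x := by
  classical
  exact Finsupp.sum_add_index' (by simp) (by intros; simp [add_mul])

theorem qpEval_single (b : ℂ) (p : ℂ[X]) (x : ℂ) :
    qpEval ℓ (Finsupp.single b p) x = p.eval (x * ℓ) * Complex.exp (ℓ * b * x) :=
  Finsupp.sum_single_index (by simp)

theorem qpEval_sub (P Q : ℂ →₀ ℂ[X]) (x : ℂ) :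
    qpEval ℓ (P - Q) x = qpEval ℓ P x - qpEval ℓ Q x := by
  rw [eq_sub_iff_add_eq, ← qpEval_add, sub_add_cancel]

theorem qpEval_finsetSum {ι : Type*} (s : Finset ι) (P : ι → ℂ →₀ ℂ[X]) (x : ℂ) :
    qpEval ℓ (∑ i ∈ s, P i) x = ∑ i ∈ s, qpEval ℓ (P i) x := by
  classical
  induction s using Finset.induction_on with
  | empty => simp [qpEval]
  | insert i s hi ih => rw [Finset.sum_insert hi, Finset.sum_insert hi, qpEval_add, ih]

theorem jet_add (P Q : ℂ →₀ ℂ[X]) (a : ℂ) (l : ℕ) :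
    jet ℓ (P + Q) a l = jet ℓ P a l + jet ℓ Q a l := by
  classical
  refine Finsupp.sum_add_index' (by simp) fun b p p' => ?_
  split_ifs <;> simp

open Classical in
theorem jet_single (b : ℂ) (p : ℂ[X]) (a : ℂ) (l : ℕ) :
    jet ℓ (Finsupp.single b p) a l =
      if InPeriods ℓ (b - a) then (l.factorial : ℂ) * p.coeff l else 0 := by
  rw [jet, Finsupp.sum_single_index (by simp)]
  congr 1
  rw [← Polynomial.coeff_zero_eq_eval_zero, Polynomial.coeff_iterate_derivative]
  simp [Nat.descFactorial_self]

theorem jet_sub (P Q : ℂ →₀ ℂ[X]) (a : ℂ) (l : ℕ) :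
    jet ℓ (P - Q) a l = jet ℓ P a l - jet ℓ Q a l := by
  rw [eq_sub_iff_add_eq, ← jet_add, sub_add_cancel]

theorem jet_finsetSum {ι : Type*} (s : Finset ι) (P : ι → ℂ →₀ ℂ[X]) (a : ℂ) (l : ℕ) :
    jet ℓ (∑ i ∈ s, P i) a l = ∑ i ∈ s, jet ℓ (P i) a l := by
  classical
  induction s using Finset.induction_on with
  | empty => simp [jet]
  | insert i s hi ih => rw [Finset.sum_insert hi, Finset.sum_insert hi, jet_add, ih]

theorem inPeriods_iff (hℓ : ℓ ≠ 0) (b : ℂ) : InPeriods ℓ b ↔ Complex.exp (ℓ * b) = 1 := by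
  rw [Complex.exp_eq_one_iff]
  refine exists_congr fun r => ?_
  rw [mul_div_assoc', eq_div_iff hℓ, mul_comm b ℓ]

theorem inPeriods_sub_iff (hℓ : ℓ ≠ 0) (a b : ℂ) :
    InPeriods ℓ (a - b) ↔ Complex.exp (ℓ * a) = Complex.exp (ℓ * b) := by
  rw [inPeriods_iff hℓ, mul_sub, Complex.exp_sub, div_eq_one_iff_eq (Complex.exp_ne_zero _)]

theorem exp_mul_intCast (b : ℂ) (n : ℤ) :
    Complex.exp (ℓ * b * n) = Complex.exp (ℓ * b) ^ n := by
  rw [← Complex.exp_int_mul, mul_comm]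

open Classical in
/-- The sum of the polynomials of all exponents that agree with `a` modulo the periods. -/
def classPoly (ℓ : ℂ) (P : ℂ →₀ ℂ[X]) (u : ℂ) : ℂ[X] :=
  ∑ b ∈ P.support.filter fun b => Complex.exp (ℓ * b) = u, P b

/-- Jets are the Taylor coefficients of `classPoly`, up to factorials. So they carry exactly what
the restriction to the integers sees, where exponents matter only through `exp (ℓ * a)`. -/
theorem jet_eq_coeff (hℓ : ℓ ≠ 0) (P : ℂ →₀ ℂ[X]) (a : ℂ) (l : ℕ) :
    jet ℓ P a l = l.factorial * (classPoly ℓ P (Complex.exp (ℓ * a))).coeff l := by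
  classical
  conv_lhs => rw [← Finsupp.sum_single P, Finsupp.sum, jet_finsetSum]
  rw [classPoly, Polynomial.finsetSum_coeff, Finset.mul_sum, Finset.sum_filter]
  refine Finset.sum_congr rfl fun b _ => ?_
  rw [jet_single]
  simp only [inPeriods_sub_iff hℓ]

theorem jet_congr (hℓ : ℓ ≠ 0) (P : ℂ →₀ ℂ[X]) {a b : ℂ} (h : InPeriods ℓ (a - b)) (l : ℕ) :
    jet ℓ P a l = jet ℓ P b l := by
  rw [jet_eq_coeff hℓ, jet_eq_coeff hℓ, (inPeriods_sub_iff hℓ a b).1 h]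

theorem qpEval_eq_sum_classPoly (P : ℂ →₀ ℂ[X]) (n : ℤ) :
    qpEval ℓ P n = ∑ u ∈ P.support.image fun b => Complex.exp (ℓ * b),
      (classPoly ℓ P u).eval ((n : ℂ) * ℓ) * u ^ n := by
  classical
  rw [qpEval, Finsupp.sum,
    ← Finset.sum_fiberwise_of_maps_to (g := fun b => Complex.exp (ℓ * b))
      (fun b hb => Finset.mem_image_of_mem (fun b => Complex.exp (ℓ * b)) hb)]
  refine Finset.sum_congr (by congr) fun u _ => ?_
  rw [classPoly, Polynomial.eval_finsetSum, Finset.sum_mul]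
  refine Finset.sum_congr (by congr) fun b hb => ?_
  rw [exp_mul_intCast, (Finset.mem_filter.1 hb).2]

theorem qpEval_eq_zero_of_jet (hℓ : ℓ ≠ 0) {P : ℂ →₀ ℂ[X]} (h : ∀ b l, jet ℓ P b l = 0)
    (n : ℤ) : qpEval ℓ P n = 0 := by
  rw [qpEval_eq_sum_classPoly]
  refine Finset.sum_eq_zero fun u hu => ?_
  obtain ⟨b, -, rfl⟩ := Finset.mem_image.1 hu
  have : classPoly ℓ P (Complex.exp (ℓ * b)) = 0 := by
    ext l
    have := h b l
    rw [jet_eq_coeff hℓ] at this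
    simpa [Nat.factorial_ne_zero] using this
  rw [this]
  simp

/-- Already the positive integers separate the class polynomials, by `quasipoly_unique`. With
`qpEval_eq_zero_of_jet` it follows that values at nonzero integers force the value at `0`, which the
formulas for the labels do not mention. -/
theorem jet_eq_zero_of_qpEval (hℓ : ℓ ≠ 0) {P : ℂ →₀ ℂ[X]}
    (h : ∀ n : ℤ, n ≠ 0 → qpEval ℓ P n = 0) (b : ℂ) (l : ℕ) : jet ℓ P b l = 0 := by
  classical
  rw [jet_eq_coeff hℓ]
  by_cases hb : Complex.exp (ℓ * b) ∈ P.support.image fun b => Complex.exp (ℓ * b)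
  · have key := quasipoly_unique (P.support.image fun b => Complex.exp (ℓ * b)) id (by
      intro u hu
      obtain ⟨b, -, rfl⟩ := Finset.mem_image.1 hu
      exact Complex.exp_ne_zero _) (fun _ _ _ _ h => h)
      (fun u => (classPoly ℓ P u).comp (Polynomial.C ℓ * Polynomial.X)) (by
      intro n hn
      have := h n (by omega)
      rw [qpEval_eq_sum_classPoly] at this
      rw [← this]
      refine Finset.sum_congr (by congr) fun u _ => ?_
      simp only [Polynomial.eval_comp, Polynomial.eval_mul, Polynomial.eval_C, Polynomial.eval_X,
        id, Int.cast_natCast, zpow_natCast]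
      rw [mul_comm ℓ]) _ hb
    have h2 : classPoly ℓ P (Complex.exp (ℓ * b)) = 0 := by
      refine Polynomial.funext fun x => ?_
      have := congrArg (Polynomial.eval (x / ℓ)) key
      simp only [Polynomial.eval_comp, Polynomial.eval_mul, Polynomial.eval_C, Polynomial.eval_X,
        Polynomial.eval_zero] at this
      rw [mul_div_cancel₀ _ hℓ] at this
      rw [this, Polynomial.eval_zero]
    rw [h2]
    simp
  · rw [classPoly, Finset.filter_eq_empty_iff.2, Finset.sum_empty]
    · simp
    · intro c hc hcb
      exact hb (hcb ▸ Finset.mem_image_of_mem (fun b => Complex.exp (ℓ * b)) hc)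

theorem qpEval_eq_of_jet (hℓ : ℓ ≠ 0) {P Q : ℂ →₀ ℂ[X]} (h : ∀ b l, jet ℓ P b l = jet ℓ Q b l)
    (n : ℤ) : qpEval ℓ P n = qpEval ℓ Q n := by
  rw [← sub_eq_zero, ← qpEval_sub]
  exact qpEval_eq_zero_of_jet hℓ (fun b l => by rw [jet_sub, h, sub_self]) n

theorem jet_eq_of_qpEval (hℓ : ℓ ≠ 0) {P Q : ℂ →₀ ℂ[X]}
    (h : ∀ n : ℤ, n ≠ 0 → qpEval ℓ P n = qpEval ℓ Q n) (b : ℂ) (l : ℕ) :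
    jet ℓ P b l = jet ℓ Q b l := by
  rw [← sub_eq_zero, ← jet_sub]
  exact jet_eq_zero_of_qpEval hℓ (fun n hn => by rw [qpEval_sub, h n hn, sub_self]) b l

/-- Bilateral sequences that satisfy a linear recurrence are quasipolynomials. -/
theorem exists_qpEval_of_recurrence (hℓ : ℓ ≠ 0) (f : ℂ[X]) (hf : f ≠ 0) (s : ℤ → ℂ)
    (h : ∀ n : ℤ, ∑ k ∈ f.support, f.coeff k * s (n + k) = 0) :
    ∃ P : ℂ →₀ ℂ[X], ∀ n : ℤ, s n = qpEval ℓ P n := by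
  let Q : Submodule ℂ (ℤ → ℂ) :=
    { carrier := {s | ∃ P : ℂ →₀ ℂ[X], ∀ n : ℤ, s n = qpEval ℓ P n}
      zero_mem' := ⟨0, by simp [qpEval]⟩
      add_mem' := by
        rintro s t ⟨P, hP⟩ ⟨P', hP'⟩
        exact ⟨P + P', fun n => by rw [qpEval_add, ← hP, ← hP']; rfl⟩
      smul_mem' := by
        rintro c s ⟨P, hP⟩
        refine ⟨P.mapRange (fun p => c • p) (by simp), fun n => ?_⟩
        rw [qpEval, Finsupp.sum_mapRange_index (by simp), Pi.smul_apply, hP, qpEval, Finsupp.sum,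
          Finsupp.sum, smul_eq_mul, Finset.mul_sum]
        refine Finset.sum_congr rfl fun b _ => ?_
        rw [Polynomial.eval_smul, smul_eq_mul]
        ring }
  -- The root `u = 0` contributes nothing because the shift is injective on bilateral sequences. For
  -- `u ≠ 0` any exponent `b` with `exp (ℓ * b) = u` would serve.
  have hpow : ∀ (u : ℂ) (k : ℕ),
      LinearMap.ker ((seqShift ℤ - u • (1 : Module.End ℂ (ℤ → ℂ))) ^ k) ≤ Q := by
    intro u k s hs
    by_cases hu : u = 0
    · subst hu
      have : s = 0 := by
        rw [LinearMap.mem_ker, zero_smul, sub_zero] at hs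
        have hinj : Function.Injective (seqShift ℤ) := by
          intro a b hab
          ext n
          have := congrFun hab (n - 1)
          simpa [seqShift] using this
        have h2 : Function.Injective ((seqShift ℤ) ^ k) := by
          rw [Module.End.coe_pow]
          exact hinj.iterate k
        exact h2 (by rw [hs, map_zero])
      rw [this]
      exact Q.zero_mem
    · obtain ⟨p, hp⟩ := eq_quasipoly_of_pow_eq_zero u hu k s hs
      refine ⟨Finsupp.single (Complex.log u / ℓ) (p.comp (Polynomial.C ℓ⁻¹ * Polynomial.X)),
        fun n => ?_⟩
      rw [hp, qpEval_single, exp_mul_intCast, mul_div_cancel₀ _ hℓ, Complex.exp_log hu]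
      congr 1
      simp only [Polynomial.eval_comp, Polynomial.eval_mul, Polynomial.eval_C, Polynomial.eval_X]
      congr 1
      field_simp
  -- Primary decomposition of the kernel: one root is split off with its full multiplicity, the
  -- cofactor is coprime to it and has smaller degree.
  have key : ∀ (d : ℕ) (f : ℂ[X]), f ≠ 0 → f.natDegree = d →
      LinearMap.ker (Polynomial.aeval (seqShift ℤ) f) ≤ Q := by
    intro d
    induction d using Nat.strong_induction_on with
    | _ d ih =>
      intro f hf hfd
      by_cases hd : d = 0
      · have hc : f = Polynomial.C (f.coeff 0) :=
          Polynomial.eq_C_of_natDegree_eq_zero (hfd.trans hd)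
        have hc0 : f.coeff 0 ≠ 0 := fun h0 => hf (by rw [hc, h0, map_zero])
        intro s hs
        rw [hc, Polynomial.aeval_C, LinearMap.mem_ker, Module.algebraMap_end_apply] at hs
        rw [(smul_eq_zero.1 hs).resolve_left hc0]
        exact Q.zero_mem
      · obtain ⟨u, hu⟩ := IsAlgClosed.exists_root f (by
          rw [Polynomial.degree_eq_natDegree hf, hfd]; exact_mod_cast hd)
        obtain ⟨c, hfc, hnd⟩ := f.exists_eq_pow_rootMultiplicity_mul_and_not_dvd hf u
        have hm : 0 < f.rootMultiplicity u := (Polynomial.rootMultiplicity_pos hf).2 hu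
        have hc0 : c ≠ 0 := by rintro rfl; simp at hnd
        have hcop : IsCoprime ((Polynomial.X - Polynomial.C u) ^ f.rootMultiplicity u) c :=
          IsCoprime.pow_left (((Polynomial.irreducible_X_sub_C u).coprime_iff_not_dvd).2 hnd)
        have hdeg : c.natDegree < d := by
          have := congrArg Polynomial.natDegree hfc
          rw [Polynomial.natDegree_mul (pow_ne_zero _ (Polynomial.X_sub_C_ne_zero u)) hc0,
            Polynomial.natDegree_pow, Polynomial.natDegree_X_sub_C, hfd] at this
          omega
        rw [hfc, ← Polynomial.sup_ker_aeval_eq_ker_aeval_mul_of_coprime _ hcop]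
        refine sup_le ?_ (ih _ hdeg c hc0 rfl)
        have haeval : Polynomial.aeval (seqShift ℤ) ((Polynomial.X - Polynomial.C u) ^
            f.rootMultiplicity u) = (seqShift ℤ - u • 1) ^ f.rootMultiplicity u := by
          rw [map_pow, map_sub, Polynomial.aeval_X, Polynomial.aeval_C, Algebra.algebraMap_eq_smul_one]
        rw [haeval]
        exact hpow u _
  refine key _ f hf rfl (x := s) ?_
  rw [LinearMap.mem_ker]
  ext n
  have hsh : ∀ k : ℕ, ((seqShift ℤ) ^ k) s n = s (n + k) := by
    intro k
    induction k generalizing n with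
    | zero => simp
    | succ k ih =>
      rw [pow_succ', Module.End.mul_apply]
      change ((seqShift ℤ) ^ k) s (n + 1) = _
      rw [ih]
      congr 1
      push_cast
      ring
  rw [Polynomial.aeval_eq_sum_range, Pi.zero_apply, ← h n, LinearMap.sum_apply, Finset.sum_apply]
  rw [← Finset.sum_subset (s₁ := f.support)]
  · refine Finset.sum_congr rfl fun k _ => ?_
    rw [LinearMap.smul_apply, Pi.smul_apply, hsh, smul_eq_mul]
  · intro k hk
    rw [Finset.mem_range]
    exact Nat.lt_succ_of_le (Polynomial.le_natDegree_of_mem_supp k hk)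
  · intro k _ hk
    rw [Polynomial.notMem_support_iff.1 hk, zero_smul]
    rfl

end Jets


/-! ### Truncated polynomials -/

namespace Trunc

theorem t_pow_eq_zero (m : ℕ) : t m ^ (m + 1) = 0 := by
  have := AdjoinRoot.eval₂_root (Polynomial.X ^ (m + 1) : ℂ[X])
  simpa [t] using this

theorem coeff_t_pow (m l k : ℕ) (hk : k ≤ m) : coeff m l (t m ^ k) = if l = k then 1 else 0 := by
  have h1 : t m ^ k = AdjoinRoot.mk (Polynomial.X ^ (m + 1) : ℂ[X]) (Polynomial.X ^ k) := by
    rw [map_pow, AdjoinRoot.mk_X, t]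
  rw [coeff, LinearMap.comp_apply, h1, AdjoinRoot.modByMonicHom_mk,
    (Polynomial.modByMonic_eq_self_iff (Polynomial.monic_X_pow (m + 1))).2, Polynomial.lcoeff_apply,
    Polynomial.coeff_X_pow]
  rw [Polynomial.degree_X_pow, Polynomial.degree_X_pow]
  exact_mod_cast Nat.lt_succ_of_le hk

theorem eq_sum (m : ℕ) (x : Trunc m) :
    x = ∑ l ∈ Finset.range (m + 1), coeff m l x • t m ^ l := by
  have hmon := Polynomial.monic_X_pow (R := ℂ) (m + 1)
  have h1 := AdjoinRoot.mk_leftInverse hmon x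
  have h2 : (AdjoinRoot.modByMonicHom hmon x).natDegree < m + 1 := by
    obtain ⟨p, rfl⟩ := AdjoinRoot.mk_surjective x
    rw [AdjoinRoot.modByMonicHom_mk]
    have := Polynomial.natDegree_modByMonic_lt p hmon (by
      intro h
      have := congrArg Polynomial.natDegree h
      simp at this)
    simpa using this
  conv_lhs => rw [← h1, Polynomial.as_sum_range' _ _ h2, map_sum]
  refine Finset.sum_congr rfl fun l _ => ?_
  rw [← Polynomial.C_mul_X_pow_eq_monomial, map_mul, map_pow, AdjoinRoot.mk_X, AdjoinRoot.mk_C,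
    Algebra.smul_def]
  rfl

theorem coeff_exp (m l : ℕ) (hl : l ≤ m) (y : ℂ) : coeff m l (exp m y) = y ^ l / l.factorial := by
  rw [exp, map_sum, Finset.sum_eq_single l]
  · rw [map_smul, coeff_t_pow m l l hl, if_pos rfl, smul_eq_mul, mul_one]
  · intro k hk hkl
    rw [map_smul, coeff_t_pow m l k (Nat.lt_succ_iff.1 (Finset.mem_range.1 hk)),
      if_neg (Ne.symm hkl), smul_zero]
  · intro h
    exact absurd (Finset.mem_range.2 (Nat.lt_succ_of_le hl)) h

theorem exp_eq (m : ℕ) (y : ℂ) : exp m y = IsNilpotent.exp (y • t m) := by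
  rw [IsNilpotent.exp_eq_sum (k := m + 1) (by rw [smul_pow, t_pow_eq_zero, smul_zero]), exp]
  refine Finset.sum_congr rfl fun l _ => ?_
  rw [smul_pow, ← Rat.cast_smul_eq_qsmul ℂ, smul_smul]
  congr 1
  push_cast
  rw [div_eq_inv_mul]

theorem exp_add (m : ℕ) (y z : ℂ) : exp m (y + z) = exp m y * exp m z := by
  have hn : ∀ y : ℂ, IsNilpotent (y • t m) := fun y =>
    ⟨m + 1, by rw [smul_pow, t_pow_eq_zero, smul_zero]⟩
  rw [exp_eq, exp_eq, exp_eq, add_smul,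
    IsNilpotent.exp_add_of_commute (Commute.all _ _) (hn y) (hn z)]

theorem exp_zero (m : ℕ) : exp m 0 = 1 := by
  rw [exp_eq, zero_smul, IsNilpotent.exp_zero]

end Trunc

/-! ### The bracket of `glHat` -/

section GlBracket

variable {m : ℕ}

theorem superComm_finite {A : ℤ → ℤ → Trunc m} (hA : A ∈ band m) (B : ℤ → ℤ → Trunc m)
    (p s : ℤ) : (Function.support fun r : ℤ =>
      A p r * B r s - ((-1 : ℂ) ^ ((r - p) * (s - r))) • (B p r * A r s)).Finite := by
  obtain ⟨a, ha⟩ := hA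
  refine ((Set.finite_Icc (p - a) (p + a)).union (Set.finite_Icc (s - a) (s + a))).subset ?_
  intro r hr
  by_contra hcon
  simp only [Set.mem_union, Set.mem_Icc, not_or, not_and_or, not_le] at hcon
  have h1 : A p r = 0 := ha p r (by rw [lt_abs]; omega)
  have h2 : A r s = 0 := ha r s (by rw [lt_abs]; omega)
  exact hr (by simp [h1, h2])

/-- The commutator with `J` keeps only entries with exactly one index at most `1`, and a banded
matrix has finitely many of those. The threshold is `1` because the indices `0` and `1` both belong
to `j = 0`. -/
theorem glCocycle_finite {A : ℤ → ℤ → Trunc m} (hA : A ∈ band m) (B : ℤ → ℤ → Trunc m) :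
    (Function.support fun x : ℤ × ℤ =>
      ((-1 : ℂ) ^ x.1 * ((if x.1 ≤ 1 then 1 else 0) - (if x.2 ≤ 1 then 1 else 0))) •
      (A x.1 x.2 * B x.2 x.1)).Finite := by
  obtain ⟨a, ha⟩ := hA
  refine ((Set.finite_Icc (1 - a) (1 + a)).prod (Set.finite_Icc (1 - a) (1 + a))).subset ?_
  rintro ⟨x, y⟩ hr
  by_contra hcon
  simp only [Set.mem_prod, Set.mem_Icc, not_and_or, not_le] at hcon
  apply hr
  by_cases hxy : a < |x - y|
  · simp [ha x y hxy]
  · have h2 := abs_le.1 (not_lt.1 hxy)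
    by_cases hx : x ≤ 1 <;> by_cases hy : y ≤ 1 <;> simp [hx, hy] <;> omega

theorem superComm_add_right {A : ℤ → ℤ → Trunc m} (hA : A ∈ band m) (B B' : ℤ → ℤ → Trunc m) :
    superComm A (B + B') = superComm A B + superComm A B' := by
  funext p s
  simp only [superComm, Pi.add_apply]
  rw [← finsum_add_distrib (superComm_finite hA B p s) (superComm_finite hA B' p s)]
  refine finsum_congr fun r => ?_
  rw [mul_add, add_mul, smul_add]
  ring

theorem superComm_add_left {A A' : ℤ → ℤ → Trunc m} (hA : A ∈ band m) (hA' : A' ∈ band m)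
    (B : ℤ → ℤ → Trunc m) : superComm (A + A') B = superComm A B + superComm A' B := by
  funext p s
  simp only [superComm, Pi.add_apply]
  rw [← finsum_add_distrib (superComm_finite hA B p s) (superComm_finite hA' B p s)]
  refine finsum_congr fun r => ?_
  rw [mul_add, add_mul, smul_add]
  ring

theorem superComm_smul_right (c : ℂ) (A B : ℤ → ℤ → Trunc m) :
    superComm A (c • B) = c • superComm A B := by
  funext p s
  simp only [superComm, Pi.smul_apply]
  rw [smul_finsum]
  refine finsum_congr fun r => ?_
  rw [smul_sub, mul_smul_comm, smul_mul_assoc, smul_comm]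

theorem superComm_smul_left (c : ℂ) (A B : ℤ → ℤ → Trunc m) :
    superComm (c • A) B = c • superComm A B := by
  funext p s
  simp only [superComm, Pi.smul_apply]
  rw [smul_finsum]
  refine finsum_congr fun r => ?_
  rw [smul_sub, mul_smul_comm, smul_mul_assoc, smul_comm]

theorem glCocycle_add_right {A : ℤ → ℤ → Trunc m} (hA : A ∈ band m) (B B' : ℤ → ℤ → Trunc m) :
    glCocycle A (B + B') = glCocycle A B + glCocycle A B' := by
  simp only [glCocycle, Pi.add_apply]
  rw [← finsum_add_distrib (glCocycle_finite hA B) (glCocycle_finite hA B')]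
  exact finsum_congr fun r => by rw [mul_add, smul_add]

theorem glCocycle_add_left {A A' : ℤ → ℤ → Trunc m} (hA : A ∈ band m) (hA' : A' ∈ band m)
    (B : ℤ → ℤ → Trunc m) : glCocycle (A + A') B = glCocycle A B + glCocycle A' B := by
  simp only [glCocycle, Pi.add_apply]
  rw [← finsum_add_distrib (glCocycle_finite hA B) (glCocycle_finite hA' B)]
  exact finsum_congr fun r => by rw [add_mul, smul_add]

theorem glCocycle_smul_right (c : ℂ) (A B : ℤ → ℤ → Trunc m) :
    glCocycle A (c • B) = c • glCocycle A B := by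
  simp only [glCocycle, Pi.smul_apply]
  rw [smul_finsum]
  exact finsum_congr fun r => by rw [mul_smul_comm, smul_comm]

theorem glCocycle_smul_left (c : ℂ) (A B : ℤ → ℤ → Trunc m) :
    glCocycle (c • A) B = c • glCocycle A B := by
  simp only [glCocycle, Pi.smul_apply]
  rw [smul_finsum]
  exact finsum_congr fun r => by rw [smul_mul_assoc, smul_comm]

variable (m) in
/-- The bracket of `glHat` as a bilinear map. -/
def glBracket : (band m × Trunc m) →ₗ[ℂ] (band m × Trunc m) →ₗ[ℂ] band m × Trunc m :=
  LinearMap.mk₂ ℂ (glHat m).bracket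
    (fun X X' _ => Prod.ext (Subtype.ext (superComm_add_left X.1.2 X'.1.2 _))
      (glCocycle_add_left X.1.2 X'.1.2 _))
    (fun c _ _ => Prod.ext (Subtype.ext (superComm_smul_left c _ _)) (glCocycle_smul_left c _ _))
    (fun X _ _ => Prod.ext (Subtype.ext (superComm_add_right X.1.2 _ _))
      (glCocycle_add_right X.1.2 _ _))
    (fun c _ _ => Prod.ext (Subtype.ext (superComm_smul_right c _ _)) (glCocycle_smul_right c _ _))

theorem glBracket_apply (X Y : band m × Trunc m) : glBracket m X Y = (glHat m).bracket X Y := rfl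

theorem glHat_bracket_fst (X Y : band m × Trunc m) :
    ((glHat m).bracket X Y).1.1 = superComm X.1.1 Y.1.1 := rfl

theorem glHat_bracket_snd (X Y : band m × Trunc m) :
    ((glHat m).bracket X Y).2 = glCocycle X.1.1 Y.1.1 := rfl

theorem mem_glHat_deg {d : ℤ} {X : band m × Trunc m} :
    X ∈ (glHat m).deg d ↔ (∀ p r : ℤ, r - p ≠ d → X.1.1 p r = 0) ∧ (d ≠ 0 → X.2 = 0) := by
  change X ∈ Submodule.prod (diagonal m d) (if d = 0 then ⊤ else ⊥) ↔ _
  rw [Submodule.mem_prod]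
  refine and_congr Iff.rfl ?_
  by_cases hd : d = 0 <;> simp [hd]

theorem superComm_apply_eq_zero {i j : ℤ} {A B : ℤ → ℤ → Trunc m}
    (hA : ∀ p r : ℤ, r - p ≠ i → A p r = 0) (hB : ∀ p r : ℤ, r - p ≠ j → B p r = 0) (p s : ℤ)
    (h : s - p ≠ i + j) : superComm A B p s = 0 := by
  rw [superComm]
  refine finsum_eq_zero_of_forall_eq_zero fun r => ?_
  have h1 : A p r * B r s = 0 := by
    by_cases h : r - p = i
    · rw [hB r s (by omega), mul_zero]
    · rw [hA p r h, zero_mul]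
  have h2 : B p r * A r s = 0 := by
    by_cases h : r - p = j
    · rw [hA r s (by omega), mul_zero]
    · rw [hB p r h, zero_mul]
  rw [h1, h2, smul_zero, sub_zero]

theorem glCocycle_eq_zero_of_deg {i j : ℤ} {A B : ℤ → ℤ → Trunc m}
    (hA : ∀ p r : ℤ, r - p ≠ i → A p r = 0) (hB : ∀ p r : ℤ, r - p ≠ j → B p r = 0)
    (h : i + j ≠ 0) : glCocycle A B = 0 := by
  rw [glCocycle]
  refine finsum_eq_zero_of_forall_eq_zero fun x => ?_
  have h1 : A x.1 x.2 * B x.2 x.1 = 0 := by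
    by_cases h : x.2 - x.1 = i
    · rw [hB _ _ (by omega), mul_zero]
    · rw [hA _ _ h, zero_mul]
  rw [h1, smul_zero]

/-- The part of a banded matrix on one diagonal. -/
def diagPart (d : ℤ) : band m →ₗ[ℂ] band m where
  toFun A := ⟨fun p r => if r - p = d then A.1 p r else 0, |d|, fun p r h => if_neg (by
    rintro rfl
    rw [abs_sub_comm] at h
    exact lt_irrefl _ h)⟩
  map_add' A B := by
    ext p r
    by_cases h : r - p = d <;> simp [h]
  map_smul' c A := by
    ext p r
    by_cases h : r - p = d <;> simp [h]

theorem diagPart_apply (d : ℤ) (A : band m) (p r : ℤ) :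
    (diagPart d A).1 p r = if r - p = d then A.1 p r else 0 := rfl

theorem diagPart_mem (d : ℤ) (A : band m) : diagPart d A ∈ diagonal m d :=
  fun _ _ h => if_neg h

theorem exists_sum_diagPart (A : band m) :
    ∃ s : Finset ℤ, A = ∑ d ∈ s, diagPart d A := by
  obtain ⟨a, ha⟩ := A.2
  refine ⟨Finset.Icc (-a) a, ?_⟩
  ext p r
  rw [AddSubmonoidClass.coe_finsetSum, Finset.sum_apply, Finset.sum_apply]
  simp only [diagPart_apply]
  rw [Finset.sum_ite_eq]
  split_ifs with h
  · rfl
  · refine ha p r ?_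
    rw [Finset.mem_Icc] at h
    rw [lt_abs]
    omega

theorem glHat_isGraded (m : ℕ) : (glHat m).IsGraded where
  iSup_deg := by
    rw [eq_top_iff]
    rintro ⟨A, c⟩ -
    obtain ⟨s, hs⟩ := exists_sum_diagPart A
    have h1 : ((A, c) : band m × Trunc m) = (∑ d ∈ s, (diagPart d A, 0)) + (0, c) := by
      refine Prod.ext ?_ ?_
      · rw [Prod.fst_add, Prod.fst_sum, add_zero]
        exact hs
      · rw [Prod.snd_add, Prod.snd_sum]
        simp
    rw [h1]
    refine Submodule.add_mem _ (Submodule.sum_mem _ fun d _ => ?_) ?_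
    · exact Submodule.mem_iSup_of_mem d (mem_glHat_deg.2 ⟨diagPart_mem d A, fun _ => rfl⟩)
    · exact Submodule.mem_iSup_of_mem 0 (mem_glHat_deg.2 ⟨fun _ _ _ => rfl, fun h => absurd rfl h⟩)
  bracket_mem i j x y hx hy := by
    obtain ⟨hx, -⟩ := mem_glHat_deg.1 hx
    obtain ⟨hy, -⟩ := mem_glHat_deg.1 hy
    exact mem_glHat_deg.2 ⟨superComm_apply_eq_zero hx hy, glCocycle_eq_zero_of_deg hx hy⟩

end GlBracket

/-! ### Matrices that vanish near the origin -/

section Vanishing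

variable {m : ℕ}

/-- The rows of index at most `N` in absolute value vanish. -/
def RowsVanish (N : ℕ) (A : ℤ → ℤ → Trunc m) : Prop := ∀ p r : ℤ, |p| ≤ N → A p r = 0

theorem RowsVanish.mono {N N' : ℕ} (h : N ≤ N') {A : ℤ → ℤ → Trunc m} (hA : RowsVanish N' A) :
    RowsVanish N A := fun p r hp => hA p r (hp.trans (by exact_mod_cast h))

/-- Row `p` of `A B` involves only row `p + j` of `B`, and row `p` of `B A` only row `p` of `B`;
hence the margin `|j|`. -/
theorem RowsVanish.superComm_right {N : ℕ} {j : ℤ} {A B : ℤ → ℤ → Trunc m}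
    (hA : ∀ p r : ℤ, r - p ≠ j → A p r = 0) (hB : RowsVanish (N + j.natAbs) B) :
    RowsVanish N (superComm A B) := by
  intro p s hp
  rw [superComm]
  refine finsum_eq_zero_of_forall_eq_zero fun r => ?_
  have h2 : B p r = 0 := hB p r (by rw [Nat.cast_add]; omega)
  have h1 : A p r * B r s = 0 := by
    by_cases h : r - p = j
    · rw [hB r s (by rw [Nat.cast_add]; rw [abs_le] at hp ⊢; omega), mul_zero]
    · rw [hA p r h, zero_mul]
  rw [h1, h2, zero_mul, smul_zero, sub_zero]

theorem RowsVanish.superComm_left {N : ℕ} {j : ℤ} {A B : ℤ → ℤ → Trunc m}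
    (hB : ∀ p r : ℤ, r - p ≠ j → B p r = 0) (hA : RowsVanish (N + j.natAbs) A) :
    RowsVanish N (superComm A B) := by
  intro p s hp
  rw [superComm]
  refine finsum_eq_zero_of_forall_eq_zero fun r => ?_
  have h2 : A p r = 0 := hA p r (by rw [Nat.cast_add]; omega)
  have h1 : B p r * A r s = 0 := by
    by_cases h : r - p = j
    · rw [hA r s (by rw [Nat.cast_add]; rw [abs_le] at hp ⊢; omega), mul_zero]
    · rw [hB p r h, zero_mul]
  rw [h1, h2, zero_mul, smul_zero, sub_zero]

/-- The cocycle sees only entries whose indices are separated by the threshold between `1` and `2`.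
A step of length `|j|` starting beyond `|j| + 1` cannot cross it. -/
theorem RowsVanish.glCocycle_right {N : ℕ} {j : ℤ} {A B : ℤ → ℤ → Trunc m}
    (hB : ∀ p r : ℤ, r - p ≠ j → B p r = 0) (hN : RowsVanish N B) (hj : j.natAbs + 1 ≤ N) :
    glCocycle A B = 0 := by
  rw [glCocycle]
  refine finsum_eq_zero_of_forall_eq_zero fun x => ?_
  by_cases h : x.1 - x.2 = j
  · by_cases h2 : |x.2| ≤ N
    · rw [hN _ _ h2, mul_zero, smul_zero]
    · rw [not_le, lt_abs] at h2
      by_cases hx : x.1 ≤ 1 <;> by_cases hy : x.2 ≤ 1 <;> simp [hx, hy] <;> omega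
  · rw [hB _ _ h, mul_zero, smul_zero]

theorem RowsVanish.glCocycle_left {N : ℕ} {j : ℤ} {A B : ℤ → ℤ → Trunc m}
    (hA : ∀ p r : ℤ, r - p ≠ j → A p r = 0) (hN : RowsVanish N A) (hj : j.natAbs + 1 ≤ N) :
    glCocycle A B = 0 := by
  rw [glCocycle]
  refine finsum_eq_zero_of_forall_eq_zero fun x => ?_
  by_cases h : x.2 - x.1 = j
  · by_cases h2 : |x.1| ≤ N
    · rw [hN _ _ h2, zero_mul, smul_zero]
    · rw [not_le, lt_abs] at h2
      by_cases hx : x.1 ≤ 1 <;> by_cases hy : x.2 ≤ 1 <;> simp [hx, hy] <;> omega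
  · rw [hA _ _ h, zero_mul, smul_zero]

/-- A functional on degree zero that depends on finitely many diagonal entries and the centre. -/
def FinSupp (mu : Module.Dual ℂ ((glHat m).deg 0)) : Prop :=
  ∃ P : ℕ, ∀ (A : band m) (hA : ((A, 0) : band m × Trunc m) ∈ (glHat m).deg 0),
    RowsVanish P A.1 → mu ⟨(A, 0), hA⟩ = 0

/-- A functional of finite support vanishes on brackets with a matrix that vanishes near the
origin. -/
theorem FinSupp.exists_bracket_eq_zero {mu : Module.Dual ℂ ((glHat m).deg 0)} (h : FinSupp mu)
    (j : ℤ) : ∃ N : ℕ, ∀ x X : band m × Trunc m, x ∈ (glHat m).deg j → X ∈ (glHat m).deg (-j) →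
      (RowsVanish N X.1.1 ∨ RowsVanish N x.1.1) →
      ∀ h0 : (glHat m).bracket x X ∈ (glHat m).deg 0, mu ⟨(glHat m).bracket x X, h0⟩ = 0 := by
  obtain ⟨P, hP⟩ := h
  refine ⟨P + j.natAbs + 1, fun x X hx hX hN h0 => ?_⟩
  obtain ⟨hx, -⟩ := mem_glHat_deg.1 hx
  obtain ⟨hX, -⟩ := mem_glHat_deg.1 hX
  have hc : glCocycle x.1.1 X.1.1 = 0 := by
    rcases hN with hN | hN
    · exact hN.glCocycle_right hX (by omega)
    · exact hN.glCocycle_left hx (by omega)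
  have hr : RowsVanish P (superComm x.1.1 X.1.1) := by
    rcases hN with hN | hN
    · exact (hN.mono (by omega : P + j.natAbs ≤ _)).superComm_right hx
    · exact (hN.mono (by omega : P + (-j).natAbs ≤ _)).superComm_left hX
  have heq : (glHat m).bracket x X = (⟨superComm x.1.1 X.1.1, superComm_mem x.1.2 X.1.2⟩, 0) :=
    Prod.ext rfl hc
  have key := hP ⟨superComm x.1.1 X.1.1, superComm_mem x.1.2 X.1.2⟩ (heq ▸ h0) hr
  rw [← key]
  congr 1
  exact Subtype.ext heq

/-- The homogeneous elements whose matrices vanish near the origin. -/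
def glVanish (m : ℕ) (N : ℕ) (k : ℤ) : Set (glHat m).carrier :=
  {X | X ∈ (glHat m).deg k ∧ RowsVanish N (X : band m × Trunc m).1.1}

/-- On a vector of an irreducible highest weight module of finite support, matrices that vanish
near the origin act by zero in nonzero degrees. -/
theorem glHat_locally_trivial {M : GradedAction (glHat m)} {mu : Module.Dual ℂ ((glHat m).deg 0)}
    (hM : M.IsL mu) (hmu : FinSupp mu) (u : M.carrier) (k : ℤ) (hk : k ≠ 0) :
    ∃ N0, ∀ N, N0 ≤ N → ∀ X ∈ glVanish m N k, M.act X u = 0 := by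
  obtain ⟨mu', hmu'⟩ := LinearMap.exists_extend (p := (glHat m).deg 0) mu
  have hmu'' : ∀ x : (glHat m).deg 0, mu' x = mu x := fun x => by rw [← hmu']; rfl
  have key := hM.locally_trivial (glHat_isGraded m) mu' hmu'' (glVanish m)
    (fun N k X hX => hX.1) (fun N N' k hN X hX => ⟨hX.1, hX.2.mono hN⟩)
    (fun j => ⟨j.natAbs, fun N k x hx X hX =>
      ⟨(glHat_isGraded m).bracket_mem _ _ _ _ hx hX.1, hX.2.superComm_right (mem_glHat_deg.1 hx).1⟩⟩)
    (fun j => by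
      obtain ⟨N, hN⟩ := hmu.exists_bracket_eq_zero j
      refine ⟨N, fun x hx X hX => ?_⟩
      have h0 : (glHat m).bracket x X ∈ (glHat m).deg 0 := by
        simpa using (glHat_isGraded m).bracket_mem _ _ _ _ hx hX.1
      rw [← hN x X hx hX.1 (Or.inl hX.2) h0, ← hmu'']) u k
  simpa [hk] using key

end Vanishing


/-! ### The bracket of `SSq` -/

section SSqBracket

variable (q : ℂ)

/-- The bracket of two basis elements. -/
def basisBracket (x y : Idx) : (Idx →₀ ℂ) × ℂ :=
  (mulBasis q x y - Idx.sign x y • mulBasis q y x, psiBasis q x y)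

/-- The bracket of `SSq` modulo its centre as a bilinear map. -/
def ssBracket : (Idx →₀ ℂ) →ₗ[ℂ] (Idx →₀ ℂ) →ₗ[ℂ] (Idx →₀ ℂ) × ℂ :=
  Finsupp.linearCombination ℂ fun x => Finsupp.linearCombination ℂ fun y => basisBracket q x y

theorem ssBracket_apply (F G : Idx →₀ ℂ) : ssBracket q F G =
    F.sum fun x a => G.sum fun y b => (a * b) • basisBracket q x y := by
  simp only [ssBracket, Finsupp.linearCombination_apply, Finsupp.sum, LinearMap.sum_apply,
    LinearMap.smul_apply, Finset.smul_sum, smul_smul]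

theorem SSq_bracket (X Y : (Idx →₀ ℂ) × ℂ) : (SSq q).bracket X Y = ssBracket q X.1 Y.1 := by
  rw [ssBracket_apply]
  refine Prod.ext ?_ ?_
  · simp only [Finsupp.sum, Prod.fst_sum, Prod.smul_fst]
    rfl
  · simp only [Finsupp.sum, Prod.snd_sum, Prod.smul_snd]
    rfl

theorem ssBracket_single (x y : Idx) (a b : ℂ) :
    ssBracket q (Finsupp.single x a) (Finsupp.single y b) = (a * b) • basisBracket q x y := by
  rw [ssBracket, Finsupp.linearCombination_single, LinearMap.smul_apply,
    Finsupp.linearCombination_single, smul_smul]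

theorem mem_SSq_deg {d : ℤ} {X : (Idx →₀ ℂ) × ℂ} :
    X ∈ (SSq q).deg d ↔ (∀ x : Idx, x.deg ≠ d → X.1 x = 0) ∧ (d ≠ 0 → X.2 = 0) := by
  change X ∈ Submodule.prod (Finsupp.supported ℂ ℂ {x : Idx | x.deg = d})
    (if d = 0 then ⊤ else ⊥) ↔ _
  rw [Submodule.mem_prod]
  refine and_congr ?_ ?_
  · rw [Finsupp.mem_supported']
    rfl
  · by_cases hd : d = 0 <;> simp [hd]

theorem single_mem_SSq_deg {d : ℤ} {x : Idx} (hx : x.deg = d) (a : ℂ) :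
    ((Finsupp.single x a, 0) : (Idx →₀ ℂ) × ℂ) ∈ (SSq q).deg d := by
  refine (mem_SSq_deg q).2 ⟨fun y hy => ?_, fun _ => rfl⟩
  exact Finsupp.single_eq_of_ne (by rintro rfl; exact hy hx)

theorem mulBasis_mem {x y : Idx} : ((mulBasis q x y, 0) : (Idx →₀ ℂ) × ℂ) ∈
    (SSq q).deg (x.deg + y.deg) := by
  rw [mulBasis]
  split_ifs with h
  · refine single_mem_SSq_deg q ?_ _
    simp only [Idx.deg, h]
    ring
  · exact zero_mem _

theorem basisBracket_mem (x y : Idx) : basisBracket q x y ∈ (SSq q).deg (x.deg + y.deg) := by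
  have h : basisBracket q x y = (mulBasis q x y, 0) - Idx.sign x y • (mulBasis q y x, 0) +
      (0, psiBasis q x y) := by
    refine Prod.ext ?_ ?_ <;> simp [basisBracket]
  rw [h]
  refine Submodule.add_mem _ (Submodule.sub_mem _ (mulBasis_mem q)
    (Submodule.smul_mem _ _ ?_)) ((mem_SSq_deg q).2 ⟨fun _ _ => rfl, fun h0 => ?_⟩)
  · rw [add_comm]
    exact mulBasis_mem q
  · refine if_neg fun h => h0 ?_
    simp only [Idx.deg, h.2.2.1, h.2.2.2]
    have := h.1
    omega

theorem SSq_isGraded : (SSq q).IsGraded where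
  iSup_deg := by
    rw [eq_top_iff]
    rintro ⟨F, c⟩ -
    have h1 : ((F, c) : (Idx →₀ ℂ) × ℂ) =
        (F.sum fun x a => ((Finsupp.single x a, 0) : (Idx →₀ ℂ) × ℂ)) + (0, c) := by
      refine Prod.ext ?_ ?_
      · rw [Prod.fst_add, Finsupp.sum, Prod.fst_sum, add_zero]
        exact F.sum_single.symm
      · rw [Prod.snd_add, Finsupp.sum, Prod.snd_sum]
        simp
    rw [h1]
    refine Submodule.add_mem _ (Submodule.sum_mem _ fun x _ => ?_) ?_
    · exact Submodule.mem_iSup_of_mem _ (single_mem_SSq_deg q rfl _)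
    · exact Submodule.mem_iSup_of_mem 0
        ((mem_SSq_deg q).2 ⟨fun _ _ => rfl, fun h => absurd rfl h⟩)
  bracket_mem i j X Y hX hY := by
    obtain ⟨hX, -⟩ := (mem_SSq_deg q).1 hX
    obtain ⟨hY, -⟩ := (mem_SSq_deg q).1 hY
    refine (congrArg (· ∈ (SSq q).deg (i + j)) (SSq_bracket q X Y)).mpr ?_
    rw [ssBracket_apply]
    refine Submodule.sum_mem _ fun x hx => Submodule.sum_mem _ fun y hy =>
      Submodule.smul_mem _ _ ?_
    have h1 : x.deg = i := by
      by_contra h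
      exact (Finsupp.mem_support_iff.1 hx) (hX x h)
    have h2 : y.deg = j := by
      by_contra h
      exact (Finsupp.mem_support_iff.1 hy) (hY y h)
    rw [← h1, ← h2]
    exact basisBracket_mem q x y

end SSqBracket

/-! ### `phiHat` is a homomorphism -/

section Phi

variable {q ℓ : ℂ} (a : ℂ) (m : ℕ)

variable (ℓ) in
/-- The linear map underlying `phiHat`. -/
def phiLin : ((Idx →₀ ℂ) × ℂ) →ₗ[ℂ] band m × Trunc m :=
  LinearMap.coprod
    (Finsupp.linearCombination ℂ fun x : Idx => (phiMatrix ℓ a m x, phiCentral ℓ a m x))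
    (LinearMap.toSpanSingleton ℂ (band m × Trunc m) (0, 1))

theorem phiLin_apply (X : (Idx →₀ ℂ) × ℂ) : phiLin ℓ a m X =
    Finsupp.linearCombination ℂ
      (fun x : Idx => ((phiMatrix ℓ a m x, phiCentral ℓ a m x) : band m × Trunc m)) X.1 +
    X.2 • ((0, 1) : band m × Trunc m) := rfl

theorem phiLin_single (x : Idx) (c : ℂ) :
    phiLin ℓ a m (Finsupp.single x c, 0) = c • (phiMatrix ℓ a m x, phiCentral ℓ a m x) := by
  rw [phiLin_apply, Finsupp.linearCombination_single, zero_smul, add_zero]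

theorem phiMatrix_apply (x : Idx) (p r : ℤ) : (phiMatrix ℓ a m x).1 p r =
    if r % 2 = ((x.2.2.2 : ℕ) : ℤ) ∧ p = 2 * (r / 2 - x.1) + ((x.2.2.1 : ℕ) : ℤ) then
      Complex.exp (ℓ * (a - ((r / 2 : ℤ) : ℂ)) * (x.2.1 : ℂ)) • Trunc.exp m ((x.2.1 : ℂ) * ℓ)
    else 0 := rfl

theorem phiMatrix_deg (x : Idx) (p r : ℤ) (h : r - p ≠ x.deg) : (phiMatrix ℓ a m x).1 p r = 0 := by
  rw [phiMatrix_apply]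
  refine if_neg ?_
  rintro ⟨h1, h2⟩
  apply h
  rw [Idx.deg]
  omega

theorem phiLin_deg {d : ℤ} {X : (Idx →₀ ℂ) × ℂ} (hX : X ∈ (SSq q).deg d) :
    phiLin ℓ a m X ∈ (glHat m).deg d := by
  obtain ⟨h1, h2⟩ := (mem_SSq_deg q).1 hX
  rw [phiLin_apply, Finsupp.linearCombination_apply]
  refine Submodule.add_mem _ (Submodule.sum_mem _ fun x hx => Submodule.smul_mem _ _ ?_) ?_
  · have hxd : x.deg = d := by
      by_contra h
      exact (Finsupp.mem_support_iff.1 hx) (h1 x h)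
    rw [← hxd]
    refine mem_glHat_deg.2 ⟨phiMatrix_deg a m x, fun h => if_neg fun h' => h ?_⟩
    rw [Idx.deg, h'.1, h'.2.1]
    ring
  · by_cases hd : d = 0
    · exact Submodule.smul_mem _ _ (mem_glHat_deg.2 ⟨fun _ _ _ => rfl, fun h => absurd hd h⟩)
    · rw [h2 hd, zero_smul]
      exact Submodule.zero_mem _

variable {a m}

/-- Each column of a `phiMatrix` has at most one nonzero entry, so a product of two of them has one
term per entry. -/
theorem phiMatrix_mul_ne (x y : Idx) (p r s : ℤ)
    (h : r ≠ 2 * (s / 2 - y.1) + ((y.2.2.1 : ℕ) : ℤ)) :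
    (phiMatrix ℓ a m x).1 p r * (phiMatrix ℓ a m y).1 r s = 0 := by
  rw [phiMatrix_apply a m y, if_neg (fun h' => h h'.2), mul_zero]

theorem fin_two_cast_le (i : Fin 2) : ((i : ℕ) : ℤ) ≤ 1 := by
  have := i.2; omega

theorem fin_two_cast_inj {i j : Fin 2} (h : ((i : ℕ) : ℤ) = ((j : ℕ) : ℤ)) : i = j := by
  exact Fin.ext (by exact_mod_cast h)

theorem phiMatrix_mul_sum (hℓ : Complex.exp ℓ = q) (x y : Idx) (p s : ℤ) :
    ∑ᶠ r : ℤ, (phiMatrix ℓ a m x).1 p r * (phiMatrix ℓ a m y).1 r s =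
      (phiLin ℓ a m (mulBasis q x y, 0)).1.1 p s := by
  rw [finsum_eq_single _ (2 * (s / 2 - y.1) + ((y.2.2.1 : ℕ) : ℤ))
    (fun r hr => phiMatrix_mul_ne x y p r s hr)]
  obtain ⟨n, k, i, j⟩ := x
  obtain ⟨n', k', r, t⟩ := y
  have hr1 := fin_two_cast_le r
  have hmod : (2 * (s / 2 - n') + ((r : ℕ) : ℤ)) % 2 = ((r : ℕ) : ℤ) := by omega
  have hdiv : (2 * (s / 2 - n') + ((r : ℕ) : ℤ)) / 2 = s / 2 - n' := by omega
  simp only [phiMatrix_apply, hmod, hdiv, and_true]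
  rw [mulBasis]
  by_cases hjr : j = r
  · subst hjr
    simp only [if_true, true_and]
    rw [phiLin_single]
    simp only [Prod.smul_fst, SetLike.val_smul, Pi.smul_apply, phiMatrix_apply]
    by_cases hs : s % 2 = ((t : ℕ) : ℤ)
    · by_cases hp : p = 2 * (s / 2 - n' - n) + ((i : ℕ) : ℤ)
      · rw [if_pos hp, if_pos hs, if_pos ⟨hs, by omega⟩, smul_mul_smul_comm, ← Trunc.exp_add,
          smul_smul]
        congr 1
        · rw [← hℓ, ← Complex.exp_int_mul, ← Complex.exp_add, ← Complex.exp_add]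
          congr 1
          push_cast
          ring
        · congr 1
          push_cast
          ring
      · rw [if_neg hp, zero_mul, if_neg (fun h => hp (by rw [h.2]; ring)), smul_zero]
    · rw [if_neg hs, mul_zero, if_neg (fun h => hs h.1), smul_zero]
  · rw [if_neg (fun h => hjr (fin_two_cast_inj h.1.symm)), zero_mul, if_neg hjr]
    rw [Prod.mk_zero_zero, map_zero]
    rfl

/-- Where the entries are nonzero, `r - p` and `s - r` are the doubled degrees of `y` and `x`, and
these have the parities of the two basis elements. -/
theorem phiMatrix_sign (x y : Idx) (p r s : ℤ) :
    ((-1 : ℂ) ^ ((r - p) * (s - r))) • ((phiMatrix ℓ a m y).1 p r * (phiMatrix ℓ a m x).1 r s) =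
      Idx.sign x y • ((phiMatrix ℓ a m y).1 p r * (phiMatrix ℓ a m x).1 r s) := by
  by_cases h1 : r - p = y.deg
  · by_cases h2 : s - r = x.deg
    · congr 1
      rw [h1, h2]
      obtain ⟨n, k, i, j⟩ := x
      obtain ⟨n', k', i', j'⟩ := y
      simp only [Idx.deg, Idx.sign]
      have even : ∀ n : ℤ, ∀ c : ℤ, (-1 : ℂ) ^ (2 * n * c) = 1 := fun n c => by
        rw [mul_assoc, zpow_mul]; norm_num
      have odd1 : ∀ n n' : ℤ, ∀ c d : ℤ, (c = 1 ∨ c = -1) → (d = 1 ∨ d = -1) →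
          (-1 : ℂ) ^ ((2 * n + c) * (2 * n' + d)) = -1 := fun n n' c d hc hd => by
        refine Odd.neg_one_zpow (Odd.mul ?_ ?_)
        · rcases hc with rfl | rfl
          · exact ⟨n, rfl⟩
          · exact ⟨n - 1, by ring⟩
        · rcases hd with rfl | rfl
          · exact ⟨n', rfl⟩
          · exact ⟨n' - 1, by ring⟩
      have even' : ∀ n : ℤ, ∀ c : ℤ, (-1 : ℂ) ^ (c * (2 * n)) = 1 := fun n c => by
        rw [mul_comm]; exact even n c
      by_cases hij : i = j
      · subst hij
        rw [if_neg (by simp), add_sub_assoc, add_sub_cancel_right]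
        exact even' n _
      · by_cases hij' : i' = j'
        · subst hij'
          rw [if_neg (by simp), add_sub_cancel_right]
          exact even n' _
        · rw [if_pos ⟨hij, hij'⟩, add_sub_assoc, add_sub_assoc]
          refine odd1 _ _ _ _ ?_ ?_
          · have := fin_two_cast_le i'; have := fin_two_cast_le j'
            have h : ((i' : ℕ) : ℤ) ≠ ((j' : ℕ) : ℤ) := fun h => hij' (fin_two_cast_inj h)
            omega
          · have := fin_two_cast_le i; have := fin_two_cast_le j
            have h : ((i : ℕ) : ℤ) ≠ ((j : ℕ) : ℤ) := fun h => hij (fin_two_cast_inj h)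
            omega
    · rw [phiMatrix_deg a m x r s h2, mul_zero, smul_zero, smul_zero]
  · rw [phiMatrix_deg a m y p r h1, zero_mul, smul_zero, smul_zero]

theorem superComm_phiMatrix (hℓ : Complex.exp ℓ = q) (x y : Idx) :
    superComm (phiMatrix ℓ a m x).1 (phiMatrix ℓ a m y).1 =
      (phiLin ℓ a m (basisBracket q x y)).1.1 := by
  funext p s
  have hfin : ∀ x y : Idx, (Function.support fun r : ℤ =>
      (phiMatrix ℓ a m x).1 p r * (phiMatrix ℓ a m y).1 r s).Finite := fun x y =>
    (Set.finite_singleton (2 * (s / 2 - y.1) + ((y.2.2.1 : ℕ) : ℤ))).subset fun r hr => by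
      by_contra h
      exact hr (phiMatrix_mul_ne x y p r s h)
  have h0 : basisBracket q x y = (mulBasis q x y, 0) - Idx.sign x y • (mulBasis q y x, 0) +
      (0, psiBasis q x y) := by
    refine Prod.ext ?_ ?_ <;> simp [basisBracket]
  have h3 : (phiLin ℓ a m ((0, psiBasis q x y) : (Idx →₀ ℂ) × ℂ)).1.1 p s = 0 := by
    rw [phiLin_apply]
    simp
  rw [superComm, h0, map_add, map_sub, map_smul, Prod.fst_add, Prod.fst_sub, Prod.smul_fst,
    Submodule.coe_add, Submodule.coe_sub, Submodule.coe_smul, Pi.add_apply, Pi.add_apply,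
    Pi.sub_apply, Pi.sub_apply, Pi.smul_apply, Pi.smul_apply, h3, add_zero, ← phiMatrix_mul_sum hℓ x y, ← phiMatrix_mul_sum hℓ y x,
    smul_finsum, ← finsum_sub_distrib (hfin x y) (((hfin y x)).subset fun r hr => by
      by_contra h
      apply hr
      rw [Function.notMem_support] at h
      simp only
      rw [h, smul_zero])]
  exact finsum_congr fun r => by rw [phiMatrix_sign]

/-- The sum runs over `0 < J ≤ n`, or with a minus sign over `n < J ≤ 0`. Both cases telescope to
the antidifference normalized at `0`, which allows one computation for either sign of `n`. -/
theorem finsum_heaviside (g H : ℤ → ℂ) (h0 : H 0 = 0) (hH : ∀ n, H (n + 1) = H n + g (n + 1))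
    (n : ℤ) : ∑ᶠ J : ℤ, ((if J ≤ n then (1 : ℂ) else 0) - (if J ≤ 0 then 1 else 0)) * g J = H n := by
  have hfin : ∀ n : ℤ, (Function.support fun J : ℤ =>
      ((if J ≤ n then (1 : ℂ) else 0) - (if J ≤ 0 then 1 else 0)) * g J).Finite := fun n =>
    (Set.finite_Icc (-|n|) |n|).subset fun J hJ => by
      by_contra hcon
      rw [Set.mem_Icc, not_and_or] at hcon
      apply hJ
      have h1 := le_abs_self n
      have h2 := neg_abs_le n
      by_cases h3 : J ≤ n <;> by_cases h4 : J ≤ 0 <;> simp [h3, h4] <;> omega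
  have step : ∀ n : ℤ,
      ∑ᶠ J : ℤ, ((if J ≤ n + 1 then (1 : ℂ) else 0) - (if J ≤ 0 then 1 else 0)) * g J =
      ∑ᶠ J : ℤ, ((if J ≤ n then (1 : ℂ) else 0) - (if J ≤ 0 then 1 else 0)) * g J + g (n + 1) := by
    intro n
    have h1 : g (n + 1) = ∑ᶠ J : ℤ, (if J = n + 1 then g J else 0) := by
      rw [finsum_eq_single _ (n + 1) (fun J hJ => if_neg hJ), if_pos rfl]
    rw [h1, ← finsum_add_distrib (hfin n) ((Set.finite_singleton (n + 1)).subset fun J hJ => by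
      by_contra h
      exact hJ (if_neg h))]
    refine finsum_congr fun J => ?_
    by_cases h3 : J = n + 1
    · subst h3
      simp only [le_refl, if_true, if_neg (show ¬ n + 1 ≤ n by omega)]
      ring
    · rw [if_neg h3, add_zero]
      have : J ≤ n + 1 ↔ J ≤ n := by omega
      simp only [this]
  induction n using Int.induction_on with
  | zero => simp [h0]
  | succ n ih => rw [step, ih, hH]
  | pred n ih =>
    have h1 := step (-(n : ℤ) - 1)
    have h2 := hH (-(n : ℤ) - 1)
    rw [sub_add_cancel] at h1 h2
    rw [ih, h2] at h1
    exact (add_right_cancel h1).symm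

end Phi


/-! ### The central terms, and compatibility of `phiHat` with the brackets. -/

section PhiHom

variable {q ℓ : ℂ} {a : ℂ} {m : ℕ}

theorem phiLin_mulBasis_snd (x y : Idx) : (phiLin ℓ a m (mulBasis q x y, 0)).2 =
    if x.2.2.2 = y.2.2.1 then q ^ (x.2.1 * y.1) •
      phiCentral ℓ a m (x.1 + y.1, x.2.1 + y.2.1, x.2.2.1, y.2.2.2) else 0 := by
  rw [mulBasis]
  split_ifs with h
  · rw [phiLin_single]
    rfl
  · rw [Prod.mk_zero_zero, map_zero]
    rfl

theorem phiLin_basisBracket_snd (x y : Idx) : (phiLin ℓ a m (basisBracket q x y)).2 =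
    (phiLin ℓ a m (mulBasis q x y, 0)).2 - Idx.sign x y • (phiLin ℓ a m (mulBasis q y x, 0)).2 +
      psiBasis q x y • 1 := by
  have h0 : basisBracket q x y = (mulBasis q x y, 0) - Idx.sign x y • (mulBasis q y x, 0) +
      (0, psiBasis q x y) := by
    refine Prod.ext ?_ ?_ <;> simp [basisBracket]
  have h1 : (phiLin ℓ a m ((0, psiBasis q x y) : (Idx →₀ ℂ) × ℂ)).2 = psiBasis q x y • 1 := by
    rw [phiLin_apply]
    simp
  rw [h0, map_add, map_sub, map_smul, Prod.snd_add, Prod.snd_sub, Prod.smul_snd, h1]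

theorem glCocycle_phiMatrix_eq_zero (x y : Idx)
    (h : ¬ (x.1 + y.1 = 0 ∧ x.2.2.2 = y.2.2.1 ∧ x.2.2.1 = y.2.2.2)) :
    glCocycle (phiMatrix ℓ a m x).1 (phiMatrix ℓ a m y).1 = 0 := by
  rw [glCocycle]
  refine finsum_eq_zero_of_forall_eq_zero fun z => ?_
  rw [phiMatrix_apply, phiMatrix_apply]
  by_cases h1 : z.2 % 2 = ((x.2.2.2 : ℕ) : ℤ) ∧ z.1 = 2 * (z.2 / 2 - x.1) + ((x.2.2.1 : ℕ) : ℤ)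
  · by_cases h2 : z.1 % 2 = ((y.2.2.2 : ℕ) : ℤ) ∧
        z.2 = 2 * (z.1 / 2 - y.1) + ((y.2.2.1 : ℕ) : ℤ)
    · exfalso
      apply h
      have b1 := fin_two_cast_le x.2.2.1
      have b2 := fin_two_cast_le y.2.2.1
      refine ⟨by omega, fin_two_cast_inj (by omega), fin_two_cast_inj (by omega)⟩
    · rw [if_neg h2, mul_zero, smul_zero]
  · rw [if_neg h1, zero_mul, smul_zero]

/-- The nonzero terms of the trace are parametrized by the block index `J` of the column. In terms
of blocks the threshold becomes `J ≤ n` for the row and `J ≤ 0` for the column. -/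
theorem glCocycle_phiMatrix_eq_finsum (n k k' : ℤ) (i j : Fin 2) :
    glCocycle (phiMatrix ℓ a m (n, k, i, j)).1 (phiMatrix ℓ a m (-n, k', j, i)).1 =
      ((-1) ^ (i : ℕ) * ∑ᶠ J : ℤ, ((if J ≤ n then (1 : ℂ) else 0) - (if J ≤ 0 then 1 else 0)) *
        (Complex.exp (ℓ * (a - J) * ((k + k' : ℤ) : ℂ)) * Complex.exp (ℓ * n * k'))) •
        Trunc.exp m (((k + k' : ℤ) : ℂ) * ℓ) := by
  have bi := fin_two_cast_le i
  have bj := fin_two_cast_le j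
  let g : ℤ → ℤ × ℤ := fun J => (2 * (J - n) + ((i : ℕ) : ℤ), 2 * J + ((j : ℕ) : ℤ))
  have hg : Function.Injective g := by
    intro J J' h
    have := congrArg Prod.snd h
    simp only [g] at this
    omega
  rw [glCocycle, mul_finsum, finsum_smul]
  have hsup : ∀ f : ℤ × ℤ → Trunc m, (∀ z, z ∉ Set.range g → f z = 0) →
      ∑ᶠ z, f z = ∑ᶠ J, f (g J) := by
    intro f hf
    rw [← finsum_mem_range hg, finsum_mem_def, Set.indicator_eq_self.2]
    intro z hz
    by_contra h
    exact hz (hf z h)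
  rw [hsup]
  · refine finsum_congr fun J => ?_
    have e1 : (2 * J + ((j : ℕ) : ℤ)) % 2 = ((j : ℕ) : ℤ) := by omega
    have e2 : (2 * J + ((j : ℕ) : ℤ)) / 2 = J := by omega
    have e3 : (2 * (J - n) + ((i : ℕ) : ℤ)) % 2 = ((i : ℕ) : ℤ) := by omega
    have e4 : (2 * (J - n) + ((i : ℕ) : ℤ)) / 2 = J - n := by omega
    have e5 : (2 * (J - n) + ((i : ℕ) : ℤ) ≤ 1) ↔ J ≤ n := by omega
    have e6 : (2 * J + ((j : ℕ) : ℤ) ≤ 1) ↔ J ≤ 0 := by omega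
    have e7 : (-1 : ℂ) ^ (2 * (J - n) + ((i : ℕ) : ℤ)) = (-1) ^ (i : ℕ) := by
      rw [zpow_add₀ (by norm_num), zpow_mul]
      norm_num
    simp only [phiMatrix_apply, g, e1, e2, e3, e4, e5, e6, e7, sub_neg_eq_add, sub_add_cancel,
      and_self, if_true]
    rw [smul_mul_smul_comm, ← Trunc.exp_add, smul_smul]
    congr 1
    · rw [mul_assoc]
      congr 2
      rw [← Complex.exp_add, ← Complex.exp_add]
      congr 1
      push_cast
      ring
    · congr 1
      push_cast
      ring
  · rintro ⟨z1, z2⟩ hz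
    rw [phiMatrix_apply]
    by_cases h1 : z2 % 2 = ((j : ℕ) : ℤ) ∧ z1 = 2 * (z2 / 2 - n) + ((i : ℕ) : ℤ)
    · exfalso
      refine hz ⟨z2 / 2, Prod.ext h1.2.symm ?_⟩
      simp only [g]
      omega
    · simp only
      rw [if_neg h1, zero_mul, smul_zero]

/-- If `k + k' = 0`, the exponentials no longer depend on `J` and the sum counts `n` terms, which is
`psiBasis`. Otherwise it is a geometric sum, and its two end terms are exactly what `phiCentral`
contributes through the two products in the bracket: outside `k + k' = 0` the cocycle is a
coboundary. -/
theorem glCocycle_phiMatrix (hℓ : Complex.exp ℓ = q)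
    (hq : ∀ n : ℤ, n ≠ 0 → Complex.exp (ℓ * n) ≠ 1) (x y : Idx) :
    glCocycle (phiMatrix ℓ a m x).1 (phiMatrix ℓ a m y).1 =
      (phiLin ℓ a m (basisBracket q x y)).2 := by
  rw [phiLin_basisBracket_snd, phiLin_mulBasis_snd, phiLin_mulBasis_snd]
  by_cases h : x.1 + y.1 = 0 ∧ x.2.2.2 = y.2.2.1 ∧ x.2.2.1 = y.2.2.2
  · obtain ⟨n, k, i, j⟩ := x
    obtain ⟨n', k', j', i'⟩ := y
    obtain ⟨h1, h2, h3⟩ := h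
    simp only at h1 h2 h3
    subst h2 h3
    obtain rfl : n' = -n := by omega
    rw [glCocycle_phiMatrix_eq_finsum]
    simp only [if_true, phiCentral, psiBasis, add_neg_cancel, neg_add_cancel, true_and, and_self,
      and_true, add_comm k' k]
    have hexp : ∀ z : ℤ, q ^ z = Complex.exp (ℓ * z) := fun z => by
      rw [← hℓ, ← Complex.exp_int_mul, mul_comm]
    by_cases hK : k + k' = 0
    · obtain rfl : k' = -k := by omega
      simp only [add_neg_cancel, ne_eq, not_true_eq_false, if_false, smul_zero, sub_zero, zero_add,
        if_true, Int.cast_zero, zero_mul, mul_zero, Complex.exp_zero, one_mul, Trunc.exp_zero]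
      have e0 : Complex.exp (ℓ * n * ((-k : ℤ) : ℂ)) = Complex.exp (ℓ * ((-(k * n) : ℤ) : ℂ)) := by
        congr 1; push_cast; ring
      rw [finsum_heaviside (fun _ => Complex.exp (ℓ * n * ((-k : ℤ) : ℂ)))
        (fun N => N * Complex.exp (ℓ * n * ((-k : ℤ) : ℂ))) (by simp) (fun N => by push_cast; ring),
        hexp, e0, mul_assoc]
    · rw [if_pos hK, if_pos hK, if_neg hK, zero_smul, add_zero, smul_smul, smul_smul, smul_smul,
        ← sub_smul]
      congr 1
      generalize hKd : k + k' = K at hK ⊢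
      have hK1 := hq K hK
      have hK2 : Complex.exp (ℓ * K) - 1 ≠ 0 := sub_ne_zero.2 hK1
      have hK3 : 1 - Complex.exp (ℓ * K) ≠ 0 := sub_ne_zero.2 (Ne.symm hK1)
      -- The antidifference is the geometric sum over `0 < J ≤ N`, with ratio `exp (-ℓ K)`.
      rw [finsum_heaviside (fun J : ℤ => Complex.exp (ℓ * (a - J) * K) * Complex.exp (ℓ * n * k'))
        (fun N : ℤ => Complex.exp (ℓ * n * k') * Complex.exp (ℓ * a * K) *
          (1 - Complex.exp (-(ℓ * N * K))) / (Complex.exp (ℓ * K) - 1)) (by simp) (fun N => by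
          have e1 : Complex.exp (-(ℓ * N * K)) =
              Complex.exp (-(ℓ * ((N + 1 : ℤ) : ℂ) * K)) * Complex.exp (ℓ * K) := by
            rw [← Complex.exp_add]; congr 1; push_cast; ring
          have e2 : Complex.exp (ℓ * (a - ((N + 1 : ℤ) : ℂ)) * K) =
              Complex.exp (ℓ * a * K) * Complex.exp (-(ℓ * ((N + 1 : ℤ) : ℂ) * K)) := by
            rw [← Complex.exp_add]; congr 1; ring
          rw [e1, e2]
          field_simp
          ring)]
      have e3 : q ^ (k * -n) = Complex.exp (ℓ * n * k') * Complex.exp (-(ℓ * n * K)) := by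
        rw [hexp, ← Complex.exp_add, ← hKd]; congr 1; push_cast; ring
      have e4 : q ^ (k' * n) = Complex.exp (ℓ * n * k') := by
        rw [hexp]; congr 1; push_cast; ring
      rw [e3, e4]
      have hs : Idx.sign (n, k, i, j) (-n, k', j, i) * (-1 : ℂ) ^ (j : ℕ) = (-1) ^ (i : ℕ) := by
        simp only [Idx.sign]
        fin_cases i <;> fin_cases j <;> simp
      have e5 : Complex.exp (ℓ * K) - 1 = -(1 - Complex.exp (ℓ * K)) := by ring
      rw [e5]
      have e6 : Idx.sign (n, k, i, j) (-n, k', j, i) * Complex.exp (ℓ * n * k') *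
          ((-1) ^ (j : ℕ) * (Complex.exp (ℓ * a * K) / (1 - Complex.exp (ℓ * K)))) =
          (-1) ^ (i : ℕ) * (Complex.exp (ℓ * n * k') *
          (Complex.exp (ℓ * a * K) / (1 - Complex.exp (ℓ * K)))) := by
        rw [← hs]; ring
      rw [e6]
      field_simp
      ring
  · rw [glCocycle_phiMatrix_eq_zero x y h]
    have h1 : ∀ c : ℂ, (if x.2.2.2 = y.2.2.1 then c • phiCentral ℓ a m
        (x.1 + y.1, x.2.1 + y.2.1, x.2.2.1, y.2.2.2) else 0) = 0 := by
      intro c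
      split_ifs with hj
      · rw [phiCentral, if_neg (fun hc => h ⟨hc.1, hj, hc.2.1⟩), smul_zero]
      · rfl
    have h2 : ∀ c : ℂ, (if y.2.2.2 = x.2.2.1 then c • phiCentral ℓ a m
        (y.1 + x.1, y.2.1 + x.2.1, y.2.2.1, x.2.2.2) else 0) = 0 := by
      intro c
      split_ifs with hj
      · rw [phiCentral, if_neg (fun hc => h ⟨by rw [add_comm]; exact hc.1, hc.2.1.symm, hj.symm⟩),
          smul_zero]
      · rfl
    rw [h1, h2, psiBasis, if_neg (fun hc => h ⟨hc.1, hc.2.2⟩)]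
    simp

theorem phiLin_ssBracket (hℓ : Complex.exp ℓ = q)
    (hq : ∀ n : ℤ, n ≠ 0 → Complex.exp (ℓ * n) ≠ 1) (F G : Idx →₀ ℂ) :
    phiLin ℓ a m (ssBracket q F G) =
      glBracket m (phiLin ℓ a m (F, 0)) (phiLin ℓ a m (G, 0)) := by
  have hadd : ∀ F F' : Idx →₀ ℂ, phiLin ℓ a m (F + F', 0) =
      phiLin ℓ a m (F, 0) + phiLin ℓ a m (F', 0) := fun F F' => by
    rw [← map_add]
    simp
  induction F using Finsupp.induction_linear with
  | zero => rw [Prod.mk_zero_zero]; simp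
  | add F F' h h' =>
    rw [map_add, LinearMap.add_apply, map_add, hadd, map_add, LinearMap.add_apply, h, h']
  | single x b =>
    induction G using Finsupp.induction_linear with
    | zero => rw [Prod.mk_zero_zero]; simp
    | add G G' h h' => rw [map_add, map_add, hadd, map_add, h, h']
    | single y c =>
      rw [ssBracket_single, map_smul, phiLin_single, phiLin_single, map_smul, map_smul,
        LinearMap.smul_apply, smul_smul, mul_comm c b]
      congr 1
      exact Prod.ext (Subtype.ext (superComm_phiMatrix hℓ x y).symm)
        (glCocycle_phiMatrix hℓ hq x y).symm

/-- `phiHat` is compatible with the brackets. -/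
theorem phiHat_bracket (hℓ : Complex.exp ℓ = q)
    (hq : ∀ n : ℤ, n ≠ 0 → Complex.exp (ℓ * n) ≠ 1) (X Y : (Idx →₀ ℂ) × ℂ) :
    phiHat q ℓ a m ((SSq q).bracket X Y) =
      (glHat m).bracket (phiHat q ℓ a m X) (phiHat q ℓ a m Y) := by
  have h1 : phiHat q ℓ a m ((SSq q).bracket X Y) = phiLin ℓ a m (ssBracket q X.1 Y.1) :=
    congrArg (phiLin ℓ a m) (SSq_bracket q X Y)
  rw [h1, phiLin_ssBracket hℓ hq]
  have h2 : ∀ X : (Idx →₀ ℂ) × ℂ, (phiLin ℓ a m X).1 = (phiLin ℓ a m (X.1, 0)).1 := by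
    intro X
    rw [phiLin_apply, phiLin_apply]
    simp
  rw [glBracket_apply]
  refine Prod.ext (Subtype.ext ?_) ?_
  · rw [glHat_bracket_fst]
    refine Eq.trans ?_ (glHat_bracket_fst (phiLin ℓ a m X) (phiLin ℓ a m Y)).symm
    rw [h2 X, h2 Y]
  · rw [glHat_bracket_snd]
    refine Eq.trans ?_ (glHat_bracket_snd (phiLin ℓ a m X) (phiLin ℓ a m Y)).symm
    rw [h2 X, h2 Y]

end PhiHom

/-! ### Consequences of the norm condition -/

/-- The condition on the norm enters only here and in `log_ne_zero`; what is needed of `q` is that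
it is not a root of unity. -/
theorem exp_mul_int_ne_one {q ℓ : ℂ} (hℓ : Complex.exp ℓ = q) (hq : ‖q‖ ≠ 1) (n : ℤ)
    (hn : n ≠ 0) : Complex.exp (ℓ * n) ≠ 1 := by
  intro h
  rw [mul_comm, Complex.exp_int_mul, hℓ] at h
  have h1 : ‖q‖ ^ n = 1 := by rw [← norm_zpow, h, norm_one]
  exact hn ((zpow_eq_one_iff_right₀ (norm_nonneg q) hq).1 h1)

theorem log_ne_zero {q ℓ : ℂ} (hℓ : Complex.exp ℓ = q) (hq : ‖q‖ ≠ 1) : ℓ ≠ 0 := by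
  rintro rfl
  rw [Complex.exp_zero] at hℓ
  rw [← hℓ, norm_one] at hq
  exact hq rfl


/-! ### Surjectivity onto finitely many rows -/

section LocalSurjectivity

variable {q ℓ : ℂ} {ι : Type} (a : ι → ℂ) (m : ι → ℕ)

theorem cong_of_exp_eq (hℓ0 : ℓ ≠ 0) {b c : ℂ} {J J' : ℤ}
    (h : Complex.exp (ℓ * (b - J)) = Complex.exp (ℓ * (c - J'))) : Cong ℓ b c := by
  refine ⟨J - J', ?_⟩
  have := (inPeriods_sub_iff hℓ0 _ _).2 h
  convert this using 1
  push_cast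
  ring

theorem int_eq_of_exp_eq (hq : ∀ n : ℤ, n ≠ 0 → Complex.exp (ℓ * n) ≠ 1) {b : ℂ} {J J' : ℤ}
    (h : Complex.exp (ℓ * (b - J)) = Complex.exp (ℓ * (b - J'))) : J = J' := by
  by_contra hne
  refine hq (J' - J) (sub_ne_zero.2 (Ne.symm hne)) ?_
  have h1 : ℓ * ((J' - J : ℤ) : ℂ) = ℓ * (b - J) - ℓ * (b - J') := by push_cast; ring
  rw [h1, Complex.exp_sub, h, div_self (Complex.exp_ne_zero _)]

/-- Evaluation of a Laurent polynomial in `T_q` at the point `q^{a_i - J + t}`. -/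
def evalPoint (ℓ : ℂ) (i : ι) (J : ℤ) : (ℤ →₀ ℂ) →ₗ[ℂ] Trunc (m i) :=
  Finsupp.linearCombination ℂ fun κ : ℤ =>
    Complex.exp (ℓ * (a i - J) * κ) • Trunc.exp (m i) (κ * ℓ)

variable {a m}

/-- Hermite interpolation by Laurent polynomials at the points `q^{a_i - J}`, which are distinct
because the `a_i` are incongruent and `q` is not a root of unity. A functional that kills the image,
tested on `T_q ^ n` with `n ≥ 1`, is a vanishing quasipolynomial, so its coefficients are zero. -/
theorem evalPoint_surjective [Fintype ι] (hℓ0 : ℓ ≠ 0)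
    (hq : ∀ n : ℤ, n ≠ 0 → Complex.exp (ℓ * n) ≠ 1)
    (ha : ∀ i j, i ≠ j → ¬ Cong ℓ (a i) (a j)) (S : Finset ℤ) :
    Function.Surjective (LinearMap.pi fun x : ι × S => evalPoint a m ℓ x.1 x.2) := by
  classical
  rw [← LinearMap.range_eq_top]
  by_contra hne
  obtain ⟨g, hg0, hg⟩ := Submodule.exists_le_ker_of_lt_top _ (lt_top_iff_ne_top.2 hne)
  apply hg0
  -- The coordinates of the functional; up to the nonzero factors `ℓ ^ l / l!` they are the
  -- coefficients of the quasipolynomial.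
  let c : ι × S → ℕ → ℂ := fun x l => g (Pi.single x (Trunc.t (m x.1) ^ l))
  let p : ι × S → ℂ[X] := fun x => ∑ l ∈ Finset.range (m x.1 + 1),
    Polynomial.monomial l (ℓ ^ l / l.factorial * c x l)
  have hp : ∀ x ∈ (Finset.univ : Finset (ι × S)), p x = 0 := by
    refine quasipoly_unique Finset.univ (fun x => Complex.exp (ℓ * (a x.1 - ((x.2 : ℤ) : ℂ))))
      (fun _ _ => Complex.exp_ne_zero _) ?_ p ?_
    · rintro ⟨i, J⟩ - ⟨i', J'⟩ - h
      have hi : i = i' := by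
        by_contra hne
        exact ha i i' hne (cong_of_exp_eq hℓ0 h)
      subst hi
      exact Prod.ext rfl (Subtype.ext (int_eq_of_exp_eq hq h))
    · intro n _
      have h1 : g (LinearMap.pi (fun x : ι × S => evalPoint a m ℓ x.1 x.2)
          (Finsupp.single (n : ℤ) 1)) = 0 := hg (LinearMap.mem_range_self _ _)
      rw [← Finset.univ_sum_single (LinearMap.pi (fun x : ι × S => evalPoint a m ℓ x.1 x.2)
          (Finsupp.single (n : ℤ) 1)), map_sum] at h1
      rw [← h1]
      refine Finset.sum_congr rfl fun x _ => ?_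
      rw [LinearMap.pi_apply, evalPoint, Finsupp.linearCombination_single, one_smul, Trunc.exp,
        Finset.smul_sum]
      have h2 : (Pi.single x (∑ l ∈ Finset.range (m x.1 + 1),
          Complex.exp (ℓ * (a x.1 - ((x.2 : ℤ) : ℂ)) * ((n : ℤ) : ℂ)) •
            (((((n : ℤ) : ℂ) * ℓ) ^ l / (l.factorial : ℂ)) • Trunc.t (m x.1) ^ l)) :
            Π x : ι × S, Trunc (m x.1)) =
          ∑ l ∈ Finset.range (m x.1 + 1),
          (Complex.exp (ℓ * (a x.1 - ((x.2 : ℤ) : ℂ)) * ((n : ℤ) : ℂ)) *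
            ((((n : ℤ) : ℂ) * ℓ) ^ l / (l.factorial : ℂ))) •
              (Pi.single x (Trunc.t (m x.1) ^ l) : Π x : ι × S, Trunc (m x.1)) := by
        have := map_sum (LinearMap.single ℂ (fun x : ι × S => Trunc (m x.1)) x)
          (fun l => Complex.exp (ℓ * (a x.1 - ((x.2 : ℤ) : ℂ)) * ((n : ℤ) : ℂ)) •
            (((((n : ℤ) : ℂ) * ℓ) ^ l / (l.factorial : ℂ)) • Trunc.t (m x.1) ^ l))
          (Finset.range (m x.1 + 1))
        refine this.trans (Finset.sum_congr rfl fun l _ => ?_)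
        rw [smul_smul, map_smul]
        rfl
      rw [h2, map_sum, Polynomial.eval_finsetSum, Finset.sum_mul]
      refine Finset.sum_congr rfl fun l _ => ?_
      rw [map_smul, Polynomial.eval_monomial, exp_mul_intCast, zpow_natCast, smul_eq_mul]
      simp only [c, Int.cast_natCast]
      ring
  have hc : ∀ x : ι × S, ∀ l, l ≤ m x.1 → c x l = 0 := by
    intro x l hl
    have h1 := congrArg (fun p => Polynomial.coeff p l) (hp x (Finset.mem_univ _))
    simp only [p, Polynomial.finsetSum_coeff, Polynomial.coeff_monomial, Polynomial.coeff_zero,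
      Finset.sum_ite_eq', Finset.mem_range, Nat.lt_succ_of_le hl, if_true] at h1
    refine (mul_eq_zero.1 h1).resolve_left (div_ne_zero (pow_ne_zero _ hℓ0) ?_)
    exact_mod_cast Nat.factorial_ne_zero l
  refine LinearMap.pi_ext fun x y => ?_
  rw [LinearMap.zero_apply]
  have h3 := map_sum (LinearMap.single ℂ (fun x : ι × S => Trunc (m x.1)) x)
    (fun l => Trunc.coeff (m x.1) l y • Trunc.t (m x.1) ^ l) (Finset.range (m x.1 + 1))
  rw [← Trunc.eq_sum] at h3
  have h4 : (Pi.single x y : Π x : ι × S, Trunc (m x.1)) = ∑ l ∈ Finset.range (m x.1 + 1),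
      Trunc.coeff (m x.1) l y • (Pi.single x (Trunc.t (m x.1) ^ l) : Π x : ι × S, Trunc (m x.1)) :=
    h3.trans (Finset.sum_congr rfl fun l _ => by rw [map_smul]; rfl)
  rw [h4, map_sum]
  refine Finset.sum_eq_zero fun l hl => ?_
  rw [map_smul]
  have := hc x l (Nat.lt_succ_iff.1 (Finset.mem_range.1 hl))
  simp only [c] at this
  rw [this, smul_zero]

/-- The elements `z^n f(T_q) M_{αβ}` of degree `k` with row parity `α`. -/
def rowEmbed (k : ℤ) (α : Fin 2) : (ℤ →₀ ℂ) →ₗ[ℂ] (Idx →₀ ℂ) × ℂ :=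
  LinearMap.inl ℂ _ _ ∘ₗ Finsupp.lmapDomain ℂ ℂ fun κ : ℤ =>
    (((k + ((α : ℕ) : ℤ)) / 2, κ, α, if (k + ((α : ℕ) : ℤ)) % 2 = 0 then 0 else 1) : Idx)

theorem rowEmbed_single (k : ℤ) (α : Fin 2) (κ : ℤ) (c : ℂ) :
    rowEmbed k α (Finsupp.single κ c) = (Finsupp.single
      ((k + ((α : ℕ) : ℤ)) / 2, κ, α, if (k + ((α : ℕ) : ℤ)) % 2 = 0 then 0 else 1) c, 0) := by
  simp [rowEmbed, Finsupp.mapDomain_single]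

theorem rowEmbed_mem (k : ℤ) (α : Fin 2) (f : ℤ →₀ ℂ) : rowEmbed k α f ∈ (SSq q).deg k := by
  induction f using Finsupp.induction_linear with
  | zero => rw [map_zero]; exact zero_mem _
  | add f g hf hg => rw [map_add]; exact Submodule.add_mem _ hf hg
  | single κ c =>
    rw [rowEmbed_single]
    refine single_mem_SSq_deg q ?_ c
    simp only [Idx.deg]
    split_ifs with h <;> simp <;> omega

theorem phiLin_rowEmbed (i : ι) (k : ℤ) (α : Fin 2) (f : ℤ →₀ ℂ) (p : ℤ) :
    (phiLin ℓ (a i) (m i) (rowEmbed k α f)).1.1 p (p + k) =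
      if p % 2 = ((α : ℕ) : ℤ) then evalPoint a m ℓ i ((p + k) / 2) f else 0 := by
  induction f using Finsupp.induction_linear with
  | zero => simp
  | add f g hf hg =>
    rw [map_add, map_add, Prod.fst_add, Submodule.coe_add, Pi.add_apply, Pi.add_apply, hf, hg,
      map_add]
    split_ifs
    · rfl
    · rw [add_zero]
  | single κ c =>
    rw [rowEmbed_single, phiLin_single, evalPoint, Finsupp.linearCombination_single, Prod.smul_fst,
      Submodule.coe_smul, Pi.smul_apply, Pi.smul_apply, phiMatrix_apply]
    have hα := fin_two_cast_le α
    have hβ : (((if (k + ((α : ℕ) : ℤ)) % 2 = 0 then (0 : Fin 2) else 1 : Fin 2) : ℕ) : ℤ) =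
        (k + ((α : ℕ) : ℤ)) % 2 := by
      split_ifs with h
      · rw [h]; rfl
      · have : (k + ((α : ℕ) : ℤ)) % 2 = 1 := by omega
        rw [this]; rfl
    simp only [hβ]
    by_cases hp : p % 2 = ((α : ℕ) : ℤ)
    · rw [if_pos hp, if_pos (by omega)]
    · rw [if_neg hp, if_neg (by omega), smul_zero]

/-- Prescribing finitely many rows, linearly. -/
theorem exists_section [Fintype ι] (hℓ0 : ℓ ≠ 0)
    (hq : ∀ n : ℤ, n ≠ 0 → Complex.exp (ℓ * n) ≠ 1)
    (ha : ∀ i j, i ≠ j → ¬ Cong ℓ (a i) (a j)) (N : ℕ) (k : ℤ) :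
    ∃ s : (Π i, ℤ → Trunc (m i)) →ₗ[ℂ] (Idx →₀ ℂ) × ℂ, ∀ y, s y ∈ (SSq q).deg k ∧
      ∀ i (p : ℤ), |p| ≤ N → (phiLin ℓ (a i) (m i) (s y)).1.1 p (p + k) = y i p := by
  -- Large enough to contain the column block `(p + k) / 2` of every row with `|p| ≤ N`.
  set S : Finset ℤ := Finset.Icc (-(N + |k| + 1)) (N + |k| + 1)
  obtain ⟨σ, hσ⟩ := LinearMap.exists_rightInverse_of_surjective _
    (LinearMap.range_eq_top.2 (evalPoint_surjective (m := m) hℓ0 hq ha S))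
  have hσ' : ∀ (w : Π x : ι × S, Trunc (m x.1)) (i : ι) (J : ℤ) (hJ : J ∈ S),
      evalPoint a m ℓ i J (σ w) = w (i, ⟨J, hJ⟩) := by
    intro w i J hJ
    have := congrFun (LinearMap.congr_fun hσ w) (i, ⟨J, hJ⟩)
    exact this
  -- At the point `J` the prescribed value is the one in the unique row of parity `α` whose entry on
  -- the `k`-th diagonal lies in column block `J`.
  let row : Fin 2 → (Π i, ℤ → Trunc (m i)) →ₗ[ℂ] (Π x : ι × S, Trunc (m x.1)) := fun α =>
    LinearMap.pi fun x => LinearMap.proj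
      (2 * ((x.2 : ℤ) - (k + ((α : ℕ) : ℤ)) / 2) + ((α : ℕ) : ℤ)) ∘ₗ LinearMap.proj x.1
  refine ⟨∑ α : Fin 2, rowEmbed k α ∘ₗ σ ∘ₗ row α, fun y => ⟨?_, fun i p hp => ?_⟩⟩
  · rw [LinearMap.sum_apply]
    exact Submodule.sum_mem _ fun α _ => rowEmbed_mem k α _
  · have hJ : (p + k) / 2 ∈ S := by
      rw [abs_le] at hp
      have h1 := le_abs_self k
      have h2 := neg_abs_le k
      rw [Finset.mem_Icc]
      omega
    have hsum : ∀ F : Fin 2 → (Idx →₀ ℂ) × ℂ,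
        (phiLin ℓ (a i) (m i) (∑ α, F α)).1.1 p (p + k) =
          ∑ α, (phiLin ℓ (a i) (m i) (F α)).1.1 p (p + k) := by
      intro F
      rw [Fin.sum_univ_two, Fin.sum_univ_two, map_add]
      rfl
    rw [LinearMap.sum_apply, hsum]
    simp only [LinearMap.comp_apply, phiLin_rowEmbed, hσ' _ i _ hJ]
    rw [Fin.sum_univ_two]
    rcases Int.emod_two_eq_zero_or_one p with h | h
    · rw [if_pos (by simpa using h), if_neg (by simp [h]), add_zero]
      change y i _ = y i p
      congr 1
      simp only [Fin.val_zero, Nat.cast_zero]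
      omega
    · rw [if_neg (by simp [h]), if_pos (by simpa using h), zero_add]
      change y i _ = y i p
      congr 1
      simp only [Fin.val_one, Nat.cast_one]
      omega

/-- Simultaneous approximation of homogeneous matrices by elements of `SSq`. -/
theorem exists_approx [Fintype ι] (hℓ0 : ℓ ≠ 0)
    (hq : ∀ n : ℤ, n ≠ 0 → Complex.exp (ℓ * n) ≠ 1)
    (ha : ∀ i j, i ≠ j → ¬ Cong ℓ (a i) (a j)) (N : ℕ) (k : ℤ) (A : Π i, band (m i))
    (hA : ∀ i, A i ∈ diagonal (m i) k) :
    ∃ X : (Idx →₀ ℂ) × ℂ, X ∈ (SSq q).deg k ∧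
      ∀ i, RowsVanish N ((phiLin ℓ (a i) (m i) X).1.1 - (A i).1) := by
  obtain ⟨s, hs⟩ := exists_section (q := q) (m := m) hℓ0 hq ha N k
  obtain ⟨h1, h2⟩ := hs fun i p => (A i).1 p (p + k)
  refine ⟨_, h1, fun i p r hp => ?_⟩
  rw [Pi.sub_apply, Pi.sub_apply]
  by_cases hr : r - p = k
  · obtain rfl : r = p + k := by omega
    rw [h2 i p hp, sub_self]
  · rw [hA i p r hr, (mem_glHat_deg.1 (phiLin_deg (q := q) (a i) (m i) h1)).1 p r hr, sub_zero]

variable (q ℓ a m) in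
/-- The homogeneous elements whose images under all `phiHat` vanish near the origin. -/
def ssVanish (N : ℕ) (k : ℤ) : Set (SSq q).carrier :=
  {X | X ∈ (SSq q).deg k ∧ ∀ i, RowsVanish N (phiLin ℓ (a i) (m i) X).1.1}

theorem ssVanish_anti {N N' : ℕ} (h : N ≤ N') (k : ℤ) :
    ssVanish q ℓ a m N' k ⊆ ssVanish q ℓ a m N k :=
  fun _ hX => ⟨hX.1, fun i => (hX.2 i).mono h⟩

theorem phiLin_bracket_fst (hℓ : Complex.exp ℓ = q)
    (hq : ∀ n : ℤ, n ≠ 0 → Complex.exp (ℓ * n) ≠ 1) (b : ℂ) (M : ℕ) (X Y : (Idx →₀ ℂ) × ℂ) :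
    (phiLin ℓ b M ((SSq q).bracket X Y)).1.1 =
      superComm (phiLin ℓ b M X).1.1 (phiLin ℓ b M Y).1.1 :=
  congrArg (fun W : band M × Trunc M => W.1.1) (phiHat_bracket (a := b) (m := M) hℓ hq X Y)

theorem ssVanish_bracket (hℓ : Complex.exp ℓ = q)
    (hq : ∀ n : ℤ, n ≠ 0 → Complex.exp (ℓ * n) ≠ 1) {N : ℕ} {j k : ℤ} {x X : (Idx →₀ ℂ) × ℂ}
    (hx : x ∈ (SSq q).deg j) (hX : X ∈ ssVanish q ℓ a m (N + j.natAbs) k) :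
    (SSq q).bracket x X ∈ ssVanish q ℓ a m N (j + k) := by
  refine ⟨(SSq_isGraded q).bracket_mem _ _ _ _ hx hX.1, fun i => ?_⟩
  have h1 := phiLin_bracket_fst hℓ hq (a i) (m i) x X
  have h2 := (hX.2 i).superComm_right
    (A := (phiLin ℓ (a i) (m i) x).1.1) (mem_glHat_deg.1 (phiLin_deg (ℓ := ℓ) (a i) (m i) hx)).1
  intro p r hp
  exact (congrFun (congrFun h1 p) r).trans (h2 p r hp)

end LocalSurjectivity


/-! ### Linear algebra of tensor products -/

section TensorLemmas

variable {E F : Type*} [AddCommGroup E] [Module ℂ E] [AddCommGroup F] [Module ℂ F]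

theorem tensor_eq_zero_of_functionals_right (t : E ⊗[ℂ] F)
    (h : ∀ f : Module.Dual ℂ F, TensorProduct.rid ℂ E (f.lTensor E t) = 0) : t = 0 := by
  classical
  let b := Module.Basis.ofVectorSpace ℂ F
  have key : ∀ (t : E ⊗[ℂ] F) i, TensorProduct.equivFinsuppOfBasisRight b t i =
      TensorProduct.rid ℂ E ((b.coord i).lTensor E t) := by
    intro t i
    induction t using TensorProduct.induction_on with
    | zero => simp
    | tmul x y => simp
    | add x y hx hy => rw [map_add, Finsupp.add_apply, hx, hy, map_add, map_add]
  have h0 : TensorProduct.equivFinsuppOfBasisRight b t = 0 := by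
    ext i
    rw [key, h]
    rfl
  simpa using h0

theorem tensor_eq_zero_of_functionals_left (t : E ⊗[ℂ] F)
    (h : ∀ f : Module.Dual ℂ E, TensorProduct.lid ℂ F (f.rTensor F t) = 0) : t = 0 := by
  have h1 : TensorProduct.comm ℂ E F t = 0 := by
    refine tensor_eq_zero_of_functionals_right _ fun f => ?_
    have key : ∀ t : E ⊗[ℂ] F, TensorProduct.rid ℂ F (f.lTensor F (TensorProduct.comm ℂ E F t)) =
        TensorProduct.lid ℂ F (f.rTensor F t) := by
      intro t
      induction t using TensorProduct.induction_on with
      | zero => simp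
      | tmul x y => simp
      | add x y hx hy => simp only [map_add, hx, hy]
    rw [key, h]
  simpa using h1

/-- The operator that multiplies the piece of degree `d` by `d`. -/
def degreeOp {A : ℤ → Submodule ℂ E} (h : DirectSum.IsInternal A) : E →ₗ[ℂ] E :=
  DirectSum.toModule ℂ ℤ E (fun d => (d : ℂ) • (A d).subtype) ∘ₗ (gradedEquiv h).toLinearMap

theorem degreeOp_apply {A : ℤ → Submodule ℂ E} (h : DirectSum.IsInternal A) {d : ℤ} {v : E}
    (hv : v ∈ A d) : degreeOp h v = (d : ℂ) • v := by
  rw [degreeOp, LinearMap.comp_apply, LinearEquiv.coe_coe, gradedEquiv_apply h hv,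
    DirectSum.toModule_lof]
  rfl

end TensorLemmas

namespace SSq

variable {q : ℂ} {V U : GradedAction (SSq q)}

/-- The carrier of `tensor` as a tensor product. -/
theorem mem_tensor_deg_induction {d : ℤ} {p : V.carrier ⊗[ℂ] U.carrier → Prop}
    (tmul : ∀ i v u, v ∈ V.deg i → u ∈ U.deg (d - i) → p (v ⊗ₜ u)) (zero : p 0)
    (add : ∀ x y, p x → p y → p (x + y)) (t : V.carrier ⊗[ℂ] U.carrier)
    (ht : t ∈ (tensor V U).deg d) : p t := by
  refine Submodule.iSup_induction _ (motive := p) ht (fun i t ht => ?_) zero add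
  obtain ⟨s, rfl⟩ := ht
  induction s using TensorProduct.induction_on with
  | zero => rw [map_zero]; exact zero
  | tmul x y => exact tmul i x y x.2 y.2
  | add x y hx hy => rw [map_add]; exact add _ _ hx hy

theorem tmul_mem_tensor_deg {i j : ℤ} {v : V.carrier} {u : U.carrier} (hv : v ∈ V.deg i)
    (hu : u ∈ U.deg j) : v ⊗ₜ[ℂ] u ∈ (tensor V U).deg (i + j) := by
  refine Submodule.mem_iSup_of_mem i ⟨⟨v, hv⟩ ⊗ₜ ⟨u, ?_⟩, rfl⟩
  simpa using hu

theorem evenPart_of_mem {k : ℤ} {X : (Idx →₀ ℂ) × ℂ} (hX : X ∈ (SSq q).deg k) :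
    evenPart q X = if Even k then X else 0 := by
  obtain ⟨h1, h2⟩ := (mem_SSq_deg q).1 hX
  have hpar : ∀ x ∈ X.1.support, (x.2.2.1 = x.2.2.2 ↔ Even k) := by
    intro x hx
    have hxk : x.deg = k := by
      by_contra h
      exact (Finsupp.mem_support_iff.1 hx) (h1 x h)
    rw [← hxk, Idx.deg]
    have b1 := fin_two_cast_le x.2.2.1
    have b2 := fin_two_cast_le x.2.2.2
    constructor
    · intro h
      rw [h, add_sub_cancel_right]
      exact even_two_mul _
    · intro h
      rw [Int.even_iff] at h
      exact fin_two_cast_inj (by omega)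
  have key : evenPart q X = (Finsupp.linearCombination ℂ (fun x : Idx =>
      if x.2.2.1 = x.2.2.2 then Finsupp.single x (1 : ℂ) else 0) X.1, X.2) := rfl
  rw [key, Finsupp.linearCombination_apply, Finsupp.sum]
  split_ifs with hk
  · refine Prod.ext ?_ rfl
    refine Eq.trans (Finset.sum_congr rfl fun x hx => ?_) X.1.sum_single
    rw [if_pos ((hpar x hx).2 hk), Finsupp.smul_single, smul_eq_mul, mul_one]
  · refine Prod.ext ?_ (h2 (by rintro rfl; exact hk Even.zero))
    refine Finset.sum_eq_zero fun x hx => ?_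
    rw [if_neg (fun h => hk ((hpar x hx).1 h)), smul_zero]

/-- The power of the parity operator that accompanies an element of degree `k`. -/
def parPow (V : GradedAction (SSq q)) (k : ℤ) : V.carrier →ₗ[ℂ] V.carrier :=
  if Even k then LinearMap.id else V.par

theorem parPow_parPow (hV : V.IsGradedModule) (k : ℤ) (v : V.carrier) :
    parPow V k (parPow V k v) = v := by
  rw [parPow]
  split_ifs
  · rfl
  · exact hV.par_par v

theorem parPow_apply (hV : V.IsGradedModule) (k : ℤ) {d : ℤ} {v : V.carrier} (hv : v ∈ V.deg d) :
    parPow V k v = ((-1 : ℂ) ^ (k * d)) • v := by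
  rw [parPow]
  split_ifs with h
  · rw [(h.mul_right d).neg_one_zpow, one_smul]
    rfl
  · rw [hV.par_apply d v hv, zpow_mul, (Int.not_even_iff_odd.1 h).neg_one_zpow]

/-- A homogeneous element is purely even or purely odd according to its doubled degree, so only one
of the two terms on the second factor survives. -/
theorem tensor_act {k : ℤ} {X : (Idx →₀ ℂ) × ℂ} (hX : X ∈ (SSq q).deg k)
    (t : V.carrier ⊗[ℂ] U.carrier) : (tensor V U).act X t =
      (V.act X).rTensor U.carrier t + TensorProduct.map (parPow V k) (U.act X) t := by
  have h1 : (tensor V U).act X t = (V.act X).rTensor U.carrier t +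
      (U.act (evenPart q X)).lTensor V.carrier t +
      TensorProduct.map V.par (U.act (oddPart q X)) t := rfl
  have h2 : U.act (oddPart q X) = U.act X - U.act (evenPart q X) := map_sub U.act X _
  have h3 := evenPart_of_mem hX
  rw [h1, h2, parPow, add_assoc]
  congr 1
  split_ifs at h3 ⊢ with h
  · rw [h3, sub_self]
    simp [LinearMap.lTensor]
  · have h4 : U.act (evenPart q X) = 0 := (congrArg U.act h3).trans (map_zero U.act)
    rw [h4]
    simp

theorem tensor_act_tmul (hV : V.IsGradedModule) {k d : ℤ} {X : (Idx →₀ ℂ) × ℂ}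
    (hX : X ∈ (SSq q).deg k) {v : V.carrier} (hv : v ∈ V.deg d) (u : U.carrier) :
    (tensor V U).act X (v ⊗ₜ[ℂ] u) =
      (V.act X v) ⊗ₜ[ℂ] u + ((-1 : ℂ) ^ (k * d)) • (v ⊗ₜ[ℂ] (U.act X u)) := by
  rw [tensor_act hX, LinearMap.rTensor_tmul, TensorProduct.map_tmul, parPow_apply hV k hv,
    TensorProduct.smul_tmul']

theorem tensor_induction (hV : V.IsGradedModule) (hU : U.IsGradedModule)
    {p : V.carrier ⊗[ℂ] U.carrier → Prop} (t : V.carrier ⊗[ℂ] U.carrier)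
    (tmul : ∀ i j v u, v ∈ V.deg i → u ∈ U.deg j → p (v ⊗ₜ u)) (zero : p 0)
    (add : ∀ x y, p x → p y → p (x + y)) : p t := by
  induction t using TensorProduct.induction_on with
  | zero => exact zero
  | add x y hx hy => exact add x y hx hy
  | tmul v u =>
    refine isInternal_induction hV.internal (p := fun v => p (v ⊗ₜ u)) v (fun i v hv => ?_)
      (by rw [TensorProduct.zero_tmul]; exact zero)
      (fun x y hx hy => by rw [TensorProduct.add_tmul]; exact add _ _ hx hy)
    exact isInternal_induction hU.internal (p := fun u => p (v ⊗ₜ u)) u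
      (fun j u hu => tmul i j v u hv hu)
      (by rw [TensorProduct.tmul_zero]; exact zero)
      (fun x y hx hy => by rw [TensorProduct.tmul_add]; exact add _ _ hx hy)

theorem tensor_isInternal (hV : V.IsGradedModule) (hU : U.IsGradedModule) :
    DirectSum.IsInternal (tensor V U).deg := by
  rw [DirectSum.isInternal_submodule_iff_iSupIndep_and_iSup_eq_top]
  constructor
  -- The total degree operator acts by `d` on the piece of degree `d`, and eigenspaces for distinct
  -- eigenvalues are independent.
  · let T : Module.End ℂ (V.carrier ⊗[ℂ] U.carrier) :=
      (degreeOp hV.internal).rTensor U.carrier + (degreeOp hU.internal).lTensor V.carrier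
    refine ((T.eigenspaces_iSupIndep).comp (f := fun d : ℤ => (d : ℂ)) Int.cast_injective).mono
      fun d t ht => ?_
    rw [Function.comp_apply, Module.End.mem_eigenspace_iff]
    refine mem_tensor_deg_induction (p := fun t => T t = (d : ℂ) • t) (fun i v u hv hu => ?_)
      (by simp) (fun x y hx hy => ?_) t ht
    · simp only [T, LinearMap.add_apply, LinearMap.rTensor_tmul, LinearMap.lTensor_tmul,
        degreeOp_apply _ hv, degreeOp_apply _ hu, TensorProduct.smul_tmul,
        TensorProduct.tmul_smul, ← add_smul]
      congr 1
      push_cast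
      ring
    · rw [map_add, hx, hy, smul_add]
  · rw [eq_top_iff]
    intro t _
    refine tensor_induction hV hU (p := fun t => t ∈ ⨆ d, (tensor V U).deg d) t
      (fun i j v u hv hu => ?_) (Submodule.zero_mem _) (fun x y hx hy => Submodule.add_mem _ hx hy)
    exact le_iSup (tensor V U).deg (i + j) (tmul_mem_tensor_deg hv hu)

theorem tensor_isGradedModule (hV : V.IsGradedModule) (hU : U.IsGradedModule) :
    (tensor V U).IsGradedModule where
  internal := tensor_isInternal hV hU
  par_apply d t ht := by
    refine mem_tensor_deg_induction (p := fun t => (tensor V U).par t = ((-1 : ℂ) ^ d) • t)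
      (fun i v u hv hu => ?_) ?_ (fun x y hx hy => ?_) t ht
    · have key : TensorProduct.map V.par U.par (v ⊗ₜ[ℂ] u) = ((-1 : ℂ) ^ d) • (v ⊗ₜ[ℂ] u) := by
        rw [TensorProduct.map_tmul, hV.par_apply i v hv, hU.par_apply _ u hu,
          TensorProduct.smul_tmul_smul, ← zpow_add₀ (by norm_num), add_sub_cancel]
      exact key
    · exact (map_zero _).trans (smul_zero _).symm
    · exact (map_add _ x y).trans ((congrArg₂ _ hx hy).trans (smul_add _ x y).symm)
  act_mem i j x t hx ht := by
    refine mem_tensor_deg_induction (p := fun t => (tensor V U).act x t ∈ (tensor V U).deg (i + j))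
      (fun e v u hv hu => ?_) ?_ (fun y z hy hz => ?_) t ht
    · rw [tensor_act_tmul hV hx hv]
      refine Submodule.add_mem _ ?_ (Submodule.smul_mem _ _ ?_)
      · have := tmul_mem_tensor_deg (hV.act_mem _ _ _ _ hx hv) hu
        rwa [show i + e + (j - e) = i + j by ring] at this
      · have := tmul_mem_tensor_deg hv (hU.act_mem _ _ _ _ hx hu)
        rwa [show e + (i + (j - e)) = i + j by ring] at this
    · exact (congrArg (· ∈ (tensor V U).deg (i + j)) (map_zero ((tensor V U).act x))).mpr
        (Submodule.zero_mem _)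
    · exact (congrArg (· ∈ (tensor V U).deg (i + j)) (map_add ((tensor V U).act x) y z)).mpr
        (Submodule.add_mem _ hy hz)
  act_bracket i j x y hx hy := by
    refine LinearMap.ext fun t => ?_
    refine tensor_induction hV hU (p := fun t => (tensor V U).act ((SSq q).bracket x y) t =
      ((tensor V U).act x * (tensor V U).act y -
        ((-1 : ℂ) ^ (i * j)) • ((tensor V U).act y * (tensor V U).act x)) t) t
      (fun d e v u hv hu => ?_) ?_ (fun s t hs ht => ?_)
    · have hb := (SSq_isGraded q).bracket_mem i j x y hx hy
      have hexp : ((tensor V U).act x * (tensor V U).act y -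
          ((-1 : ℂ) ^ (i * j)) • ((tensor V U).act y * (tensor V U).act x)) (v ⊗ₜ u) =
          (tensor V U).act x ((tensor V U).act y (v ⊗ₜ u)) - ((-1 : ℂ) ^ (i * j)) •
            (tensor V U).act y ((tensor V U).act x (v ⊗ₜ u)) := rfl
      have hadd : ∀ (z : (SSq q).carrier) (a b : V.carrier ⊗[ℂ] U.carrier) (c : ℂ),
          (tensor V U).act z (a + c • b) = (tensor V U).act z a + c • (tensor V U).act z b :=
        fun z a b c => (map_add ((tensor V U).act z) a (c • b)).trans
          (congrArg _ (map_smul ((tensor V U).act z) c b))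
      rw [hexp, tensor_act_tmul hV hb hv, tensor_act_tmul hV hy hv, tensor_act_tmul hV hx hv,
        hadd, hadd, tensor_act_tmul hV hx (hV.act_mem _ _ _ _ hy hv), tensor_act_tmul hV hx hv,
        tensor_act_tmul hV hy (hV.act_mem _ _ _ _ hx hv), tensor_act_tmul hV hy hv,
        hV.act_bracket i j x y hx hy, hU.act_bracket i j x y hx hy]
      simp only [LinearMap.sub_apply, LinearMap.smul_apply, Module.End.mul_apply,
        TensorProduct.sub_tmul, TensorProduct.tmul_sub, TensorProduct.tmul_smul]
      rw [← TensorProduct.smul_tmul', add_mul, mul_add, mul_add, zpow_add₀ (by norm_num),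
        zpow_add₀ (by norm_num), zpow_add₀ (by norm_num), mul_comm j i]
      have hsq := neg_one_zpow_mul_self (i * j)
      -- What remains is linear in six tensors; the mixed terms cancel because `α` has square one.
      generalize hα : (-1 : ℂ) ^ (i * j) = α at *
      generalize (-1 : ℂ) ^ (i * d) = β
      generalize (-1 : ℂ) ^ (j * d) = γ
      generalize (V.act x (V.act y v)) ⊗ₜ[ℂ] u = w1
      generalize (V.act y (V.act x v)) ⊗ₜ[ℂ] u = w2
      generalize v ⊗ₜ[ℂ] (U.act x (U.act y u)) = w3
      generalize v ⊗ₜ[ℂ] (U.act y (U.act x u)) = w4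
      generalize (V.act x v) ⊗ₜ[ℂ] (U.act y u) = w5
      generalize (V.act y v) ⊗ₜ[ℂ] (U.act x u) = w6
      have h5 : α • (α * γ) • w5 = γ • w5 := by rw [smul_smul, ← mul_assoc, hsq, one_mul]
      change w1 - α • w2 + (β * γ) • (w3 - α • w4) = w1 + (α * β) • w6 + γ • (w5 + β • w3) -
        α • (w2 + (α * γ) • w5 + β • (w6 + γ • w4))
      simp only [smul_add, h5]
      module
    · exact (map_zero _).trans (map_zero _).symm
    · exact (map_add _ s t).trans ((congrArg₂ _ hs ht).trans (map_add _ s t).symm)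

end SSq


namespace SSq

/-! ### Tensor products of irreducible highest weight modules -/

variable {q : ℂ} {V U : GradedAction (SSq q)}

/-- On each vector, the elements of `Z N k`, `k ≠ 0`, with large `N` act by zero. -/
def LocallyTrivial (Z : ℕ → ℤ → Set ((Idx →₀ ℂ) × ℂ)) (V : GradedAction (SSq q)) : Prop :=
  ∀ (u : V.carrier) (k : ℤ), k ≠ 0 → ∃ N, ∀ N', N ≤ N' → ∀ X ∈ Z N' k, V.act X u = 0

variable {Z1 Z2 : ℕ → ℤ → Set ((Idx →₀ ℂ) × ℂ)}

theorem LocallyTrivial.rTensor (hV : LocallyTrivial Z1 V) (t : V.carrier ⊗[ℂ] U.carrier) {k : ℤ}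
    (hk : k ≠ 0) : ∃ N, ∀ N', N ≤ N' → ∀ X ∈ Z1 N' k, (V.act X).rTensor U.carrier t = 0 := by
  induction t using TensorProduct.induction_on with
  | zero => exact ⟨0, fun N _ X _ => map_zero _⟩
  | tmul v u =>
    obtain ⟨N, hN⟩ := hV v k hk
    exact ⟨N, fun N' h X hX => by rw [LinearMap.rTensor_tmul, hN N' h X hX, TensorProduct.zero_tmul]⟩
  | add x y hx hy =>
    obtain ⟨N, hN⟩ := hx
    obtain ⟨N', hN'⟩ := hy
    refine ⟨max N N', fun M hM X hX => ?_⟩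
    rw [map_add, hN M ((le_max_left _ _).trans hM) X hX,
      hN' M ((le_max_right _ _).trans hM) X hX, add_zero]

theorem LocallyTrivial.map (hU : LocallyTrivial Z2 U) (f : Module.End ℂ V.carrier)
    (t : V.carrier ⊗[ℂ] U.carrier) {k : ℤ}
    (hk : k ≠ 0) : ∃ N, ∀ N', N ≤ N' → ∀ X ∈ Z2 N' k, TensorProduct.map f (U.act X) t = 0 := by
  induction t using TensorProduct.induction_on with
  | zero => exact ⟨0, fun N _ X _ => map_zero _⟩
  | tmul v u =>
    obtain ⟨N, hN⟩ := hU u k hk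
    exact ⟨N, fun N' h X hX => by rw [TensorProduct.map_tmul, hN N' h X hX, TensorProduct.tmul_zero]⟩
  | add x y hx hy =>
    obtain ⟨N, hN⟩ := hx
    obtain ⟨N', hN'⟩ := hy
    refine ⟨max N N', fun M hM X hX => ?_⟩
    rw [map_add, hN M ((le_max_left _ _).trans hM) X hX,
      hN' M ((le_max_right _ _).trans hM) X hX, add_zero]

/-- Every element is the sum of one that is invisible to `Z1`-trivial and one that is invisible to
`Z2`-trivial modules. -/
def Splits (q : ℂ) (Z1 Z2 : ℕ → ℤ → Set ((Idx →₀ ℂ) × ℂ)) : Prop :=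
  ∀ (N : ℕ) (k : ℤ), k ≠ 0 → ∀ X : (Idx →₀ ℂ) × ℂ, X ∈ (SSq q).deg k →
    ∃ X' : (Idx →₀ ℂ) × ℂ, X' ∈ (SSq q).deg k ∧ X' ∈ Z1 N k ∧ X - X' ∈ Z2 N k

/-- The element `X'` is chosen invisible to `V` and indistinguishable from `X` for `U`, to an
accuracy depending on `t`. So on each tensor the second factor is acted on alone, and by subtraction
the first as well (`exists_act_left`). -/
theorem exists_act_right (hV : LocallyTrivial Z1 V) (hU : LocallyTrivial Z2 U)
    (hs : Splits q Z1 Z2) {k : ℤ} (hk : k ≠ 0) {X : (Idx →₀ ℂ) × ℂ} (hX : X ∈ (SSq q).deg k)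
    (t : V.carrier ⊗[ℂ] U.carrier) : ∃ X' : (Idx →₀ ℂ) × ℂ, X' ∈ (SSq q).deg k ∧
      (tensor V U).act X' t = TensorProduct.map (parPow V k) (U.act X) t := by
  obtain ⟨N1, h1⟩ := hV.rTensor t hk
  obtain ⟨N2, h2⟩ := hU.map (parPow V k) t hk
  obtain ⟨X', hX', hz1, hz2⟩ := hs (max N1 N2) k hk X hX
  refine ⟨X', hX', ?_⟩
  have h3 := h2 _ (le_max_right _ _) _ hz2
  have h4 : U.act (X - X') = U.act X - U.act X' := map_sub U.act X X'
  rw [h4, ← TensorProduct.mapBilinear_apply, map_sub, TensorProduct.mapBilinear_apply,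
    TensorProduct.mapBilinear_apply, LinearMap.sub_apply, sub_eq_zero] at h3
  rw [tensor_act hX', h1 _ (le_max_left _ _) X' hz1, zero_add, h3]

theorem exists_act_left (hV : LocallyTrivial Z1 V) (hU : LocallyTrivial Z2 U)
    (hs : Splits q Z1 Z2) {k : ℤ} (hk : k ≠ 0) {X : (Idx →₀ ℂ) × ℂ} (hX : X ∈ (SSq q).deg k)
    (t : V.carrier ⊗[ℂ] U.carrier) : ∃ X' : (Idx →₀ ℂ) × ℂ, X' ∈ (SSq q).deg k ∧
      (tensor V U).act X' t = (V.act X).rTensor U.carrier t := by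
  obtain ⟨X', hX', h⟩ := exists_act_right hV hU hs hk hX t
  refine ⟨X - X', Submodule.sub_mem _ hX hX', ?_⟩
  have h1 : (tensor V U).act (X - X') t = (tensor V U).act X t - (tensor V U).act X' t :=
    (congrArg (fun f : Module.End ℂ (tensor V U).carrier => f t)
      (map_sub (tensor V U).act X X')).trans (LinearMap.sub_apply _ _ t)
  rw [h1, h, tensor_act hX]
  exact add_sub_cancel_right _ _

theorem tmul_ne_zero {E F : Type*} [AddCommGroup E] [Module ℂ E] [AddCommGroup F] [Module ℂ F]
    {x : E} {y : F} (hx : x ≠ 0) (hy : y ≠ 0) : x ⊗ₜ[ℂ] y ≠ 0 := by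
  intro h
  obtain ⟨f, hf⟩ := Module.Projective.exists_dual_ne_zero ℂ hx
  have := congrArg (fun t => TensorProduct.lid ℂ F (f.rTensor F t)) h
  simp only [LinearMap.rTensor_tmul, TensorProduct.lid_tmul, map_zero] at this
  exact (smul_ne_zero hf hy) this

/-- The graded pieces of the tensor product, as subspaces of the tensor product of the spaces. -/
def tensorDeg (V U : GradedAction (SSq q)) (d : ℤ) : Submodule ℂ (V.carrier ⊗[ℂ] U.carrier) :=
  (tensor V U).deg d

theorem tmul_mem_tensorDeg {i j d : ℤ} (h : i + j = d) {v : V.carrier} {u : U.carrier}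
    (hv : v ∈ V.deg i) (hu : u ∈ U.deg j) : v ⊗ₜ[ℂ] u ∈ tensorDeg V U d := by
  subst h
  exact tmul_mem_tensor_deg hv hu

theorem map_gradedProj_mem (hV : V.IsGradedModule) (hU : U.IsGradedModule)
    (t : V.carrier ⊗[ℂ] U.carrier) :
    TensorProduct.map (gradedProj hV.internal 0) (gradedProj hU.internal 0) t ∈
      tensorDeg V U 0 := by
  induction t using TensorProduct.induction_on with
  | zero => rw [map_zero]; exact Submodule.zero_mem _
  | tmul v u =>
    exact tmul_mem_tensorDeg (zero_add 0) (gradedProj_mem hV.internal 0 v)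
      (gradedProj_mem hU.internal 0 u)
  | add x y hx hy => rw [map_add]; exact Submodule.add_mem _ hx hy

/-- Generation is the point: a subspace stable under negative degrees is stable under those of each
factor separately. It is first filled along `V` with the second vector fixed, then along `U` for all
vectors of `V` at once. -/
theorem isHighestWeight_tensor {l1 l2 : Module.Dual ℂ ((SSq q).deg 0)}
    (hV : V.IsHighestWeight l1) (hU : U.IsHighestWeight l2)
    (hZ1 : LocallyTrivial Z1 V) (hZ2 : LocallyTrivial Z2 U) (hs : Splits q Z1 Z2) :
    (tensor V U).IsHighestWeight (l1 + l2) := by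
  refine ⟨tensor_isGradedModule hV.1 hU.1, hV.vec ⊗ₜ[ℂ] hU.vec, ?_, ?_, ?_, ?_, ?_⟩
  · exact tmul_ne_zero hV.vec_ne_zero hU.vec_ne_zero
  · apply le_antisymm
    · intro t ht
      refine mem_tensor_deg_induction (p := fun t =>
        t ∈ Submodule.span ℂ {hV.vec ⊗ₜ[ℂ] hU.vec}) (fun i v u hv hu => ?_)
        (Submodule.zero_mem _) (fun x y hx hy => Submodule.add_mem _ hx hy) t ht
      rcases lt_trichotomy i 0 with hi | rfl | hi
      · rw [hU.deg_pos (show 0 < 0 - i by omega), Submodule.mem_bot] at hu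
        rw [hu, TensorProduct.tmul_zero]
        exact Submodule.zero_mem _
      · rw [hV.deg_zero, Submodule.mem_span_singleton] at hv
        rw [sub_zero, hU.deg_zero, Submodule.mem_span_singleton] at hu
        obtain ⟨a, rfl⟩ := hv
        obtain ⟨b, rfl⟩ := hu
        rw [TensorProduct.smul_tmul_smul]
        exact Submodule.smul_mem _ _ (Submodule.mem_span_singleton_self _)
      · rw [hV.deg_pos hi, Submodule.mem_bot] at hv
        rw [hv, TensorProduct.zero_tmul]
        exact Submodule.zero_mem _
    · have h1 := tmul_mem_tensorDeg (zero_add 0) hV.vec_mem hU.vec_mem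
      exact (Submodule.span_singleton_le_iff_mem _ (tensorDeg V U 0)).2 h1
  · rintro ⟨X, hX⟩
    have h1 := tensor_act_tmul hV.1 hX hV.vec_mem hU.vec
    rw [mul_zero, zpow_zero, one_smul, hV.act_deg_zero hX, hU.act_deg_zero hX,
      TensorProduct.tmul_smul, ← TensorProduct.smul_tmul', ← add_smul] at h1
    exact h1
  · intro d hd X hX
    have h1 := tensor_act_tmul hV.1 hX hV.vec_mem hU.vec
    rw [hV.act_pos hd hX, hU.act_pos hd hX, TensorProduct.tmul_zero, smul_zero, add_zero,
      TensorProduct.zero_tmul] at h1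
    exact h1
  · intro W hW hst
    have hl : ∀ d : ℤ, d < 0 → ∀ X ∈ (SSq q).deg d, ∀ t ∈ W,
        (V.act X).rTensor U.carrier t ∈ W := by
      intro d hd X hX t ht
      obtain ⟨X', hX', h⟩ := exists_act_left hZ1 hZ2 hs hd.ne hX t
      exact h ▸ hst d hd X' hX' t ht
    have hr : ∀ d : ℤ, d < 0 → ∀ X ∈ (SSq q).deg d, ∀ t ∈ W,
        TensorProduct.map (parPow V d) (U.act X) t ∈ W := by
      intro d hd X hX t ht
      obtain ⟨X', hX', h⟩ := exists_act_right hZ1 hZ2 hs hd.ne hX t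
      exact h ▸ hst d hd X' hX' t ht
    let P : Submodule ℂ V.carrier := W.comap ((TensorProduct.mk ℂ V.carrier U.carrier).flip hU.vec)
    have hP : P = ⊤ := hV.eq_top P hW fun d hd X hX v hv => hl d hd X hX _ hv
    let Q : Submodule ℂ U.carrier := ⨅ v : V.carrier,
      W.comap (TensorProduct.mk ℂ V.carrier U.carrier v)
    have hQ : Q = ⊤ := by
      refine hU.eq_top Q ?_ fun d hd X hX u hu => ?_
      · refine (Submodule.mem_iInf _).2 fun v => ?_
        have : v ∈ P := by rw [hP]; trivial
        exact this
      · refine (Submodule.mem_iInf _).2 fun v => ?_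
        -- Starting from `parPow V d v` cancels the parity operator that accompanies `X`.
        have h1 := hr d hd X hX _ ((Submodule.mem_iInf _).1 hu (parPow V d v))
        have h2 : TensorProduct.map (parPow V d) (U.act X) (parPow V d v ⊗ₜ[ℂ] u) =
            v ⊗ₜ[ℂ] (U.act X u) := by
          rw [TensorProduct.map_tmul, parPow_parPow hV.1]
        change v ⊗ₜ[ℂ] (U.act X u) ∈ W
        rw [← h2]
        exact h1
    refine Submodule.eq_top_iff'.2 fun t => ?_
    refine tensor_induction hV.1 hU.1 (p := fun t => t ∈ W) t (fun i j v u _ _ => ?_)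
      (Submodule.zero_mem _) (fun x y hx hy => Submodule.add_mem _ hx hy)
    have : u ∈ Q := by rw [hQ]; trivial
    exact (Submodule.mem_iInf _).1 this v

theorem rid_lTensor_rTensor {E F : Type*} [AddCommGroup E] [Module ℂ E] [AddCommGroup F]
    [Module ℂ F] (f : Module.Dual ℂ F) (A : Module.End ℂ E) (t : E ⊗[ℂ] F) :
    TensorProduct.rid ℂ E (f.lTensor E (A.rTensor F t)) =
      A (TensorProduct.rid ℂ E (f.lTensor E t)) := by
  induction t using TensorProduct.induction_on with
  | zero => simp
  | tmul x y => simp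
  | add x y hx hy => simp only [map_add, hx, hy]

theorem lid_rTensor_lTensor {E F : Type*} [AddCommGroup E] [Module ℂ E] [AddCommGroup F]
    [Module ℂ F] (f : Module.Dual ℂ E) (A : Module.End ℂ F) (t : E ⊗[ℂ] F) :
    TensorProduct.lid ℂ F (f.rTensor F (A.lTensor E t)) =
      A (TensorProduct.lid ℂ F (f.rTensor F t)) := by
  induction t using TensorProduct.induction_on with
  | zero => simp
  | tmul x y => simp
  | add x y hx hy => simp only [map_add, hx, hy]

/-- A singular tensor is killed by the positive degrees of each factor separately. Contracting it
with functionals on the other factor gives singular vectors, which lie in degree zero; so the tensor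
lies in the product of the two degree zero pieces. -/
theorem isL_tensor {l1 l2 : Module.Dual ℂ ((SSq q).deg 0)}
    (hV : V.IsL l1) (hU : U.IsL l2)
    (hZ1 : LocallyTrivial Z1 V) (hZ2 : LocallyTrivial Z2 U) (hs : Splits q Z1 Z2) :
    (tensor V U).IsL (l1 + l2) := by
  have hw := isHighestWeight_tensor hV.1 hU.1 hZ1 hZ2 hs
  refine ⟨hw, hw.irreducible_of_singular fun t ht => ?_⟩
  have hg := SSq_isGraded q
  change V.carrier ⊗[ℂ] U.carrier at t
  have hl : (gradedProj hV.1.1.internal 0).rTensor U.carrier t = t := by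
    rw [← sub_eq_zero]
    refine tensor_eq_zero_of_functionals_right _ fun f => ?_
    rw [map_sub, map_sub, rid_lTensor_rTensor, sub_eq_zero]
    refine gradedProj_same _ (hV.mem_deg_zero hg fun d hd X hX => ?_)
    obtain ⟨X', hX', h⟩ := exists_act_left hZ1 hZ2 hs hd.ne' hX t
    rw [← rid_lTensor_rTensor, ← h, ht d hd X' hX']
    exact (congrArg _ (map_zero _)).trans (map_zero _)
  have hr : (gradedProj hU.1.1.internal 0).lTensor V.carrier t = t := by
    rw [← sub_eq_zero]
    refine tensor_eq_zero_of_functionals_left _ fun f => ?_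
    rw [map_sub, map_sub, lid_rTensor_lTensor, sub_eq_zero]
    refine gradedProj_same _ (hU.mem_deg_zero hg fun d hd X hX => ?_)
    obtain ⟨X', hX', h⟩ := exists_act_right hZ1 hZ2 hs hd.ne' hX t
    rw [ht d hd X' hX'] at h
    -- The parity operator on the first factor is an involution and can be stripped off.
    have h2 : (U.act X).lTensor V.carrier t = 0 := by
      have h3 : (U.act X).lTensor V.carrier t = (parPow V d).rTensor U.carrier
          (TensorProduct.map (parPow V d) (U.act X) t) := by
        have h5 : ∀ s : V.carrier ⊗[ℂ] U.carrier, (U.act X).lTensor V.carrier s =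
            (parPow V d).rTensor U.carrier (TensorProduct.map (parPow V d) (U.act X) s) := by
          intro s
          induction s using TensorProduct.induction_on with
          | zero => simp
          | tmul v u => simp [parPow_parPow hV.1.1]
          | add x y hx hy => simp only [map_add, hx, hy]
        exact h5 t
      rw [h3, ← h]
      exact map_zero _
    rw [← lid_rTensor_lTensor, h2, map_zero, map_zero]
  have key := map_gradedProj_mem hV.1.1 hU.1.1 t
  have h1 : TensorProduct.map (gradedProj hV.1.1.internal 0) (gradedProj hU.1.1.internal 0) t =
      t := by
    rw [← LinearMap.lTensor_comp_rTensor, LinearMap.comp_apply, hl, hr]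
  rwa [h1] at key

theorem LocallyTrivial.tensor (hg1 : ∀ N k, ∀ X ∈ Z1 N k, X ∈ (SSq q).deg k)
    (hV : LocallyTrivial Z1 V) (hU : LocallyTrivial Z2 U) :
    LocallyTrivial (fun N k => Z1 N k ∩ Z2 N k) (tensor V U) := by
  intro t k hk
  obtain ⟨N1, h1⟩ := hV.rTensor (U := U) t hk
  obtain ⟨N2, h2⟩ := hU.map (V := V) (parPow V k) t hk
  refine ⟨max N1 N2, fun N hN X hX => ?_⟩
  refine (tensor_act (hg1 _ _ _ hX.1) t).trans ?_
  rw [h1 N ((le_max_left _ _).trans hN) X hX.1, h2 N ((le_max_right _ _).trans hN) X hX.2,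
    add_zero]
  rfl

end SSq


namespace SSq

/-! ### One-dimensional modules -/

variable {q ℓ : ℂ}

/-- The supertrace of the `z^0 T_q^0`-part. -/
def strZero : (Idx →₀ ℂ) →ₗ[ℂ] ℂ :=
  Finsupp.lapply ((0, 0, 0, 0) : Idx) - Finsupp.lapply ((0, 0, 1, 1) : Idx)

variable (q) in
/-- The weight of `charModule`. -/
def charWeight (κ : ℂ) : Module.Dual ℂ ((SSq q).deg 0) where
  toFun X := κ * strZero (X.1 : (Idx →₀ ℂ) × ℂ).1
  map_add' _ _ := (congrArg (κ * ·) (map_add strZero _ _)).trans (mul_add _ _ _)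
  map_smul' c _ := (congrArg (κ * ·) (map_smul strZero c _)).trans (mul_left_comm _ _ _)

theorem charModule_act (κ : ℂ) (X : (Idx →₀ ℂ) × ℂ) (c : ℂ) :
    (charModule q κ).act X c = (κ * strZero X.1) * c := rfl

theorem strZero_eq_zero {k : ℤ} (hk : k ≠ 0) {X : (Idx →₀ ℂ) × ℂ} (hX : X ∈ (SSq q).deg k) :
    strZero X.1 = 0 := by
  have h := ((mem_SSq_deg q).1 hX).1
  change X.1 _ - X.1 _ = 0
  rw [h _ (by simp [Idx.deg, hk.symm]), h _ (by simp [Idx.deg, hk.symm]), sub_zero]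

/-- The supertrace vanishes on super commutators. Contributions occur only for opposite powers of
`z` and `T_q`, and there the two products carry the same power of `q`. This is what makes
`charModule` a module. -/
theorem strZero_basisBracket (x y : Idx) : strZero (basisBracket q x y).1 = 0 := by
  obtain ⟨n, k, i, j⟩ := x
  obtain ⟨n', k', r, s⟩ := y
  change (mulBasis q _ _ - Idx.sign _ _ • mulBasis q _ _ : Idx →₀ ℂ) _ -
    (mulBasis q _ _ - Idx.sign _ _ • mulBasis q _ _ : Idx →₀ ℂ) _ = 0
  have hmul : ∀ (n k n' k' : ℤ) (i j r s t : Fin 2),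
      mulBasis q (n, k, i, j) (n', k', r, s) (0, 0, t, t) =
      if j = r ∧ n + n' = 0 ∧ k + k' = 0 ∧ i = t ∧ s = t then q ^ (k * n') else 0 := by
    intro n k n' k' i j r s t
    rw [mulBasis]
    dsimp only
    by_cases hjr : j = r
    · rw [if_pos hjr, Finsupp.single_apply]
      simp [hjr]
    · simp [hjr]
  simp only [Finsupp.sub_apply, Finsupp.smul_apply, hmul, Idx.sign]
  by_cases h : n + n' = 0 ∧ k + k' = 0
  · obtain ⟨h1, h2⟩ := h
    obtain rfl : n' = -n := by omega
    obtain rfl : k' = -k := by omega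
    have e : q ^ (-k * n) = q ^ (k * -n) := by congr 1; ring
    fin_cases i <;> fin_cases j <;> fin_cases r <;> fin_cases s <;> simp
  · have h' : ∀ a b c : Prop, ¬ (a ∧ n + n' = 0 ∧ k + k' = 0 ∧ b ∧ c) := by tauto
    have h'' : ∀ a b c : Prop, ¬ (a ∧ n' + n = 0 ∧ k' + k = 0 ∧ b ∧ c) := by
      intro a b c
      rw [add_comm n', add_comm k']
      exact h' a b c
    simp [h', h'']

theorem strZero_bracket (X Y : (Idx →₀ ℂ) × ℂ) :
    strZero ((SSq q).bracket X Y : (Idx →₀ ℂ) × ℂ).1 = 0 := by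
  have h1 := congrArg (fun Z : (Idx →₀ ℂ) × ℂ => strZero Z.1) (SSq_bracket q X Y)
  refine h1.trans ?_
  rw [ssBracket_apply]
  simp only [Finsupp.sum, Prod.fst_sum, map_sum, Prod.smul_fst, map_smul, strZero_basisBracket,
    smul_zero, Finset.sum_const_zero]

theorem mem_charModule_deg (κ : ℂ) {d : ℤ} {c : ℂ} :
    c ∈ (charModule q κ).deg d ↔ d = 0 ∨ c = 0 := by
  change c ∈ (if d = 0 then ⊤ else ⊥ : Submodule ℂ ℂ) ↔ _
  split_ifs with h <;> simp [h]

theorem charModule_isInternal (κ : ℂ) : DirectSum.IsInternal (charModule q κ).deg := by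
  suffices h : DirectSum.IsInternal (fun d : ℤ => (if d = 0 then ⊤ else ⊥ : Submodule ℂ ℂ)) from h
  rw [DirectSum.isInternal_submodule_iff_iSupIndep_and_iSup_eq_top]
  refine ⟨?_, ?_⟩
  · rw [iSupIndep_def]
    intro i
    by_cases hi : i = 0
    · have : (⨆ (j : ℤ) (_ : j ≠ i), (if j = 0 then ⊤ else ⊥ : Submodule ℂ ℂ)) = ⊥ := by
        refine iSup_eq_bot.2 fun j => iSup_eq_bot.2 fun hj => ?_
        rw [if_neg (hi ▸ hj)]
      rw [this]
      exact disjoint_bot_right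
    · rw [if_neg hi]
      exact disjoint_bot_left
  · rw [eq_top_iff]
    refine le_trans ?_ (le_iSup _ (0 : ℤ))
    rw [if_pos rfl]

theorem charModule_isGradedModule (κ : ℂ) : (charModule q κ).IsGradedModule where
  internal := charModule_isInternal κ
  par_apply d v hv := by
    rcases (mem_charModule_deg κ).1 hv with rfl | h
    · rw [zpow_zero, one_smul]; rfl
    · rw [h]; exact (mul_zero ((-1 : ℂ) ^ d)).symm
  act_mem i j x v hx hv := by
    change ℂ at v
    refine (mem_charModule_deg κ).2 ?_
    rcases (mem_charModule_deg κ).1 hv with rfl | h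
    · by_cases hi : i = 0
      · exact Or.inl (by omega)
      · right
        exact (charModule_act κ x v).trans (by rw [strZero_eq_zero hi hx, mul_zero, zero_mul])
    · right
      rw [h]
      exact map_zero _
  act_bracket i j x y hx hy := by
    refine LinearMap.ext fun (c : ℂ) => ?_
    have h0 := strZero_bracket (q := q) x y
    change (κ * strZero ((SSq q).bracket x y : (Idx →₀ ℂ) × ℂ).1) * c =
      (κ * strZero (x : (Idx →₀ ℂ) × ℂ).1) * ((κ * strZero (y : (Idx →₀ ℂ) × ℂ).1) * c) -
      (-1) ^ (i * j) *
        ((κ * strZero (y : (Idx →₀ ℂ) × ℂ).1) * ((κ * strZero (x : (Idx →₀ ℂ) × ℂ).1) * c))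
    rw [h0]
    by_cases hi : i = 0
    · subst hi
      rw [zero_mul, zpow_zero]
      ring
    · rw [strZero_eq_zero hi hx]
      ring

theorem charModule_isL (κ : ℂ) : (charModule q κ).IsL (charWeight q κ) := by
  refine ⟨⟨charModule_isGradedModule κ, (1 : ℂ), (one_ne_zero : (1 : ℂ) ≠ 0), ?_, ?_, ?_, ?_⟩, ?_⟩
  · have h1 : (if (0 : ℤ) = 0 then ⊤ else ⊥ : Submodule ℂ ℂ) = ⊤ := if_pos rfl
    exact h1.trans (Ideal.span_singleton_one (α := ℂ)).symm
  · rintro ⟨X, hX⟩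
    rfl
  · intro d hd X hX
    exact (charModule_act κ X 1).trans (by rw [strZero_eq_zero hd.ne' hX, mul_zero, zero_mul]; rfl)
  · intro (W : Submodule ℂ ℂ) hW _
    exact (Ideal.eq_top_iff_one W).2 hW
  · intro (W : Submodule ℂ ℂ) _
    exact eq_bot_or_eq_top W

theorem charModule_locallyTrivial (κ : ℂ) :
    LocallyTrivial (fun _ k => {X | X ∈ (SSq q).deg k}) (charModule q κ) := by
  intro (c : ℂ) k hk
  refine ⟨0, fun N _ X hX => ?_⟩
  have h : (κ * strZero X.1) * c = 0 := by
    rw [strZero_eq_zero (q := q) hk hX, mul_zero, zero_mul]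
  exact h

/-! ### Pull-backs -/

/-- The pull-back of a weight along `phiHat`. -/
def pullWeight (q ℓ a : ℂ) (m : ℕ) (mu : Module.Dual ℂ ((glHat m).deg 0)) :
    Module.Dual ℂ ((SSq q).deg 0) :=
  mu ∘ₗ (phiHat q ℓ a m).restrict (p := (SSq q).deg 0) (q := (glHat m).deg 0)
    fun _ hX => phiLin_deg (ℓ := ℓ) a m hX

section Pullback

variable {a : ℂ} {m : ℕ} {M : GradedAction (glHat m)} {mu : Module.Dual ℂ ((glHat m).deg 0)}

/-- The image of `SSq` is dense: `x` is approximated on as many rows as the vector `w` can see, and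
the remainder acts by zero. Nonzero degrees suffice, both for generation and for detecting singular
vectors. -/
theorem exists_act_phi (hℓ0 : ℓ ≠ 0) (hq : ∀ n : ℤ, n ≠ 0 → Complex.exp (ℓ * n) ≠ 1)
    (hM : M.IsL mu) (hmu : FinSupp mu) {d : ℤ} (hd : d ≠ 0) {x : band m × Trunc m}
    (hx : x ∈ (glHat m).deg d) (w : M.carrier) :
    ∃ X : (Idx →₀ ℂ) × ℂ, X ∈ (SSq q).deg d ∧ M.act (phiLin ℓ a m X) w = M.act x w := by
  obtain ⟨N, hN⟩ := glHat_locally_trivial hM hmu w d hd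
  obtain ⟨X, hX, hX'⟩ := exists_approx (q := q) (ι := Unit) (a := fun _ => a) (m := fun _ => m)
    hℓ0 hq (by simp) N d (fun _ => x.1) (fun _ => (mem_glHat_deg.1 hx).1)
  refine ⟨X, hX, ?_⟩
  have h1 := hN N le_rfl (phiLin ℓ a m X - x)
    ⟨Submodule.sub_mem _ (phiLin_deg (ℓ := ℓ) a m hX) hx, hX' ()⟩
  have h2 : M.act (phiLin ℓ a m X - x) = M.act (phiLin ℓ a m X) - M.act x := map_sub M.act _ _
  rw [h2, LinearMap.sub_apply, sub_eq_zero] at h1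
  exact h1

theorem pullback_isGradedModule (hℓ : Complex.exp ℓ = q)
    (hq : ∀ n : ℤ, n ≠ 0 → Complex.exp (ℓ * n) ≠ 1) (hM : M.IsGradedModule) :
    (M.pullback (phiHat q ℓ a m)).IsGradedModule where
  internal := hM.internal
  par_apply := hM.par_apply
  act_mem i j x v hx hv := hM.act_mem i j _ v (phiLin_deg (ℓ := ℓ) a m hx) hv
  act_bracket i j x y hx hy := by
    have h1 := hM.act_bracket i j _ _ (phiLin_deg (ℓ := ℓ) a m hx) (phiLin_deg (ℓ := ℓ) a m hy)
    exact (congrArg M.act (phiHat_bracket hℓ hq x y)).trans h1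

/-- By `exists_act_phi` the two algebras have the same singular vectors and generate the same
subspaces from the highest weight vector. -/
theorem pullback_isL (hℓ0 : ℓ ≠ 0) (hℓ : Complex.exp ℓ = q)
    (hq : ∀ n : ℤ, n ≠ 0 → Complex.exp (ℓ * n) ≠ 1) (hM : M.IsL mu) (hmu : FinSupp mu) :
    (M.pullback (phiHat q ℓ a m)).IsL (pullWeight q ℓ a m mu) := by
  have hw : (M.pullback (phiHat q ℓ a m)).IsHighestWeight (pullWeight q ℓ a m mu) := by
    refine ⟨pullback_isGradedModule hℓ hq hM.1.1, hM.1.vec, hM.1.vec_ne_zero, hM.1.deg_zero,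
      fun X => hM.1.act_deg_zero (phiLin_deg (ℓ := ℓ) a m X.2),
      fun d hd X hX => hM.1.act_pos hd (phiLin_deg (ℓ := ℓ) a m hX), fun W hW hst => ?_⟩
    refine hM.1.eq_top W hW fun d hd x hx w hw => ?_
    obtain ⟨X, hX, h⟩ := exists_act_phi (q := q) (a := a) hℓ0 hq hM hmu hd.ne hx w
    exact h ▸ hst d hd X hX w hw
  refine ⟨hw, hw.irreducible_of_singular fun u hu => ?_⟩
  refine hM.mem_deg_zero (glHat_isGraded m) fun d hd x hx => ?_
  obtain ⟨X, hX, h⟩ := exists_act_phi (q := q) (a := a) hℓ0 hq hM hmu hd.ne' hx u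
  exact h.symm.trans (hu d hd X hX)

theorem pullback_locallyTrivial (hM : M.IsL mu) (hmu : FinSupp mu) :
    LocallyTrivial (ssVanish q ℓ (fun _ : Unit => a) (fun _ : Unit => m))
      (M.pullback (phiHat q ℓ a m)) := by
  intro u k hk
  obtain ⟨N, hN⟩ := glHat_locally_trivial hM hmu u k hk
  exact ⟨N, fun N' h X hX => hN N' h _ ⟨phiLin_deg (ℓ := ℓ) a m hX.1, hX.2 ()⟩⟩

end Pullback

/-! ### The tensor products of pull-backs -/

theorem tensorList_isL (hℓ0 : ℓ ≠ 0) (hℓ : Complex.exp ℓ = q)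
    (hq : ∀ n : ℤ, n ≠ 0 → Complex.exp (ℓ * n) ≠ 1) {N : ℕ} (a : Fin N → ℂ) (m : Fin N → ℕ)
    (mu : ∀ i, Module.Dual ℂ ((glHat (m i)).deg 0)) (M : ∀ i, GradedAction (glHat (m i)))
    (ha : ∀ i j, i ≠ j → ¬ Cong ℓ (a i) (a j)) (hM : ∀ i, (M i).IsL (mu i))
    (hmu : ∀ i, FinSupp (mu i)) :
    (tensorList (List.ofFn fun i => (M i).pullback (phiHat q ℓ (a i) (m i)))).IsL
      (∑ i, pullWeight q ℓ (a i) (m i) (mu i)) ∧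
    LocallyTrivial (ssVanish q ℓ a m)
      (tensorList (List.ofFn fun i => (M i).pullback (phiHat q ℓ (a i) (m i)))) := by
  induction N with
  | zero =>
    rw [List.ofFn_zero, Finset.univ_eq_empty, Finset.sum_empty]
    have h0 : charWeight q 0 = 0 := LinearMap.ext fun X => zero_mul _
    refine ⟨h0 ▸ charModule_isL 0, fun u k hk => ?_⟩
    obtain ⟨N, hN⟩ := charModule_locallyTrivial (q := q) 0 u k hk
    exact ⟨N, fun N' h X hX => hN N' h X hX.1⟩
  | succ n ih =>
    rw [List.ofFn_succ, Fin.sum_univ_succ]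
    obtain ⟨h1, h2⟩ := ih (fun i => a i.succ) (fun i => m i.succ) (fun i => mu i.succ)
      (fun i => M i.succ) (fun i j hij => ha _ _ (fun h => hij (Fin.succ_injective _ h)))
      (fun i => hM i.succ) (fun i => hmu i.succ)
    have h3 := pullback_isL (a := a 0) hℓ0 hℓ hq (hM 0) (hmu 0)
    have h4 := pullback_locallyTrivial (q := q) (ℓ := ℓ) (a := a 0) (hM 0) (hmu 0)
    -- Incongruence of the `a i` allows approximating `0` at the first point and the images of `X`
    -- at all others simultaneously.
    have hs : Splits q (ssVanish q ℓ (fun _ : Unit => a 0) (fun _ : Unit => m 0))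
        (ssVanish q ℓ (fun i : Fin n => a i.succ) (fun i => m i.succ)) := by
      intro N k hk X hX
      obtain ⟨X', hX', h⟩ := exists_approx (q := q) (m := m) hℓ0 hq ha N k
        (Fin.cons 0 fun i : Fin n => (phiLin ℓ (a i.succ) (m i.succ) X).1)
        (by
          refine Fin.cases ?_ fun i => ?_
          · exact Submodule.zero_mem _
          · exact (mem_glHat_deg.1 (phiLin_deg (ℓ := ℓ) (a i.succ) (m i.succ) hX)).1)
      refine ⟨X', hX', ⟨hX', fun _ p r hp => ?_⟩, Submodule.sub_mem _ hX hX', fun i p r hp => ?_⟩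
      · have := h 0 p r hp
        simpa using this
      · have h5 := h i.succ p r hp
        have h6 := congrArg (fun W : band _ × Trunc _ => W.1.1 p r)
          (map_sub (phiLin ℓ (a i.succ) (m i.succ)) X X')
        refine h6.trans ?_
        rw [Fin.cons_succ] at h5
        rw [Pi.sub_apply, Pi.sub_apply, sub_eq_zero] at h5
        exact sub_eq_zero.2 h5.symm
    refine ⟨isL_tensor h3 h1 h4 h2 hs, fun u k hk => ?_⟩
    obtain ⟨N, hN⟩ := LocallyTrivial.tensor (fun N k X hX => hX.1) h4 h2 u k hk
    exact ⟨N, fun N' h X hX => hN N' h X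
      ⟨⟨hX.1, fun _ => hX.2 0⟩, hX.1, fun i => hX.2 i.succ⟩⟩

theorem realization_isL (hℓ0 : ℓ ≠ 0) (hℓ : Complex.exp ℓ = q)
    (hq : ∀ n : ℤ, n ≠ 0 → Complex.exp (ℓ * n) ≠ 1) (κ : ℂ) {N : ℕ} (a : Fin N → ℂ)
    (m : Fin N → ℕ)
    (mu : ∀ i, Module.Dual ℂ ((glHat (m i)).deg 0)) (M : ∀ i, GradedAction (glHat (m i)))
    (ha : ∀ i j, i ≠ j → ¬ Cong ℓ (a i) (a j)) (hM : ∀ i, (M i).IsL (mu i))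
    (hmu : ∀ i, FinSupp (mu i)) :
    (realization q ℓ κ a m M).IsL
      (charWeight q κ + ∑ i, pullWeight q ℓ (a i) (m i) (mu i)) := by
  obtain ⟨h1, h2⟩ := tensorList_isL hℓ0 hℓ hq a m mu M ha hM hmu
  refine isL_tensor (charModule_isL κ) h1 (charModule_locallyTrivial κ) h2
    -- Every element of nonzero degree is invisible to the one-dimensional module, so `X` itself
    -- splits with remainder zero.
    fun N k hk X hX => ⟨X, hX, hX, ?_⟩
  rw [sub_self]
  refine ⟨Submodule.zero_mem _, fun i p r _ => ?_⟩
  exact congrArg (fun W : band _ × Trunc _ => W.1.1 p r) (map_zero (phiLin ℓ (a i) (m i)))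

end SSq


/-! ### Sums over half-lines -/

section TailSum

/-- The sum of `f k` over `k ≥ i`. -/
def tailSum (f : ℤ → ℂ) (i : ℤ) : ℂ := ∑ᶠ (k : ℤ) (_ : i ≤ k), f k

theorem tailSum_eq_add {f : ℤ → ℂ} (hf : f.support.Finite) (i : ℤ) :
    tailSum f i = f i + tailSum f (i + 1) := by
  have h1 : tailSum f i = ∑ᶠ k ∈ Set.Ici i, f k := rfl
  have h2 : tailSum f (i + 1) = ∑ᶠ k ∈ Set.Ici (i + 1), f k := rfl
  have h3 : Set.Ici i = insert i (Set.Ici (i + 1)) := by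
    ext k
    simp only [Set.mem_Ici, Set.mem_insert_iff]
    omega
  rw [h1, h2, h3, finsum_mem_insert' _ (by simp) (hf.subset Set.inter_subset_right)]

theorem tailSum_eq_zero {f : ℤ → ℂ} {i : ℤ} (h : ∀ k, i ≤ k → f k = 0) : tailSum f i = 0 :=
  finsum_mem_eq_zero_of_forall_eq_zero (s := Set.Ici i) fun k hk => h k hk

theorem tailSum_eq_of_sub {f g : ℤ → ℂ} (hf : f.support.Finite)
    (h : ∀ k, g k - g (k + 1) = f k) {K : ℤ} (hg : ∀ k, K < k → g k = 0) (i : ℤ) :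
    tailSum f i = g i := by
  have key : ∀ n : ℕ, tailSum f i - g i = tailSum f (i + n) - g (i + n) := by
    intro n
    induction n with
    | zero => simp
    | succ n ih =>
      rw [ih, tailSum_eq_add hf, ← h, Nat.cast_succ, ← add_assoc]
      ring
  rw [← sub_eq_zero, key (K + 1 - i).toNat, hg _ (by omega), sub_zero]
  refine tailSum_eq_zero fun k hk => ?_
  rw [← h, hg _ (by omega), hg _ (by omega), sub_zero]

theorem tailSum_eq_finsum {f : ℤ → ℂ} {i : ℤ} (h : ∀ k, k < i → f k = 0) :
    tailSum f i = ∑ᶠ k, f k := by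
  refine finsum_congr fun k => ?_
  by_cases hk : i ≤ k
  · simp [hk]
  · simp [hk, h k (not_le.1 hk)]

theorem finsum_shift (f : ℤ → ℂ) : ∑ᶠ k : ℤ, f (k + 1) = ∑ᶠ k, f k :=
  finsum_comp_equiv (Equiv.addRight (1 : ℤ))

theorem support_finite_of_abs {f : ℤ → ℂ} {K : ℤ} (h : ∀ k, K < |k| → f k = 0) :
    f.support.Finite := by
  refine (Set.finite_Icc (-K) K).subset fun k hk => ?_
  rw [Set.mem_Icc, ← abs_le]
  by_contra h'
  exact hk (h k (not_le.1 h'))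

theorem finsum_eq_sum_Icc {f : ℤ → ℂ} {K : ℤ} (h : ∀ k, K < |k| → f k = 0) :
    ∑ᶠ k, f k = ∑ k ∈ Finset.Icc (-K) K, f k := by
  refine finsum_eq_sum_of_support_subset _ fun k hk => ?_
  rw [Finset.coe_Icc, Set.mem_Icc, ← abs_le]
  by_contra h'
  exact hk (h k (not_le.1 h'))

theorem sum_Icc_shift {f : ℤ → ℂ} {K : ℤ} (h : ∀ k, K ≤ |k| → f k = 0) :
    ∑ k ∈ Finset.Icc (-K) K, f (k + 1) = ∑ k ∈ Finset.Icc (-K) K, f k := by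
  rw [← finsum_eq_sum_Icc (fun k hk => h k hk.le), ← finsum_eq_sum_Icc (f := fun k => f (k + 1)),
    finsum_shift]
  intro k hk
  refine h _ ?_
  rw [lt_abs] at hk
  rw [le_abs]
  omega

end TailSum

/-! ### Quasipolynomials with prescribed jets -/

section PrescribedJets

variable {ι : Type} [Fintype ι] (ℓ : ℂ) (a : ι → ℂ) (m : ι → ℕ) (K : ℤ) (d : ι → ℤ → ℕ → ℂ)

/-- The quasipolynomial with jets `d i j l` at `a i - j`, `|j| ≤ K`, `l ≤ m i`. -/
def qpOf : ℂ →₀ ℂ[X] :=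
  ∑ i, ∑ j ∈ Finset.Icc (-K) K, Finsupp.single (a i - j)
    (∑ l ∈ Finset.range (m i + 1), Polynomial.monomial l (d i j l / l.factorial))

theorem qpEval_qpOf (n : ℤ) : qpEval ℓ (qpOf a m K d) n =
    ∑ i, ∑ l ∈ Finset.range (m i + 1), ((n : ℂ) * ℓ) ^ l / l.factorial *
      ∑ j ∈ Finset.Icc (-K) K, d i j l * Complex.exp (ℓ * (a i - j) * n) := by
  rw [qpOf, qpEval_finsetSum]
  refine Finset.sum_congr rfl fun i _ => ?_
  rw [qpEval_finsetSum]
  simp only [qpEval_single, Polynomial.eval_finsetSum, Polynomial.eval_monomial, Finset.sum_mul,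
    Finset.mul_sum]
  rw [Finset.sum_comm]
  refine Finset.sum_congr rfl fun l _ => Finset.sum_congr rfl fun j _ => ?_
  ring

theorem jet_qpOf_eq_zero {b : ℂ} (hb : ∀ i, ¬ Cong ℓ b (a i)) (l : ℕ) :
    jet ℓ (qpOf a m K d) b l = 0 := by
  rw [qpOf, jet_finsetSum]
  refine Finset.sum_eq_zero fun i _ => ?_
  rw [jet_finsetSum]
  refine Finset.sum_eq_zero fun j _ => ?_
  rw [jet_single, if_neg]
  rintro ⟨r, hr⟩
  refine hb i ⟨-j, -r, ?_⟩
  push_cast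
  linear_combination -hr

variable {ℓ a}

theorem not_inPeriods (hℓ0 : ℓ ≠ 0) (hq : ∀ n : ℤ, n ≠ 0 → Complex.exp (ℓ * n) ≠ 1) {n : ℤ}
    (hn : n ≠ 0) : ¬ InPeriods ℓ (n : ℂ) := fun h => hq n hn ((inPeriods_iff hℓ0 _).1 h)

/-- The points `a i - j` are pairwise distinct modulo the periods, so a single summand contributes
to each jet. -/
theorem jet_qpOf (hℓ0 : ℓ ≠ 0) (hq : ∀ n : ℤ, n ≠ 0 → Complex.exp (ℓ * n) ≠ 1)
    (ha : ∀ i j, i ≠ j → ¬ Cong ℓ (a i) (a j)) (hd : ∀ i j l, K < |j| → d i j l = 0)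
    (i : ι) (j : ℤ) (l : ℕ) :
    jet ℓ (qpOf a m K d) (a i - j) l = if l ≤ m i then d i j l else 0 := by
  classical
  rw [qpOf, jet_finsetSum, Finset.sum_eq_single i]
  · rw [jet_finsetSum, Finset.sum_eq_single j]
    · rw [jet_single, if_pos ⟨0, by simp⟩, Polynomial.finsetSum_coeff]
      simp only [Polynomial.coeff_monomial, Finset.sum_ite_eq', Finset.mem_range, Nat.lt_succ_iff]
      split_ifs
      · rw [mul_div_cancel₀]
        exact_mod_cast l.factorial_ne_zero
      · exact mul_zero _
    · intro j' _ hj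
      rw [jet_single, if_neg]
      have h1 : a i - j' - (a i - j) = ((j - j' : ℤ) : ℂ) := by push_cast; ring
      rw [h1]
      exact not_inPeriods hℓ0 hq (by omega)
    · intro hj
      have : K < |j| := by
        rw [Finset.mem_Icc, ← abs_le] at hj
        exact not_le.1 hj
      simp [hd i j _ this, jet]
  · intro i' _ hi
    rw [jet_finsetSum]
    refine Finset.sum_eq_zero fun j' _ => ?_
    rw [jet_single, if_neg]
    rintro ⟨r, hr⟩
    refine ha i' i hi ⟨j' - j, r, ?_⟩
    push_cast
    linear_combination hr
  · exact fun h => absurd (Finset.mem_univ _) h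

/-- The jets of a quasipolynomial along `a + ℤ` vanish far away from `a`. -/
theorem exists_jet_eq_zero (hℓ0 : ℓ ≠ 0) (hq : ∀ n : ℤ, n ≠ 0 → Complex.exp (ℓ * n) ≠ 1)
    (P : ℂ →₀ ℂ[X]) (a : ℂ) : ∃ K : ℕ, ∀ k : ℤ, (K : ℤ) < |k| → ∀ l, jet ℓ P (a - k) l = 0 := by
  classical
  induction P using Finsupp.induction_linear with
  | zero => exact ⟨0, fun k _ l => by simp [jet]⟩
  | add P Q hP hQ =>
    obtain ⟨K, hK⟩ := hP
    obtain ⟨K', hK'⟩ := hQ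
    refine ⟨max K K', fun k hk l => ?_⟩
    rw [Nat.cast_max, max_lt_iff] at hk
    rw [jet_add, hK k hk.1, hK' k hk.2, add_zero]
  | single b p =>
    by_cases h : ∃ k0 : ℤ, InPeriods ℓ (b - (a - k0))
    · obtain ⟨k0, hk0⟩ := h
      refine ⟨k0.natAbs, fun k hk l => ?_⟩
      rw [jet_single, if_neg]
      intro h1
      refine not_inPeriods hℓ0 hq (n := k - k0) (by rintro h; obtain rfl : k = k0 := by omega
                                                    simp at hk) ?_
      obtain ⟨r, hr⟩ := hk0
      obtain ⟨r', hr'⟩ := h1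
      refine ⟨r' - r, ?_⟩
      push_cast
      linear_combination hr' - hr
    · refine ⟨0, fun k _ l => ?_⟩
      rw [jet_single, if_neg fun h' => h ⟨k, h'⟩]

end PrescribedJets

/-! ### Labels and central charges -/

section Labels

variable {m : ℕ}

/-- The matrix with the only entry `x` at `(p, p)`. -/
def diagUnit (m : ℕ) (p : ℤ) : Trunc m →ₗ[ℂ] band m where
  toFun x := ⟨fun p' r => if p' = p ∧ r = p then x else 0, 0, fun p' r h => if_neg (by
    rintro ⟨rfl, rfl⟩
    simp at h)⟩
  map_add' x y := by
    ext p' r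
    simp only [Submodule.coe_add, Pi.add_apply]
    split_ifs <;> simp
  map_smul' c x := by
    ext p' r
    simp only [Submodule.coe_smul, Pi.smul_apply, RingHom.id_apply]
    split_ifs <;> simp

theorem diagUnit_apply (p : ℤ) (x : Trunc m) (p' r : ℤ) :
    (diagUnit m p x).1 p' r = if p' = p ∧ r = p then x else 0 := rfl

theorem diagUnit_mem (p : ℤ) (x : Trunc m) :
    ((diagUnit m p x, 0) : band m × Trunc m) ∈ (glHat m).deg 0 := by
  refine mem_glHat_deg.2 ⟨fun p' r h => if_neg ?_, fun h => absurd rfl h⟩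
  rintro ⟨rfl, rfl⟩
  simp at h

theorem central_mem (c : Trunc m) : ((0, c) : band m × Trunc m) ∈ (glHat m).deg 0 :=
  mem_glHat_deg.2 ⟨fun _ _ _ => rfl, fun h => absurd rfl h⟩

/-- The label at the entry `t^l E_{pp}`. -/
def glLabel (mu : Module.Dual ℂ ((glHat m).deg 0)) (p : ℤ) (l : ℕ) : ℂ :=
  mu ⟨(diagUnit m p (Trunc.t m ^ l), 0), diagUnit_mem p _⟩

/-- The central charge at `t^l`. -/
def glCharge (mu : Module.Dual ℂ ((glHat m).deg 0)) (l : ℕ) : ℂ :=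
  mu ⟨(0, Trunc.t m ^ l), central_mem _⟩

theorem exists_extend_gl (mu : Module.Dual ℂ ((glHat m).deg 0)) :
    ∃ mu' : band m × Trunc m →ₗ[ℂ] ℂ, ∀ x (hx : x ∈ (glHat m).deg 0), mu' x = mu ⟨x, hx⟩ := by
  obtain ⟨mu', hmu'⟩ := LinearMap.exists_extend (p := (glHat m).deg 0) mu
  exact ⟨mu', fun x hx => by rw [← hmu']; rfl⟩

/-- Cutting the diagonal off at `K` changes it only in rows that the functional ignores. The formula
holds for every `K ≥ P`, so that finitely many functionals can share one `K`. -/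
theorem FinSupp.exists_apply {mu : Module.Dual ℂ ((glHat m).deg 0)} (hmu : FinSupp mu) :
    ∃ P : ℕ, (∀ (j : ℤ) (l : ℕ), (P : ℤ) < |j| →
      glLabel mu (2 * j) l = 0 ∧ glLabel mu (2 * j + 1) l = 0) ∧
    ∀ K : ℤ, P ≤ K → ∀ (A : band m) (c : Trunc m) (h : ((A, c) : band m × Trunc m) ∈ (glHat m).deg 0),
      mu ⟨(A, c), h⟩ = ∑ l ∈ Finset.range (m + 1),
        ((∑ j ∈ Finset.Icc (-K) K, (glLabel mu (2 * j) l * Trunc.coeff m l (A.1 (2 * j) (2 * j)) +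
          glLabel mu (2 * j + 1) l * Trunc.coeff m l (A.1 (2 * j + 1) (2 * j + 1)))) +
          glCharge mu l * Trunc.coeff m l c) := by
  obtain ⟨P, hP⟩ := hmu
  obtain ⟨mu', hmu'⟩ := exists_extend_gl mu
  have hunit : ∀ (p : ℤ), (P : ℤ) < |p| → ∀ x, mu ⟨(diagUnit m p x, 0), diagUnit_mem p x⟩ = 0 := by
    intro p hp x
    refine hP _ _ fun p' r hp' => if_neg ?_
    rintro ⟨rfl, rfl⟩
    omega
  refine ⟨P, fun j l hj => ⟨hunit _ ?_ _, hunit _ ?_ _⟩, fun K hK A c h => ?_⟩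
  · rw [lt_abs] at hj ⊢; omega
  · rw [lt_abs] at hj ⊢; omega
  have hu : ∀ p x, mu' (diagUnit m p x, 0) =
      ∑ l ∈ Finset.range (m + 1), glLabel mu p l * Trunc.coeff m l x := by
    intro p x
    have h1 : mu' ∘ₗ LinearMap.inl ℂ (band m) (Trunc m) ∘ₗ diagUnit m p =
        ∑ l ∈ Finset.range (m + 1), glLabel mu p l • Trunc.coeff m l := by
      ext x
      rw [LinearMap.sum_apply]
      conv_lhs => rw [Trunc.eq_sum m x]
      rw [map_sum]
      refine Finset.sum_congr rfl fun l _ => ?_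
      rw [map_smul, LinearMap.smul_apply, smul_eq_mul, smul_eq_mul, mul_comm]
      exact congrArg (· * _) (hmu' _ _)
    have h2 := LinearMap.congr_fun h1 x
    rw [LinearMap.sum_apply] at h2
    exact h2
  have hc : mu' (0, c) = ∑ l ∈ Finset.range (m + 1), glCharge mu l * Trunc.coeff m l c := by
    have h1 : mu' ∘ₗ LinearMap.inr ℂ (band m) (Trunc m) =
        ∑ l ∈ Finset.range (m + 1), glCharge mu l • Trunc.coeff m l := by
      ext x
      rw [LinearMap.sum_apply]
      conv_lhs => rw [Trunc.eq_sum m x]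
      rw [map_sum]
      refine Finset.sum_congr rfl fun l _ => ?_
      rw [map_smul, LinearMap.smul_apply, smul_eq_mul, smul_eq_mul, mul_comm]
      exact congrArg (· * _) (hmu' _ _)
    have h2 := LinearMap.congr_fun h1 c
    rw [LinearMap.sum_apply] at h2
    exact h2
  set S : band m := ∑ j ∈ Finset.Icc (-K) K,
    (diagUnit m (2 * j) (A.1 (2 * j) (2 * j)) +
      diagUnit m (2 * j + 1) (A.1 (2 * j + 1) (2 * j + 1))) with hS
  have hSm : ((S, 0) : band m × Trunc m) ∈ (glHat m).deg 0 := by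
    have h1 : ((S, 0) : band m × Trunc m) = ∑ j ∈ Finset.Icc (-K) K,
        ((diagUnit m (2 * j) (A.1 (2 * j) (2 * j)), 0) +
          (diagUnit m (2 * j + 1) (A.1 (2 * j + 1) (2 * j + 1)), 0)) := by
      refine Prod.ext ?_ ?_
      · rw [Prod.fst_sum]; rfl
      · rw [Prod.snd_sum]; simp
    rw [h1]
    exact Submodule.sum_mem _ fun j _ => Submodule.add_mem _ (diagUnit_mem _ _) (diagUnit_mem _ _)
  have hA := (mem_glHat_deg.1 h).1
  have hA0 : ((A, 0) : band m × Trunc m) ∈ (glHat m).deg 0 :=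
    mem_glHat_deg.2 ⟨hA, fun h => absurd rfl h⟩
  have hrem : mu' (A - S, 0) = 0 := by
    have hm : ((A - S, 0) : band m × Trunc m) ∈ (glHat m).deg 0 :=
      mem_glHat_deg.2 ⟨Submodule.sub_mem (diagonal m 0) hA (mem_glHat_deg.1 hSm).1,
        fun h => absurd rfl h⟩
    rw [hmu' _ hm]
    refine hP _ _ fun p r hp => ?_
    rw [Submodule.coe_sub, Pi.sub_apply, Pi.sub_apply, sub_eq_zero, hS,
      AddSubmonoidClass.coe_finsetSum, Finset.sum_apply, Finset.sum_apply]
    simp only [Submodule.coe_add, Pi.add_apply, diagUnit_apply]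
    by_cases hr : r = p
    · subst hr
      have hj : r / 2 ∈ Finset.Icc (-K) K := by
        rw [abs_le] at hp
        rw [Finset.mem_Icc]
        omega
      rw [Finset.sum_eq_single_of_mem _ hj]
      · rcases Int.emod_two_eq_zero_or_one r with h0 | h0
        · have e : 2 * (r / 2) = r := by omega
          rw [if_pos (by omega), if_neg (by omega), add_zero, e]
        · have e : 2 * (r / 2) + 1 = r := by omega
          rw [if_neg (by omega), if_pos (by omega), zero_add, e]
      · intro j _ hj
        rw [if_neg (by omega), if_neg (by omega), add_zero]
    · rw [hA p r (by omega)]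
      refine (Finset.sum_eq_zero fun j _ => ?_).symm
      rw [if_neg (by rintro ⟨h1, h2⟩; exact hr (h2.trans h1.symm)),
        if_neg (by rintro ⟨h1, h2⟩; exact hr (h2.trans h1.symm)), add_zero]
  have hsplit : ((A, c) : band m × Trunc m) = (A - S, 0) + (S, 0) + (0, c) := by
    refine Prod.ext ?_ ?_ <;> simp
  have hSv : mu' (S, 0) = ∑ j ∈ Finset.Icc (-K) K,
      (mu' (diagUnit m (2 * j) (A.1 (2 * j) (2 * j)), 0) +
        mu' (diagUnit m (2 * j + 1) (A.1 (2 * j + 1) (2 * j + 1)), 0)) := by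
    have := map_sum (mu' ∘ₗ LinearMap.inl ℂ (band m) (Trunc m)) (fun j =>
      (diagUnit m (2 * j) (A.1 (2 * j) (2 * j)) +
        diagUnit m (2 * j + 1) (A.1 (2 * j + 1) (2 * j + 1)))) (Finset.Icc (-K) K)
    refine this.trans (Finset.sum_congr rfl fun j _ => ?_)
    rw [map_add]
    rfl
  rw [← hmu' _ h, hsplit, map_add, map_add, hrem, zero_add, hSv, hc]
  conv_rhs => rw [Finset.sum_add_distrib, Finset.sum_comm]
  congr 1
  refine Finset.sum_congr rfl fun j _ => ?_
  rw [hu, hu, Finset.sum_add_distrib]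

/-- Functionals of finite support are determined by their labels and central charges. -/
theorem FinSupp.ext {mu nu : Module.Dual ℂ ((glHat m).deg 0)} (hmu : FinSupp mu) (hnu : FinSupp nu)
    (h1 : ∀ j : ℤ, ∀ l ≤ m, glLabel mu (2 * j) l = glLabel nu (2 * j) l)
    (h2 : ∀ j : ℤ, ∀ l ≤ m, glLabel mu (2 * j + 1) l = glLabel nu (2 * j + 1) l)
    (h3 : ∀ l ≤ m, glCharge mu l = glCharge nu l) : mu = nu := by
  obtain ⟨P, -, hP⟩ := hmu.exists_apply
  obtain ⟨P', -, hP'⟩ := hnu.exists_apply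
  refine LinearMap.ext fun ⟨⟨A, c⟩, hx⟩ => ?_
  rw [hP (max P P') (le_max_left _ _), hP' (max P P') (le_max_right _ _)]
  refine Finset.sum_congr rfl fun l hl => ?_
  have hl' := Nat.lt_succ_iff.1 (Finset.mem_range.1 hl)
  rw [h3 l hl']
  congr 1
  refine Finset.sum_congr rfl fun j _ => ?_
  rw [h1 j l hl', h2 j l hl']

end Labels


/-! ### Labels of pulled back weights -/

section PullLabels

variable {q ℓ : ℂ} {m : ℕ}

theorem phiMatrix_diag_zero (a : ℂ) (k j : ℤ) :
    (phiMatrix ℓ a m (0, k, 0, 0)).1 (2 * j) (2 * j) =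
        Complex.exp (ℓ * (a - j) * k) • Trunc.exp m (k * ℓ) ∧
      (phiMatrix ℓ a m (0, k, 0, 0)).1 (2 * j + 1) (2 * j + 1) = 0 := by
  have h : 2 * j / 2 = j := by omega
  refine ⟨?_, ?_⟩
  · rw [phiMatrix_apply, if_pos (by simp), h]
  · rw [phiMatrix_apply, if_neg (by simp)]

theorem phiMatrix_diag_one (a : ℂ) (k j : ℤ) :
    (phiMatrix ℓ a m (0, k, 1, 1)).1 (2 * j + 1) (2 * j + 1) =
        Complex.exp (ℓ * (a - j) * k) • Trunc.exp m (k * ℓ) ∧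
      (phiMatrix ℓ a m (0, k, 1, 1)).1 (2 * j) (2 * j) = 0 := by
  have h : (2 * j + 1) / 2 = j := by omega
  refine ⟨?_, ?_⟩
  · rw [phiMatrix_apply, if_pos (by simp; omega), h]
  · rw [phiMatrix_apply, if_neg (by simp)]

theorem pullWeight_diag (a : ℂ) (mu : Module.Dual ℂ ((glHat m).deg 0)) (k : ℤ) (i : Fin 2) :
    ∃ h, SSq.pullWeight q ℓ a m mu (SSq.diag q k i) =
      mu ⟨(phiMatrix ℓ a m (0, k, i, i), phiCentral ℓ a m (0, k, i, i)), h⟩ := by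
  have h1 : phiLin ℓ a m (Finsupp.single (0, k, i, i) 1, 0) =
      (phiMatrix ℓ a m (0, k, i, i), phiCentral ℓ a m (0, k, i, i)) :=
    (phiLin_single a m _ _).trans (one_smul _ _)
  refine ⟨h1 ▸ phiLin_deg (q := q) (ℓ := ℓ) a m (SSq.diag q k i).2, ?_⟩
  exact congrArg mu (Subtype.ext h1)

theorem pullWeight_central (a : ℂ) (mu : Module.Dual ℂ ((glHat m).deg 0)) :
    SSq.pullWeight q ℓ a m mu (SSq.centralC q) = glCharge mu 0 := by
  refine congrArg mu (Subtype.ext ?_)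
  have h1 : phiLin ℓ a m (0, 1) = (0, 1) := by
    rw [phiLin_apply, map_zero, zero_add, one_smul]
  have h2 : ((0, Trunc.t m ^ 0) : band m × Trunc m) = (0, 1) := by rw [pow_zero]
  exact h1.trans h2.symm

theorem FinSupp.exists_pullWeight {mu : Module.Dual ℂ ((glHat m).deg 0)} (hmu : FinSupp mu)
    (q ℓ a : ℂ) : ∃ P : ℕ, (∀ (j : ℤ) (l : ℕ), (P : ℤ) < |j| →
      glLabel mu (2 * j) l = 0 ∧ glLabel mu (2 * j + 1) l = 0) ∧
    ∀ K : ℤ, P ≤ K → ∀ k : ℤ,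
      SSq.pullWeight q ℓ a m mu (SSq.diag q k 0) =
        ∑ l ∈ Finset.range (m + 1), ((k : ℂ) * ℓ) ^ l / l.factorial *
          (∑ j ∈ Finset.Icc (-K) K, glLabel mu (2 * j) l * Complex.exp (ℓ * (a - j) * k) +
            (if k = 0 then 0 else Complex.exp (ℓ * a * k) / (1 - Complex.exp (ℓ * k))) *
              glCharge mu l) ∧
      SSq.pullWeight q ℓ a m mu (SSq.diag q k 1) =
        ∑ l ∈ Finset.range (m + 1), ((k : ℂ) * ℓ) ^ l / l.factorial *
          (∑ j ∈ Finset.Icc (-K) K, glLabel mu (2 * j + 1) l * Complex.exp (ℓ * (a - j) * k) -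
            (if k = 0 then 0 else Complex.exp (ℓ * a * k) / (1 - Complex.exp (ℓ * k))) *
              glCharge mu l) := by
  obtain ⟨P, h0, hP⟩ := hmu.exists_apply
  refine ⟨P, h0, fun K hK k => ⟨?_, ?_⟩⟩
  · obtain ⟨h, e⟩ := pullWeight_diag (q := q) (ℓ := ℓ) a mu k 0
    rw [e, hP K hK]
    refine Finset.sum_congr rfl fun l hl => ?_
    have hl' := Nat.lt_succ_iff.1 (Finset.mem_range.1 hl)
    simp only [phiMatrix_diag_zero, map_smul, map_zero, mul_zero, add_zero, Trunc.coeff_exp m l hl',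
      smul_eq_mul, phiCentral]
    rw [mul_add, Finset.mul_sum]
    congr 1
    · exact Finset.sum_congr rfl fun j _ => by ring
    · by_cases hk : k = 0
      · simp [hk]
      · simp only [hk, true_and, ne_eq, not_false_eq_true, if_true, if_false, map_smul,
          Trunc.coeff_exp m l hl', Fin.val_zero, pow_zero, one_mul, smul_eq_mul]
        ring
  · obtain ⟨h, e⟩ := pullWeight_diag (q := q) (ℓ := ℓ) a mu k 1
    rw [e, hP K hK]
    refine Finset.sum_congr rfl fun l hl => ?_
    have hl' := Nat.lt_succ_iff.1 (Finset.mem_range.1 hl)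
    simp only [phiMatrix_diag_one, map_smul, map_zero, mul_zero, zero_add, Trunc.coeff_exp m l hl',
      smul_eq_mul, phiCentral]
    rw [mul_sub, Finset.mul_sum, sub_eq_add_neg (∑ j ∈ _, _)]
    congr 1
    · exact Finset.sum_congr rfl fun j _ => by ring
    · by_cases hk : k = 0
      · simp [hk]
      · simp only [hk, true_and, ne_eq, not_false_eq_true, if_true, if_false, map_smul,
          Trunc.coeff_exp m l hl', Fin.val_one, pow_one, smul_eq_mul]
        ring

/-- Minus the sum of the two labels at `j`. -/
def labelSum (mu : Module.Dual ℂ ((glHat m).deg 0)) (j : ℤ) (l : ℕ) : ℂ :=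
  -(glLabel mu (2 * j) l + glLabel mu (2 * j + 1) l)

/-- The decrement of the first label at `j`, corrected by the central charge at `j = 0`. -/
def labelDiff (mu : Module.Dual ℂ ((glHat m).deg 0)) (j : ℤ) (l : ℕ) : ℂ :=
  glLabel mu (2 * j) l - glLabel mu (2 * (j + 1)) l + if j = 0 then glCharge mu l else 0

/-- Multiplication by `q^k` shifts the index `j`, so multiplication by `q^k - 1` turns labels into
their differences. It also clears the denominator of the central correction, which then sits at `j =
0`. -/
theorem sum_exp_telescope {F : ℤ → ℂ} {K : ℤ} (hK : 0 ≤ K) (hF : ∀ j, K ≤ |j| → F j = 0)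
    (a c : ℂ) (k : ℤ) (hk : Complex.exp (ℓ * k) ≠ 1) :
    -(Complex.exp (ℓ * k) - 1) * (∑ j ∈ Finset.Icc (-K) K, F j * Complex.exp (ℓ * (a - j) * k) +
      Complex.exp (ℓ * a * k) / (1 - Complex.exp (ℓ * k)) * c) =
    ∑ j ∈ Finset.Icc (-K) K, (F j - F (j + 1) + if j = 0 then c else 0) *
      Complex.exp (ℓ * (a - j) * k) := by
  have h1 := sum_Icc_shift (K := K)
    (f := fun j => F j * (Complex.exp (ℓ * (a - j) * k) * Complex.exp (ℓ * k)))
    (fun j hj => by rw [hF j hj, zero_mul])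
  have h2 : ∀ j : ℤ, Complex.exp (ℓ * (a - (j + 1 : ℤ)) * k) * Complex.exp (ℓ * k) =
      Complex.exp (ℓ * (a - j) * k) := by
    intro j
    rw [← Complex.exp_add]
    congr 1
    push_cast
    ring
  simp only [h2] at h1
  have h3 : ∑ j ∈ Finset.Icc (-K) K, (if j = 0 then c else 0) * Complex.exp (ℓ * (a - j) * k) =
      c * Complex.exp (ℓ * a * k) := by
    rw [Finset.sum_eq_single_of_mem 0 (by rw [Finset.mem_Icc]; omega)]
    · simp
    · intro j _ hj
      rw [if_neg hj, zero_mul]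
  simp only [add_mul, sub_mul, Finset.sum_add_distrib, Finset.sum_sub_distrib, h1, h3]
  have h4 : 1 - Complex.exp (ℓ * k) ≠ 0 := sub_ne_zero.2 hk.symm
  have h5 : ∑ j ∈ Finset.Icc (-K) K,
      F j * (Complex.exp (ℓ * (a - j) * k) * Complex.exp (ℓ * k)) =
      (∑ j ∈ Finset.Icc (-K) K, F j * Complex.exp (ℓ * (a - j) * k)) * Complex.exp (ℓ * k) := by
    rw [Finset.sum_mul]
    exact Finset.sum_congr rfl fun j _ => by ring
  rw [h5]
  field_simp
  ring

variable {ι : Type} [Fintype ι] {a : ι → ℂ} {m : ι → ℕ}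

/-- The labels of a sum of pulled back weights are given by explicit quasipolynomials. -/
theorem exists_hasLabels (hℓ : Complex.exp ℓ = q) (hℓ0 : ℓ ≠ 0)
    (hq : ∀ n : ℤ, n ≠ 0 → Complex.exp (ℓ * n) ≠ 1)
    (ha : ∀ i j, i ≠ j → ¬ Cong ℓ (a i) (a j)) (κ : ℂ)
    (mu : ∀ i, Module.Dual ℂ ((glHat (m i)).deg 0)) (hmu : ∀ i, FinSupp (mu i))
    (lam : Module.Dual ℂ ((SSq q).deg 0))
    (hlam : lam = SSq.charWeight q κ + ∑ i, SSq.pullWeight q ℓ (a i) (m i) (mu i)) :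
    ∃ Q12 Q21 : ℂ →₀ ℂ[X], HasLabels q ℓ lam Q12 Q21 ∧
      qpEval ℓ Q21 0 = SSq.label lam 0 0 + SSq.label lam 0 1 ∧
      (∀ i (j : ℤ) l, jet ℓ Q21 (a i - j) l = if l ≤ m i then labelSum (mu i) j l else 0) ∧
      (∀ i (j : ℤ) l, jet ℓ Q12 (a i - j) l =
        if l ≤ m i then labelSum (mu i) j l + labelDiff (mu i) j l else 0) ∧
      (∀ b, (∀ i, ¬ Cong ℓ b (a i)) → ∀ l, jet ℓ Q12 b l = 0 ∧ jet ℓ Q21 b l = 0) ∧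
      lam (SSq.diag q 0 0) = κ + ∑ i, ∑ᶠ j : ℤ, glLabel (mu i) (2 * j) 0 := by
  choose P h0 hP using fun i => (hmu i).exists_pullWeight q ℓ (a i)
  -- One more than the largest support bound, so that labels vanish also at `|j| = K` and sums can
  -- be shifted without boundary terms.
  set K : ℤ := ((Finset.univ.sup P : ℕ) : ℤ) + 1 with hKdef
  have hPK : ∀ i, (P i : ℤ) < K := fun i => by
    have : P i ≤ Finset.univ.sup P := Finset.le_sup (Finset.mem_univ i)
    omega
  have hK0 : 0 ≤ K := by omega
  have hz : ∀ i (j : ℤ) l, K ≤ |j| → glLabel (mu i) (2 * j) l = 0 ∧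
      glLabel (mu i) (2 * j + 1) l = 0 := fun i j l hj => h0 i j l (lt_of_lt_of_le (hPK i) hj)
  have hz1 : ∀ i j l, K < |j| → labelSum (mu i) j l = 0 := by
    intro i j l hj
    rw [labelSum, (hz i j l hj.le).1, (hz i j l hj.le).2, add_zero, neg_zero]
  have hz2 : ∀ i j l, K < |j| → labelDiff (mu i) j l = 0 := by
    intro i j l hj
    rw [labelDiff, (hz i j l hj.le).1, (hz i (j + 1) l (by rw [lt_abs] at hj; rw [le_abs]; omega)).1,
      if_neg (by rintro rfl; simp at hj; omega), sub_zero, add_zero]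
  have hl0 : ∀ k : ℤ, lam (SSq.diag q k 0) = κ * (if k = 0 then 1 else 0) +
      ∑ i, SSq.pullWeight q ℓ (a i) (m i) (mu i) (SSq.diag q k 0) := by
    intro k
    rw [hlam, LinearMap.add_apply, LinearMap.sum_apply]
    congr 1
    have h1 : SSq.charWeight q κ (SSq.diag q k 0) = κ * SSq.strZero
        (Finsupp.single (0, k, 0, 0) 1) := rfl
    rw [h1]
    congr 1
    change (Finsupp.single ((0, k, 0, 0) : Idx) (1 : ℂ)) (0, 0, 0, 0) -
      (Finsupp.single ((0, k, 0, 0) : Idx) (1 : ℂ)) (0, 0, 1, 1) = _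
    simp [Finsupp.single_apply]
  have hl1 : ∀ k : ℤ, lam (SSq.diag q k 1) = -(κ * (if k = 0 then 1 else 0)) +
      ∑ i, SSq.pullWeight q ℓ (a i) (m i) (mu i) (SSq.diag q k 1) := by
    intro k
    rw [hlam, LinearMap.add_apply, LinearMap.sum_apply]
    congr 1
    have h1 : SSq.charWeight q κ (SSq.diag q k 1) = κ * SSq.strZero
        (Finsupp.single (0, k, 1, 1) 1) := rfl
    rw [h1, ← mul_neg]
    congr 1
    change (Finsupp.single ((0, k, 1, 1) : Idx) (1 : ℂ)) (0, 0, 0, 0) -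
      (Finsupp.single ((0, k, 1, 1) : Idx) (1 : ℂ)) (0, 0, 1, 1) = _
    simp [Finsupp.single_apply]
  have hsum : ∀ k : ℤ, SSq.label lam k 0 + SSq.label lam k 1 =
      qpEval ℓ (qpOf a m K fun i => labelSum (mu i)) k := by
    intro k
    rw [SSq.label, SSq.label, hl0, hl1, qpEval_qpOf]
    have h1 : ∑ i, SSq.pullWeight q ℓ (a i) (m i) (mu i) (SSq.diag q k 0) +
        ∑ i, SSq.pullWeight q ℓ (a i) (m i) (mu i) (SSq.diag q k 1) =
        -∑ i, ∑ l ∈ Finset.range (m i + 1), ((k : ℂ) * ℓ) ^ l / l.factorial *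
          ∑ j ∈ Finset.Icc (-K) K, labelSum (mu i) j l * Complex.exp (ℓ * (a i - j) * k) := by
      rw [← Finset.sum_add_distrib, ← Finset.sum_neg_distrib]
      refine Finset.sum_congr rfl fun i _ => ?_
      rw [(hP i K (hPK i).le k).1, (hP i K (hPK i).le k).2, ← Finset.sum_add_distrib,
        ← Finset.sum_neg_distrib]
      refine Finset.sum_congr rfl fun l _ => ?_
      rw [← mul_add, ← mul_neg, add_add_sub_cancel, ← Finset.sum_add_distrib,
        ← Finset.sum_neg_distrib]
      congr 1
      refine Finset.sum_congr rfl fun j _ => ?_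
      rw [labelSum]
      ring
    linear_combination -h1
  -- The polynomial for `P12` is the one for `P21` plus the quasipolynomial of `labelDiff`, since
  -- `P12 - P21` must be `(q^n - 1)` times the first label.
  have hqp : ∀ k : ℤ, qpEval ℓ (qpOf a m K fun i j l => labelSum (mu i) j l + labelDiff (mu i) j l) k -
      qpEval ℓ (qpOf a m K fun i => labelSum (mu i)) k =
      ∑ i, ∑ l ∈ Finset.range (m i + 1), ((k : ℂ) * ℓ) ^ l / l.factorial *
          ∑ j ∈ Finset.Icc (-K) K, labelDiff (mu i) j l * Complex.exp (ℓ * (a i - j) * k) := by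
    intro k
    rw [qpEval_qpOf, qpEval_qpOf, ← Finset.sum_sub_distrib]
    refine Finset.sum_congr rfl fun i _ => ?_
    rw [← Finset.sum_sub_distrib]
    refine Finset.sum_congr rfl fun l _ => ?_
    rw [← mul_sub, ← Finset.sum_sub_distrib]
    congr 1
    exact Finset.sum_congr rfl fun j _ => by ring
  refine ⟨qpOf a m K fun i j l => labelSum (mu i) j l + labelDiff (mu i) j l,
    qpOf a m K fun i => labelSum (mu i), ⟨fun n hn => ⟨hsum n, ?_⟩, ?_⟩, ?_,
    jet_qpOf m K _ hℓ0 hq ha hz1,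
    jet_qpOf m K _ hℓ0 hq ha (fun i j l hj => by rw [hz1 i j l hj, hz2 i j l hj, add_zero]),
    fun b hb l => ⟨jet_qpOf_eq_zero ℓ a m K _ hb l, jet_qpOf_eq_zero ℓ a m K _ hb l⟩, ?_⟩
  · have hE : q ^ n = Complex.exp (ℓ * n) := by
      rw [← hℓ, ← Complex.exp_int_mul, mul_comm]
    have hE1 := hq n hn
    rw [hE, eq_div_iff (sub_ne_zero.2 hE1), hqp, SSq.label, hl0, if_neg hn, mul_zero, zero_add,
      neg_mul_comm, mul_comm, Finset.mul_sum]
    refine Finset.sum_congr rfl fun i _ => ?_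
    rw [(hP i K (hPK i).le n).1, Finset.mul_sum]
    refine Finset.sum_congr rfl fun l _ => ?_
    rw [if_neg hn, mul_left_comm, sum_exp_telescope hK0 (fun j hj => (hz i j l hj).1) _ _ n hE1]
    rfl
  · have h1 := hqp 0
    rw [Int.cast_zero] at h1
    rw [h1, hlam, LinearMap.add_apply, LinearMap.sum_apply]
    have h2 : SSq.charWeight q κ (SSq.centralC q) = 0 :=
      (congrArg (κ * ·) (map_zero SSq.strZero)).trans (mul_zero κ)
    rw [h2, zero_add]
    refine Finset.sum_congr rfl fun i _ => ?_
    rw [pullWeight_central, Finset.sum_eq_single_of_mem 0 (by simp)]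
    · have h3 := sum_Icc_shift (K := K) (f := fun j => glLabel (mu i) (2 * j) 0)
        (fun j hj => (hz i j 0 hj).1)
      simp only [labelDiff, mul_zero, Complex.exp_zero, mul_one, Finset.sum_add_distrib,
        Finset.sum_sub_distrib, h3, Finset.sum_ite_eq']
      rw [if_pos (by rw [Finset.mem_Icc]; omega)]
      simp
    · intro l _ hl
      rw [zero_mul, zero_pow hl, zero_div, zero_mul]
  · have h1 := hsum 0
    rw [Int.cast_zero] at h1
    exact h1.symm
  · rw [hl0, if_pos rfl, mul_one]
    congr 1
    refine Finset.sum_congr rfl fun i _ => ?_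
    rw [(hP i K (hPK i).le 0).1, Finset.sum_eq_single_of_mem 0 (by simp),
      finsum_eq_sum_Icc (K := K) (fun j hj => (hz i j 0 hj.le).1)]
    · simp
    · intro l _ hl
      rw [Int.cast_zero, zero_mul, zero_pow hl, zero_div, zero_mul]

end PullLabels


/-! ### The functionals `weightS` -/

section WeightS

variable {ℓ : ℂ} (P12 P21 : ℂ →₀ ℂ[X]) (a : ℂ)

/-- All jets along `a + ℤ` vanish beyond `K`. -/
def JetBound (ℓ : ℂ) (P12 P21 : ℂ →₀ ℂ[X]) (a : ℂ) (K : ℤ) : Prop :=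
  0 ≤ K ∧ ∀ k : ℤ, K < |k| → ∀ l, jet ℓ P12 (a - k) l = 0 ∧ jet ℓ P21 (a - k) l = 0

theorem exists_jetBound (hℓ0 : ℓ ≠ 0) (hq : ∀ n : ℤ, n ≠ 0 → Complex.exp (ℓ * n) ≠ 1) :
    ∃ K, JetBound ℓ P12 P21 a K := by
  obtain ⟨K, hK⟩ := exists_jet_eq_zero hℓ0 hq P12 a
  obtain ⟨K', hK'⟩ := exists_jet_eq_zero hℓ0 hq P21 a
  refine ⟨max K K', by positivity, fun k hk l => ⟨hK k ?_ l, hK' k ?_ l⟩⟩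
  · exact (le_max_left _ _).trans_lt hk
  · exact (le_max_right _ _).trans_lt hk

variable {P12 P21 a} {K : ℤ}

theorem JetBound.diff (h : JetBound ℓ P12 P21 a K) (l : ℕ) (k : ℤ) (hk : K < |k|) :
    hTilde ℓ P12 P21 a k l - jet ℓ P21 (a - k) l = 0 := by
  rw [hTilde, (h.2 k hk l).1, (h.2 k hk l).2, if_neg (by rintro rfl; simp at hk; have := h.1; omega)]
  simp

theorem JetBound.label1_sub (h : JetBound ℓ P12 P21 a K) (i : ℤ) (l : ℕ) :
    label1 ℓ P12 P21 a i l - label1 ℓ P12 P21 a (i + 1) l =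
      hTilde ℓ P12 P21 a i l - jet ℓ P21 (a - i) l := by
  have h1 := tailSum_eq_add (support_finite_of_abs (h.diff l)) i
  have h2 : label1 ℓ P12 P21 a i l =
      tailSum (fun k => hTilde ℓ P12 P21 a k l - jet ℓ P21 (a - k) l) i := rfl
  have h3 : label1 ℓ P12 P21 a (i + 1) l =
      tailSum (fun k => hTilde ℓ P12 P21 a k l - jet ℓ P21 (a - k) l) (i + 1) := rfl
  rw [h2, h3, h1, add_sub_cancel_right]

/-- On the left the tail has become the full sum, which is zero precisely because `hTilde` subtracts
the central charge at `k = 0`. This is what makes the support finite. -/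
theorem JetBound.label1_eq_zero (h : JetBound ℓ P12 P21 a K) {i : ℤ} (hi : K < |i|) (l : ℕ) :
    label1 ℓ P12 P21 a i l = 0 := by
  have h2 : label1 ℓ P12 P21 a i l =
      tailSum (fun k => hTilde ℓ P12 P21 a k l - jet ℓ P21 (a - k) l) i := rfl
  rw [h2]
  rcases lt_abs.1 hi with hi | hi
  · exact tailSum_eq_zero fun k hk => h.diff l k (by rw [lt_abs]; omega)
  · rw [tailSum_eq_finsum fun k hk => h.diff l k (by rw [lt_abs]; omega)]
    have hfin : (fun k : ℤ => jet ℓ P12 (a - k) l - jet ℓ P21 (a - k) l).support.Finite :=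
      support_finite_of_abs (K := K) fun k hk => by rw [(h.2 k hk l).1, (h.2 k hk l).2, sub_zero]
    have hfin' : (fun k : ℤ => if k = 0 then chargeS ℓ P12 P21 a l else 0).support.Finite :=
      support_finite_of_abs (K := 0) fun k hk => if_neg (by rintro rfl; simp at hk)
    have h3 : ∀ k : ℤ, hTilde ℓ P12 P21 a k l - jet ℓ P21 (a - k) l =
        (jet ℓ P12 (a - k) l - jet ℓ P21 (a - k) l) -
          (if k = 0 then chargeS ℓ P12 P21 a l else 0) := fun k => by rw [hTilde]; ring
    simp only [h3]
    rw [finsum_sub_distrib hfin hfin', finsum_eq_single _ 0 (fun k hk => if_neg hk), if_pos rfl]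
    exact sub_self _

/-- Both sides have the same differences and vanish for large `i`. Consequently minus the sum of the
two labels at `i` is the jet of `P21`, which is how `labelSum` recovers `P21`. -/
theorem JetBound.label2_eq (h : JetBound ℓ P12 P21 a K) (i : ℤ) (l : ℕ) :
    label2 ℓ P12 P21 a i l = -jet ℓ P21 (a - i) l - label1 ℓ P12 P21 a i l := by
  have h2 : label2 ℓ P12 P21 a i l =
      tailSum (fun k => jet ℓ P21 (a - (k + 1 : ℤ)) l - hTilde ℓ P12 P21 a k l) i := rfl
  rw [h2]
  refine tailSum_eq_of_sub (g := fun i => -jet ℓ P21 (a - i) l - label1 ℓ P12 P21 a i l) (K := K)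
    (support_finite_of_abs (K := K + 1) fun k hk => ?_) (fun k => ?_) (fun k hk => ?_) i
  · rw [hTilde, (h.2 k (by omega) l).1, (h.2 (k + 1) (by rw [lt_abs] at hk ⊢; omega) l).2,
      if_neg (by rintro rfl; simp at hk; have := h.1; omega)]
    simp
  · have := h.label1_sub k l
    linear_combination -this
  · have hk' : K < |k| := by rw [lt_abs]; omega
    simp only [(h.2 k hk' l).2, h.label1_eq_zero hk' l, neg_zero, sub_zero]

theorem JetBound.label2_eq_zero (h : JetBound ℓ P12 P21 a K) {i : ℤ} (hi : K < |i|) (l : ℕ) :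
    label2 ℓ P12 P21 a i l = 0 := by
  rw [h.label2_eq, (h.2 i hi l).2, h.label1_eq_zero hi, neg_zero, sub_zero]

theorem JetBound.weightS_apply (h : JetBound ℓ P12 P21 a K) (m : ℕ) (X : band m × Trunc m)
    (hX : X ∈ (glHat m).deg 0) : weightS ℓ P12 P21 a m ⟨X, hX⟩ =
      ∑ l ∈ Finset.range (m + 1),
        (∑ i ∈ Finset.Icc (-K) K, label1 ℓ P12 P21 a i l * Trunc.coeff m l (X.1.1 (2 * i) (2 * i)) +
        ∑ i ∈ Finset.Icc (-K) K,
          label2 ℓ P12 P21 a i l * Trunc.coeff m l (X.1.1 (2 * i + 1) (2 * i + 1)) +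
        chargeS ℓ P12 P21 a l * Trunc.coeff m l X.2) := by
  have h0 : weightS ℓ P12 P21 a m ⟨X, hX⟩ = (∑ l ∈ Finset.range (m + 1),
      ((∑ᶠ i : ℤ, label1 ℓ P12 P21 a i l • entryCoeff m (2 * i) l) +
        (∑ᶠ i : ℤ, label2 ℓ P12 P21 a i l • entryCoeff m (2 * i + 1) l) +
        chargeS ℓ P12 P21 a l • centralCoeff m l) : Module.Dual ℂ (band m × Trunc m)) X := rfl
  rw [h0, LinearMap.sum_apply]
  refine Finset.sum_congr rfl fun l _ => ?_
  have hfs : ∀ F : ℤ → Module.Dual ℂ (band m × Trunc m), (∀ i, K < |i| → F i = 0) →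
      (∑ᶠ i, F i) X = ∑ i ∈ Finset.Icc (-K) K, F i X := by
    intro F hF
    rw [finsum_eq_sum_of_support_subset (s := Finset.Icc (-K) K), LinearMap.sum_apply]
    intro k hk
    rw [Finset.coe_Icc, Set.mem_Icc, ← abs_le]
    by_contra h'
    exact hk (hF k (not_le.1 h'))
  rw [LinearMap.add_apply, LinearMap.add_apply,
    hfs _ (fun i hi => by rw [h.label1_eq_zero hi, zero_smul]),
    hfs _ (fun i hi => by rw [h.label2_eq_zero hi, zero_smul])]
  rfl

theorem JetBound.weightS_finSupp (h : JetBound ℓ P12 P21 a K) (m : ℕ) :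
    FinSupp (weightS ℓ P12 P21 a m) := by
  have hK := h.1
  refine ⟨(2 * K + 1).toNat, fun A hA hrow => ?_⟩
  rw [h.weightS_apply]
  refine Finset.sum_eq_zero fun l _ => ?_
  rw [map_zero, mul_zero, add_zero, ← Finset.sum_add_distrib]
  refine Finset.sum_eq_zero fun i hi => ?_
  rw [Finset.mem_Icc] at hi
  rw [hrow (2 * i) _ (by rw [abs_le]; omega), hrow (2 * i + 1) _ (by rw [abs_le]; omega), map_zero,
    mul_zero, mul_zero, add_zero]

theorem JetBound.glCharge_weightS (h : JetBound ℓ P12 P21 a K) {m l : ℕ} (hl : l ≤ m) :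
    glCharge (weightS ℓ P12 P21 a m) l = chargeS ℓ P12 P21 a l := by
  rw [glCharge, h.weightS_apply, Finset.sum_eq_single_of_mem l (by simpa using Nat.lt_succ_of_le hl)]
  · have h0 : ∀ p r : ℤ, (0 : band m).1 p r = 0 := fun _ _ => rfl
    simp [h0, Trunc.coeff_t_pow m l l hl]
  · intro l' _ hl'
    have h0 : ∀ p r : ℤ, (0 : band m).1 p r = 0 := fun _ _ => rfl
    simp [h0, Trunc.coeff_t_pow m l' l hl, hl']

theorem JetBound.glLabel_weightS_even (h : JetBound ℓ P12 P21 a K) {m l : ℕ} (hl : l ≤ m) (j : ℤ) :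
    glLabel (weightS ℓ P12 P21 a m) (2 * j) l = label1 ℓ P12 P21 a j l := by
  have hodd : ∀ i : ℤ, ¬ (2 * i + 1 = 2 * j ∧ 2 * i + 1 = 2 * j) := by intros; omega
  have heven : ∀ i : ℤ, (2 * i = 2 * j ∧ 2 * i = 2 * j) ↔ i = j := by intros; omega
  rw [glLabel, h.weightS_apply, Finset.sum_eq_single_of_mem l (by simpa using Nat.lt_succ_of_le hl)]
  · simp only [diagUnit_apply, heven, hodd, if_false, map_zero, mul_zero, Finset.sum_const_zero,
      add_zero]
    by_cases hj : j ∈ Finset.Icc (-K) K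
    · rw [Finset.sum_eq_single_of_mem j hj (fun i _ hi => by rw [if_neg hi, map_zero, mul_zero]),
        if_pos rfl, Trunc.coeff_t_pow m l l hl, if_pos rfl, mul_one]
    · rw [Finset.mem_Icc, ← abs_le, not_le] at hj
      rw [h.label1_eq_zero hj]
      refine Finset.sum_eq_zero fun i hi => ?_
      rw [if_neg, map_zero, mul_zero]
      rintro rfl
      rw [Finset.mem_Icc, ← abs_le] at hi
      omega
  · intro l' _ hl'
    simp only [diagUnit_apply, heven, hodd, if_false, map_zero, mul_zero, Finset.sum_const_zero,
      add_zero]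
    refine Finset.sum_eq_zero fun i _ => ?_
    split_ifs
    · rw [Trunc.coeff_t_pow m l' l hl, if_neg hl', mul_zero]
    · rw [map_zero, mul_zero]

theorem JetBound.glLabel_weightS_odd (h : JetBound ℓ P12 P21 a K) {m l : ℕ} (hl : l ≤ m) (j : ℤ) :
    glLabel (weightS ℓ P12 P21 a m) (2 * j + 1) l = label2 ℓ P12 P21 a j l := by
  have hodd : ∀ i : ℤ, ¬ (2 * i = 2 * j + 1 ∧ 2 * i = 2 * j + 1) := by intros; omega
  have heven : ∀ i : ℤ, (2 * i + 1 = 2 * j + 1 ∧ 2 * i + 1 = 2 * j + 1) ↔ i = j := by intros; omega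
  rw [glLabel, h.weightS_apply, Finset.sum_eq_single_of_mem l (by simpa using Nat.lt_succ_of_le hl)]
  · simp only [diagUnit_apply, heven, hodd, if_false, map_zero, mul_zero, Finset.sum_const_zero,
      add_zero, zero_add]
    by_cases hj : j ∈ Finset.Icc (-K) K
    · rw [Finset.sum_eq_single_of_mem j hj (fun i _ hi => by rw [if_neg hi, map_zero, mul_zero]),
        if_pos rfl, Trunc.coeff_t_pow m l l hl, if_pos rfl, mul_one]
    · rw [Finset.mem_Icc, ← abs_le, not_le] at hj
      rw [h.label2_eq_zero hj]
      refine Finset.sum_eq_zero fun i hi => ?_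
      rw [if_neg, map_zero, mul_zero]
      rintro rfl
      rw [Finset.mem_Icc, ← abs_le] at hi
      omega
  · intro l' _ hl'
    simp only [diagUnit_apply, heven, hodd, if_false, map_zero, mul_zero, Finset.sum_const_zero,
      add_zero, zero_add]
    refine Finset.sum_eq_zero fun i _ => ?_
    split_ifs
    · rw [Trunc.coeff_t_pow m l' l hl, if_neg hl', mul_zero]
    · rw [map_zero, mul_zero]

end WeightS

/-! ### Comparison of weights -/

section Comparison

variable {q ℓ : ℂ}

theorem SSq.dual_ext {lam mu : Module.Dual ℂ ((SSq q).deg 0)}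
    (h : ∀ k i, lam (SSq.diag q k i) = mu (SSq.diag q k i))
    (hc : lam (SSq.centralC q) = mu (SSq.centralC q)) : lam = mu := by
  refine LinearMap.ext fun ⟨(X : (Idx →₀ ℂ) × ℂ), hX⟩ => ?_
  obtain ⟨hX1, -⟩ := (mem_SSq_deg q).1 hX
  have hx : ∀ x ∈ X.1.support, ∃ k i, x = (0, k, i, i) := by
    rintro ⟨n, k, i, j⟩ hx
    have hd : Idx.deg (n, k, i, j) = 0 := by
      by_contra h
      exact (Finsupp.mem_support_iff.1 hx) (hX1 _ h)
    simp only [Idx.deg] at hd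
    have h1 := fin_two_cast_le i
    have h2 := fin_two_cast_le j
    obtain rfl : n = 0 := by omega
    obtain rfl : i = j := fin_two_cast_inj (by omega)
    exact ⟨k, i, rfl⟩
  have hspan : (⟨X, hX⟩ : (SSq q).deg 0) ∈ Submodule.span ℂ
      (insert (SSq.centralC q) (Set.range fun x : ℤ × Fin 2 => SSq.diag q x.1 x.2)) := by
    have h1 : (⟨X, hX⟩ : (SSq q).deg 0) = X.2 • SSq.centralC q +
        ∑ x ∈ X.1.support, X.1 x • (if h : x.2.2.1 = x.2.2.2 ∧ x.1 = 0 then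
          SSq.diag q x.2.1 x.2.2.1 else 0) := by
      refine Subtype.ext ?_
      have h2 : ∀ x ∈ X.1.support, ((X.1 x • (if h : x.2.2.1 = x.2.2.2 ∧ x.1 = 0 then
          SSq.diag q x.2.1 x.2.2.1 else 0) : (SSq q).deg 0) : (SSq q).carrier) =
          (Finsupp.single x (X.1 x), (0 : ℂ)) := by
        intro x hxs
        obtain ⟨k, i, rfl⟩ := hx x hxs
        rw [dif_pos ⟨rfl, rfl⟩]
        refine Prod.ext ?_ ?_
        · exact (Finsupp.smul_single _ _ _).trans (by rw [smul_eq_mul, mul_one])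
        · exact mul_zero _
      rw [Submodule.coe_add, Submodule.coe_sum, Finset.sum_congr rfl h2]
      have h3 : ∑ x ∈ X.1.support, ((Finsupp.single x (X.1 x), 0) : (Idx →₀ ℂ) × ℂ) = (X.1, 0) := by
        refine Prod.ext ?_ ?_
        · rw [Prod.fst_sum]; exact X.1.sum_single
        · rw [Prod.snd_sum]; simp
      have h4 : X = X.2 • ((0, 1) : (Idx →₀ ℂ) × ℂ) + (X.1, 0) := by
        refine Prod.ext ?_ ?_ <;> simp
      exact h4.trans (congrArg _ h3.symm)
    rw [h1]
    refine Submodule.add_mem _ (Submodule.smul_mem _ _ (Submodule.subset_span (Set.mem_insert _ _)))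
      (Submodule.sum_mem _ fun x _ => Submodule.smul_mem _ _ ?_)
    split_ifs
    · exact Submodule.subset_span (Set.mem_insert_of_mem _ ⟨(x.2.1, x.2.2.1), rfl⟩)
    · exact Submodule.zero_mem _
  refine LinearMap.eqOn_span (f := lam) (g := mu) ?_ hspan
  rintro y (rfl | ⟨x, rfl⟩)
  · exact hc
  · exact h _ _

theorem jet_eq_zero_of_maxDeg_lt (P12 P21 : ℂ →₀ ℂ[X]) (a : ℂ) (k : ℤ) {l : ℕ}
    (hl : maxDeg ℓ P12 P21 a < l) :
    jet ℓ P12 (a - k) l = 0 ∧ jet ℓ P21 (a - k) l = 0 := by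
  classical
  have hb : ∀ b ∈ P12.support ∪ P21.support, InPeriods ℓ (b - (a - k)) →
      (P12 b).natDegree < l ∧ (P21 b).natDegree < l := by
    rintro b hb ⟨r, hr⟩
    have h1 : b ∈ (P12.support ∪ P21.support).filter fun b => Cong ℓ b a := by
      refine Finset.mem_filter.2 ⟨hb, -k, r, ?_⟩
      push_cast
      linear_combination hr
    have h2 := Finset.le_sup (f := fun b => max (P12 b).natDegree (P21 b).natDegree) h1
    have h3 : max (P12 b).natDegree (P21 b).natDegree < l := lt_of_le_of_lt
      (by rw [maxDeg]; convert h2) hl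
    exact max_lt_iff.1 h3
  constructor
  · refine Finset.sum_eq_zero fun b hbs => ?_
    dsimp only
    split_ifs with h
    · rw [Polynomial.iterate_derivative_eq_zero (hb b (Finset.mem_union_left _ hbs) h).1]
      simp
    · rfl
  · refine Finset.sum_eq_zero fun b hbs => ?_
    dsimp only
    split_ifs with h
    · rw [Polynomial.iterate_derivative_eq_zero (hb b (Finset.mem_union_right _ hbs) h).2]
      simp
    · rfl

theorem jet_eq_zero_of_not_cong {N : ℕ} {a : Fin N → ℂ} {P12 P21 : ℂ →₀ ℂ[X]}
    (ha : IsClassReps ℓ P12 P21 a) {b : ℂ} (hb : ∀ i, ¬ Cong ℓ b (a i)) (l : ℕ) :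
    jet ℓ P12 b l = 0 ∧ jet ℓ P21 b l = 0 := by
  have key : ∀ b' ∈ P12.support ∪ P21.support, ¬ InPeriods ℓ (b' - b) := by
    rintro b' hb' ⟨r, hr⟩
    obtain ⟨i, k, r', h⟩ := ha.2.1 b' hb'
    refine hb i ⟨k, r' - r, ?_⟩
    push_cast
    linear_combination h - hr
  constructor
  · exact Finset.sum_eq_zero fun b' hb' => if_neg (key b' (Finset.mem_union_left _ hb'))
  · exact Finset.sum_eq_zero fun b' hb' => if_neg (key b' (Finset.mem_union_right _ hb'))

/-- The highest weight is the sum of the pull-backs of the functionals `weightS` and of the weight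
of a one-dimensional module. -/
theorem weight_eq (hℓ : Complex.exp ℓ = q) (hℓ0 : ℓ ≠ 0)
    (hq : ∀ n : ℤ, n ≠ 0 → Complex.exp (ℓ * n) ≠ 1) {lam : Module.Dual ℂ ((SSq q).deg 0)}
    {P12 P21 : ℂ →₀ ℂ[X]} (h : HasLabels q ℓ lam P12 P21)
    (h0 : qpEval ℓ P21 0 = SSq.label lam 0 0 + SSq.label lam 0 1)
    {N : ℕ} {a : Fin N → ℂ} (ha : IsClassReps ℓ P12 P21 a) :
    lam = SSq.charWeight q (kappa ℓ lam P12 P21 a) +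
      ∑ i, SSq.pullWeight q ℓ (a i) (maxDeg ℓ P12 P21 (a i))
        (weightS ℓ P12 P21 (a i) (maxDeg ℓ P12 P21 (a i))) := by
  choose K hK using fun i => exists_jetBound P12 P21 (a i) hℓ0 hq
  obtain ⟨Q12, Q21, hQ, hQ0, hj21, hj12, hjb, hQk⟩ := exists_hasLabels hℓ hℓ0 hq ha.1
    (kappa ℓ lam P12 P21 a) (fun i => weightS ℓ P12 P21 (a i) (maxDeg ℓ P12 P21 (a i)))
    (fun i => (hK i).weightS_finSupp _) _ rfl
  set lam' := SSq.charWeight q (kappa ℓ lam P12 P21 a) +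
      ∑ i, SSq.pullWeight q ℓ (a i) (maxDeg ℓ P12 P21 (a i))
        (weightS ℓ P12 P21 (a i) (maxDeg ℓ P12 P21 (a i))) with hlam'
  -- Near the representatives the jets agree by the choice of the labels in `weightS`; for orders
  -- above `maxDeg` and for exponents in other classes all of them vanish.
  have hjets : ∀ b l, jet ℓ P12 b l = jet ℓ Q12 b l ∧ jet ℓ P21 b l = jet ℓ Q21 b l := by
    intro b l
    by_cases hb : ∃ i, Cong ℓ b (a i)
    · obtain ⟨i, k, hk⟩ := hb
      have hp : InPeriods ℓ (b - (a i - (-k : ℤ))) := by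
        convert hk using 1
        push_cast
        ring
      rw [jet_congr hℓ0 P12 hp, jet_congr hℓ0 P21 hp, jet_congr hℓ0 Q12 hp, jet_congr hℓ0 Q21 hp,
        hj21, hj12]
      split_ifs with hl
      · have e1 : labelSum (weightS ℓ P12 P21 (a i) (maxDeg ℓ P12 P21 (a i))) (-k) l =
            jet ℓ P21 (a i - (-k : ℤ)) l := by
          rw [labelSum, (hK i).glLabel_weightS_even hl, (hK i).glLabel_weightS_odd hl,
            (hK i).label2_eq]
          ring
        have e2 : labelDiff (weightS ℓ P12 P21 (a i) (maxDeg ℓ P12 P21 (a i))) (-k) l =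
            jet ℓ P12 (a i - (-k : ℤ)) l - jet ℓ P21 (a i - (-k : ℤ)) l := by
          rw [labelDiff, (hK i).glLabel_weightS_even hl, (hK i).glLabel_weightS_even hl,
            (hK i).label1_sub, (hK i).glCharge_weightS hl, hTilde]
          ring
        rw [e1, e2]
        exact ⟨by ring, rfl⟩
      · exact jet_eq_zero_of_maxDeg_lt P12 P21 (a i) (-k) (not_le.1 hl)
    · rw [not_exists] at hb
      obtain ⟨h1, h2⟩ := jet_eq_zero_of_not_cong ha hb l
      obtain ⟨h3, h4⟩ := hjb b hb l
      rw [h1, h2, h3, h4]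
      exact ⟨rfl, rfl⟩
  have e12 := qpEval_eq_of_jet hℓ0 fun b l => (hjets b l).1
  have e21 := qpEval_eq_of_jet hℓ0 fun b l => (hjets b l).2
  -- At `k = 0` the quasipolynomials determine only the sum of the two labels; `kappa` is chosen so
  -- that the first one agrees.
  have hzero : lam (SSq.diag q 0 0) = lam' (SSq.diag q 0 0) := by
    rw [hQk, kappa, eq_comm, sub_add_eq_add_sub, sub_eq_iff_eq_add]
    congr 1
    refine Finset.sum_congr rfl fun i _ => finsum_congr fun j => ?_
    rw [(hK i).glLabel_weightS_even (Nat.zero_le _)]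
  have hlab0 : ∀ k : ℤ, lam (SSq.diag q k 0) = lam' (SSq.diag q k 0) := by
    intro k
    by_cases hk : k = 0
    · rw [hk, hzero]
    · have h1 := (h.1 k hk).2
      have h2 := (hQ.1 k hk).2
      rw [e12, e21, ← h2] at h1
      exact neg_injective h1
  have hlabs : ∀ k : ℤ, SSq.label lam k 0 + SSq.label lam k 1 =
      SSq.label lam' k 0 + SSq.label lam' k 1 := by
    intro k
    by_cases hk : k = 0
    · have := e21 0
      rw [Int.cast_zero] at this
      rw [hk, ← h0, ← hQ0, this]
    · rw [(h.1 k hk).1, (hQ.1 k hk).1, e21]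
  refine SSq.dual_ext (fun k i => ?_) ?_
  · fin_cases i
    · exact hlab0 k
    · have h1 := hlabs k
      simp only [SSq.label, hlab0 k] at h1
      exact neg_injective (add_left_cancel h1)
  · have h1 := e12 0
    have h2 := e21 0
    rw [Int.cast_zero] at h1 h2
    rw [← h.2, ← hQ.2, h1, h2]

/-- The data of a realization are determined by the quasipolynomials. -/
theorem weight_unique (hℓ : Complex.exp ℓ = q) (hℓ0 : ℓ ≠ 0)
    (hq : ∀ n : ℤ, n ≠ 0 → Complex.exp (ℓ * n) ≠ 1) {lam : Module.Dual ℂ ((SSq q).deg 0)}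
    {P12 P21 : ℂ →₀ ℂ[X]} (h : HasLabels q ℓ lam P12 P21)
    {N : ℕ} {a : Fin N → ℂ} {m : Fin N → ℕ} (ha : ∀ i j, i ≠ j → ¬ Cong ℓ (a i) (a j)) {κ : ℂ}
    {mu : ∀ i, Module.Dual ℂ ((glHat (m i)).deg 0)} (hmu : ∀ i, FinSupp (mu i))
    (hlam : lam = SSq.charWeight q κ + ∑ i, SSq.pullWeight q ℓ (a i) (m i) (mu i)) :
    (∀ i, mu i = weightS ℓ P12 P21 (a i) (m i)) ∧
    (∀ i (l : ℕ), m i < l → ∀ k : ℤ,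
      jet ℓ P12 (a i - k) l = 0 ∧ jet ℓ P21 (a i - k) l = 0) ∧
    (∀ b : ℂ, (∀ i, ¬ Cong ℓ b (a i)) → ∀ l : ℕ, jet ℓ P12 b l = 0 ∧ jet ℓ P21 b l = 0) ∧
    κ = kappa ℓ lam P12 P21 a := by
  obtain ⟨Q12, Q21, hQ, -, hj21, hj12, hjb, hQk⟩ := exists_hasLabels hℓ hℓ0 hq ha κ mu hmu lam hlam
  have e21 : ∀ b l, jet ℓ P21 b l = jet ℓ Q21 b l := jet_eq_of_qpEval hℓ0 fun n hn => by
    rw [← (h.1 n hn).1, (hQ.1 n hn).1]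
  have e12 : ∀ b l, jet ℓ P12 b l = jet ℓ Q12 b l := jet_eq_of_qpEval hℓ0 fun n hn => by
    have h1 := (h.1 n hn).2
    rw [(hQ.1 n hn).2, div_left_inj', ← (h.1 n hn).1, (hQ.1 n hn).1, sub_left_inj] at h1
    · exact h1.symm
    · rw [← hℓ, ← Complex.exp_int_mul, mul_comm]
      exact sub_ne_zero.2 (hq n hn)
  choose K hK using fun i => exists_jetBound P12 P21 (a i) hℓ0 hq
  choose P hP0 hP using fun i => (hmu i).exists_apply
  have hfin : ∀ i l, (fun j => glLabel (mu i) (2 * j) l).support.Finite := fun i l =>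
    support_finite_of_abs (K := P i) fun j hj => (hP0 i j l hj).1
  have hjd : ∀ i (j : ℤ), ∀ l ≤ m i, jet ℓ P12 (a i - j) l - jet ℓ P21 (a i - j) l =
      labelDiff (mu i) j l := by
    intro i j l hl
    rw [e12, e21, hj12, hj21, if_pos hl, if_pos hl, add_sub_cancel_left]
  -- In the sum of `labelDiff` over all `j` the differences of labels telescope to zero, leaving the
  -- central charge.
  have hcharge : ∀ i, ∀ l ≤ m i, chargeS ℓ P12 P21 (a i) l = glCharge (mu i) l := by
    intro i l hl
    rw [chargeS]
    simp only [hjd i _ l hl, labelDiff]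
    have hfin1 : (fun j => glLabel (mu i) (2 * (j + 1)) l).support.Finite :=
      support_finite_of_abs (K := P i + 1) fun j hj =>
        (hP0 i (j + 1) l (by rw [lt_abs] at hj ⊢; omega)).1
    have hfin2 : (fun j : ℤ => if j = 0 then glCharge (mu i) l else 0).support.Finite :=
      support_finite_of_abs (K := 0) fun k hk => if_neg (by rintro rfl; simp at hk)
    rw [finsum_add_distrib (((hfin i l).union hfin1).subset (Function.support_sub _ _)) hfin2,
      finsum_sub_distrib (hfin i l) hfin1, finsum_shift (fun j => glLabel (mu i) (2 * j) l),
      sub_self, zero_add, finsum_eq_single _ 0 (fun k hk => if_neg hk), if_pos rfl]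
  -- Labels of finite support are the tail sums of their own decrements, and the decrements are
  -- known from the jets and the central charge.
  have hlab1 : ∀ i (j : ℤ), ∀ l ≤ m i, label1 ℓ P12 P21 (a i) j l = glLabel (mu i) (2 * j) l := by
    intro i j l hl
    refine tailSum_eq_of_sub (g := fun j => glLabel (mu i) (2 * j) l)
      (support_finite_of_abs ((hK i).diff l)) (fun k => ?_) (K := P i)
      (fun k hk => (hP0 i k l (by rw [lt_abs]; omega)).1) j
    have := hjd i k l hl
    rw [labelDiff, ← hcharge i l hl] at this
    rw [hTilde]
    linear_combination -this
  have hlab2 : ∀ i (j : ℤ), ∀ l ≤ m i,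
      label2 ℓ P12 P21 (a i) j l = glLabel (mu i) (2 * j + 1) l := by
    intro i j l hl
    rw [(hK i).label2_eq, hlab1 i j l hl, e21, hj21, if_pos hl, labelSum]
    ring
  refine ⟨fun i => ?_, fun i l hl k => ?_, fun b hb l => ?_, ?_⟩
  · refine (hmu i).ext ((hK i).weightS_finSupp _) (fun j l hl => ?_) (fun j l hl => ?_)
      (fun l hl => ?_)
    · rw [(hK i).glLabel_weightS_even hl, hlab1 i j l hl]
    · rw [(hK i).glLabel_weightS_odd hl, hlab2 i j l hl]
    · rw [(hK i).glCharge_weightS hl, hcharge i l hl]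
  · rw [e12, e21, hj12, hj21, if_neg (not_le.2 hl), if_neg (not_le.2 hl)]
    exact ⟨rfl, rfl⟩
  · rw [e12, e21]
    exact hjb b hb l
  · rw [kappa, hQk, eq_sub_iff_add_eq]
    congr 1
    refine Finset.sum_congr rfl fun i _ => finsum_congr fun j => ?_
    rw [hlab1 i j 0 (Nat.zero_le _)]

end Comparison


/-! ### Consequences of quasifiniteness -/

/-- Infinitely many vectors in a finite dimensional space are dependent. The relation is recorded as
a polynomial because it is used later as a characteristic polynomial of a recurrence and as a
function of the row index. -/
theorem exists_poly_relation {E : Type*} [AddCommGroup E] [Module ℂ E] (S : Submodule ℂ E)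
    [FiniteDimensional ℂ S] (F : ℕ → E) (hF : ∀ k, F k ∈ S) :
    ∃ f : ℂ[X], f ≠ 0 ∧ ∑ k ∈ f.support, f.coeff k • F k = 0 := by
  let T : ℂ[X] →ₗ[ℂ] S := Polynomial.lsum fun k => LinearMap.toSpanSingleton ℂ S ⟨F k, hF k⟩
  have hT : ¬ Function.Injective T := by
    intro hinj
    have h1 := (Polynomial.basisMonomials ℂ).linearIndependent.map' T (LinearMap.ker_eq_bot.2 hinj)
    exact Set.infinite_univ (α := ℕ) (Set.finite_univ_iff.2 h1.finite)
  rw [← LinearMap.ker_eq_bot, Submodule.eq_bot_iff] at hT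
  push Not at hT
  obtain ⟨f, hf, hf0⟩ := hT
  refine ⟨f, hf0, ?_⟩
  have h1 : ((T f : S) : E) = 0 := by
    rw [LinearMap.mem_ker.1 hf]; rfl
  rw [← h1]
  have h2 : T f = ∑ k ∈ f.support, f.coeff k • (⟨F k, hF k⟩ : S) := rfl
  rw [h2, Submodule.coe_sum]
  rfl

theorem GradedAction.IsHighestWeight.apply_bracket_eq_zero {g : HalfGraded}
    {V : GradedAction g}
    {lam : Module.Dual ℂ (g.deg 0)} (h : V.IsHighestWeight lam) {d : ℤ} (hd : 0 < d)
    {x y : g.carrier} (hx : x ∈ g.deg d) (hy : y ∈ g.deg (-d)) (hyv : V.act y h.vec = 0)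
    (h0 : g.bracket x y ∈ g.deg 0) : lam ⟨g.bracket x y, h0⟩ = 0 := by
  have h1 := h.1.isRep.apply_apply hx hy h.vec
  rw [hyv, h.act_pos hd hx, map_zero, map_zero, smul_zero, add_zero, h.act_deg_zero h0] at h1
  exact (smul_eq_zero.1 h1.symm).resolve_right h.vec_ne_zero

/-! ### From finite dimensional graded pieces to quasipolynomial labels. -/

section PartOne

variable {q ℓ : ℂ} {lam : Module.Dual ℂ ((SSq q).deg 0)} {L : GradedAction (SSq q)}

/-- The relation satisfied by the highest weight, obtained from a linear dependence in a graded
piece of negative degree. -/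
theorem exists_lam_relation (hL : L.IsHighestWeight lam) {d : ℤ} (hd : 0 < d)
    (hfin : FiniteDimensional ℂ (L.deg (-d))) (Y : ℕ → (Idx →₀ ℂ) × ℂ)
    (hY : ∀ k, Y k ∈ (SSq q).deg (-d)) (lam' : (Idx →₀ ℂ) × ℂ →ₗ[ℂ] ℂ)
    (hlam' : ∀ x (hx : x ∈ (SSq q).deg 0), lam' x = lam ⟨x, hx⟩) :
    ∃ f : ℂ[X], f ≠ 0 ∧ ∀ x : (Idx →₀ ℂ) × ℂ, x ∈ (SSq q).deg d →
      ∑ k ∈ f.support, f.coeff k * lam' (ssBracket q x.1 (Y k).1) = 0 := by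
  obtain ⟨f, hf0, hf⟩ := exists_poly_relation (L.deg (-d)) (fun k => L.act (Y k) hL.vec)
    (fun k => by simpa using hL.1.act_mem _ _ _ _ (hY k) hL.vec_mem)
  refine ⟨f, hf0, fun x hx => ?_⟩
  have hg := SSq_isGraded q
  let y : (Idx →₀ ℂ) × ℂ := ∑ k ∈ f.support, f.coeff k • Y k
  have hy : y ∈ (SSq q).deg (-d) := Submodule.sum_mem _ fun k _ => Submodule.smul_mem _ _ (hY k)
  have hyv : L.act y hL.vec = 0 := by
    have h1 : L.act y = ∑ k ∈ f.support, f.coeff k • L.act (Y k) :=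
      (map_sum L.act _ _).trans (Finset.sum_congr rfl fun k _ => map_smul L.act _ _)
    rw [h1, LinearMap.sum_apply]
    exact hf
  have h0 : (SSq q).bracket x y ∈ (SSq q).deg 0 := by
    simpa using hg.bracket_mem _ _ _ _ hx hy
  have h1 := hL.apply_bracket_eq_zero hd hx hy hyv h0
  have h2 : lam' (ssBracket q x.1 y.1) = 0 :=
    (congrArg lam' (SSq_bracket q x y).symm).trans ((hlam' _ h0).trans h1)
  have h3 : y.1 = ∑ k ∈ f.support, f.coeff k • (Y k).1 := by
    rw [Prod.fst_sum]
    rfl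
  rw [h3, map_sum, map_sum] at h2
  rw [← h2]
  refine Finset.sum_congr rfl fun k _ => ?_
  rw [map_smul, map_smul, smul_eq_mul]

/-- A relation among the `T_q^k M_{21} v` is bracketed with `T_q^n M_{12}`, and one among the
`z^{-1} T_q^k M_{12} v` with `z T_q^n M_{21}`. The resulting recurrences hold for all integers `n`,
including zero, where the second one contains the central charge. -/
theorem exists_labels (hℓ0 : ℓ ≠ 0) (hℓ : Complex.exp ℓ = q)
    (hL : L.IsHighestWeight lam) (hLqf : L.Quasifinite) :
    ∃ P12 P21 : ℂ →₀ ℂ[X],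
      (∀ n : ℤ, SSq.label lam n 0 + SSq.label lam n 1 = qpEval ℓ P21 n) ∧
      (∀ n : ℤ, q ^ n * SSq.label lam n 0 + SSq.label lam n 1 +
        (if n = 0 then lam (SSq.centralC q) else 0) = qpEval ℓ P12 n) := by
  have hq0 : q ≠ 0 := by rw [← hℓ]; exact Complex.exp_ne_zero ℓ
  obtain ⟨lam0, hlam0⟩ := LinearMap.exists_extend (p := (SSq q).deg 0) lam
  let lam' : (Idx →₀ ℂ) × ℂ →ₗ[ℂ] ℂ := lam0
  have hlam' : ∀ x (hx : x ∈ (SSq q).deg 0), lam' x = lam ⟨x, hx⟩ := fun x hx => by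
    rw [← hlam0]; rfl
  have hdiag : ∀ k i, lam' (Finsupp.single (0, k, i, i) 1, 0) = -SSq.label lam k i := fun k i => by
    rw [SSq.label, neg_neg]
    exact hlam' _ (SSq.diag q k i).2
  have hcent : lam' (0, 1) = lam (SSq.centralC q) := hlam' _ (SSq.centralC q).2
  obtain ⟨f, hf0, hf⟩ := exists_lam_relation hL (d := 1) one_pos (hLqf _)
    (fun k : ℕ => (Finsupp.single (0, (k : ℤ), 1, 0) 1, 0))
    (fun k => single_mem_SSq_deg q (by simp [Idx.deg]) 1) lam' hlam'
  obtain ⟨f', hf0', hf'⟩ := exists_lam_relation hL (d := 1) one_pos (hLqf _)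
    (fun k : ℕ => (Finsupp.single (-1, (k : ℤ), 0, 1) 1, 0))
    (fun k => single_mem_SSq_deg q (by simp [Idx.deg]) 1) lam' hlam'
  obtain ⟨P21, hP21⟩ := exists_qpEval_of_recurrence hℓ0 f hf0
    (fun n => SSq.label lam n 0 + SSq.label lam n 1) (fun n => by
      have h1 := hf (Finsupp.single (0, n, 0, 1) 1, 0)
        (single_mem_SSq_deg q (by simp [Idx.deg]) 1)
      rw [← neg_eq_zero, ← h1, ← Finset.sum_neg_distrib]
      refine Finset.sum_congr rfl fun k _ => ?_
      have h2 : basisBracket q (0, n, 0, 1) (0, (k : ℤ), 1, 0) =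
          ((Finsupp.single (0, n + k, 0, 0) 1, 0) + (Finsupp.single (0, n + k, 1, 1) 1, 0) :
            (Idx →₀ ℂ) × ℂ) := by
        refine Prod.ext ?_ ?_
        · simp [basisBracket, mulBasis, Idx.sign, add_comm n]
        · simp [basisBracket, psiBasis]
      rw [ssBracket_single, h2, one_mul, one_smul, map_add, hdiag, hdiag]
      ring)
  obtain ⟨P12, hP12⟩ := exists_qpEval_of_recurrence hℓ0 f' hf0'
    (fun n => q ^ n * SSq.label lam n 0 + SSq.label lam n 1 +
        (if n = 0 then lam (SSq.centralC q) else 0)) (fun n => by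
      have h1 := hf' (Finsupp.single (1, n, 1, 0) 1, 0)
        (single_mem_SSq_deg q (by simp [Idx.deg]) 1)
      -- The factor `-q ^ n` normalizes the coefficient `q ^ (-n)` of the second label and makes
      -- that of the first depend only on `n + k`.
      have h3 := congrArg (fun z => -q ^ n * z) h1
      simp only [mul_zero] at h3
      refine Eq.trans ?_ h3
      rw [Finset.mul_sum]
      refine Finset.sum_congr rfl fun k _ => ?_
      have h2 : basisBracket q (1, n, 1, 0) (-1, (k : ℤ), 0, 1) =
          (q ^ (-n) • (Finsupp.single (0, n + k, 1, 1) 1, 0) +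
            q ^ (k : ℤ) • (Finsupp.single (0, n + k, 0, 0) 1, 0) +
            (if n + k = 0 then -q ^ (-n) else 0) • (0, 1) : (Idx →₀ ℂ) × ℂ) := by
        refine Prod.ext ?_ ?_
        · split_ifs <;> simp [basisBracket, mulBasis, Idx.sign, add_comm n]
        · by_cases h : n + k = 0 <;> simp [basisBracket, psiBasis, h]
      have h4 : q ^ n * q ^ (-n) = 1 := by rw [← zpow_add₀ hq0, add_neg_cancel, zpow_zero]
      rw [ssBracket_single, h2, one_mul, one_smul, map_add, map_add, map_smul, map_smul, map_smul,
        hdiag, hdiag, hcent, zpow_add₀ hq0]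
      simp only [smul_eq_mul]
      split_ifs
      · linear_combination (-f'.coeff k * (SSq.label lam (n + k) 1 + lam (SSq.centralC q))) * h4
      · linear_combination (-f'.coeff k * (SSq.label lam (n + k) 1)) * h4)
  exact ⟨P12, P21, hP21, hP12⟩

/-- `HasLabels` constrains `P21` directly only at nonzero integers. That its value at `0` is also
right for every admissible pair follows from one good pair, since nonzero integers determine the
value at `0`; `weight_eq` needs this. -/
theorem exists_hasLabels_of_quasifinite (hℓ0 : ℓ ≠ 0) (hℓ : Complex.exp ℓ = q)
    (hq : ∀ n : ℤ, n ≠ 0 → Complex.exp (ℓ * n) ≠ 1)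
    (hL : L.IsHighestWeight lam) (hLqf : L.Quasifinite) :
    (∃ P12 P21 : ℂ →₀ ℂ[X], HasLabels q ℓ lam P12 P21) ∧
    ∀ P12 P21 : ℂ →₀ ℂ[X], HasLabels q ℓ lam P12 P21 →
      qpEval ℓ P21 0 = SSq.label lam 0 0 + SSq.label lam 0 1 := by
  obtain ⟨P12, P21, h21, h12⟩ := exists_labels hℓ0 hℓ hL hLqf
  have h21z := h21 0
  have h12z := h12 0
  rw [if_pos rfl, zpow_zero, one_mul, Int.cast_zero] at h12z
  rw [Int.cast_zero] at h21z
  refine ⟨⟨P12, P21, fun n hn => ⟨h21 n, ?_⟩, ?_⟩, fun Q12 Q21 hQ => ?_⟩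
  · have hE : q ^ n ≠ 1 := by
      rw [← hℓ, ← Complex.exp_int_mul, mul_comm]
      exact hq n hn
    have h1 := h12 n
    rw [if_neg hn, add_zero] at h1
    rw [eq_div_iff (sub_ne_zero.2 hE), ← h1, ← h21]
    ring
  · rw [← h12z, ← h21z]
    ring
  · have h1 := qpEval_eq_of_jet hℓ0 (jet_eq_of_qpEval hℓ0 (P := Q21) (Q := P21) fun n hn => by
      rw [← (hQ.1 n hn).1, h21]) 0
    rw [Int.cast_zero] at h1
    rw [h1, h21z]

end PartOne


/-! ### Quasifinite modules over `glHat` have highest weights of finite support -/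

/-- Antidifferences on the integers. -/
theorem exists_antidifference_int {M : Type*} [AddCommGroup M] (c : ℤ → M) :
    ∃ D : ℤ → M, (∀ p, D (p + 1) - D p = c p) ∧
      ∀ (p : ℤ), (∀ i, 0 ≤ i → i < p → c i = 0) → (∀ i, p ≤ i → i < 0 → c i = 0) → D p = 0 := by
  refine ⟨fun p => ∑ i ∈ Finset.Ico 0 p, c i - ∑ i ∈ Finset.Ico p 0, c i, fun p => ?_,
    fun p h1 h2 => ?_⟩
  · rcases le_or_gt 0 p with hp | hp
    · have h1 : Finset.Ico 0 (p + 1) = insert p (Finset.Ico 0 p) := by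
        ext i; simp only [Finset.mem_Ico, Finset.mem_insert]; omega
      have h2 : Finset.Ico (p + 1) 0 = ∅ := Finset.Ico_eq_empty (by omega)
      have h3 : Finset.Ico p 0 = ∅ := Finset.Ico_eq_empty (by omega)
      dsimp only
      rw [h1, h2, h3, Finset.sum_insert (by simp), Finset.sum_empty]
      abel
    · have h1 : Finset.Ico p 0 = insert p (Finset.Ico (p + 1) 0) := by
        ext i; simp only [Finset.mem_Ico, Finset.mem_insert]; omega
      have h2 : Finset.Ico 0 (p + 1) = ∅ := Finset.Ico_eq_empty (by omega)
      have h3 : Finset.Ico 0 p = ∅ := Finset.Ico_eq_empty (by omega)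
      dsimp only
      rw [h1, h2, h3, Finset.sum_insert (by simp), Finset.sum_empty]
      abel
  · dsimp only
    rw [Finset.sum_eq_zero, Finset.sum_eq_zero, sub_zero]
    · intro i hi
      rw [Finset.mem_Ico] at hi
      exact h2 i hi.1 hi.2
    · intro i hi
      rw [Finset.mem_Ico] at hi
      exact h1 i hi.1 hi.2

section OffDiag

variable {m : ℕ}

/-- The matrix with entries `c p` at `(p, p + d)`. -/
def offDiag (m : ℕ) (d : ℤ) : (ℤ → Trunc m) →ₗ[ℂ] band m where
  toFun c := ⟨fun p r => if r = p + d then c p else 0, |d|, fun p r h => if_neg (by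
    rintro rfl
    simp at h)⟩
  map_add' x y := by
    ext p r
    simp only [Submodule.coe_add, Pi.add_apply]
    split_ifs <;> simp
  map_smul' c x := by
    ext p r
    simp only [Submodule.coe_smul, Pi.smul_apply, RingHom.id_apply]
    split_ifs <;> simp

theorem offDiag_apply (d : ℤ) (c : ℤ → Trunc m) (p r : ℤ) :
    (offDiag m d c).1 p r = if r = p + d then c p else 0 := rfl

theorem offDiag_mem (d : ℤ) (c : ℤ → Trunc m) :
    ((offDiag m d c, 0) : band m × Trunc m) ∈ (glHat m).deg d :=
  mem_glHat_deg.2 ⟨fun p r h => if_neg (by omega), fun _ => rfl⟩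

theorem eq_offDiag {d : ℤ} {A : band m} (hA : ∀ p r : ℤ, r - p ≠ d → A.1 p r = 0) :
    A = offDiag m d fun p => A.1 p (p + d) := by
  ext p r
  rw [offDiag_apply]
  split_ifs with h
  · rw [h]
  · exact hA p r (by omega)

theorem superComm_offDiag (d d' : ℤ) (c c' : ℤ → Trunc m) (p s : ℤ) :
    superComm (offDiag m d c).1 (offDiag m d' c').1 p s =
      if s = p + (d + d') then
        c p * c' (p + d) - ((-1 : ℂ) ^ (d' * d)) • (c' p * c (p + d')) else 0 := by
  have h1 : ∀ r : ℤ, (offDiag m d c).1 p r * (offDiag m d' c').1 r s =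
      if r = p + d then (if s = p + (d + d') then c p * c' (p + d) else 0) else 0 := by
    intro r
    simp only [offDiag_apply]
    by_cases hr : r = p + d
    · subst hr
      simp [add_assoc]
    · simp [hr]
  have h2 : ∀ r : ℤ, ((-1 : ℂ) ^ ((r - p) * (s - r))) •
      ((offDiag m d' c').1 p r * (offDiag m d c).1 r s) =
      if r = p + d' then (if s = p + (d + d') then
        ((-1 : ℂ) ^ (d' * d)) • (c' p * c (p + d')) else 0) else 0 := by
    intro r
    simp only [offDiag_apply]
    by_cases hr : r = p + d'
    · subst hr
      by_cases hs : s = p + (d + d')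
      · subst hs
        have e : p + (d + d') = p + d' + d := by ring
        simp [e]
      · have e : ¬ s = p + d' + d := by omega
        simp [hs, e]
    · simp [hr]
  rw [superComm]
  simp only [h1, h2]
  rw [finsum_sub_distrib ((Set.finite_singleton (p + d)).subset fun r hr => by
      by_contra h; exact hr (if_neg h)) ((Set.finite_singleton (p + d')).subset fun r hr => by
      by_contra h; exact hr (if_neg h)),
    finsum_eq_single _ (p + d) (fun r hr => if_neg hr),
    finsum_eq_single _ (p + d') (fun r hr => if_neg hr), if_pos rfl, if_pos rfl]
  split_ifs
  · rfl
  · exact sub_zero _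

theorem bracket_diag_offDiag (D c : ℤ → Trunc m) :
    (glHat m).bracket (offDiag m 0 D, 0) (offDiag m (-1) c, 0) =
      (offDiag m (-1) fun p => (D p - D (p - 1)) * c p, 0) := by
  refine Prod.ext (Subtype.ext ?_) ?_
  · ext p s
    refine (superComm_offDiag 0 (-1) D c p s).trans ?_
    rw [offDiag_apply]
    simp only [zero_add, add_zero, mul_zero, zpow_zero, one_smul]
    split_ifs
    · rw [← sub_eq_add_neg]
      ring
    · rfl
  · exact glCocycle_eq_zero_of_deg (mem_glHat_deg.1 (offDiag_mem 0 D)).1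
      (mem_glHat_deg.1 (offDiag_mem (-1) c)).1 (by norm_num)

/-- The only entry of the superdiagonal crossing the threshold is `(1, 2)`; it is paired with `c 2`,
so the cocycle vanishes. Both matrices are odd, hence the plus sign. -/
theorem bracket_up_offDiag (c : ℤ → Trunc m) (h2 : c 2 = 0) :
    (glHat m).bracket (offDiag m 1 fun _ => 1, 0) (offDiag m (-1) c, 0) =
      (offDiag m 0 fun p => c (p + 1) + c p, 0) := by
  refine Prod.ext (Subtype.ext ?_) ?_
  · ext p s
    refine (superComm_offDiag 1 (-1) _ c p s).trans ?_
    rw [offDiag_apply, add_neg_cancel]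
    have e : (-1 : ℂ) ^ (-1 * 1 : ℤ) = -1 := by norm_num
    rw [e, one_mul, mul_one, neg_smul, one_smul, sub_neg_eq_add]
  · change glCocycle (offDiag m 1 fun _ => 1).1 (offDiag m (-1) c).1 = 0
    rw [glCocycle]
    refine finsum_eq_zero_of_forall_eq_zero fun x => ?_
    rw [offDiag_apply, offDiag_apply]
    by_cases h : x.2 = x.1 + 1
    · by_cases h1 : x.1 = 1
      · rw [h, h1]
        norm_num [h2]
      · have h3 : (x.1 ≤ 1 ↔ x.2 ≤ 1) := by omega
        simp [h3]
    · simp [h]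

end OffDiag

/-- A dependence among the subdiagonals with entries `p ^ k` gives a nonzero polynomial `f` whose
values form a subdiagonal killing the highest weight vector. Bracketing with diagonal matrices
multiplies this subdiagonal by any sequence, so every subdiagonal vanishing near the roots of `f`
kills that vector. Bracketing these with the superdiagonal of ones yields every diagonal that
vanishes near the origin. -/
theorem finSupp_of_quasifinite {m : ℕ} {M : GradedAction (glHat m)}
    {mu : Module.Dual ℂ ((glHat m).deg 0)} (hM : M.IsHighestWeight mu) (hqf : M.Quasifinite) :
    FinSupp mu := by
  have hg := glHat_isGraded m
  have := hqf (-1)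
  let Y : ℕ → band m × Trunc m := fun k => (offDiag m (-1) fun p => ((p : ℂ) ^ k) • 1, 0)
  obtain ⟨f, hf0, hf⟩ := exists_poly_relation (M.deg (-1)) (fun k => M.act (Y k) hM.vec)
    (fun k => by simpa using hM.1.act_mem _ _ _ _ (offDiag_mem (-1) _) hM.vec_mem)
  set F : ℤ → Trunc m := fun p => (f.eval (p : ℂ)) • 1 with hF
  have hFv : M.act (offDiag m (-1) F, 0) hM.vec = 0 := by
    have h1 : ((offDiag m (-1) F, 0) : band m × Trunc m) = ∑ k ∈ f.support, f.coeff k • Y k := by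
      have h2 : F = ∑ k ∈ f.support, f.coeff k • fun p : ℤ => ((p : ℂ) ^ k) • (1 : Trunc m) := by
        ext p
        rw [Finset.sum_apply]
        simp only [hF, Polynomial.eval_eq_sum, Polynomial.sum, Finset.sum_smul, Pi.smul_apply,
          smul_smul]
      refine Prod.ext ?_ ?_
      · rw [Prod.fst_sum, h2, map_sum]
        exact Finset.sum_congr rfl fun k _ => map_smul _ _ _
      · rw [Prod.snd_sum]
        simp [Y]
    have h3 : M.act (∑ k ∈ f.support, f.coeff k • Y k : band m × Trunc m) =
        ∑ k ∈ f.support, f.coeff k • M.act (Y k) :=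
      (map_sum M.act _ _).trans (Finset.sum_congr rfl fun k _ => map_smul M.act _ _)
    rw [h1, h3, LinearMap.sum_apply]
    exact hf
  have hcF : ∀ c : ℤ → Trunc m, M.act (offDiag m (-1) fun p => c p * F p, 0) hM.vec = 0 := by
    intro c
    obtain ⟨D, hD, -⟩ := exists_antidifference_int fun p => c (p + 1)
    have h1 : (fun p => (D p - D (p - 1)) * F p) = fun p => c p * F p := by
      ext p
      have := hD (p - 1)
      rw [sub_add_cancel] at this
      rw [this]
    have h2 := hM.1.isRep.apply_apply (offDiag_mem 0 D) (offDiag_mem (-1) F) hM.vec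
    rw [hFv, map_zero, hM.act_deg_zero (offDiag_mem 0 D), map_smul, hFv, smul_zero, smul_zero,
      add_zero, bracket_diag_offDiag, h1] at h2
    exact h2.symm
  obtain ⟨R, hR⟩ : ∃ R : ℕ, ∀ p : ℤ, (R : ℤ) < |p| → f.eval (p : ℂ) ≠ 0 := by
    have hfin : {p : ℤ | f.eval (p : ℂ) = 0}.Finite := by
      refine Set.Finite.of_finite_image (f := fun p : ℤ => (p : ℂ))
        ((f.roots.toFinset.finite_toSet).subset ?_) Int.cast_injective.injOn
      rintro _ ⟨p, hp, rfl⟩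
      simpa [hf0] using hp
    refine ⟨hfin.toFinset.sup Int.natAbs, fun p hp h => ?_⟩
    have h2 : p.natAbs ≤ hfin.toFinset.sup Int.natAbs :=
      Finset.le_sup (f := Int.natAbs) (hfin.mem_toFinset.2 h)
    rw [Int.abs_eq_natAbs] at hp
    omega
  -- Beyond `R` the polynomial has no integer roots; the extra `2` guarantees `e 2 = 0`, as
  -- `bracket_up_offDiag` requires.
  refine ⟨R + 2, fun A hA hrow => ?_⟩
  set δ : ℤ → Trunc m := fun p => A.1 p p with hδ
  have hδ0 : ∀ p : ℤ, |p| ≤ (R : ℤ) + 2 → δ p = 0 := fun p hp => hrow p p (by push_cast; exact hp)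
  obtain ⟨D, hD, hD0⟩ := exists_antidifference_int fun p => ((-1 : ℂ) ^ (p + 1)) • δ p
  -- The alternating sign turns the antidifference into a solution of `e (p + 1) + e p = δ p`.
  set e : ℤ → Trunc m := fun p => ((-1 : ℂ) ^ p) • D p with he
  have hee : ∀ p, e (p + 1) + e p = δ p := by
    intro p
    have h1 : D (p + 1) = D p + ((-1 : ℂ) ^ (p + 1)) • δ p := by rw [← hD p]; abel
    simp only [he]
    rw [h1, smul_add, smul_smul, neg_one_zpow_mul_self, one_smul, zpow_add₀ (by norm_num), zpow_one,
      mul_neg_one, neg_smul]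
    abel
  have he0 : ∀ p : ℤ, |p| ≤ (R : ℤ) + 2 → e p = 0 := by
    intro p hp
    rw [abs_le] at hp
    simp only [he]
    rw [hD0 p (fun i h1 h2 => ?_) (fun i h1 h2 => ?_), smul_zero]
    · rw [hδ0 i (by rw [abs_le]; omega), smul_zero]
    · rw [hδ0 i (by rw [abs_le]; omega), smul_zero]
  have heF : (fun p : ℤ => ((f.eval (p : ℂ))⁻¹ • e p) * F p) = e := by
    ext p
    by_cases hp : |p| ≤ (R : ℤ) + 2
    · rw [he0 p hp, smul_zero, zero_mul]
    · have := hR p (by omega)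
      simp only [hF]
      rw [smul_mul_smul_comm, mul_one, inv_mul_cancel₀ this, one_smul]
  have hev := hcF fun p : ℤ => (f.eval (p : ℂ))⁻¹ • e p
  rw [heF] at hev
  have hbr := bracket_up_offDiag e (he0 2 (by norm_num))
  have hAeq : ((A, 0) : band m × Trunc m) = (offDiag m 0 fun p => e (p + 1) + e p, 0) := by
    refine Prod.ext ?_ rfl
    refine (eq_offDiag (mem_glHat_deg.1 hA).1).trans ?_
    congr 1
    ext p
    rw [hee, add_zero]
  have h0 : (glHat m).bracket (offDiag m 1 fun _ => 1, 0) (offDiag m (-1) e, 0) ∈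
      (glHat m).deg 0 := by
    simpa using hg.bracket_mem _ _ _ _ (offDiag_mem 1 _) (offDiag_mem (-1) e)
  have key := hM.apply_bracket_eq_zero one_pos (offDiag_mem 1 _) (offDiag_mem (-1) e) hev h0
  rw [← key]
  exact congrArg mu (Subtype.ext (hAeq.trans hbr.symm))


/-! ### Submodules generated by a highest weight vector -/

/-- A singular vector of degree zero on which degree zero acts by `mu` generates a highest weight
module. -/
theorem GradedAction.IsGradedModule.exists_generated {g : HalfGraded} (hg : g.IsGraded)
    {V : GradedAction g} (hV : V.IsGradedModule) {mu : Module.Dual ℂ (g.deg 0)} {v : V.carrier}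
    (hv0 : v ≠ 0) (hv : v ∈ V.deg 0) (hdeg : ∀ x : g.deg 0, V.act (x : g.carrier) v = mu x • v)
    (hpos : V.IsSingular v) :
    ∃ (M : GradedAction g) (e : M.carrier →ₗ[ℂ] V.carrier), M.IsHighestWeight mu ∧
      Function.Injective e ∧ (∀ x w, e (M.act x w) = V.act x (e w)) ∧
      (∀ d w, w ∈ M.deg d ↔ e w ∈ V.deg d) ∧
      ∀ w, e w ∈ negSpan V.act (Submodule.span ℂ {v}) := by
  set S := negSpan V.act (Submodule.span ℂ {v}) with hS
  have hvS : v ∈ S := le_negSpan (Submodule.mem_span_singleton_self v)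
  have hinv : ∀ x, ∀ w ∈ S, V.act x w ∈ S := fun x w hw =>
    negSpan_invariant hg hV.isRep (by
      intro d hd x hx w hw
      rw [Submodule.mem_span_singleton] at hw ⊢
      obtain ⟨c, rfl⟩ := hw
      rcases hd.lt_or_eq with hd | rfl
      · exact ⟨0, by rw [zero_smul, map_smul, hpos d hd x hx, smul_zero]⟩
      · refine ⟨c * mu ⟨x, hx⟩, ?_⟩
        rw [map_smul, hdeg ⟨x, hx⟩, smul_smul]) x hw
  -- The generated subspace is spanned by its homogeneous vectors, so it inherits the grading and
  -- the parity operator.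
  have hgr : S ≤ ⨆ d, V.deg d ⊓ S := by
    refine negSpan_le ?_ fun d hd x hx w hw => ?_
    · rw [Submodule.span_singleton_le_iff_mem]
      exact Submodule.mem_iSup_of_mem 0 ⟨hv, hvS⟩
    · refine Submodule.iSup_induction (fun d => V.deg d ⊓ S)
        (motive := fun w => V.act x w ∈ ⨆ d, V.deg d ⊓ S) hw ?_ (by simp) ?_
      · rintro e w ⟨h1, h2⟩
        exact Submodule.mem_iSup_of_mem (d + e) ⟨hV.act_mem _ _ _ _ hx h1, hinv x w h2⟩
      · intro a b ha hb
        rw [map_add]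
        exact add_mem ha hb
  have hpar : ∀ w ∈ S, V.par w ∈ S := by
    intro w hw
    refine Submodule.iSup_induction (fun d => V.deg d ⊓ S)
      (motive := fun w => V.par w ∈ S) (hgr hw) ?_ (by simp) ?_
    · rintro e w ⟨h1, h2⟩
      rw [hV.par_apply e w h1]
      exact S.smul_mem _ h2
    · intro a b ha hb
      rw [map_add]
      exact add_mem ha hb
  have hproj : S ≤ (Submodule.span ℂ {v}).comap (gradedProj hV.internal 0) ⊓
      ⨅ e : {e : ℤ // 0 < e}, LinearMap.ker (gradedProj hV.internal e) := by
    refine negSpan_le ?_ ?_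
    · rw [Submodule.span_singleton_le_iff_mem]
      refine Submodule.mem_inf.2
        ⟨?_, (Submodule.mem_iInf _).2 fun e => gradedProj_ne _ e.2.ne hv⟩
      rw [Submodule.mem_comap, gradedProj_same _ hv]
      exact Submodule.mem_span_singleton_self v
    · intro d hd x hx w hw
      have hw := (Submodule.mem_inf.1 hw).2
      rw [Submodule.mem_iInf] at hw
      have h1 : ∀ e : ℤ, 0 ≤ e → gradedProj hV.internal e (V.act x w) = 0 := by
        intro e he
        have h2 := hV.proj_act hx (e - d) w
        have h3 : gradedProj hV.internal (e - d) w = 0 := hw ⟨e - d, by omega⟩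
        rwa [add_sub_cancel, h3, map_zero] at h2
      refine Submodule.mem_inf.2 ⟨?_, (Submodule.mem_iInf _).2 fun e => h1 e e.2.le⟩
      rw [Submodule.mem_comap, h1 0 le_rfl]
      exact zero_mem _
  let M : GradedAction g :=
    { carrier := S
      deg := fun d => (V.deg d).comap S.subtype
      par := V.par.restrict hpar
      act :=
        { toFun := fun x => (V.act x).restrict (hinv x)
          map_add' := fun x y => LinearMap.ext fun w => Subtype.ext
            (by simp [LinearMap.restrict_apply])
          map_smul' := fun c x => LinearMap.ext fun w => Subtype.ext
            (by simp [LinearMap.restrict_apply]) } }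
  refine ⟨M, S.subtype, ⟨⟨?_, ?_, ?_, ?_⟩, ⟨v, hvS⟩, ?_, ?_, ?_, ?_, ?_⟩,
    S.injective_subtype, fun _ _ => rfl, fun _ _ => Iff.rfl, fun w => w.2⟩
  · rw [DirectSum.isInternal_submodule_iff_iSupIndep_and_iSup_eq_top]
    constructor
    · rw [iSupIndep_def]
      intro i
      rw [Submodule.disjoint_def]
      intro w hw hw'
      have hind := (iSupIndep_def.1 hV.internal.submodule_iSupIndep) i
      rw [Submodule.disjoint_def] at hind
      refine Subtype.ext (hind w.1 hw ?_)
      have : (⨆ (j : ℤ) (_ : j ≠ i), M.deg j) ≤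
          (⨆ (j : ℤ) (_ : j ≠ i), V.deg j).comap S.subtype :=
        iSup₂_le fun j hj => Submodule.comap_mono (le_iSup₂ (f := fun j (_ : j ≠ i) => V.deg j) j hj)
      exact this hw'
    · rw [eq_top_iff]
      rintro ⟨w, hw⟩ -
      refine Submodule.iSup_induction' (fun d => V.deg d ⊓ S)
        (motive := fun w _ => ∀ hw : w ∈ S, (⟨w, hw⟩ : S) ∈ ⨆ d, M.deg d) ?_ ?_ ?_ (hgr hw) hw
      · rintro e w ⟨h1, h2⟩ hw
        exact Submodule.mem_iSup_of_mem e h1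
      · intro hw
        exact zero_mem _
      · intro x y hx hy h1 h2 hw
        have hle : (⨆ d, V.deg d ⊓ S) ≤ S := iSup_le fun d => inf_le_right
        exact add_mem (h1 (hle hx)) (h2 (hle hy))
  · intro d w hw
    exact Subtype.ext (hV.par_apply d w.1 hw)
  · intro i j x w hx hw
    exact hV.act_mem i j x w.1 hx hw
  · intro i j x y hx hy
    refine LinearMap.ext fun w => Subtype.ext ?_
    have := LinearMap.congr_fun (hV.act_bracket i j x y hx hy) w.1
    exact this
  · exact fun h => hv0 (congrArg Subtype.val h)
  · ext w
    rw [Submodule.mem_span_singleton]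
    constructor
    · intro (hw : w.1 ∈ V.deg 0)
      have h1 := (Submodule.mem_inf.1 (hproj w.2)).1
      rw [Submodule.mem_comap, gradedProj_same _ hw, Submodule.mem_span_singleton] at h1
      obtain ⟨c, hc⟩ := h1
      exact ⟨c, Subtype.ext hc⟩
    · rintro ⟨c, rfl⟩
      exact (V.deg 0).smul_mem c hv
  · exact fun x => Subtype.ext (hdeg x)
  · exact fun d hd x hx => Subtype.ext (hpos d hd x hx)
  · intro W hW hst
    have h1 : S ≤ W.map S.subtype := by
      refine negSpan_le ?_ ?_
      · rw [Submodule.span_singleton_le_iff_mem]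
        exact ⟨_, hW, rfl⟩
      · rintro d hd x hx _ ⟨w, hw, rfl⟩
        exact ⟨M.act x w, hst d hd x hx w hw, rfl⟩
    rw [eq_top_iff]
    rintro w -
    obtain ⟨w', hw', h⟩ := h1 w.2
    rwa [← Subtype.ext (show w'.1 = w.1 from h)]


open Filter

/-! ### Compatible weights -/

section Compatible

variable {q ℓ : ℂ} {ι : Type} [Fintype ι] {a : ι → ℂ} {m : ι → ℕ}

variable (q ℓ a m) in
/-- Functionals on `SSq` and on the `glHat (m i)`, vanishing in nonzero degrees, such that the
first one agrees on brackets with the sum of the pull-backs of the others, which are of finite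
support. -/
structure CompatibleWeights (lam : Module.Dual ℂ ((Idx →₀ ℂ) × ℂ))
    (mu : ∀ i, Module.Dual ℂ (band (m i) × Trunc (m i))) : Prop where
  lam_deg : ∀ k : ℤ, k ≠ 0 → ∀ X ∈ (SSq q).deg k, lam X = 0
  mu_deg : ∀ (i) (k : ℤ), k ≠ 0 → ∀ x ∈ (glHat (m i)).deg k, mu i x = 0
  lam_bracket : ∀ (i j : ℤ) (X Y : (Idx →₀ ℂ) × ℂ), i + j = 0 → X ∈ (SSq q).deg i →
    Y ∈ (SSq q).deg j → lam ((SSq q).bracket X Y) =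
      ∑ s, mu s ((glHat (m s)).bracket (phiLin ℓ (a s) (m s) X) (phiLin ℓ (a s) (m s) Y))
  mu_bracket : ∀ s (i j : ℤ), i + j = 0 → ∃ N : ℕ, ∀ x ∈ (glHat (m s)).deg i,
    ∀ y ∈ (glHat (m s)).deg j,
      (RowsVanish N (y : band (m s) × Trunc (m s)).1.1 ∨
        RowsVanish N (x : band (m s) × Trunc (m s)).1.1) →
      mu s ((glHat (m s)).bracket x y) = 0

theorem exists_extend_glHat {M : ℕ} (mu : Module.Dual ℂ ((glHat M).deg 0)) :
    ∃ mu' : band M × Trunc M →ₗ[ℂ] ℂ, (∀ x (hx : x ∈ (glHat M).deg 0), mu' x = mu ⟨x, hx⟩) ∧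
      ∀ k : ℤ, k ≠ 0 → ∀ x ∈ (glHat M).deg k, mu' x = 0 := by
  obtain ⟨mu', h⟩ := exists_extend_gl mu
  refine ⟨mu' ∘ₗ (diagPart 0).prodMap LinearMap.id, fun x hx => ?_, fun k hk x hx => ?_⟩
  · rw [← h]
    refine congrArg mu' (Prod.ext (Subtype.ext ?_) rfl)
    ext p r
    refine (diagPart_apply 0 x.1 p r).trans ?_
    split_ifs with hpr
    · rfl
    · exact ((mem_glHat_deg.1 hx).1 p r hpr).symm
  · have : (diagPart 0).prodMap LinearMap.id x = (0 : band M × Trunc M) := by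
      refine Prod.ext (Subtype.ext ?_) ((mem_glHat_deg.1 hx).2 hk)
      ext p r
      refine (diagPart_apply 0 x.1 p r).trans ?_
      split_ifs with hpr
      · exact (mem_glHat_deg.1 hx).1 p r (by omega)
      · rfl
    exact (congrArg mu' this).trans (map_zero mu')

theorem exists_extend_SSq (lam : Module.Dual ℂ ((SSq q).deg 0)) :
    ∃ lam' : (Idx →₀ ℂ) × ℂ →ₗ[ℂ] ℂ, (∀ x (hx : x ∈ (SSq q).deg 0), lam' x = lam ⟨x, hx⟩) ∧
      ∀ k : ℤ, k ≠ 0 → ∀ x ∈ (SSq q).deg k, lam' x = 0 := by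
  obtain ⟨lam', h⟩ := LinearMap.exists_extend (p := (SSq q).deg 0) lam
  let f : (Idx →₀ ℂ) →ₗ[ℂ] (Idx →₀ ℂ) :=
    (Finsupp.supported ℂ ℂ {x : Idx | x.deg = 0}).subtype ∘ₗ Finsupp.restrictDom ℂ ℂ _
  have hf : ∀ F x, f F x = if x.deg = 0 then F x else 0 := fun F x => by
    simp [f, Finsupp.restrictDom_apply, Finsupp.filter_apply]
  let lam2 : (Idx →₀ ℂ) × ℂ →ₗ[ℂ] ℂ := lam'
  refine ⟨lam2 ∘ₗ f.prodMap LinearMap.id, fun x hx => ?_, fun k hk x hx => ?_⟩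
  · rw [← h]
    refine congrArg lam2 (Prod.ext ?_ rfl)
    ext y
    refine (hf _ _).trans ?_
    split_ifs with hy
    · rfl
    · exact (((mem_SSq_deg q).1 hx).1 y hy).symm
  · have : f.prodMap LinearMap.id x = (0 : (Idx →₀ ℂ) × ℂ) := by
      refine Prod.ext ?_ (((mem_SSq_deg q).1 hx).2 hk)
      ext y
      refine (hf _ _).trans ?_
      split_ifs with hy
      · exact ((mem_SSq_deg q).1 hx).1 y (by omega)
      · rfl
    exact (congrArg lam2 this).trans (map_zero lam2)

/-- The one-dimensional summand disappears because the supertrace kills brackets. Extending all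
functionals by zero to the other degrees allows elements of every degree to be treated uniformly. -/
theorem exists_compatibleWeights (hℓ : Complex.exp ℓ = q)
    (hq : ∀ n : ℤ, n ≠ 0 → Complex.exp (ℓ * n) ≠ 1) {lam : Module.Dual ℂ ((SSq q).deg 0)} {κ : ℂ}
    {mu : ∀ i, Module.Dual ℂ ((glHat (m i)).deg 0)} (hmu : ∀ i, FinSupp (mu i))
    (hlam : lam = SSq.charWeight q κ + ∑ i, SSq.pullWeight q ℓ (a i) (m i) (mu i)) :
    ∃ lam' mu', CompatibleWeights q ℓ a m lam' mu' ∧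
      (∀ x (hx : x ∈ (SSq q).deg 0), lam' x = lam ⟨x, hx⟩) ∧
      ∀ i x (hx : x ∈ (glHat (m i)).deg 0), mu' i x = mu i ⟨x, hx⟩ := by
  obtain ⟨lam', hl, hl'⟩ := exists_extend_SSq lam
  choose mu' hm hm' using fun i => exists_extend_glHat (mu i)
  refine ⟨lam', mu', ⟨hl', hm', fun i j X Y hij hX hY => ?_, fun s i j hij => ?_⟩, hl, hm⟩
  · have hb : (SSq q).bracket X Y ∈ (SSq q).deg 0 :=
      hij ▸ (SSq_isGraded q).bracket_mem i j X Y hX hY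
    have h1 : SSq.charWeight q κ ⟨_, hb⟩ = 0 :=
      (congrArg (κ * ·) (SSq.strZero_bracket X Y)).trans (mul_zero κ)
    rw [hl _ hb, hlam, LinearMap.add_apply, LinearMap.sum_apply, h1, zero_add]
    exact Finset.sum_congr rfl fun s _ => (hm s _ (phiLin_deg (ℓ := ℓ) (a s) (m s) hb)).symm.trans
      (congrArg (mu' s) (phiHat_bracket (a := a s) (m := m s) hℓ hq X Y))
  · obtain rfl : j = -i := by omega
    obtain ⟨N, hN⟩ := (hmu s).exists_bracket_eq_zero i
    refine ⟨N, fun x hx y hy hr => ?_⟩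
    have h0 : (glHat (m s)).bracket x y ∈ (glHat (m s)).deg 0 :=
      hij ▸ (glHat_isGraded (m s)).bracket_mem _ _ _ _ hx hy
    rw [hm s _ h0, hN x y hx hy hr h0]

namespace CompatibleWeights

variable {lam : Module.Dual ℂ ((Idx →₀ ℂ) × ℂ)}
  {mu : ∀ i, Module.Dual ℂ (band (m i) × Trunc (m i))} (h : CompatibleWeights q ℓ a m lam mu)
include h

theorem eventually_mu_bracket (i j : ℤ) (hij : i + j = 0) : ∀ᶠ N : ℕ in atTop, ∀ s,
    ∀ x ∈ (glHat (m s)).deg i, ∀ y ∈ (glHat (m s)).deg j,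
      (RowsVanish N (y : band (m s) × Trunc (m s)).1.1 ∨
        RowsVanish N (x : band (m s) × Trunc (m s)).1.1) →
      mu s ((glHat (m s)).bracket x y) = 0 := by
  rw [eventually_all]
  intro s
  obtain ⟨N, hN⟩ := h.mu_bracket s i j hij
  filter_upwards [eventually_ge_atTop N] with N' hN' x hx y hy hr
  exact hN x hx y hy (hr.imp (fun h => h.mono hN') fun h => h.mono hN')

/-- Brackets of elements one of which is small at every point. -/
theorem eventually_lam_bracket (i j : ℤ) : ∀ᶠ N : ℕ in atTop, ∀ X ∈ (SSq q).deg i,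
    ∀ Y ∈ (SSq q).deg j, (∀ s, RowsVanish N (phiLin ℓ (a s) (m s) Y).1.1 ∨
      RowsVanish N (phiLin ℓ (a s) (m s) X).1.1) → lam ((SSq q).bracket X Y) = 0 := by
  by_cases hij : i + j = 0
  · filter_upwards [h.eventually_mu_bracket i j hij] with N hN X hX Y hY hr
    rw [h.lam_bracket i j X Y hij hX hY]
    exact Finset.sum_eq_zero fun s _ => hN s _ (phiLin_deg (ℓ := ℓ) (a s) (m s) hX) _
      (phiLin_deg (ℓ := ℓ) (a s) (m s) hY) (hr s)
  · exact Eventually.of_forall fun N X hX Y hY _ =>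
      h.lam_deg _ hij _ ((SSq_isGraded q).bracket_mem _ _ _ _ hX hY)

variable {L : GradedAction (SSq q)} {lam0 : Module.Dual ℂ ((SSq q).deg 0)}

/-- An instance of `IsL.locally_trivial` for `L` itself. In degree zero small elements act by the
scalar `lam X`, which need not vanish; this is the origin of the scalar correction in the limit
action. -/
theorem eventually_act (hℓ : Complex.exp ℓ = q) (hq : ∀ n : ℤ, n ≠ 0 → Complex.exp (ℓ * n) ≠ 1)
    (hL : L.IsL lam0) (hlam : ∀ x (hx : x ∈ (SSq q).deg 0), lam x = lam0 ⟨x, hx⟩)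
    (u : L.carrier) (k : ℤ) :
    ∀ᶠ N : ℕ in atTop, ∀ X ∈ ssVanish q ℓ a m N k, L.act X u = lam X • u := by
  obtain ⟨N0, hN0⟩ := hL.locally_trivial (SSq_isGraded q) lam (fun x => hlam x.1 x.2)
    (ssVanish q ℓ a m) (fun N k X hX => hX.1) (fun N N' k hN => ssVanish_anti hN k)
    (fun j => ⟨j.natAbs, fun N k x hx X hX => ssVanish_bracket hℓ hq hx hX⟩)
    (fun j => by
      obtain ⟨N, hN⟩ := (h.eventually_lam_bracket j (-j)).exists
      exact ⟨N, fun x hx X hX => hN x hx X hX.1 fun s => Or.inl (hX.2 s)⟩) u k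
  filter_upwards [eventually_ge_atTop N0] with N hN X hX
  refine (hN0 N hN X hX).trans ?_
  split_ifs with hk
  · rfl
  · rw [h.lam_deg k hk X hX.1]

end CompatibleWeights

end Compatible

/-! ### Approximation -/

section Approximation

variable {q ℓ : ℂ} {ι : Type} {a : ι → ℂ} {m : ι → ℕ}

variable (q ℓ a m) in
/-- The elements of degree `k` whose images under all `phiHat` agree with `y` near the origin. -/
def ApproxSet (N : ℕ) (k : ℤ) (y : Π i, band (m i) × Trunc (m i)) : Set ((Idx →₀ ℂ) × ℂ) :=
  {X | X ∈ (SSq q).deg k ∧ ∀ i, RowsVanish N ((phiLin ℓ (a i) (m i) X).1.1 - (y i).1.1)}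

theorem ApproxSet.mono {N N' : ℕ} (h : N ≤ N') {k : ℤ} {y : Π i, band (m i) × Trunc (m i)}
    {X : (Idx →₀ ℂ) × ℂ} (hX : X ∈ ApproxSet q ℓ a m N' k y) : X ∈ ApproxSet q ℓ a m N k y :=
  ⟨hX.1, fun i => (hX.2 i).mono h⟩

theorem ApproxSet.sub_mem {N : ℕ} {k : ℤ} {y : Π i, band (m i) × Trunc (m i)}
    {X Y : (Idx →₀ ℂ) × ℂ} (hX : X ∈ ApproxSet q ℓ a m N k y)
    (hY : Y ∈ ApproxSet q ℓ a m N k y) : X - Y ∈ ssVanish q ℓ a m N k := by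
  refine ⟨Submodule.sub_mem _ hX.1 hY.1, fun i p r hp => ?_⟩
  have h1 := hX.2 i p r hp
  have h2 := hY.2 i p r hp
  rw [Pi.sub_apply, Pi.sub_apply, sub_eq_zero] at h1 h2
  exact (congrArg (fun W : band _ × Trunc _ => W.1.1 p r)
    (map_sub (phiLin ℓ (a i) (m i)) X Y)).trans (sub_eq_zero.2 (h1.trans h2.symm))

theorem exists_mem_approxSet [Fintype ι] (hℓ0 : ℓ ≠ 0)
    (hq : ∀ n : ℤ, n ≠ 0 → Complex.exp (ℓ * n) ≠ 1)
    (ha : ∀ i j, i ≠ j → ¬ Cong ℓ (a i) (a j)) (N : ℕ) (k : ℤ)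
    {y : Π i, band (m i) × Trunc (m i)} (hy : ∀ i, y i ∈ (glHat (m i)).deg k) :
    ∃ X, X ∈ ApproxSet q ℓ a m N k y :=
  exists_approx hℓ0 hq ha N k (fun i => (y i).1) fun i => (mem_glHat_deg.1 (hy i)).1

/-- The bracket in the product of the `glHat (m i)`. -/
def piBracket (y z : Π i, band (m i) × Trunc (m i)) : Π i, band (m i) × Trunc (m i) :=
  fun i => (glHat (m i)).bracket (y i) (z i)

theorem ApproxSet.bracket (hℓ : Complex.exp ℓ = q)
    (hq : ∀ n : ℤ, n ≠ 0 → Complex.exp (ℓ * n) ≠ 1) {N : ℕ} {i j : ℤ}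
    {y z : Π i, band (m i) × Trunc (m i)} (hy : ∀ s, y s ∈ (glHat (m s)).deg i)
    {X Y : (Idx →₀ ℂ) × ℂ} (hX : X ∈ ApproxSet q ℓ a m (N + j.natAbs) i y)
    (hY : Y ∈ ApproxSet q ℓ a m (N + i.natAbs) j z) :
    (SSq q).bracket X Y ∈ ApproxSet q ℓ a m N (i + j) (piBracket y z) := by
  refine ⟨(SSq_isGraded q).bracket_mem _ _ _ _ hX.1 hY.1, fun s => ?_⟩
  set A := (phiLin ℓ (a s) (m s) X).1 with hA
  set B := (phiLin ℓ (a s) (m s) Y).1 with hB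
  have h1 := phiLin_bracket_fst hℓ hq (a s) (m s) X Y
  -- The error of a bracket splits into one term for the error of each argument, `[A, B] - [y, z] =
  -- [A - y, B] + [y, B - z]`.
  have h2 : superComm A.1 B.1 - superComm (y s).1.1 (z s).1.1 =
      superComm (A.1 - (y s).1.1) B.1 + superComm (y s).1.1 (B.1 - (z s).1.1) := by
    have e1 := superComm_add_left (Submodule.sub_mem _ A.2 (y s).1.2) (y s).1.2 B.1
    have e2 := superComm_add_right (y s).1.2 (B.1 - (z s).1.1) (z s).1.1
    rw [sub_add_cancel] at e1 e2
    rw [e1, e2]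
    abel
  have h3 := (hX.2 s).superComm_left (mem_glHat_deg.1 (phiLin_deg (ℓ := ℓ) (a s) (m s) hY.1)).1
  have h4 := (hY.2 s).superComm_right (mem_glHat_deg.1 (hy s)).1
  intro p r hp
  refine (congrFun (congrFun (congrArg₂ (· - ·) h1 rfl) p) r).trans ?_
  refine (congrFun (congrFun h2 p) r).trans ?_
  rw [Pi.add_apply, Pi.add_apply, h3 p r hp, h4 p r hp, add_zero]

end Approximation


/-! ### The limit action -/

section LimitAction

open Filter

variable {q ℓ : ℂ} {ι : Type} {a : ι → ℂ} {m : ι → ℕ}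

variable (m) in
/-- The `k`-th diagonals. -/
def diagRows (k : ℤ) : (Π i, band (m i) × Trunc (m i)) →ₗ[ℂ] Π i, ℤ → Trunc (m i) where
  toFun y i p := (y i).1.1 p (p + k)
  map_add' _ _ := rfl
  map_smul' _ _ := rfl

theorem diagRows_eq_zero {k k' : ℤ} (hk : k ≠ k') {y : Π i, band (m i) × Trunc (m i)}
    (hy : ∀ i, y i ∈ (glHat (m i)).deg k) : diagRows m k' y = 0 := by
  ext i p
  exact (mem_glHat_deg.1 (hy i)).1 p (p + k') (by omega)

theorem single_mem_glHat_deg [DecidableEq ι] {i : ι} {k : ℤ} {x : band (m i) × Trunc (m i)}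
    (hx : x ∈ (glHat (m i)).deg k) (j : ι) :
    (Pi.single i x : Π i, band (m i) × Trunc (m i)) j ∈ (glHat (m j)).deg k := by
  by_cases hj : j = i
  · subst hj
    exact (congrArg (· ∈ (glHat (m j)).deg k)
      (Pi.single_eq_same (M := fun i => band (m i) × Trunc (m i)) j x)).mpr hx
  · exact (congrArg (· ∈ (glHat (m j)).deg k)
      (Pi.single_eq_of_ne (M := fun i => band (m i) × Trunc (m i)) hj x)).mpr (zero_mem _)

variable [Fintype ι]

/-- The limit action exists: homogeneous tuples of matrices act on a vector of an irreducible
module as their close approximations do, up to a scalar fixed by the weights. -/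
theorem CompatibleWeights.exists_limitAction {lam : Module.Dual ℂ ((Idx →₀ ℂ) × ℂ)}
    {mu : ∀ i, Module.Dual ℂ (band (m i) × Trunc (m i))} (h : CompatibleWeights q ℓ a m lam mu)
    {L : GradedAction (SSq q)} {lam0 : Module.Dual ℂ ((SSq q).deg 0)}
    (hℓ0 : ℓ ≠ 0) (hℓ : Complex.exp ℓ = q) (hq : ∀ n : ℤ, n ≠ 0 → Complex.exp (ℓ * n) ≠ 1)
    (ha : ∀ i j, i ≠ j → ¬ Cong ℓ (a i) (a j))
    (hL : L.IsL lam0) (hlam : ∀ x (hx : x ∈ (SSq q).deg 0), lam x = lam0 ⟨x, hx⟩) :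
    ∃ T : (Π i, band (m i) × Trunc (m i)) →ₗ[ℂ] Module.End ℂ L.carrier,
      ∀ (k : ℤ) (y : Π i, band (m i) × Trunc (m i)) (u : L.carrier),
        (∀ i, y i ∈ (glHat (m i)).deg k) → ∀ᶠ N : ℕ in atTop, ∀ X ∈ ApproxSet q ℓ a m N k y,
          T y u = L.act X u + (∑ i, mu i (y i) - lam X) • u := by
  classical
  choose s hs using exists_section (q := q) (m := m) hℓ0 hq ha
  let ρ : (Idx →₀ ℂ) × ℂ →ₗ[ℂ] Module.End ℂ L.carrier := L.act
  -- Linear in `y` because the approximations come from linear sections. Only the degrees up to `N`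
  -- are used, and the last summand exchanges the scalar `lam` of the approximation for the
  -- prescribed `mu`.
  let F : ℕ → (Π i, band (m i) × Trunc (m i)) →ₗ[ℂ] Module.End ℂ L.carrier := fun N =>
    (∑ k ∈ Finset.Icc (-(N : ℤ)) N, ρ ∘ₗ s N k ∘ₗ diagRows m k) +
      ((∑ i, mu i ∘ₗ LinearMap.proj i) - lam ∘ₗ s N 0 ∘ₗ diagRows m 0).smulRight 1
  have hF : ∀ (N : ℕ) (k : ℤ) (y : Π i, band (m i) × Trunc (m i)) (u : L.carrier),
      (∀ i, y i ∈ (glHat (m i)).deg k) → |k| ≤ N →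
      F N y u = ρ (s N k (diagRows m k y)) u +
        (∑ i, mu i (y i) - lam (s N k (diagRows m k y))) • u := by
    intro N k y u hy hkN
    have h1 : lam (s N 0 (diagRows m 0 y)) = lam (s N k (diagRows m k y)) := by
      by_cases hk : k = 0
      · rw [hk]
      · rw [diagRows_eq_zero hk hy, map_zero, map_zero, h.lam_deg k hk _ (hs N k _).1]
    have h2 : (∑ k ∈ Finset.Icc (-(N : ℤ)) N, ρ ∘ₗ s N k ∘ₗ diagRows m k) y =
        ρ (s N k (diagRows m k y)) := by
      rw [LinearMap.sum_apply, Finset.sum_eq_single k]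
      · rfl
      · intro k' _ hk'
        rw [LinearMap.comp_apply, LinearMap.comp_apply, diagRows_eq_zero hk'.symm hy, map_zero,
          map_zero]
      · intro hk
        exact absurd (Finset.mem_Icc.2 (abs_le.1 hkN)) hk
    simp only [F, LinearMap.add_apply, h2, LinearMap.smulRight_apply, LinearMap.sub_apply,
      LinearMap.sum_apply, LinearMap.comp_apply, h1, LinearMap.smul_apply, LinearMap.proj_apply,
      Module.End.one_apply]
  have happ : ∀ (N : ℕ) (k : ℤ) (y : Π i, band (m i) × Trunc (m i)),
      (∀ i, y i ∈ (glHat (m i)).deg k) → s N k (diagRows m k y) ∈ ApproxSet q ℓ a m N k y := by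
    intro N k y hy
    obtain ⟨h1, h2⟩ := hs N k (diagRows m k y)
    refine ⟨h1, fun i p r hp => ?_⟩
    rw [Pi.sub_apply, Pi.sub_apply]
    by_cases hr : r - p = k
    · obtain rfl : r = p + k := by omega
      exact sub_eq_zero.2 (h2 i p hp)
    · rw [(mem_glHat_deg.1 (hy i)).1 p r hr,
        (mem_glHat_deg.1 (phiLin_deg (ℓ := ℓ) (a i) (m i) h1)).1 p r hr, sub_zero]
  -- Two good approximations differ by an element that acts on `u` as the scalar `lam`, and this is
  -- just what the correction compensates.
  have key : ∀ (k : ℤ) (y : Π i, band (m i) × Trunc (m i)) (u : L.carrier),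
      (∀ i, y i ∈ (glHat (m i)).deg k) → ∃ t, ∀ᶠ N : ℕ in atTop, F N y u = t ∧
        ∀ X ∈ ApproxSet q ℓ a m N k y, t = L.act X u + (∑ i, mu i (y i) - lam X) • u := by
    intro k y u hy
    obtain ⟨N0, hN0⟩ := (h.eventually_act hℓ hq hL hlam u k).exists
    set X0 := s N0 k (diagRows m k y)
    have hX0 := happ N0 k y hy
    have h1 : ∀ X ∈ ApproxSet q ℓ a m N0 k y, ρ X0 u + (∑ i, mu i (y i) - lam X0) • u =
        ρ X u + (∑ i, mu i (y i) - lam X) • u := by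
      intro X hX
      have h2 : ρ (X - X0) u = lam (X - X0) • u := hN0 _ (ApproxSet.sub_mem hX hX0)
      rw [map_sub, map_sub, LinearMap.sub_apply, sub_smul, sub_eq_iff_eq_add] at h2
      rw [h2, sub_smul, sub_smul]
      abel
    refine ⟨ρ X0 u + (∑ i, mu i (y i) - lam X0) • u, ?_⟩
    filter_upwards [eventually_ge_atTop N0, eventually_ge_atTop k.natAbs] with N hN hk
    refine ⟨?_, fun X hX => h1 X (ApproxSet.mono hN hX)⟩
    rw [hF N k y u hy (by rw [Int.abs_eq_natAbs]; exact_mod_cast hk)]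
    exact (h1 _ (ApproxSet.mono hN (happ N k y hy))).symm
  have hlim : ∀ y u, ∃ t, ∀ᶠ N : ℕ in atTop, F N y u = t := by
    intro y u
    have hadd : ∀ y z, (∃ t, ∀ᶠ N : ℕ in atTop, F N y u = t) →
        (∃ t, ∀ᶠ N : ℕ in atTop, F N z u = t) → ∃ t, ∀ᶠ N : ℕ in atTop, F N (y + z) u = t := by
      rintro y z ⟨t, ht⟩ ⟨t', ht'⟩
      refine ⟨t + t', ?_⟩
      filter_upwards [ht, ht'] with N h1 h2
      rw [map_add, LinearMap.add_apply, h1, h2]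
    have hzero : ∃ t, ∀ᶠ N : ℕ in atTop, F N 0 u = t :=
      ⟨0, Eventually.of_forall fun N => by rw [map_zero, LinearMap.zero_apply]⟩
    have hsingle : ∀ i x, ∃ t, ∀ᶠ N : ℕ in atTop, F N (Pi.single i x) u = t := by
      intro i x
      refine Submodule.iSup_induction (glHat (m i)).deg
        (motive := fun x : band (m i) × Trunc (m i) =>
          ∃ t, ∀ᶠ N : ℕ in atTop, F N (Pi.single i x) u = t)
        (by rw [(glHat_isGraded (m i)).iSup_deg]; trivial) (fun d x hx => ?_) ?_ ?_
      · obtain ⟨t, ht⟩ := key d (Pi.single i x) u (single_mem_glHat_deg hx)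
        exact ⟨t, ht.mono fun N h => h.1⟩
      · exact (Pi.single_zero (M := fun i => band (m i) × Trunc (m i)) i).symm ▸ hzero
      · intro x z hx hz
        exact (Pi.single_add (f := fun i => band (m i) × Trunc (m i)) i x z).symm ▸ hadd _ _ hx hz
    rw [← Finset.univ_sum_single y]
    exact Finset.sum_induction _ (fun y => ∃ t, ∀ᶠ N : ℕ in atTop, F N y u = t) hadd hzero
      fun i _ => hsingle i _
  obtain ⟨T, hT⟩ := exists_eventual_limit F hlim
  refine ⟨T, fun k y u hy => ?_⟩
  obtain ⟨t, ht⟩ := key k y u hy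
  have hTt : T y u = t := by
    obtain ⟨N, h1, h2⟩ := ((hT y u).and ht).exists
    exact h1.symm.trans h2.1
  filter_upwards [ht] with N hN X hX
  rw [hTt]
  exact hN.2 X hX

end LimitAction


/-! ### The tensor factors inside an irreducible module -/

section Factors

open Filter

variable {q ℓ : ℂ} {ι : Type} {a : ι → ℂ} {m : ι → ℕ} [Fintype ι]
  {lam : Module.Dual ℂ ((Idx →₀ ℂ) × ℂ)} {mu : ∀ i, Module.Dual ℂ (band (m i) × Trunc (m i))}
  {L : GradedAction (SSq q)} {lam0 : Module.Dual ℂ ((SSq q).deg 0)}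

/-- For close approximations the scalar correction of a bracket is zero, since finitely supported
weights ignore the errors. This is why the limit is a representation and not merely a projective
one. -/
theorem CompatibleWeights.eventually_bracket_eq (h : CompatibleWeights q ℓ a m lam mu) {i j : ℤ}
    {y z : Π i, band (m i) × Trunc (m i)} (hy : ∀ s, y s ∈ (glHat (m s)).deg i)
    (hz : ∀ s, z s ∈ (glHat (m s)).deg j) :
    ∀ᶠ N : ℕ in atTop, ∀ X ∈ ApproxSet q ℓ a m N i y, ∀ Y ∈ ApproxSet q ℓ a m N j z,
      ∑ s, mu s (piBracket y z s) - lam ((SSq q).bracket X Y) = 0 := by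
  by_cases hij : i + j = 0
  · filter_upwards [h.eventually_mu_bracket i j hij] with N hN X hX Y hY
    rw [h.lam_bracket i j X Y hij hX.1 hY.1, ← Finset.sum_sub_distrib]
    refine Finset.sum_eq_zero fun s _ => ?_
    have hXd := phiLin_deg (ℓ := ℓ) (a s) (m s) hX.1
    have hYd := phiLin_deg (ℓ := ℓ) (a s) (m s) hY.1
    set A : band (m s) × Trunc (m s) := phiLin ℓ (a s) (m s) X
    set B : band (m s) × Trunc (m s) := phiLin ℓ (a s) (m s) Y
    have h1 : mu s (glBracket (m s) (A - y s) B) = 0 :=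
      hN s _ (Submodule.sub_mem _ hXd (hy s)) _ hYd (Or.inr (hX.2 s))
    have h2 : mu s (glBracket (m s) (y s) (B - z s)) = 0 :=
      hN s _ (hy s) _ (Submodule.sub_mem _ hYd (hz s)) (Or.inl (hY.2 s))
    rw [map_sub, LinearMap.sub_apply, map_sub, sub_eq_zero] at h1
    rw [map_sub, map_sub, sub_eq_zero] at h2
    exact sub_eq_zero.2 (h2.symm.trans h1.symm)
  · refine Eventually.of_forall fun N X hX Y hY => ?_
    rw [h.lam_deg _ hij _ ((SSq_isGraded q).bracket_mem _ _ _ _ hX.1 hY.1), sub_zero]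
    exact Finset.sum_eq_zero fun s _ => h.mu_deg s _ hij _
      ((glHat_isGraded (m s)).bracket_mem _ _ _ _ (hy s) (hz s))

variable (q ℓ a m L lam mu) in
/-- `T` is the limit of the actions of approximations. -/
def IsLimitAction (T : (Π i, band (m i) × Trunc (m i)) →ₗ[ℂ] Module.End ℂ L.carrier) : Prop :=
  ∀ (k : ℤ) (y : Π i, band (m i) × Trunc (m i)) (u : L.carrier),
    (∀ i, y i ∈ (glHat (m i)).deg k) → ∀ᶠ N : ℕ in atTop, ∀ X ∈ ApproxSet q ℓ a m N k y,
      T y u = L.act X u + (∑ i, mu i (y i) - lam X) • u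

namespace IsLimitAction

variable {T : (Π i, band (m i) × Trunc (m i)) →ₗ[ℂ] Module.End ℂ L.carrier}
  (hT : IsLimitAction q ℓ a m lam mu L T) (h : CompatibleWeights q ℓ a m lam mu)
  (hℓ0 : ℓ ≠ 0) (hℓ : Complex.exp ℓ = q) (hq : ∀ n : ℤ, n ≠ 0 → Complex.exp (ℓ * n) ≠ 1)
  (ha : ∀ i j, i ≠ j → ¬ Cong ℓ (a i) (a j)) (hL : L.IsL lam0)
include hT hℓ0 hq ha hL

theorem act_vec (hlam : ∀ x (hx : x ∈ (SSq q).deg 0), lam x = lam0 ⟨x, hx⟩)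
    {y : Π i, band (m i) × Trunc (m i)} (hy : ∀ s, y s ∈ (glHat (m s)).deg 0) :
    T y hL.1.vec = (∑ s, mu s (y s)) • hL.1.vec := by
  obtain ⟨N, e⟩ := (hT 0 y hL.1.vec hy).exists
  obtain ⟨X, hX⟩ := exists_mem_approxSet (q := q) hℓ0 hq ha N 0 hy
  rw [e X hX, hL.1.act_deg_zero hX.1, hlam X hX.1, sub_smul]
  abel

include h

theorem bracket (hℓ : Complex.exp ℓ = q) {i j : ℤ} {y z : Π i, band (m i) × Trunc (m i)}
    (hy : ∀ s, y s ∈ (glHat (m s)).deg i) (hz : ∀ s, z s ∈ (glHat (m s)).deg j) :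
    T (piBracket y z) = T y * T z - ((-1 : ℂ) ^ (i * j)) • (T z * T y) := by
  refine LinearMap.ext fun u => ?_
  have hyz : ∀ s, piBracket y z s ∈ (glHat (m s)).deg (i + j) := fun s =>
    (glHat_isGraded (m s)).bracket_mem _ _ _ _ (hy s) (hz s)
  obtain ⟨N, e1, e2, e3, e4, e5, e6⟩ := ((hT i y u hy).and ((hT j z u hz).and
    ((hT i y (T z u) hy).and ((hT j z (T y u) hz).and ((hT (i + j) _ u hyz).and
      (h.eventually_bracket_eq hy hz)))))).exists
  obtain ⟨X, hX⟩ := exists_mem_approxSet (q := q) hℓ0 hq ha (N + j.natAbs) i hy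
  obtain ⟨Y, hY⟩ := exists_mem_approxSet (q := q) hℓ0 hq ha (N + i.natAbs) j hz
  have hX' := ApproxSet.mono (Nat.le_add_right _ _) hX
  have hY' := ApproxSet.mono (Nat.le_add_right _ _) hY
  have hb := e5 _ (ApproxSet.bracket hℓ hq hy hX hY)
  rw [e6 X hX' Y hY', zero_smul, add_zero, hL.1.1.act_bracket i j X Y hX.1 hY.1] at hb
  have h1 := e1 X hX'
  have h2 := e2 Y hY'
  have h3 := e3 X hX'
  have h4 := e4 Y hY'
  have hα : i ≠ 0 → ∑ s, mu s (y s) - lam X = 0 := fun hi => by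
    rw [h.lam_deg i hi X hX.1, sub_zero]
    exact Finset.sum_eq_zero fun s _ => h.mu_deg s i hi _ (hy s)
  have hβ : j ≠ 0 → ∑ s, mu s (z s) - lam Y = 0 := fun hj => by
    rw [h.lam_deg j hj Y hY.1, sub_zero]
    exact Finset.sum_eq_zero fun s _ => h.mu_deg s j hj _ (hz s)
  set α := ∑ s, mu s (y s) - lam X
  set β := ∑ s, mu s (z s) - lam Y
  simp only [LinearMap.sub_apply, Module.End.mul_apply, LinearMap.smul_apply] at hb ⊢
  rw [hb, h3, h4, h1, h2]
  simp only [map_add, map_smul]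
  -- The corrections `α` and `β` vanish in nonzero degrees. If one degree is zero the sign is `1`,
  -- and scalars drop out of the commutator.
  by_cases hij : i = 0 ∨ j = 0
  · have hs : (-1 : ℂ) ^ (i * j) = 1 := by
      rcases hij with rfl | rfl <;> simp
    rw [hs]
    module
  · rw [not_or] at hij
    rw [hα hij.1, hβ hij.2]
    simp

theorem act_mem {k d : ℤ} {y : Π i, band (m i) × Trunc (m i)}
    (hy : ∀ s, y s ∈ (glHat (m s)).deg k) {u : L.carrier} (hu : u ∈ L.deg d) :
    T y u ∈ L.deg (k + d) := by
  obtain ⟨N, e⟩ := (hT k y u hy).exists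
  obtain ⟨X, hX⟩ := exists_mem_approxSet (q := q) hℓ0 hq ha N k hy
  rw [e X hX]
  refine Submodule.add_mem _ (hL.1.1.act_mem _ _ _ _ hX.1 hu) ?_
  by_cases hk : k = 0
  · subst hk
    rw [zero_add]
    exact Submodule.smul_mem _ _ hu
  · rw [h.lam_deg k hk X hX.1, sub_zero, Finset.sum_eq_zero fun s _ => h.mu_deg s k hk _ (hy s),
      zero_smul]
    exact zero_mem _

theorem act_vec_pos {k : ℤ} (hk : 0 < k) {y : Π i, band (m i) × Trunc (m i)}
    (hy : ∀ s, y s ∈ (glHat (m s)).deg k) : T y hL.1.vec = 0 := by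
  obtain ⟨N, e⟩ := (hT k y hL.1.vec hy).exists
  obtain ⟨X, hX⟩ := exists_mem_approxSet (q := q) hℓ0 hq ha N k hy
  rw [e X hX, hL.1.act_pos hk hX.1, zero_add, h.lam_deg k hk.ne' X hX.1, sub_zero,
    Finset.sum_eq_zero fun s _ => h.mu_deg s k hk.ne' _ (hy s), zero_smul]

end IsLimitAction

variable [DecidableEq ι]

section FactorAction

omit [Fintype ι]

variable (L) in
/-- The action of one of the `glHat (m r)` obtained from a limit action. -/
def factorAction (T : (Π i, band (m i) × Trunc (m i)) →ₗ[ℂ] Module.End ℂ L.carrier) (r : ι) :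
    GradedAction (glHat (m r)) where
  carrier := L.carrier
  deg := L.deg
  par := L.par
  act := T ∘ₗ LinearMap.single ℂ (fun i => band (m i) × Trunc (m i)) r

theorem piBracket_single (r : ι) (x y : band (m r) × Trunc (m r)) :
    piBracket (Pi.single r x) (Pi.single r y) =
      (Pi.single r ((glHat (m r)).bracket x y) : Π i, band (m i) × Trunc (m i)) := by
  funext i
  rw [piBracket]
  by_cases hi : i = r
  · subst hi
    rw [Pi.single_eq_same, Pi.single_eq_same]
    exact (Pi.single_eq_same (M := fun i => band (m i) × Trunc (m i)) i _).symm
  · rw [Pi.single_eq_of_ne hi, Pi.single_eq_of_ne hi]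
    exact (map_zero (glBracket (m i) 0)).trans
      (Pi.single_eq_of_ne (M := fun i => band (m i) × Trunc (m i)) hi _).symm

end FactorAction

theorem sum_apply_single (mu : ∀ i, Module.Dual ℂ (band (m i) × Trunc (m i))) (r : ι)
    (x : band (m r) × Trunc (m r)) :
    ∑ s, mu s ((Pi.single r x : Π i, band (m i) × Trunc (m i)) s) = mu r x := by
  rw [Finset.sum_eq_single r]
  · rw [Pi.single_eq_same]
  · intro s _ hs
    rw [Pi.single_eq_of_ne hs, map_zero]
  · intro hr
    exact absurd (Finset.mem_univ r) hr

namespace IsLimitAction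

variable {T : (Π i, band (m i) × Trunc (m i)) →ₗ[ℂ] Module.End ℂ L.carrier}
  (hT : IsLimitAction q ℓ a m lam mu L T) (h : CompatibleWeights q ℓ a m lam mu)
  (hℓ0 : ℓ ≠ 0) (hℓ : Complex.exp ℓ = q) (hq : ∀ n : ℤ, n ≠ 0 → Complex.exp (ℓ * n) ≠ 1)
  (ha : ∀ i j, i ≠ j → ¬ Cong ℓ (a i) (a j)) (hL : L.IsL lam0)
include hT h hℓ0 hq ha hL hℓ

theorem factorAction_isGradedModule (r : ι) : (factorAction L T r).IsGradedModule where
  internal := hL.1.1.internal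
  par_apply := hL.1.1.par_apply
  act_mem i j x u hx hu :=
    hT.act_mem h hℓ0 hq ha hL (single_mem_glHat_deg (m := m) hx) hu
  act_bracket i j x y hx hy := by
    have := hT.bracket h hℓ0 hq ha hL hℓ (single_mem_glHat_deg (m := m) hx)
      (single_mem_glHat_deg (m := m) hy)
    exact (congrArg T (piBracket_single r x y)).symm.trans this

/-- Elements that are small at one point kill the vectors of the corresponding factor. -/
theorem eventually_act_eq_zero (hlam : ∀ x (hx : x ∈ (SSq q).deg 0), lam x = lam0 ⟨x, hx⟩) (r : ι)
    {w : L.carrier} (hw : w ∈ negSpan (factorAction L T r).act (Submodule.span ℂ {hL.1.vec}))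
    {k : ℤ} (hk : 0 < k) : ∀ᶠ N : ℕ in atTop, ∀ Y ∈ (SSq q).deg k,
      RowsVanish N (phiLin ℓ (a r) (m r) Y).1.1 → L.act Y w = 0 := by
  let W : Submodule ℂ L.carrier :=
    { carrier := {w | ∀ k : ℤ, 0 < k → ∀ᶠ N : ℕ in atTop, ∀ Y ∈ (SSq q).deg k,
        RowsVanish N (phiLin ℓ (a r) (m r) Y).1.1 → L.act Y w = 0}
      zero_mem' := fun k hk => Eventually.of_forall fun N Y _ _ => map_zero _
      add_mem' := fun {u v} hu hv k hk => by
        filter_upwards [hu k hk, hv k hk] with N h1 h2 Y hY hr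
        rw [map_add, h1 Y hY hr, h2 Y hY hr, add_zero]
      smul_mem' := fun c u hu k hk => by
        filter_upwards [hu k hk] with N h1 Y hY hr
        rw [map_smul, h1 Y hY hr, smul_zero] }
  suffices hle : negSpan (factorAction L T r).act (Submodule.span ℂ {hL.1.vec}) ≤ W from hle hw k hk
  refine negSpan_le ?_ ?_
  · exact (Submodule.span_singleton_le_iff_mem _ _).2 fun k hk => Eventually.of_forall fun N Y hY _ => hL.1.act_pos hk hY
  · intro e he (x : band (m r) × Trunc (m r)) hx (u : L.carrier) hu k hk
    -- On `u`, the matrix `x` acts as an approximation `Z` up to a scalar, with `Z` small at all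
    -- points other than `r`. When `Y` is small at `r`, the bracket of `Y` and `Z` is small at every
    -- point, so it kills `u`; then `Y Z u = ± Z Y u = 0`.
    have hs := single_mem_glHat_deg (m := m) hx
    obtain ⟨N, e1, e2, e3, e4⟩ := ((hu k hk).and ((h.eventually_act hℓ hq hL hlam u (k + e)).and
      ((h.eventually_lam_bracket k e).and (hT e _ u hs)))).exists
    obtain ⟨Z, hZ⟩ := exists_mem_approxSet (q := q) hℓ0 hq ha (N + k.natAbs) e hs
    have hZ' := ApproxSet.mono (Nat.le_add_right _ _) hZ
    have hZr : ∀ i, i ≠ r → RowsVanish (N + k.natAbs) (phiLin ℓ (a i) (m i) Z).1.1 := by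
      intro i hi p s hp
      have h1 := hZ.2 i p s hp
      rw [Pi.single_eq_of_ne hi] at h1
      simpa using h1
    filter_upwards [eventually_ge_atTop (N + e.natAbs)] with N' hN' Y hY hr
    have hYe := hr.mono hN'
    have hYu : L.act Y u = 0 := e1 Y hY (hYe.mono (Nat.le_add_right _ _))
    have hb : L.act ((SSq q).bracket Y Z) u = 0 := by
      rw [e2 _ ⟨(SSq_isGraded q).bracket_mem _ _ _ _ hY hZ.1, fun i => ?_⟩,
        e3 Y hY Z hZ.1 fun i => ?_, zero_smul]
      · by_cases hi : i = r
        · subst hi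
          exact Or.inr (hYe.mono (Nat.le_add_right _ _))
        · exact Or.inl ((hZr i hi).mono (Nat.le_add_right _ _))
      · have h1 := phiLin_bracket_fst hℓ hq (a i) (m i) Y Z
        intro p s hp
        refine (congrFun (congrFun h1 p) s).trans ?_
        by_cases hi : i = r
        · subst hi
          exact hYe.superComm_left
            (mem_glHat_deg.1 (phiLin_deg (ℓ := ℓ) (a i) (m i) hZ.1)).1 p s hp
        · exact (hZr i hi).superComm_right
            (mem_glHat_deg.1 (phiLin_deg (ℓ := ℓ) (a i) (m i) hY)).1 p s hp
    have h2 : (factorAction L T r).act x u =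
        L.act Z u + (∑ i, mu i ((Pi.single r x : Π i, band (m i) × Trunc (m i)) i) - lam Z) • u :=
      e4 Z hZ'
    refine (congrArg (L.act Y) h2).trans ?_
    rw [map_add, map_smul, hYu, smul_zero, add_zero, hL.1.1.isRep.apply_apply hY hZ.1, hb, hYu,
      map_zero, smul_zero, add_zero]

/-- Write `X = Z + (X - Z)`, with `Z` close to `X` at the point `r` and close to zero elsewhere. On
`w`, the first part acts through the factor `r`, and the second, being small at `r`, acts by zero.
-/
theorem isSingular_of_factor (hlam : ∀ x (hx : x ∈ (SSq q).deg 0), lam x = lam0 ⟨x, hx⟩) (r : ι)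
    {w : L.carrier} (hw : w ∈ negSpan (factorAction L T r).act (Submodule.span ℂ {hL.1.vec}))
    (hs : ∀ k : ℤ, 0 < k → ∀ x ∈ (glHat (m r)).deg k, (factorAction L T r).act x w = 0) :
    L.IsSingular w := by
  intro k hk (X : (Idx →₀ ℂ) × ℂ) hX
  have hφ := phiLin_deg (ℓ := ℓ) (a r) (m r) hX
  have hy := single_mem_glHat_deg (m := m) hφ
  obtain ⟨N, e1, e2⟩ := ((hT k _ w hy).and
    (hT.eventually_act_eq_zero h hℓ0 hℓ hq ha hL hlam r hw hk)).exists
  obtain ⟨Z, hZ⟩ := exists_mem_approxSet (q := q) hℓ0 hq ha N k hy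
  have h1 := (hs k hk _ hφ).symm.trans (e1 Z hZ)
  rw [h.lam_deg k hk.ne' Z hZ.1, sub_zero,
    Finset.sum_eq_zero fun s _ => h.mu_deg s k hk.ne' _ (hy s), zero_smul, add_zero] at h1
  have h2 : L.act (X - Z) w = 0 := by
    refine e2 (X - Z) (Submodule.sub_mem _ hX hZ.1) fun p s hp => ?_
    have h3 := hZ.2 r p s hp
    rw [Pi.single_eq_same, Pi.sub_apply, Pi.sub_apply, sub_eq_zero] at h3
    exact (congrArg (fun W : band _ × Trunc _ => W.1.1 p s)
      (map_sub (phiLin ℓ (a r) (m r)) X Z)).trans (sub_eq_zero.2 h3.symm)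
  have h4 : L.act (X - Z) = L.act X - L.act Z := map_sub L.act _ _
  rw [h4, LinearMap.sub_apply, sub_eq_zero] at h2
  exact h2.trans h1.symm

end IsLimitAction

/-- An irreducible module whose weight is a sum of pull-backs of weights of finite support contains
irreducible modules with these weights. -/
theorem exists_factor (hℓ0 : ℓ ≠ 0) (hℓ : Complex.exp ℓ = q)
    (hq : ∀ n : ℤ, n ≠ 0 → Complex.exp (ℓ * n) ≠ 1) (ha : ∀ i j, i ≠ j → ¬ Cong ℓ (a i) (a j))
    (hL : L.IsL lam0) (hLqf : L.Quasifinite) {κ : ℂ}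
    {mu0 : ∀ i, Module.Dual ℂ ((glHat (m i)).deg 0)} (hmu : ∀ i, FinSupp (mu0 i))
    (hlam : lam0 = SSq.charWeight q κ + ∑ i, SSq.pullWeight q ℓ (a i) (m i) (mu0 i)) (r : ι) :
    ∃ M : GradedAction (glHat (m r)), M.IsL (mu0 r) ∧ M.Quasifinite := by
  obtain ⟨lam, mu, h, hl, hm⟩ := exists_compatibleWeights hℓ hq hmu hlam
  obtain ⟨T, hT⟩ := h.exists_limitAction hℓ0 hℓ hq ha hL hl
  have hT : IsLimitAction q ℓ a m lam mu L T := hT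
  have hV := hT.factorAction_isGradedModule h hℓ0 hℓ hq ha hL r
  -- The factor is what `glHat (m r)` generates from the highest weight vector of `L`. Its singular
  -- vectors are singular in `L`, hence of degree zero, and its graded pieces embed in those of `L`.
  obtain ⟨M, e, hM, hinj, hact, hdeg, hmem⟩ := hV.exists_generated (mu := mu0 r) (v := hL.1.vec)
    (glHat_isGraded (m r)) hL.1.vec_ne_zero hL.1.vec_mem
    (fun x => by
      have h1 := hT.act_vec hℓ0 hq ha hL hl (single_mem_glHat_deg (m := m) x.2)
      refine h1.trans (congrArg (· • hL.1.vec) ?_)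
      exact (sum_apply_single mu r x.1).trans (hm r x.1 x.2))
    (fun k hk x hx => hT.act_vec_pos h hℓ0 hq ha hL hk (single_mem_glHat_deg (m := m) hx))
  refine ⟨M, ⟨hM, hM.irreducible_of_singular fun u hu => ?_⟩, fun d => ?_⟩
  · rw [hdeg]
    refine hL.mem_deg_zero (SSq_isGraded q) (hT.isSingular_of_factor h hℓ0 hℓ hq ha hL hl r
      (hmem u) fun k hk x hx => ?_)
    rw [← hact, hu k hk x hx, map_zero]
  · have := hLqf d
    let f : M.deg d →ₗ[ℂ] L.deg d :=
      (e.domRestrict (M.deg d)).codRestrict (L.deg d) fun w => (hdeg d w.1).1 w.2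
    refine FiniteDimensional.of_injective f fun w w' hw => Subtype.ext (hinj ?_)
    exact congrArg Subtype.val hw

end Factors


/-- Isomorphic highest weight modules have the same highest weight. -/
theorem GradedAction.Iso.weight_eq {g : HalfGraded} {V V' : GradedAction g}
    {lam lam' : Module.Dual ℂ (g.deg 0)} (h : V.Iso V') (hV : V.IsHighestWeight lam)
    (hV' : V'.IsHighestWeight lam') : lam = lam' := by
  obtain ⟨e, he, -, hdeg⟩ := h
  have h1 : e hV.vec ∈ V'.deg 0 := by
    rw [← hdeg 0]
    exact Submodule.mem_map_of_mem hV.vec_mem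
  rw [hV'.deg_zero, Submodule.mem_span_singleton] at h1
  obtain ⟨c, hc⟩ := h1
  have hne : e hV.vec ≠ 0 := fun h0 => hV.vec_ne_zero (e.map_eq_zero_iff.1 h0)
  refine LinearMap.ext fun x => ?_
  have h2 := he x.1 hV.vec
  rw [hV.act_deg_zero x.2, map_smul, ← hc, map_smul, hV'.act_deg_zero x.2, smul_comm c, hc] at h2
  exact smul_left_injective ℂ hne h2

end QPDO

end

open QPDO in
theorem mainTheorem3 (q ℓ : ℂ) (hℓ : Complex.exp ℓ = q) (hq : ‖q‖ ≠ 1)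
    (lam : Module.Dual ℂ ((SSq q).deg 0)) (L : GradedAction (SSq q))
    (hL : L.IsL lam) (hLqf : L.Quasifinite) :
    (∃ P12 P21 : ℂ →₀ Polynomial ℂ, HasLabels q ℓ lam P12 P21) ∧
    ∀ P12 P21 : ℂ →₀ Polynomial ℂ, HasLabels q ℓ lam P12 P21 →
      -- existence: `L` is the tensor product attached to the classes of exponents
      (∀ (N : ℕ) (a : Fin N → ℂ), IsClassReps ℓ P12 P21 a →
        (∀ i, ∃ M : GradedAction (glHat (maxDeg ℓ P12 P21 (a i))),
          M.IsL (weightS ℓ P12 P21 (a i) (maxDeg ℓ P12 P21 (a i))) ∧ M.Quasifinite) ∧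
        ∀ M : ∀ i, GradedAction (glHat (maxDeg ℓ P12 P21 (a i))),
          (∀ i, (M i).IsL (weightS ℓ P12 P21 (a i) (maxDeg ℓ P12 P21 (a i)))) →
          L.Iso (realization q ℓ (kappa ℓ lam P12 P21 a) a
            (fun i => maxDeg ℓ P12 P21 (a i)) M)) ∧
      -- uniqueness: the data of any such realization of `L` are the ones given above
      (∀ (N : ℕ) (a : Fin N → ℂ) (m : Fin N → ℕ)
        (mu : ∀ i, Module.Dual ℂ ((glHat (m i)).deg 0))
        (M : ∀ i, GradedAction (glHat (m i))) (κ : ℂ),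
        (∀ i j, i ≠ j → ¬ Cong ℓ (a i) (a j)) →
        (∀ i, (M i).IsL (mu i) ∧ (M i).Quasifinite) →
        L.Iso (realization q ℓ κ a m M) →
        (∀ i, mu i = weightS ℓ P12 P21 (a i) (m i)) ∧
        (∀ i (l : ℕ), m i < l → ∀ k : ℤ,
          jet ℓ P12 (a i - k) l = 0 ∧ jet ℓ P21 (a i - k) l = 0) ∧
        (∀ b : ℂ, (∀ i, ¬ Cong ℓ b (a i)) → ∀ l : ℕ,
          jet ℓ P12 b l = 0 ∧ jet ℓ P21 b l = 0) ∧
        κ = kappa ℓ lam P12 P21 a) := by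
  have hℓ0 := log_ne_zero hℓ hq
  have hq' := exp_mul_int_ne_one hℓ hq
  obtain ⟨h1, h2⟩ := exists_hasLabels_of_quasifinite hℓ0 hℓ hq' hL.1 hLqf
  refine ⟨h1, fun P12 P21 h => ⟨fun N a ha => ?_, fun N a m mu M κ ha hM hiso => ?_⟩⟩
  · have hlam := weight_eq hℓ hℓ0 hq' h (h2 P12 P21 h) ha
    have hfs : ∀ i, FinSupp (weightS ℓ P12 P21 (a i) (maxDeg ℓ P12 P21 (a i))) := fun i => by
      obtain ⟨K, hK⟩ := exists_jetBound P12 P21 (a i) hℓ0 hq'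
      exact hK.weightS_finSupp _
    refine ⟨exists_factor hℓ0 hℓ hq' ha.1 hL hLqf hfs hlam, fun M hM => ?_⟩
    refine hL.iso (SSq_isGraded q) ?_
    have hR := SSq.realization_isL hℓ0 hℓ hq' (kappa ℓ lam P12 P21 a) a _ _ M ha.1 hM hfs
    rw [← hlam] at hR
    exact hR
  -- Finite support of the arbitrary weights `mu i` is supplied by quasifiniteness; then the
  -- realization has a weight that the isomorphism identifies with `lam`.
  · have hfs : ∀ i, FinSupp (mu i) := fun i => finSupp_of_quasifinite (hM i).1.1 (hM i).2
    have hR := SSq.realization_isL hℓ0 hℓ hq' κ a m mu M ha (fun i => (hM i).1) hfs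
    exact weight_unique hℓ hℓ0 hq' h ha hfs (hiso.weight_eq hL.1 hR.1)
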